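/- **Conventions.** Double categories are pseudo double categories: strict in the vertical direction and weak in the horizontal one, with associativity and unit constraints given by invertible horizontally globular 2-cells (2-cells whose vertical boundaries are identities). Composites of 1h-cells are written in diagrammatic order; $[a\,|\,b]$ is horizontal pasting. A horizontal transformation $\alpha:F\Rightarrow G$ of pseudo double functors means a horizontal pseudonatural transformation: 1h-cells $\alpha_A:F A\to G A$, 2-cells $\alpha^u$ on $\alpha_A,\alpha_{A'}$ with vertical boundaries $F u,G u$ for every 1v-cell $u:A\to A'$, and invertible globular 2-cells $\alpha_f:[F f\,|\,\alpha_B]\Rightarrow[\alpha_A\,|\,G f]$ for every 1h-cell $f:A\to B$, compatible with compositors and unitors, with vertical composition and identities, and with all 2-cells. A horizontal modification consists of globular 2-cells between 1h-cell components, natural with respect to 1h-cells and with respect to 1v-cells. A horizontal equivalence is a horizontal transformation that has an inverse up to invertible horizontal modifications. A horizontal icon $F\Rightarrow G$ between functors that agree on objects is a horizontal transformation whose 1h-cell components are identities; it is invertible if its globular 2-cells and (for horizontal composition) its 2-cells at 1v-cells are invertible. A *horizontally monoidal* double category is a double category $\mathbb D$ with a pseudo double functor $\otimes:\mathbb D\times\mathbb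 D\to\mathbb D$, a unit object $I$, horizontal equivalences $\alpha_{A,B,C}:(AB)C\to A(BC)$, $\lambda_A:IA\to A$, $\rho_A:AI\to A$ and invertible horizontal modifications $$p:[\alpha_{A,B,C}D\,|\,\alpha_{A,BC,D}\,|\,A\alpha_{B,C,D}]\Rightarrow[\alpha_{AB,C,D}\,|\,\alpha_{A,B,CD}],\qquad m:[\alpha_{A,I,B}\,|\,A\lambda_B]\Rightarrow\rho_AB,$$ $$l:\lambda_AB\Rightarrow[\alpha_{I,A,B}\,|\,\lambda_{AB}],\qquad r:\rho_{AB}\Rightarrow[\alpha_{A,B,I}\,|\,A\rho_B]$$ satisfying the three axioms (TA1)–(TA3) of a monoidal bicategory (associahedron, left and right normalization). A *left action* of $\mathbb D$ on a double category $\mathbb K$ consists of a pseudo double functor $\triangleright:\mathbb D\times\mathbb K\to\mathbb K$ with horizontal equivalences $(AB)\triangleright X\to A\triangleright(B\triangleright X)$ and $I\triangleright X\to X$ and invertible modifications analogous to $p,m,l$, satisfying the analogues of (TA1), (TA2); *right actions* $\triangleleft:\mathbb K\times\mathbb D\to\mathbb K$ are mirror images (analogues of $p,m,r$ and of (TA1),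 (TA3)). A *horizontal lax action* of a horizontally monoidal double category $(\mathbb M,\otimes,J)$ on $\mathbb D$ is a pseudo double functor $\overline\otimes:\mathbb M\times\mathbb D\to\mathbb D$ with horizontal transformations (not necessarily equivalences) $\beta_{M,N,A}:M(NA)\to(MN)A$ and $\nu_A:A\to JA$ and invertible horizontal modifications $$[M\beta_{N,P,A}\,|\,\beta_{M,NP,A}]\Rightarrow[\beta_{M,N,PA}\,|\,\beta_{MN,P,A}\,|\,\alpha^{\mathbb M}_{M,N,P}A],$$ $$[\nu_{MA}\,|\,\beta_{J,M,A}\,|\,\lambda^{\mathbb M}_MA]\Rightarrow1,\qquad[M\nu_A\,|\,\beta_{M,J,A}\,|\,\rho^{\mathbb M}_MA]\Rightarrow1$$ satisfying the corresponding analogues of (TA1), (TA2). **The coPara construction.** Let $\mathbb M$ and $\mathbb D$ be horizontally monoidal double categories, with a horizontal lax action $(\overline\otimes,\beta,\nu)$ of $\mathbb M$ on $\mathbb D$. The double category $\mathbb K=\mathrm{coPara}_{\mathbb M}(\mathbb D)$ has the objects and 1v-cells of $\mathbb D$. A 1h-cell $A\to B$ is an object $M$ of $\mathbb M$ with a 1h-cell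 $f:A\to M\overline\otimes B$ of $\mathbb D$; a 2-cell $(M,f)\Rightarrow(M',f')$ with vertical boundaries $d,e$ is a 1v-cell $u:M\to M'$ of $\mathbb M$ with a 2-cell $a$ of $\mathbb D$ from $f$ to $f'$ with vertical boundaries $d$ and $u\overline\otimes e$. Horizontal composition is $(M,f)(N,g)=(M\otimes N,[f\,|\,M\overline\otimes g\,|\,\beta])$ on 1h-cells and $(u,a)(v,b)=(u\otimes v,[a\,|\,u\overline\otimes b\,|\,\beta^{u,v,e'}])$ on 2-cells, where $e'$ is the right vertical boundary of $(v,b)$. The horizontal identities are $(J,\nu_A)$ and $(1_J,\nu^d)$, and vertical composition is as in $\mathbb D$. The canonical embedding $P:\mathbb D\to\mathbb K$ is the identity on objects and 1v-cells, $P(f)=(J,[f\,|\,\nu_B])$ for $f:A\to B$, and $P(\phi)=(1_J,[\phi\,|\,\nu^v])$ for a 2-cell $\phi$ with right vertical boundary $v$. Fix any associativity and unit constraints making these cells and compositions a pseudo double category, and any compositors and unitors making $P$ a pseudo double functor. **Extensions.** A horizontally monoidal structure $(\otimes^P,\tilde{\mathfrak a},\tilde{\mathfrak l},\tilde{\mathfrak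 r};\mathfrak p,\mathfrak m,\mathfrak l,\mathfrak r)$ on $\mathbb K$ with the same tensor product of objects and the same unit object as $\mathbb D$ *extends* that of $\mathbb D$ through an invertible horizontal icon $\theta^P:P(-)\otimes^PP(-)\Rightarrow P(-\otimes-)$ if $\tilde{\mathfrak a}_{A,B,C}=P(\alpha_{A,B,C})$, $\tilde{\mathfrak l}_A=P(\lambda_A)$, $\tilde{\mathfrak r}_A=P(\rho_A)$, and the cells of $\tilde{\mathfrak a},\tilde{\mathfrak l},\tilde{\mathfrak r}$ at the values of $P$ on 1h-cells and on 1v-cells, as well as $\mathfrak p,\mathfrak m,\mathfrak l,\mathfrak r$, correspond through $\theta^P$ (and the compositors and unitors of $P$) to the images under $P$ of the cells of $\alpha,\lambda,\rho$ and of $p,m,l,r$. For instance, at 1h-cells $f,g,h$ of $\mathbb D$, $$\tilde{\mathfrak a}_{Pf,Pg,Ph}\ \text{ followed by }\ (1\otimes\theta^P_{g,h})\text{ and }\theta^P_{f,g\otimes h}\quad\text{equals}\quad(\theta^P_{f,g}\otimes1)\text{ and }\theta^P_{f\otimes g,h}\ \text{ followed by }\ P(\alpha_{f,g,h}).$$ A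 *left extension along $P$ of the canonical action of $\mathbb D$ on itself* is a left action $\triangleright$ of $\mathbb D$ on $\mathbb K$ with an invertible horizontal icon $\theta:-\triangleright P(-)\Rightarrow P(-\otimes-)$ satisfying the analogous conditions for $\alpha,\lambda$ and $p,m,l$. A *right extension* is a right action $\triangleleft$ with an invertible horizontal icon $\xi:P(-)\triangleleft-\Rightarrow P(-\otimes-)$ satisfying the analogous conditions for $\alpha,\rho$ and $p,m,r$. **Statement.** Suppose that a horizontally monoidal structure $\otimes^P$ on $\mathbb K=\mathrm{coPara}_{\mathbb M}(\mathbb D)$ extends that of $\mathbb D$ through $\theta^P$. Then there are a left extension $(\triangleright,\theta)$ and a right extension $(\triangleleft,\xi)$ along $P$ of the canonical action of $\mathbb D$ on itself, with underlying pseudo double functors $$\triangleright=\otimes^P\circ(P\times\mathrm{Id}),\qquad\triangleleft=\otimes^P\circ(\mathrm{Id}\times P),$$ and such that $\theta$ and $\xi$ have the same components as $\theta^P$. They form a biaction: there is a horizontal equivalence $$\kappa_{A,X,C}:(A\triangleright X)\triangleleft C\longrightarrow A\triangleright(X\triangleleft C)\qquad(A,C\in\mathbb D,\ X\in\mathbb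 K),$$ natural in $\mathbb D\times\mathbb K\times\mathbb D$ (so that it restricts along $P$ to a horizontal equivalence $(-\triangleright P(-))\triangleleft-\Rightarrow-\triangleright(P(-)\triangleleft-)$), with 1h-cell components $\kappa_{A,B,C}=P(\alpha_{A,B,C})$, satisfying the following five axioms, each for 1h-cells and for 1v-cells. (1) The cells of $\kappa$ at $(f,P(g),h)$ correspond through $\theta$ and $\xi$ to the images under $P$ of the cells of $\alpha$ at $(f,g,h)$. The 2-cells of $\mathbb K$ that correspond through $\theta$ and $\xi$ to the images under $P$ of the cells of $p$, $l$, $r$ are horizontal modifications $$(2)\quad[\tilde{\mathfrak a}^{\triangleright}_{A,B,X}\triangleleft D\,|\,\kappa_{A,B\triangleright X,D}\,|\,A\triangleright\kappa_{B,X,D}]\Rightarrow[\kappa_{AB,X,D}\,|\,\tilde{\mathfrak a}^{\triangleright}_{A,B,X\triangleleft D}],$$ $$(3)\quad[\kappa_{A,X,C}\triangleleft D\,|\,\kappa_{A,X\triangleleft C,D}\,|\,A\triangleright\tilde{\mathfrak a}^{\triangleleft}_{X,C,D}]\Rightarrow[\tilde{\mathfrak a}^{\triangleleft}_{A\triangleright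 X,C,D}\,|\,\kappa_{A,X,CD}],$$ $$(4)\quad\tilde{\mathfrak l}_X\triangleleft C\Rightarrow[\kappa_{I,X,C}\,|\,\tilde{\mathfrak l}_{X\triangleleft C}],\qquad(5)\quad\tilde{\mathfrak r}_{A\triangleright X}\Rightarrow[\kappa_{A,X,I}\,|\,A\triangleright\tilde{\mathfrak r}_X],$$ natural in $X\in\mathbb K$ and in the remaining variables in $\mathbb D$, where $\tilde{\mathfrak a}^{\triangleright},\tilde{\mathfrak l}$ and $\tilde{\mathfrak a}^{\triangleleft},\tilde{\mathfrak r}$ are the constraints of $\triangleright$ and $\triangleleft$. -/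

import Mathlib

open CategoryTheory Bicategory
set_option linter.checkUnivs false

set_option linter.unusedVariables false

universe u v w x u' v' w' x' u'' v'' w'' x''

/-- Cells and compositions of a pseudo double category, without the horizontal constraint cells:
the vertical direction is a strict category, squares have top and bottom a horizontal 1-cell
and left and right boundary `src`, `tgt` a vertical 1-cell; `shid`, `shcomp` are the
(functorial) horizontal identities and composites of squares. -/
structure PreDbl (Ob : Type u) where
  V : Ob → Ob → Type v
  vid : ∀ A, V A A
  vcomp : ∀ {A B C}, V A B → V B C → V A C
  vid_vcomp : ∀ {A B} (s : V A B), vcomp (vid A) s = s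
  vcomp_vid : ∀ {A B} (s : V A B), vcomp s (vid B) = s
  vcomp_assoc : ∀ {A B C E} (s : V A B) (t : V B C) (r : V C E),
    vcomp (vcomp s t) r = vcomp s (vcomp t r)
  H : Ob → Ob → Type w
  hid : ∀ A, H A A
  hcomp : ∀ {A B C}, H A B → H B C → H A C
  Sq : ∀ {A B A' B'}, H A B → H A' B' → Type x
  src : ∀ {A B A' B'} {f : H A B} {g : H A' B'}, Sq f g → V A A'
  tgt : ∀ {A B A' B'} {f : H A B} {g : H A' B'}, Sq f g → V B B'
  sid : ∀ {A B} (f : H A B), Sq f f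
  scomp : ∀ {A B A' B' A'' B''} {f : H A B} {g : H A' B'} {h : H A'' B''},
    Sq f g → Sq g h → Sq f h
  sid_scomp : ∀ {A B A' B'} {f : H A B} {g : H A' B'} (a : Sq f g), scomp (sid f) a = a
  scomp_sid : ∀ {A B A' B'} {f : H A B} {g : H A' B'} (a : Sq f g), scomp a (sid g) = a
  scomp_assoc : ∀ {A B A' B' A'' B'' A₃ B₃} {f : H A B} {g : H A' B'} {h : H A'' B''}
    {k : H A₃ B₃} (a : Sq f g) (b : Sq g h) (c : Sq h k),
    scomp (scomp a b) c = scomp a (scomp b c)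
  src_sid : ∀ {A B} (f : H A B), src (sid f) = vid A
  tgt_sid : ∀ {A B} (f : H A B), tgt (sid f) = vid B
  src_scomp : ∀ {A B A' B' A'' B''} {f : H A B} {g : H A' B'} {h : H A'' B''}
    (a : Sq f g) (b : Sq g h), src (scomp a b) = vcomp (src a) (src b)
  tgt_scomp : ∀ {A B A' B' A'' B''} {f : H A B} {g : H A' B'} {h : H A'' B''}
    (a : Sq f g) (b : Sq g h), tgt (scomp a b) = vcomp (tgt a) (tgt b)
  shid : ∀ {A A'}, V A A' → Sq (hid A) (hid A')
  src_shid : ∀ {A A'} (s : V A A'), src (shid s) = s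
  tgt_shid : ∀ {A A'} (s : V A A'), tgt (shid s) = s
  shid_vid : ∀ A, shid (vid A) = sid (hid A)
  shid_vcomp : ∀ {A B C} (s : V A B) (t : V B C), shid (vcomp s t) = scomp (shid s) (shid t)
  shcomp : ∀ {A B C A' B' C'} {f : H A B} {f' : H A' B'} {g : H B C} {g' : H B' C'}
    (a : Sq f f') (b : Sq g g'), tgt a = src b → Sq (hcomp f g) (hcomp f' g')
  src_shcomp : ∀ {A B C A' B' C'} {f : H A B} {f' : H A' B'} {g : H B C} {g' : H B' C'}
    (a : Sq f f') (b : Sq g g') (e : tgt a = src b), src (shcomp a b e) = src a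
  tgt_shcomp : ∀ {A B C A' B' C'} {f : H A B} {f' : H A' B'} {g : H B C} {g' : H B' C'}
    (a : Sq f f') (b : Sq g g') (e : tgt a = src b), tgt (shcomp a b e) = tgt b
  shcomp_sid : ∀ {A B C} (f : H A B) (g : H B C) (e : tgt (sid f) = src (sid g)),
    shcomp (sid f) (sid g) e = sid (hcomp f g)
  interchange : ∀ {A B C A' B' C' A'' B'' C''} {f : H A B} {f' : H A' B'} {f'' : H A'' B''}
    {g : H B C} {g' : H B' C'} {g'' : H B'' C''} (a : Sq f f') (a' : Sq f' f'')
    (b : Sq g g') (b' : Sq g' g'') (e : tgt a = src b) (e' : tgt a' = src b')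
    (e'' : tgt (scomp a a') = src (scomp b b')),
    shcomp (scomp a a') (scomp b b') e'' = scomp (shcomp a b e) (shcomp a' b' e')

namespace PreDbl
variable {Ob : Type u} (C : PreDbl.{u, v, w, x} Ob)

/-- Horizontally globular squares: both vertical boundaries are identities. -/
@[ext] structure Glob {A B : Ob} (f g : C.H A B) : Type x where
  cell : C.Sq f g
  src_cell : C.src cell = C.vid A
  tgt_cell : C.tgt cell = C.vid B

attribute [simp] vid_vcomp vcomp_vid vcomp_assoc sid_scomp scomp_sid scomp_assoc src_sid tgt_sid
  src_scomp tgt_scomp src_shid tgt_shid shid_vid src_shcomp tgt_shcomp shcomp_sid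
  Glob.src_cell Glob.tgt_cell


/-- The identity globular square. -/
def Glob.id {A B : Ob} (f : C.H A B) : C.Glob f f := ⟨C.sid f, by simp, by simp⟩

instance homCat (A B : Ob) : Category.{x} (C.H A B) where
  Hom f g := C.Glob f g
  id f := Glob.id C f
  comp a b := ⟨C.scomp a.cell b.cell, by simp, by simp⟩
  id_comp _ := by ext; exact C.sid_scomp _
  comp_id _ := by ext; exact C.scomp_sid _
  assoc _ _ _ := by ext; exact C.scomp_assoc _ _ _

@[simp] lemma comp_cell {A B : Ob} {f g h : C.H A B} (a : f ⟶ g) (b : g ⟶ h) :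
    Glob.cell (a ≫ b) = C.scomp (Glob.cell a) (Glob.cell b) := rfl

@[simp] lemma id_cell {A B : Ob} (f : C.H A B) : Glob.cell (𝟙 f) = C.sid f := rfl

/-- Horizontal composite of globular squares. -/
def gcomp {C : PreDbl.{u, v, w, x} Ob} {A B B' : Ob} {f f' : C.H A B} {g g' : C.H B B'} (a : f ⟶ f') (b : g ⟶ g') :
    C.hcomp f g ⟶ C.hcomp f' g' :=
  ⟨C.shcomp a.cell b.cell (by simp), by simp, by simp⟩

/-- Associativity and unit constraints making the given cells into a pseudo double category. -/
structure Coherence where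
  assoc : ∀ {A B B' E} (f : C.H A B) (g : C.H B B') (h : C.H B' E),
    C.hcomp (C.hcomp f g) h ≅ C.hcomp f (C.hcomp g h)
  leftU : ∀ {A B} (f : C.H A B), C.hcomp (C.hid A) f ≅ f
  rightU : ∀ {A B} (f : C.H A B), C.hcomp f (C.hid B) ≅ f
  assoc_nat : ∀ {A B E F A' B' E' F'} {f : C.H A B} {g : C.H B E} {h : C.H E F}
    {f' : C.H A' B'} {g' : C.H B' E'} {h' : C.H E' F'}
    (a : C.Sq f f') (b : C.Sq g g') (c : C.Sq h h') (e₁ : C.tgt a = C.src b)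
    (e₂ : C.tgt b = C.src c),
    C.scomp (C.shcomp (C.shcomp a b e₁) c (by simpa using e₂)) (assoc f' g' h').hom.cell
      = C.scomp (assoc f g h).hom.cell (C.shcomp a (C.shcomp b c e₂) (by simpa using e₁))
  leftU_nat : ∀ {A B A' B'} {f : C.H A B} {f' : C.H A' B'} (a : C.Sq f f'),
    C.scomp (C.shcomp (C.shid (C.src a)) a (by simp)) (leftU f').hom.cell
      = C.scomp (leftU f).hom.cell a
  rightU_nat : ∀ {A B A' B'} {f : C.H A B} {f' : C.H A' B'} (a : C.Sq f f'),
    C.scomp (C.shcomp a (C.shid (C.tgt a)) (by simp)) (rightU f').hom.cell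
      = C.scomp (rightU f).hom.cell a
  pentagon : ∀ {A B E F G} (f : C.H A B) (g : C.H B E) (h : C.H E F) (k : C.H F G),
    gcomp (assoc f g h).hom (𝟙 k) ≫ (assoc f (C.hcomp g h) k).hom ≫ gcomp (𝟙 f) (assoc g h k).hom
      = (assoc (C.hcomp f g) h k).hom ≫ (assoc f g (C.hcomp h k)).hom
  triangle : ∀ {A B E} (f : C.H A B) (g : C.H B E),
    (assoc f (C.hid B) g).hom ≫ gcomp (𝟙 f) (leftU g).hom = gcomp (rightU f).hom (𝟙 g)

end PreDbl

/-- Pseudo double categories (strict vertically, weak horizontally) with objects `Ob`. -/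
structure DblCat (Ob : Type u) where
  pre : PreDbl.{u, v, w, x} Ob
  coh : pre.Coherence

namespace DblCat
variable {Ob : Type u} (D : DblCat.{u, v, w, x} Ob)

/-- The objects of `D`, carrying the underlying horizontal bicategory. -/
@[ext] structure Cell (D : DblCat.{u, v, w, x} Ob) : Type u where
  c ::
  ob : Ob

section
variable {D}
open PreDbl

theorem gcomp_assoc_nat {A B E F : Ob} {f f' : D.pre.H A B} {g g' : D.pre.H B E}
    {h h' : D.pre.H E F} (a : f ⟶ f') (b : g ⟶ g') (c : h ⟶ h') :
    gcomp (gcomp a b) c ≫ (D.coh.assoc f' g' h').hom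
    = (D.coh.assoc f g h).hom ≫ gcomp a (gcomp b c) :=
  Glob.ext (D.coh.assoc_nat a.cell b.cell c.cell _ _)

theorem gcomp_comp {A B E : Ob} {f f' f'' : D.pre.H A B} {g g' g'' : D.pre.H B E}
    (a : f ⟶ f') (a' : f' ⟶ f'') (b : g ⟶ g') (b' : g' ⟶ g'') :
    gcomp (a ≫ a') (b ≫ b') = gcomp a b ≫ gcomp a' b' :=
  Glob.ext (D.pre.interchange a.cell a'.cell b.cell b'.cell _ _ _)

theorem gcomp_id {A B E : Ob} (f : D.pre.H A B) (g : D.pre.H B E) :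
    gcomp (𝟙 f) (𝟙 g) = 𝟙 _ :=
  Glob.ext (D.pre.shcomp_sid f g _)

theorem gcomp_leftU_nat {A B : Ob} {f f' : D.pre.H A B} (a : f ⟶ f') :
    gcomp (𝟙 (D.pre.hid A)) a ≫ (D.coh.leftU f').hom = (D.coh.leftU f).hom ≫ a := by
  refine Glob.ext ((congrArg (fun s => D.pre.scomp s (D.coh.leftU f').hom.cell) ?_).trans
    (D.coh.leftU_nat a.cell))
  show D.pre.shcomp _ _ _ = D.pre.shcomp _ _ _
  congr 1
  rw [a.src_cell, D.pre.shid_vid]; rfl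

theorem gcomp_rightU_nat {A B : Ob} {f f' : D.pre.H A B} (a : f ⟶ f') :
    gcomp a (𝟙 (D.pre.hid B)) ≫ (D.coh.rightU f').hom = (D.coh.rightU f).hom ≫ a := by
  refine Glob.ext ((congrArg (fun s => D.pre.scomp s (D.coh.rightU f').hom.cell) ?_).trans
    (D.coh.rightU_nat a.cell))
  show D.pre.shcomp _ _ _ = D.pre.shcomp _ _ _
  congr 1
  rw [a.tgt_cell, D.pre.shid_vid]; rfl
end

/-- The underlying horizontal bicategory: 2-cells are the horizontally globular squares. -/
instance bicat : Bicategory.{x, w} D.Cell where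
  Hom A B := D.pre.H A.ob B.ob
  id A := D.pre.hid A.ob
  comp f g := D.pre.hcomp f g
  homCategory A B := D.pre.homCat A.ob B.ob
  whiskerLeft f _ _ b := PreDbl.gcomp (C := D.pre) (𝟙 f) b
  whiskerRight a g := PreDbl.gcomp (C := D.pre) a (𝟙 g)
  associator f g h := D.coh.assoc f g h
  leftUnitor f := D.coh.leftU f
  rightUnitor f := D.coh.rightU f
  whiskerLeft_id f g := gcomp_id f g
  whiskerLeft_comp f _ _ _ b b' := by rw [← gcomp_comp, Category.comp_id]
  id_whiskerLeft b := by
    rw [← Category.assoc, ← gcomp_leftU_nat, Category.assoc, Iso.hom_inv_id, Category.comp_id]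
  comp_whiskerLeft f g _ _ b := by
    rw [← Category.assoc, ← gcomp_assoc_nat, Category.assoc, Iso.hom_inv_id, Category.comp_id,
      gcomp_id]
  id_whiskerRight f g := gcomp_id f g
  comp_whiskerRight a a' g := by rw [← gcomp_comp, Category.comp_id]
  whiskerRight_id a := by
    rw [← Category.assoc, ← gcomp_rightU_nat, Category.assoc, Iso.hom_inv_id, Category.comp_id]
  whiskerRight_comp a g h := by
    rw [gcomp_assoc_nat, Iso.inv_hom_id_assoc, gcomp_id]
  whisker_assoc f _ _ b h := by
    rw [← Category.assoc, ← gcomp_assoc_nat, Category.assoc, Iso.hom_inv_id, Category.comp_id]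
  whisker_exchange a b := by
    rw [← gcomp_comp, ← gcomp_comp]; simp
  pentagon := fun f g h k => D.coh.pentagon f g h k
  triangle := fun f g => D.coh.triangle f g
end DblCat

namespace DblCat
variable {Ob : Type u} {D : DblCat.{u, v, w, x} Ob}

/-- An object of the horizontal bicategory. -/
abbrev c (D : DblCat.{u, v, w, x} Ob) (A : Ob) : D.Cell := ⟨A⟩

/-- Squares with top `f` and bottom `g`. -/
abbrev Sq {A B A' B' : D.Cell} (f : A ⟶ B) (g : A' ⟶ B') : Type x := D.pre.Sq f g

/-- Vertical composite of squares, first argument on top. -/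
abbrev vc {A B A' B' A'' B'' : D.Cell} {f : A ⟶ B} {g : A' ⟶ B'} {h : A'' ⟶ B''}
    (a : Sq f g) (b : Sq g h) : Sq f h := D.pre.scomp a b

/-- Horizontal composite of squares, first argument on the left. -/
abbrev hc {A B E A' B' E' : D.Cell} {f : A ⟶ B} {f' : A' ⟶ B'} {g : B ⟶ E} {g' : B' ⟶ E'}
    (a : Sq f f') (b : Sq g g') (e : D.pre.tgt a = D.pre.src b) : Sq (f ≫ g) (f' ≫ g') :=
  D.pre.shcomp a b e

/-- The horizontal identity square on a vertical 1-cell. -/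
abbrev hi {A A' : Ob} (s : D.pre.V A A') : Sq (𝟙 (D.c A)) (𝟙 (D.c A')) := D.pre.shid s

/-- The square underlying a 2-cell of the horizontal bicategory. -/
abbrev sq {A B : D.Cell} {f g : A ⟶ B} (γ : f ⟶ g) : Sq f g := PreDbl.Glob.cell γ

end DblCat

/-- Double-graph morphism with object map `o`, strictly functorial in the vertical direction. -/
structure PreFun {Ob : Type u} {Ob' : Type u'} (C : PreDbl.{u, v, w, x} Ob)
    (D : PreDbl.{u', v', w', x'} Ob') (o : Ob → Ob') where
  mapV : ∀ {A B}, C.V A B → D.V (o A) (o B)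
  mapH : ∀ {A B}, C.H A B → D.H (o A) (o B)
  mapSq : ∀ {A B A' B'} {f : C.H A B} {g : C.H A' B'}, C.Sq f g → D.Sq (mapH f) (mapH g)
  src_mapSq : ∀ {A B A' B'} {f : C.H A B} {g : C.H A' B'} (a : C.Sq f g),
    D.src (mapSq a) = mapV (C.src a)
  tgt_mapSq : ∀ {A B A' B'} {f : C.H A B} {g : C.H A' B'} (a : C.Sq f g),
    D.tgt (mapSq a) = mapV (C.tgt a)
  mapV_vid : ∀ A, mapV (C.vid A) = D.vid (o A)
  mapV_vcomp : ∀ {A B E} (s : C.V A B) (t : C.V B E),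
    mapV (C.vcomp s t) = D.vcomp (mapV s) (mapV t)
  mapSq_sid : ∀ {A B} (f : C.H A B), mapSq (C.sid f) = D.sid (mapH f)
  mapSq_scomp : ∀ {A B A' B' A'' B''} {f : C.H A B} {g : C.H A' B'} {h : C.H A'' B''}
    (a : C.Sq f g) (b : C.Sq g h), mapSq (C.scomp a b) = D.scomp (mapSq a) (mapSq b)

attribute [simp] PreFun.src_mapSq PreFun.tgt_mapSq PreFun.mapV_vid PreFun.mapV_vcomp
  PreFun.mapSq_sid PreFun.mapSq_scomp

section
variable {Ob : Type u} {Ob' : Type u'} {C : DblCat.{u, v, w, x} Ob}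
  {D : DblCat.{u', v', w', x'} Ob'} {o : Ob → Ob'}
open DblCat

/-- Action on horizontal 1-cells. -/
def PreFun.h (F : PreFun C.pre D.pre o) {A B : Ob} (f : C.c A ⟶ C.c B) :
    D.c (o A) ⟶ D.c (o B) := F.mapH f

/-- Action on globular 2-cells. -/
def PreFun.g (F : PreFun C.pre D.pre o) {A B : Ob} {f f' : C.c A ⟶ C.c B} (a : f ⟶ f') :
    F.h f ⟶ F.h f' :=
  PreDbl.Glob.mk (F.mapSq (sq a))
    ((F.src_mapSq _).trans ((congrArg F.mapV a.src_cell).trans (F.mapV_vid _)))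
    ((F.tgt_mapSq _).trans ((congrArg F.mapV a.tgt_cell).trans (F.mapV_vid _)))

/-- Action on squares. -/
abbrev PreFun.s (F : PreFun C.pre D.pre o) {A B A' B' : Ob} {f : C.c A ⟶ C.c B}
    {g : C.c A' ⟶ C.c B'} (a : Sq f g) : Sq (F.h f) (F.h g) := F.mapSq a

/-- Compositors and unitors making `F` a pseudo double functor. -/
structure FunCoh (F : PreFun C.pre D.pre o) where
  mapComp : ∀ {A B E : Ob} (f : C.c A ⟶ C.c B) (g : C.c B ⟶ C.c E),
    F.h f ≫ F.h g ≅ F.h (f ≫ g)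
  mapId : ∀ A : Ob, 𝟙 (D.c (o A)) ≅ F.h (𝟙 (C.c A))
  mapComp_nat : ∀ {A B E A' B' E' : Ob} {f : C.c A ⟶ C.c B} {g : C.c B ⟶ C.c E}
    {f' : C.c A' ⟶ C.c B'} {g' : C.c B' ⟶ C.c E'} (a : Sq f f') (b : Sq g g')
    (e : C.pre.tgt a = C.pre.src b),
    vc (hc (F.s a) (F.s b)
      ((F.tgt_mapSq a).trans ((congrArg F.mapV e).trans (F.src_mapSq b).symm))) (sq (mapComp f' g').hom) =
      vc (sq (mapComp f g).hom) (F.s (hc a b e))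
  mapId_nat : ∀ {A A' : Ob} (s : C.pre.V A A'),
    vc (hi (F.mapV s)) (sq (mapId A').hom) = vc (sq (mapId A).hom) (F.s (hi s))
  map_assoc : ∀ {A B E G : Ob} (f : C.c A ⟶ C.c B) (g : C.c B ⟶ C.c E) (k : C.c E ⟶ C.c G),
    (mapComp f g).hom ▷ F.h k ≫ (mapComp (f ≫ g) k).hom ≫ F.g (α_ f g k).hom =
      (α_ (F.h f) (F.h g) (F.h k)).hom ≫ F.h f ◁ (mapComp g k).hom ≫ (mapComp f (g ≫ k)).hom
  map_leftUnitor : ∀ {A B : Ob} (f : C.c A ⟶ C.c B),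
    (mapId A).hom ▷ F.h f ≫ (mapComp (𝟙 (C.c A)) f).hom ≫ F.g (λ_ f).hom = (λ_ (F.h f)).hom
  map_rightUnitor : ∀ {A B : Ob} (f : C.c A ⟶ C.c B),
    F.h f ◁ (mapId B).hom ≫ (mapComp f (𝟙 (C.c B))).hom ≫ F.g (ρ_ f).hom = (ρ_ (F.h f)).hom
end

/-- Pseudo double functors with object map `o`. -/
structure DblFun {Ob : Type u} {Ob' : Type u'} (C : DblCat.{u, v, w, x} Ob)
    (D : DblCat.{u', v', w', x'} Ob') (o : Ob → Ob') extends PreFun C.pre D.pre o where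
  coh : FunCoh toPreFun

/-- Products of double categories. -/
def PreDbl.prod {Ob : Type u} {Ob' : Type u'} (C : PreDbl.{u, v, w, x} Ob)
    (D : PreDbl.{u', v', w', x'} Ob') : PreDbl (Ob × Ob') where
  V A B := C.V A.1 B.1 × D.V A.2 B.2
  vid A := (C.vid A.1, D.vid A.2)
  vcomp s t := (C.vcomp s.1 t.1, D.vcomp s.2 t.2)
  vid_vcomp _ := by simp
  vcomp_vid _ := by simp
  vcomp_assoc _ _ _ := by simp
  H A B := C.H A.1 B.1 × D.H A.2 B.2
  hid A := (C.hid A.1, D.hid A.2)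
  hcomp f g := (C.hcomp f.1 g.1, D.hcomp f.2 g.2)
  Sq f g := C.Sq f.1 g.1 × D.Sq f.2 g.2
  src a := (C.src a.1, D.src a.2)
  tgt a := (C.tgt a.1, D.tgt a.2)
  sid f := (C.sid f.1, D.sid f.2)
  scomp a b := (C.scomp a.1 b.1, D.scomp a.2 b.2)
  sid_scomp _ := by simp
  scomp_sid _ := by simp
  scomp_assoc _ _ _ := by simp
  src_sid _ := by simp
  tgt_sid _ := by simp
  src_scomp _ _ := by simp
  tgt_scomp _ _ := by simp
  shid s := (C.shid s.1, D.shid s.2)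
  src_shid _ := by simp
  tgt_shid _ := by simp
  shid_vid _ := by simp
  shid_vcomp _ _ := by simp [C.shid_vcomp, D.shid_vcomp]
  shcomp a b e := (C.shcomp a.1 b.1 (congrArg Prod.fst e), D.shcomp a.2 b.2 (congrArg Prod.snd e))
  src_shcomp _ _ _ := by simp
  tgt_shcomp _ _ _ := by simp
  shcomp_sid _ _ _ := by simp
  interchange a a' b b' e e' _ := Prod.ext
    (C.interchange a.1 a'.1 b.1 b'.1 (congrArg Prod.fst e) (congrArg Prod.fst e') _)
    (D.interchange a.2 a'.2 b.2 b'.2 (congrArg Prod.snd e) (congrArg Prod.snd e') _)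

/-- Componentwise isomorphism of horizontal 1-cells in a product. -/
def PreDbl.prodIso {Ob : Type u} {Ob' : Type u'} {C : PreDbl.{u, v, w, x} Ob}
    {D : PreDbl.{u', v', w', x'} Ob'} {A B : Ob × Ob'} {f g : (C.prod D).H A B}
    (i : f.1 ≅ g.1) (j : f.2 ≅ g.2) : f ≅ g where
  hom := ⟨(i.hom.cell, j.hom.cell), Prod.ext i.hom.src_cell j.hom.src_cell,
    Prod.ext i.hom.tgt_cell j.hom.tgt_cell⟩
  inv := ⟨(i.inv.cell, j.inv.cell), Prod.ext i.inv.src_cell j.inv.src_cell,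
    Prod.ext i.inv.tgt_cell j.inv.tgt_cell⟩
  hom_inv_id := PreDbl.Glob.ext (Prod.ext (congrArg PreDbl.Glob.cell i.hom_inv_id)
    (congrArg PreDbl.Glob.cell j.hom_inv_id))
  inv_hom_id := PreDbl.Glob.ext (Prod.ext (congrArg PreDbl.Glob.cell i.inv_hom_id)
    (congrArg PreDbl.Glob.cell j.inv_hom_id))

def DblCat.prod {Ob : Type u} {Ob' : Type u'} (C : DblCat.{u, v, w, x} Ob)
    (D : DblCat.{u', v', w', x'} Ob') : DblCat (Ob × Ob') where
  pre := C.pre.prod D.pre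
  coh :=
  { assoc f g h := PreDbl.prodIso (C.coh.assoc f.1 g.1 h.1) (D.coh.assoc f.2 g.2 h.2)
    leftU f := PreDbl.prodIso (C.coh.leftU f.1) (D.coh.leftU f.2)
    rightU f := PreDbl.prodIso (C.coh.rightU f.1) (D.coh.rightU f.2)
    assoc_nat a b e e₁ e₂ := Prod.ext
      (C.coh.assoc_nat a.1 b.1 e.1 (congrArg Prod.fst e₁) (congrArg Prod.fst e₂))
      (D.coh.assoc_nat a.2 b.2 e.2 (congrArg Prod.snd e₁) (congrArg Prod.snd e₂))
    leftU_nat a := Prod.ext (C.coh.leftU_nat a.1) (D.coh.leftU_nat a.2)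
    rightU_nat a := Prod.ext (C.coh.rightU_nat a.1) (D.coh.rightU_nat a.2)
    pentagon f g h k := PreDbl.Glob.ext (Prod.ext
      (congrArg PreDbl.Glob.cell (C.coh.pentagon f.1 g.1 h.1 k.1))
      (congrArg PreDbl.Glob.cell (D.coh.pentagon f.2 g.2 h.2 k.2)))
    triangle f g := PreDbl.Glob.ext (Prod.ext
      (congrArg PreDbl.Glob.cell (C.coh.triangle f.1 g.1))
      (congrArg PreDbl.Glob.cell (D.coh.triangle f.2 g.2))) }

section
variable {Ob : Type u} {Ob' : Type u'} {Ob'' : Type u''} {C : DblCat.{u, v, w, x} Ob}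
  {D : DblCat.{u', v', w', x'} Ob'} {E : DblCat.{u'', v'', w'', x''} Ob''}
open DblCat

@[simp] lemma PreFun.g_id {o : Ob → Ob'} (F : PreFun C.pre D.pre o) {A B : Ob}
    (f : C.c A ⟶ C.c B) : F.g (𝟙 f) = 𝟙 (F.h f) := PreDbl.Glob.ext (F.mapSq_sid f)

@[simp] lemma PreFun.g_comp {o : Ob → Ob'} (F : PreFun C.pre D.pre o) {A B : Ob}
    {f f' f'' : C.c A ⟶ C.c B} (a : f ⟶ f') (b : f' ⟶ f'') :
    F.g (a ≫ b) = F.g a ≫ F.g b := PreDbl.Glob.ext (F.mapSq_scomp _ _)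

/-- Action on invertible globular 2-cells. -/
@[simps] def PreFun.gi {o : Ob → Ob'} (F : PreFun C.pre D.pre o) {A B : Ob}
    {f f' : C.c A ⟶ C.c B} (a : f ≅ f') : F.h f ≅ F.h f' where
  hom := F.g a.hom
  inv := F.g a.inv
  hom_inv_id := by rw [← F.g_comp, a.hom_inv_id, F.g_id]
  inv_hom_id := by rw [← F.g_comp, a.inv_hom_id, F.g_id]

lemma FunCoh.g_whiskerRight {o : Ob → Ob'} {F : PreFun C.pre D.pre o} (c : FunCoh F) {A B B' : Ob}
    {f f' : C.c A ⟶ C.c B} (a : f ⟶ f') (g : C.c B ⟶ C.c B') :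
    F.g a ▷ F.h g ≫ (c.mapComp f' g).hom = (c.mapComp f g).hom ≫ F.g (a ▷ g) := by
  refine PreDbl.Glob.ext (Eq.trans ?_ (c.mapComp_nat (sq a) (sq (𝟙 g)) _))
  refine congrArg (fun s => vc s (sq (c.mapComp f' g).hom)) ?_
  show D.pre.shcomp _ _ _ = D.pre.shcomp _ _ _
  congr 1
  exact (F.mapSq_sid g).symm

lemma FunCoh.g_whiskerLeft {o : Ob → Ob'} {F : PreFun C.pre D.pre o} (c : FunCoh F) {A B B' : Ob}
    (f : C.c A ⟶ C.c B) {g g' : C.c B ⟶ C.c B'} (b : g ⟶ g') :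
    F.h f ◁ F.g b ≫ (c.mapComp f g').hom = (c.mapComp f g).hom ≫ F.g (f ◁ b) := by
  refine PreDbl.Glob.ext (Eq.trans ?_ (c.mapComp_nat (sq (𝟙 f)) (sq b) _))
  refine congrArg (fun s => vc s (sq (c.mapComp f g').hom)) ?_
  show D.pre.shcomp _ _ _ = D.pre.shcomp _ _ _
  congr 1
  exact (F.mapSq_sid f).symm

/-- The identity pseudo double functor. -/
def DblFun.id (C : DblCat.{u, v, w, x} Ob) : DblFun C C (fun A => A) where
  mapV s := s
  mapH f := f
  mapSq a := a
  src_mapSq _ := rfl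
  tgt_mapSq _ := rfl
  mapV_vid _ := rfl
  mapV_vcomp _ _ := rfl
  mapSq_sid _ := rfl
  mapSq_scomp _ _ := rfl
  coh :=
  { mapComp f g := Iso.refl _
    mapId A := Iso.refl _
    mapComp_nat a b e := (C.pre.scomp_sid _).trans (C.pre.sid_scomp _).symm
    mapId_nat s := (C.pre.scomp_sid _).trans (C.pre.sid_scomp _).symm
    map_assoc f g k := by
      simp only [Iso.refl_hom]
      erw [id_whiskerRight, whiskerLeft_id, Category.id_comp, Category.id_comp, Category.id_comp,
        Category.comp_id]; rfl
    map_leftUnitor f := by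
      simp only [Iso.refl_hom]
      erw [id_whiskerRight, Category.id_comp, Category.id_comp]; rfl
    map_rightUnitor f := by
      simp only [Iso.refl_hom]
      erw [whiskerLeft_id, Category.id_comp, Category.id_comp]; rfl }

/-- Composition of double functors on cells, without compositors. -/
def PreFun.comp {o : Ob → Ob'} {o' : Ob' → Ob''} (F : PreFun C.pre D.pre o)
    (G : PreFun D.pre E.pre o') : PreFun C.pre E.pre (fun A => o' (o A)) where
  mapV s := G.mapV (F.mapV s)
  mapH f := G.mapH (F.mapH f)
  mapSq a := G.mapSq (F.mapSq a)
  src_mapSq _ := by simp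
  tgt_mapSq _ := by simp
  mapV_vid _ := by simp
  mapV_vcomp _ _ := by simp
  mapSq_sid _ := by simp
  mapSq_scomp _ _ := by simp

/-- Composition of pseudo double functors. -/
def DblFun.comp {o : Ob → Ob'} {o' : Ob' → Ob''} (F : DblFun C D o)
    (G : DblFun D E o') : DblFun C E (fun A => o' (o A)) where
  toPreFun := F.toPreFun.comp G.toPreFun
  coh :=
  { mapComp f g := G.coh.mapComp (F.h f) (F.h g) ≪≫ G.gi (F.coh.mapComp f g)
    mapId A := G.coh.mapId (o A) ≪≫ G.gi (F.coh.mapId A)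
    mapComp_nat {_ _ _ _ _ _ f g f' g'} a b e := by
      have h1 := G.coh.mapComp_nat (F.s a) (F.s b)
        ((F.tgt_mapSq a).trans ((congrArg F.mapV e).trans (F.src_mapSq b).symm))
      have h2 := congrArg G.mapSq (F.coh.mapComp_nat a b e)
      have h3 := (G.mapSq_scomp _ _).symm.trans (h2.trans (G.mapSq_scomp _ _))
      show E.pre.scomp _ (E.pre.scomp (sq (G.coh.mapComp (F.h f') (F.h g')).hom) _)
        = E.pre.scomp (E.pre.scomp (sq (G.coh.mapComp (F.h f) (F.h g)).hom) _) _
      refine (E.pre.scomp_assoc _ _ _).symm.trans ?_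
      refine (congrArg (fun t => E.pre.scomp t _) h1).trans ?_
      refine (E.pre.scomp_assoc _ _ _).trans ?_
      refine (congrArg (fun t => E.pre.scomp _ t) h3).trans ?_
      exact (E.pre.scomp_assoc _ _ _).symm
    mapId_nat {A A'} s := by
      have h1 := G.coh.mapId_nat (F.mapV s)
      have h3 := (G.mapSq_scomp _ _).symm.trans
        ((congrArg G.mapSq (F.coh.mapId_nat s)).trans (G.mapSq_scomp _ _))
      show E.pre.scomp _ (E.pre.scomp (sq (G.coh.mapId (o A')).hom) _)
        = E.pre.scomp (E.pre.scomp (sq (G.coh.mapId (o A)).hom) _) _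
      refine (E.pre.scomp_assoc _ _ _).symm.trans ?_
      refine (congrArg (fun t => E.pre.scomp t _) h1).trans ?_
      refine (E.pre.scomp_assoc _ _ _).trans ?_
      refine (congrArg (fun t => E.pre.scomp _ t) h3).trans ?_
      exact (E.pre.scomp_assoc _ _ _).symm
    map_assoc {A B B' B''} f g k := by
      show ((G.coh.mapComp (F.h f) (F.h g)).hom ≫ G.g (F.coh.mapComp f g).hom) ▷ G.h (F.h k) ≫
        ((G.coh.mapComp (F.h (f ≫ g)) (F.h k)).hom ≫ G.g (F.coh.mapComp (f ≫ g) k).hom) ≫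
          G.g (F.g (α_ f g k).hom) = (α_ (G.h (F.h f)) (G.h (F.h g)) (G.h (F.h k))).hom ≫
          G.h (F.h f) ◁ ((G.coh.mapComp (F.h g) (F.h k)).hom ≫ G.g (F.coh.mapComp g k).hom) ≫
          ((G.coh.mapComp (F.h f) (F.h (g ≫ k))).hom ≫ G.g (F.coh.mapComp f (g ≫ k)).hom)
      have h1 := G.coh.map_assoc (F.h f) (F.h g) (F.h k)
      have h2 := congrArg G.g (F.coh.map_assoc f g k)
      simp only [PreFun.g_comp] at h2
      simp only [comp_whiskerRight, whiskerLeft_comp, Category.assoc]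
      rw [reassoc_of% (G.coh.g_whiskerRight (F.coh.mapComp f g).hom (F.h k)), h2,
        reassoc_of% (G.coh.g_whiskerLeft (F.h f) (F.coh.mapComp g k).hom), reassoc_of% h1]
    map_leftUnitor f := by
      show ((G.coh.mapId _).hom ≫ G.g (F.coh.mapId _).hom) ▷ G.h (F.h f) ≫
        ((G.coh.mapComp _ (F.h f)).hom ≫ G.g (F.coh.mapComp (𝟙 _) f).hom) ≫ G.g (F.g (λ_ f).hom)
        = (λ_ (G.h (F.h f))).hom
      have h1 := G.coh.map_leftUnitor (F.h f)
      have h2 := congrArg G.g (F.coh.map_leftUnitor f)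
      simp only [PreFun.g_comp] at h2
      simp only [comp_whiskerRight, Category.assoc]
      rw [reassoc_of% (G.coh.g_whiskerRight (F.coh.mapId _).hom (F.h f)), h2, h1]
    map_rightUnitor f := by
      show G.h (F.h f) ◁ ((G.coh.mapId _).hom ≫ G.g (F.coh.mapId _).hom) ≫
        ((G.coh.mapComp (F.h f) _).hom ≫ G.g (F.coh.mapComp f (𝟙 _)).hom) ≫ G.g (F.g (ρ_ f).hom)
        = (ρ_ (G.h (F.h f))).hom
      have h1 := G.coh.map_rightUnitor (F.h f)
      have h2 := congrArg G.g (F.coh.map_rightUnitor f)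
      simp only [PreFun.g_comp] at h2
      simp only [whiskerLeft_comp, Category.assoc]
      rw [reassoc_of% (G.coh.g_whiskerLeft (F.h f) (F.coh.mapId _).hom), h2, h1] }

/-- The constant pseudo double functor at an object. -/
def DblFun.const (C : DblCat.{u, v, w, x} Ob) (D : DblCat.{u', v', w', x'} Ob') (I : Ob') :
    DblFun C D (fun _ => I) where
  mapV _ := D.pre.vid I
  mapH _ := D.pre.hid I
  mapSq _ := D.pre.sid _
  src_mapSq _ := by simp
  tgt_mapSq _ := by simp
  mapV_vid _ := rfl
  mapV_vcomp _ _ := by simp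
  mapSq_sid _ := rfl
  mapSq_scomp _ _ := by simp
  coh :=
  { mapComp f g := λ_ (𝟙 (D.c I))
    mapId A := Iso.refl _
    mapComp_nat a b e :=
      (congrArg (fun t => D.pre.scomp t _) (D.pre.shcomp_sid _ _ _)).trans
        ((D.pre.sid_scomp _).trans (D.pre.scomp_sid _).symm)
    mapId_nat s :=
      (congrArg (fun t => D.pre.scomp t _) (D.pre.shid_vid I)).trans
        ((D.pre.sid_scomp _).trans (D.pre.scomp_sid _).symm)
    map_assoc f g k := by
      have : (λ_ (𝟙 (D.c I))).hom ▷ 𝟙 (D.c I) ≫ (λ_ (𝟙 (D.c I))).hom ≫ 𝟙 _ =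
        (α_ (𝟙 (D.c I)) (𝟙 _) (𝟙 _)).hom ≫ 𝟙 (D.c I) ◁ (λ_ (𝟙 (D.c I))).hom
          ≫ (λ_ (𝟙 (D.c I))).hom := by simp [unitors_equal]
      exact this
    map_leftUnitor f := by
      have : 𝟙 (𝟙 (D.c I)) ▷ 𝟙 (D.c I) ≫ (λ_ (𝟙 (D.c I))).hom ≫ 𝟙 _ = (λ_ (𝟙 (D.c I))).hom := by
        simp
      exact this
    map_rightUnitor f := by
      have : 𝟙 (D.c I) ◁ 𝟙 (𝟙 (D.c I)) ≫ (λ_ (𝟙 (D.c I))).hom ≫ 𝟙 _ = (ρ_ (𝟙 (D.c I))).hom := by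
        simp [unitors_equal]
      exact this }

/-- The first projection. -/
def DblFun.fst (C : DblCat.{u, v, w, x} Ob) (D : DblCat.{u', v', w', x'} Ob') :
    DblFun (C.prod D) C (fun p => p.1) where
  mapV s := s.1
  mapH f := f.1
  mapSq a := a.1
  src_mapSq _ := rfl
  tgt_mapSq _ := rfl
  mapV_vid _ := rfl
  mapV_vcomp _ _ := rfl
  mapSq_sid _ := rfl
  mapSq_scomp _ _ := rfl
  coh :=
  { mapComp f g := Iso.refl _
    mapId A := Iso.refl _
    mapComp_nat a b e := (C.pre.scomp_sid _).trans (C.pre.sid_scomp _).symm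
    mapId_nat s := (C.pre.scomp_sid _).trans (C.pre.sid_scomp _).symm
    map_assoc f g k := (DblFun.id C).coh.map_assoc f.1 g.1 k.1
    map_leftUnitor f := (DblFun.id C).coh.map_leftUnitor f.1
    map_rightUnitor f := (DblFun.id C).coh.map_rightUnitor f.1 }

/-- The second projection. -/
def DblFun.snd (C : DblCat.{u, v, w, x} Ob) (D : DblCat.{u', v', w', x'} Ob') :
    DblFun (C.prod D) D (fun p => p.2) where
  mapV s := s.2
  mapH f := f.2
  mapSq a := a.2
  src_mapSq _ := rfl
  tgt_mapSq _ := rfl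
  mapV_vid _ := rfl
  mapV_vcomp _ _ := rfl
  mapSq_sid _ := rfl
  mapSq_scomp _ _ := rfl
  coh :=
  { mapComp f g := Iso.refl _
    mapId A := Iso.refl _
    mapComp_nat a b e := (D.pre.scomp_sid _).trans (D.pre.sid_scomp _).symm
    mapId_nat s := (D.pre.scomp_sid _).trans (D.pre.sid_scomp _).symm
    map_assoc f g k := (DblFun.id D).coh.map_assoc f.2 g.2 k.2
    map_leftUnitor f := (DblFun.id D).coh.map_leftUnitor f.2
    map_rightUnitor f := (DblFun.id D).coh.map_rightUnitor f.2 }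

/-- The pairing of two pseudo double functors. -/
def DblFun.pair {o : Ob → Ob'} {o' : Ob → Ob''} (F : DblFun C D o) (G : DblFun C E o') :
    DblFun C (D.prod E) (fun A => (o A, o' A)) where
  mapV s := (F.mapV s, G.mapV s)
  mapH f := (F.mapH f, G.mapH f)
  mapSq a := (F.mapSq a, G.mapSq a)
  src_mapSq _ := Prod.ext (F.src_mapSq _) (G.src_mapSq _)
  tgt_mapSq _ := Prod.ext (F.tgt_mapSq _) (G.tgt_mapSq _)
  mapV_vid _ := Prod.ext (F.mapV_vid _) (G.mapV_vid _)
  mapV_vcomp _ _ := Prod.ext (F.mapV_vcomp _ _) (G.mapV_vcomp _ _)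
  mapSq_sid _ := Prod.ext (F.mapSq_sid _) (G.mapSq_sid _)
  mapSq_scomp _ _ := Prod.ext (F.mapSq_scomp _ _) (G.mapSq_scomp _ _)
  coh :=
  { mapComp f g := PreDbl.prodIso (F.coh.mapComp f g) (G.coh.mapComp f g)
    mapId A := PreDbl.prodIso (F.coh.mapId A) (G.coh.mapId A)
    mapComp_nat a b e := Prod.ext (F.coh.mapComp_nat a b e) (G.coh.mapComp_nat a b e)
    mapId_nat s := Prod.ext (F.coh.mapId_nat s) (G.coh.mapId_nat s)
    map_assoc f g k := PreDbl.Glob.ext (Prod.ext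
      (congrArg PreDbl.Glob.cell (F.coh.map_assoc f g k))
      (congrArg PreDbl.Glob.cell (G.coh.map_assoc f g k)))
    map_leftUnitor f := PreDbl.Glob.ext (Prod.ext
      (congrArg PreDbl.Glob.cell (F.coh.map_leftUnitor f))
      (congrArg PreDbl.Glob.cell (G.coh.map_leftUnitor f)))
    map_rightUnitor f := PreDbl.Glob.ext (Prod.ext
      (congrArg PreDbl.Glob.cell (F.coh.map_rightUnitor f))
      (congrArg PreDbl.Glob.cell (G.coh.map_rightUnitor f))) }
end

section
variable {Ob : Type u} {Ob' : Type u'} {C : DblCat.{u, v, w, x} Ob}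
  {D : DblCat.{u', v', w', x'} Ob'}
open DblCat

/-- Horizontal pseudonatural transformations between pseudo double functors: horizontal
1-cell components, a square for each vertical 1-cell and an invertible globular square for
each horizontal 1-cell. -/
structure HTrans {oF oG : Ob → Ob'} (F : DblFun C D oF) (G : DblFun C D oG) where
  app : ∀ A : Ob, D.c (oF A) ⟶ D.c (oG A)
  vsq : ∀ {A A' : Ob} (s : C.pre.V A A'), Sq (app A) (app A')
  src_vsq : ∀ {A A' : Ob} (s : C.pre.V A A'), D.pre.src (vsq s) = F.mapV s
  tgt_vsq : ∀ {A A' : Ob} (s : C.pre.V A A'), D.pre.tgt (vsq s) = G.mapV s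
  nat : ∀ {A B : Ob} (f : C.c A ⟶ C.c B), F.h f ≫ app B ≅ app A ≫ G.h f
  nat_comp : ∀ {A B E : Ob} (f : C.c A ⟶ C.c B) (g : C.c B ⟶ C.c E),
    (F.coh.mapComp f g).hom ▷ app E ≫ (nat (f ≫ g)).hom =
      (α_ _ _ _).hom ≫ F.h f ◁ (nat g).hom ≫ (α_ _ _ _).inv ≫ (nat f).hom ▷ G.h g ≫
        (α_ _ _ _).hom ≫ app A ◁ (G.coh.mapComp f g).hom
  nat_id : ∀ A : Ob,
    (F.coh.mapId A).hom ▷ app A ≫ (nat (𝟙 (C.c A))).hom =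
      (λ_ (app A)).hom ≫ (ρ_ (app A)).inv ≫ app A ◁ (G.coh.mapId A).hom
  vsq_vcomp : ∀ {A A' A'' : Ob} (s : C.pre.V A A') (t : C.pre.V A' A''),
    vsq (C.pre.vcomp s t) = vc (vsq s) (vsq t)
  vsq_vid : ∀ A : Ob, vsq (C.pre.vid A) = sq (𝟙 (app A))
  nat_sq : ∀ {A B A' B' : Ob} {f : C.c A ⟶ C.c B} {g : C.c A' ⟶ C.c B'} (a : Sq f g),
    vc (hc (F.s a) (vsq (C.pre.tgt a)) ((F.tgt_mapSq a).trans (src_vsq _).symm)) (sq (nat g).hom) =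
      vc (sq (nat f).hom) (hc (vsq (C.pre.src a)) (G.s a) ((tgt_vsq _).trans (G.src_mapSq a).symm))

/-- `η` is a horizontal modification from the identity of `F` to the composite of `α` and `β`. -/
structure IsUnitMod {oF oG : Ob → Ob'} {F : DblFun C D oF} {G : DblFun C D oG} (α : HTrans F G)
    (β : HTrans G F) (η : ∀ A : Ob, 𝟙 (D.c (oF A)) ≅ α.app A ≫ β.app A) : Prop where
  nat_h : ∀ {A B : Ob} (f : C.c A ⟶ C.c B),
    (ρ_ (F.h f)).inv ≫ F.h f ◁ (η B).hom ≫ (α_ _ _ _).inv ≫ (α.nat f).hom ▷ β.app B ≫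
        (α_ _ _ _).hom ≫ α.app A ◁ (β.nat f).hom =
      (λ_ (F.h f)).inv ≫ (η A).hom ▷ F.h f ≫ (α_ _ _ _).hom
  nat_v : ∀ {A A' : Ob} (s : C.pre.V A A'),
    vc (hi (F.mapV s)) (sq (η A').hom) =
      vc (sq (η A).hom) (hc (α.vsq s) (β.vsq s) ((α.tgt_vsq s).trans (β.src_vsq s).symm))

/-- Horizontal equivalence transformations: pseudonatural transformations with a pseudonatural
inverse up to invertible horizontal modifications. -/
def HTrans.IsEquiv {oF oG : Ob → Ob'} {F : DblFun C D oF} {G : DblFun C D oG}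
    (α : HTrans F G) : Prop :=
  ∃ (β : HTrans G F) (η : ∀ A : Ob, 𝟙 (D.c (oF A)) ≅ α.app A ≫ β.app A)
    (ζ : ∀ A : Ob, 𝟙 (D.c (oG A)) ≅ β.app A ≫ α.app A), IsUnitMod α β η ∧ IsUnitMod β α ζ

/-- Horizontal icons between pseudo double functors that agree on objects: the data of a
horizontal transformation whose 1-cell components are identities (unit constraints absorbed
in `cell`), with invertible globular components `cell`. -/
structure Icon {o : Ob → Ob'} (F G : DblFun C D o) where
  cell : ∀ {A B : Ob} (f : C.c A ⟶ C.c B), F.h f ≅ G.h f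
  vsq : ∀ {A A' : Ob} (_ : C.pre.V A A'), Sq (𝟙 (D.c (o A))) (𝟙 (D.c (o A')))
  src_vsq : ∀ {A A' : Ob} (s : C.pre.V A A'), D.pre.src (vsq s) = F.mapV s
  tgt_vsq : ∀ {A A' : Ob} (s : C.pre.V A A'), D.pre.tgt (vsq s) = G.mapV s
  cell_comp : ∀ {A B E : Ob} (f : C.c A ⟶ C.c B) (g : C.c B ⟶ C.c E),
    (F.coh.mapComp f g).hom ≫ (cell (f ≫ g)).hom =
      (cell f).hom ▷ F.h g ≫ G.h f ◁ (cell g).hom ≫ (G.coh.mapComp f g).hom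
  cell_id : ∀ A : Ob,
    (F.coh.mapId A).hom ≫ (cell (𝟙 (C.c A))).hom = (G.coh.mapId A).hom
  vsq_vcomp : ∀ {A A' A'' : Ob} (s : C.pre.V A A') (t : C.pre.V A' A''),
    vsq (C.pre.vcomp s t) = vc (vsq s) (vsq t)
  vsq_vid : ∀ A : Ob, vsq (C.pre.vid A) = sq (𝟙 (𝟙 (D.c (o A))))
  cell_sq : ∀ {A B A' B' : Ob} {f : C.c A ⟶ C.c B} {g : C.c A' ⟶ C.c B'} (a : Sq f g),
    vc (hc (F.s a) (vsq (C.pre.tgt a)) ((F.tgt_mapSq a).trans (src_vsq _).symm))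
        (sq ((ρ_ (F.h g)).hom ≫ (cell g).hom ≫ (λ_ (G.h g)).inv)) =
      vc (sq ((ρ_ (F.h f)).hom ≫ (cell f).hom ≫ (λ_ (G.h f)).inv))
        (hc (vsq (C.pre.src a)) (G.s a) ((tgt_vsq _).trans (G.src_mapSq a).symm))

/-- `t` is inverse to `s` for horizontal composition of squares on identity 1-cells. -/
def SqInv {A A' : Ob'} (s t : Sq (𝟙 (D.c A)) (𝟙 (D.c A'))) : Prop :=
  ∃ (e : D.pre.tgt s = D.pre.src t) (e' : D.pre.tgt t = D.pre.src s),
    vc (hc s t e) (sq (λ_ (𝟙 (D.c A'))).hom) =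
      vc (sq (λ_ (𝟙 (D.c A))).hom) (hi (D.pre.src s)) ∧
    vc (hc t s e') (sq (λ_ (𝟙 (D.c A'))).hom) =
      vc (sq (λ_ (𝟙 (D.c A))).hom) (hi (D.pre.src t))

/-- Invertible icons; the globular components are invertible by definition. -/
def Icon.Invertible {o : Ob → Ob'} {F G : DblFun C D o} (θ : Icon F G) : Prop :=
  ∀ {A A' : Ob} (s : C.pre.V A A'), ∃ t, SqInv (θ.vsq s) t
end

/-- Pseudo double functors of two variables. -/
abbrev Bi {Ob : Type u} {Ob' : Type u'} {Ob'' : Type u''} (X : DblCat.{u, v, w, x} Ob)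
    (Y : DblCat.{u', v', w', x'} Ob') (Z : DblCat.{u'', v'', w'', x''} Ob'')
    (o : Ob → Ob' → Ob'') := DblFun (X.prod Y) Z (fun p => o p.1 p.2)

section
variable {Ob : Type u} {Ob' : Type u'} {Ob'' : Type u''} {X : DblCat.{u, v, w, x} Ob}
  {Y : DblCat.{u', v', w', x'} Ob'} {Z : DblCat.{u'', v'', w'', x''} Ob''}
  {o : Ob → Ob' → Ob''} {oX : Ob → Ob' → Ob} {oY : Ob → Ob' → Ob'}
open DblCat

namespace DblFun
/-- Value on horizontal 1-cells. -/
def bh (T : DblFun (X.prod Y) Z (fun p => o p.1 p.2)) {A A' : Ob} {B B' : Ob'}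
    (f : X.c A ⟶ X.c A') (g : Y.c B ⟶ Y.c B') : Z.c (o A B) ⟶ Z.c (o A' B') :=
  T.mapH (A := (A, B)) (B := (A', B')) (f, g)

/-- Value on vertical 1-cells. -/
def bv (T : DblFun (X.prod Y) Z (fun p => o p.1 p.2)) {A A' : Ob} {B B' : Ob'}
    (s : X.pre.V A A') (t : Y.pre.V B B') : Z.pre.V (o A B) (o A' B') :=
  T.mapV (A := (A, B)) (B := (A', B')) (s, t)

/-- Value on squares. -/
def bs (T : DblFun (X.prod Y) Z (fun p => o p.1 p.2)) {A₁ A₂ A₃ A₄ : Ob} {B₁ B₂ B₃ B₄ : Ob'}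
    {f : X.c A₁ ⟶ X.c A₂} {f' : X.c A₃ ⟶ X.c A₄} {g : Y.c B₁ ⟶ Y.c B₂} {g' : Y.c B₃ ⟶ Y.c B₄}
    (a : Sq f f') (b : Sq g g') : Sq (T.bh f g) (T.bh f' g') :=
  T.mapSq (A := (A₁, B₁)) (B := (A₂, B₂)) (A' := (A₃, B₃)) (B' := (A₄, B₄))
    (f := (f, g)) (g := (f', g')) (a, b)

lemma src_bs (T : DblFun (X.prod Y) Z (fun p => o p.1 p.2)) {A₁ A₂ A₃ A₄ : Ob}
    {B₁ B₂ B₃ B₄ : Ob'} {f : X.c A₁ ⟶ X.c A₂} {f' : X.c A₃ ⟶ X.c A₄} {g : Y.c B₁ ⟶ Y.c B₂}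
    {g' : Y.c B₃ ⟶ Y.c B₄} (a : Sq f f') (b : Sq g g') :
    Z.pre.src (T.bs a b) = T.bv (X.pre.src a) (Y.pre.src b) :=
  T.src_mapSq (A := (A₁, B₁)) (B := (A₂, B₂)) (A' := (A₃, B₃)) (B' := (A₄, B₄))
    (f := (f, g)) (g := (f', g')) (a, b)

lemma tgt_bs (T : DblFun (X.prod Y) Z (fun p => o p.1 p.2)) {A₁ A₂ A₃ A₄ : Ob}
    {B₁ B₂ B₃ B₄ : Ob'} {f : X.c A₁ ⟶ X.c A₂} {f' : X.c A₃ ⟶ X.c A₄} {g : Y.c B₁ ⟶ Y.c B₂}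
    {g' : Y.c B₃ ⟶ Y.c B₄} (a : Sq f f') (b : Sq g g') :
    Z.pre.tgt (T.bs a b) = T.bv (X.pre.tgt a) (Y.pre.tgt b) :=
  T.tgt_mapSq (A := (A₁, B₁)) (B := (A₂, B₂)) (A' := (A₃, B₃)) (B' := (A₄, B₄))
    (f := (f, g)) (g := (f', g')) (a, b)

/-- Value on globular 2-cells. -/
def bg (T : DblFun (X.prod Y) Z (fun p => o p.1 p.2)) {A A' : Ob} {B B' : Ob'}
    {f f' : X.c A ⟶ X.c A'} {g g' : Y.c B ⟶ Y.c B'} (a : f ⟶ f') (b : g ⟶ g') :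
    T.bh f g ⟶ T.bh f' g' :=
  PreFun.g T.toPreFun (A := (A, B)) (B := (A', B')) (f := (f, g)) (f' := (f', g'))
    ⟨(sq a, sq b), Prod.ext a.src_cell b.src_cell, Prod.ext a.tgt_cell b.tgt_cell⟩

/-- Compositor. -/
def bc (T : DblFun (X.prod Y) Z (fun p => o p.1 p.2)) {A A' A'' : Ob} {B B' B'' : Ob'}
    (f : X.c A ⟶ X.c A') (g : Y.c B ⟶ Y.c B') (f' : X.c A' ⟶ X.c A'') (g' : Y.c B' ⟶ Y.c B'') :
    T.bh f g ≫ T.bh f' g' ≅ T.bh (f ≫ f') (g ≫ g') :=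
  T.coh.mapComp (A := (A, B)) (B := (A', B')) (E := (A'', B'')) (f, g) (f', g')

/-- Unitor. -/
def bu (T : DblFun (X.prod Y) Z (fun p => o p.1 p.2)) (A : Ob) (B : Ob') :
    𝟙 (Z.c (o A B)) ≅ T.bh (𝟙 (X.c A)) (𝟙 (Y.c B)) :=
  T.coh.mapId (A, B)

/-- A 2-cell in the first variable, acted on by a 1-cell in the second variable. -/
def natL (T : DblFun (X.prod Y) Z (fun p => o p.1 p.2)) {A B E G : Ob} {f : X.c A ⟶ X.c B}
    {b : X.c B ⟶ X.c E} {a : X.c A ⟶ X.c G} {f' : X.c G ⟶ X.c E} (δ : f ≫ b ⟶ a ≫ f')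
    {Q R : Ob'} (k : Y.c Q ⟶ Y.c R) :
    T.bh f k ≫ T.bh b (𝟙 _) ⟶ T.bh a (𝟙 _) ≫ T.bh f' k :=
  (T.bc _ _ _ _).hom ≫ T.bg δ ((ρ_ k).hom ≫ (λ_ k).inv) ≫ (T.bc _ _ _ _).inv

/-- A 2-cell in the second variable, acted on by a 1-cell in the first variable. -/
def natR (T : DblFun (X.prod Y) Z (fun p => o p.1 p.2)) {Q R : Ob} (k : X.c Q ⟶ X.c R)
    {A B E G : Ob'} {f : Y.c A ⟶ Y.c B}
    {b : Y.c B ⟶ Y.c E} {a : Y.c A ⟶ Y.c G} {f' : Y.c G ⟶ Y.c E} (δ : f ≫ b ⟶ a ≫ f') :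
    T.bh k f ≫ T.bh (𝟙 _) b ⟶ T.bh (𝟙 _) a ≫ T.bh k f' :=
  (T.bc _ _ _ _).hom ≫ T.bg ((ρ_ k).hom ≫ (λ_ k).inv) δ ≫ (T.bc _ _ _ _).inv

/-- Compositor of two 1-cells in the first variable. -/
def l2 (T : DblFun (X.prod Y) Z (fun p => o p.1 p.2)) {A B E : Ob} (f : X.c A ⟶ X.c B)
    (g : X.c B ⟶ X.c E) (Q : Ob') :
    T.bh f (𝟙 (Y.c Q)) ≫ T.bh g (𝟙 (Y.c Q)) ⟶ T.bh (f ≫ g) (𝟙 (Y.c Q)) :=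
  (T.bc _ _ _ _).hom ≫ T.bg (𝟙 _) (λ_ _).hom

/-- Decompositor of two 1-cells in the first variable. -/
def l2' (T : DblFun (X.prod Y) Z (fun p => o p.1 p.2)) {A B E : Ob} (f : X.c A ⟶ X.c B)
    (g : X.c B ⟶ X.c E) (Q : Ob') :
    T.bh (f ≫ g) (𝟙 (Y.c Q)) ⟶ T.bh f (𝟙 (Y.c Q)) ≫ T.bh g (𝟙 (Y.c Q)) :=
  T.bg (𝟙 _) (λ_ _).inv ≫ (T.bc _ _ _ _).inv

/-- Compositor of two 1-cells in the second variable. -/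
def r2 (T : DblFun (X.prod Y) Z (fun p => o p.1 p.2)) (Q : Ob) {A B E : Ob'} (f : Y.c A ⟶ Y.c B)
    (g : Y.c B ⟶ Y.c E) :
    T.bh (𝟙 (X.c Q)) f ≫ T.bh (𝟙 (X.c Q)) g ⟶ T.bh (𝟙 (X.c Q)) (f ≫ g) :=
  (T.bc _ _ _ _).hom ≫ T.bg (λ_ _).hom (𝟙 _)

/-- Decompositor of two 1-cells in the second variable. -/
def r2' (T : DblFun (X.prod Y) Z (fun p => o p.1 p.2)) (Q : Ob) {A B E : Ob'} (f : Y.c A ⟶ Y.c B)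
    (g : Y.c B ⟶ Y.c E) :
    T.bh (𝟙 (X.c Q)) (f ≫ g) ⟶ T.bh (𝟙 (X.c Q)) f ≫ T.bh (𝟙 (X.c Q)) g :=
  T.bg (λ_ _).inv (𝟙 _) ≫ (T.bc _ _ _ _).inv

/-- A 2-cell in the first variable, with the object `Q` in the second one, on composites. -/
def whL (T : DblFun (X.prod Y) Z (fun p => o p.1 p.2)) {A B E G H : Ob} {a : X.c A ⟶ X.c B}
    {b : X.c B ⟶ X.c E} {c : X.c E ⟶ X.c H} {g : X.c A ⟶ X.c G} {h : X.c G ⟶ X.c H}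
    (δ : a ≫ b ≫ c ⟶ g ≫ h) (Q : Ob') :
    T.bh a (𝟙 (Y.c Q)) ≫ T.bh b (𝟙 _) ≫ T.bh c (𝟙 _) ⟶ T.bh g (𝟙 _) ≫ T.bh h (𝟙 _) :=
  T.bh a (𝟙 _) ◁ T.l2 b c Q ≫ T.l2 a (b ≫ c) Q ≫ T.bg δ (𝟙 _) ≫ T.l2' g h Q

/-- A 2-cell in the second variable, with the object `Q` in the first one, on composites. -/
def whR (T : DblFun (X.prod Y) Z (fun p => o p.1 p.2)) (Q : Ob) {A B E G H : Ob'}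
    {a : Y.c A ⟶ Y.c B}
    {b : Y.c B ⟶ Y.c E} {c : Y.c E ⟶ Y.c H} {g : Y.c A ⟶ Y.c G} {h : Y.c G ⟶ Y.c H}
    (δ : a ≫ b ≫ c ⟶ g ≫ h) :
    T.bh (𝟙 (X.c Q)) a ≫ T.bh (𝟙 _) b ≫ T.bh (𝟙 _) c ⟶ T.bh (𝟙 _) g ≫ T.bh (𝟙 _) h :=
  T.bh (𝟙 _) a ◁ T.r2 Q b c ≫ T.r2 Q a (b ≫ c) ≫ T.bg (𝟙 _) δ ≫ T.r2' Q g h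

/-- Fixing an object in the first variable. -/
def sectL (T : DblFun (X.prod Y) Z (fun p => o p.1 p.2)) (I : Ob) : DblFun Y Z (fun B => o I B) :=
  ((DblFun.const Y X I).pair (DblFun.id Y)).comp T

/-- Fixing an object in the second variable. -/
def sectR (T : DblFun (X.prod Y) Z (fun p => o p.1 p.2)) (I : Ob') : DblFun X Z (fun A => o A I) :=
  ((DblFun.id X).pair (DblFun.const X Y I)).comp T
end DblFun

namespace HTrans
/-- 1-cell component of a left unit constraint. -/
def la {T : DblFun (X.prod Y) Y (fun p => oY p.1 p.2)} {I : Ob}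
    (t : HTrans (T.sectL I) (DblFun.id Y)) (A : Ob') : Y.c (oY I A) ⟶ Y.c A := t.app A

/-- Naturality of a left unit constraint. -/
def ln {T : DblFun (X.prod Y) Y (fun p => oY p.1 p.2)} {I : Ob}
    (t : HTrans (T.sectL I) (DblFun.id Y)) {A B : Ob'} (f : Y.c A ⟶ Y.c B) :
    T.bh (𝟙 (X.c I)) f ≫ t.la B ≅ t.la A ≫ f := t.nat f

/-- Vertical squares of a left unit constraint. -/
def ls {T : DblFun (X.prod Y) Y (fun p => oY p.1 p.2)} {I : Ob}
    (t : HTrans (T.sectL I) (DblFun.id Y)) {A B : Ob'} (s : Y.pre.V A B) :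
    Sq (t.la A) (t.la B) := t.vsq s

lemma src_ls {T : DblFun (X.prod Y) Y (fun p => oY p.1 p.2)} {I : Ob}
    (t : HTrans (T.sectL I) (DblFun.id Y)) {A B : Ob'} (s : Y.pre.V A B) :
    Y.pre.src (t.ls s) = T.bv (X.pre.vid I) s := t.src_vsq s

lemma tgt_ls {T : DblFun (X.prod Y) Y (fun p => oY p.1 p.2)} {I : Ob}
    (t : HTrans (T.sectL I) (DblFun.id Y)) {A B : Ob'} (s : Y.pre.V A B) :
    Y.pre.tgt (t.ls s) = s := t.tgt_vsq s

/-- 1-cell component of a right unit constraint. -/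
def ra {T : DblFun (X.prod Y) X (fun p => oX p.1 p.2)} {I : Ob'}
    (t : HTrans (T.sectR I) (DblFun.id X)) (A : Ob) : X.c (oX A I) ⟶ X.c A := t.app A

/-- Naturality of a right unit constraint. -/
def rn {T : DblFun (X.prod Y) X (fun p => oX p.1 p.2)} {I : Ob'}
    (t : HTrans (T.sectR I) (DblFun.id X)) {A B : Ob} (f : X.c A ⟶ X.c B) :
    T.bh f (𝟙 (Y.c I)) ≫ t.ra B ≅ t.ra A ≫ f := t.nat f

/-- Vertical squares of a right unit constraint. -/
def rs {T : DblFun (X.prod Y) X (fun p => oX p.1 p.2)} {I : Ob'}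
    (t : HTrans (T.sectR I) (DblFun.id X)) {A B : Ob} (s : X.pre.V A B) :
    Sq (t.ra A) (t.ra B) := t.vsq s

lemma src_rs {T : DblFun (X.prod Y) X (fun p => oX p.1 p.2)} {I : Ob'}
    (t : HTrans (T.sectR I) (DblFun.id X)) {A B : Ob} (s : X.pre.V A B) :
    X.pre.src (t.rs s) = T.bv s (Y.pre.vid I) := t.src_vsq s

lemma tgt_rs {T : DblFun (X.prod Y) X (fun p => oX p.1 p.2)} {I : Ob'}
    (t : HTrans (T.sectR I) (DblFun.id X)) {A B : Ob} (s : X.pre.V A B) :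
    X.pre.tgt (t.rs s) = s := t.tgt_vsq s

/-- 1-cell component of a reversed left unit constraint. -/
def va {T : DblFun (X.prod Y) Y (fun p => oY p.1 p.2)} {I : Ob}
    (t : HTrans (DblFun.id Y) (T.sectL I)) (A : Ob') : Y.c A ⟶ Y.c (oY I A) := t.app A

/-- Naturality of a reversed left unit constraint. -/
def vn {T : DblFun (X.prod Y) Y (fun p => oY p.1 p.2)} {I : Ob}
    (t : HTrans (DblFun.id Y) (T.sectL I)) {A B : Ob'} (f : Y.c A ⟶ Y.c B) :
    f ≫ t.va B ≅ t.va A ≫ T.bh (𝟙 (X.c I)) f := t.nat f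

/-- Vertical squares of a reversed left unit constraint. -/
def vs {T : DblFun (X.prod Y) Y (fun p => oY p.1 p.2)} {I : Ob}
    (t : HTrans (DblFun.id Y) (T.sectL I)) {A B : Ob'} (s : Y.pre.V A B) :
    Sq (t.va A) (t.va B) := t.vsq s

lemma src_vs {T : DblFun (X.prod Y) Y (fun p => oY p.1 p.2)} {I : Ob}
    (t : HTrans (DblFun.id Y) (T.sectL I)) {A B : Ob'} (s : Y.pre.V A B) :
    Y.pre.src (t.vs s) = s := t.src_vsq s

lemma tgt_vs {T : DblFun (X.prod Y) Y (fun p => oY p.1 p.2)} {I : Ob}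
    (t : HTrans (DblFun.id Y) (T.sectL I)) {A B : Ob'} (s : Y.pre.V A B) :
    Y.pre.tgt (t.vs s) = T.bv (X.pre.vid I) s := t.tgt_vsq s
end HTrans
end

section
universe u₁ u₂ u₃ u₄ u₅ u₆ v₁ v₂ v₃ v₄ v₅ v₆ w₁ w₂ w₃ w₄ w₅ w₆ x₁ x₂ x₃ x₄ x₅ x₆
variable {O₁ : Type u₁} {O₂ : Type u₂} {O₃ : Type u₃} {O₁₂ : Type u₄} {O₂₃ : Type u₅}
  {O : Type u₆}
  {X₁ : DblCat.{u₁, v₁, w₁, x₁} O₁} {X₂ : DblCat.{u₂, v₂, w₂, x₂} O₂}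
  {X₃ : DblCat.{u₃, v₃, w₃, x₃} O₃} {X₁₂ : DblCat.{u₄, v₄, w₄, x₄} O₁₂}
  {X₂₃ : DblCat.{u₅, v₅, w₅, x₅} O₂₃} {Z : DblCat.{u₆, v₆, w₆, x₆} O}
  {o₁ : O₁ → O₂ → O₁₂} {o₂ : O₁₂ → O₃ → O} {o₃ : O₂ → O₃ → O₂₃} {o₄ : O₁ → O₂₃ → O}
open DblCat

/-- The ternary functor `(A B) C`. -/
def tensL (S : Bi X₁ X₂ X₁₂ o₁) (T : Bi X₁₂ X₃ Z o₂) :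
    DblFun (X₁.prod (X₂.prod X₃)) Z (fun p => o₂ (o₁ p.1 p.2.1) p.2.2) :=
  ((((DblFun.fst X₁ (X₂.prod X₃)).pair
      ((DblFun.snd X₁ (X₂.prod X₃)).comp (DblFun.fst X₂ X₃))).comp S).pair
    ((DblFun.snd X₁ (X₂.prod X₃)).comp (DblFun.snd X₂ X₃))).comp T

/-- The ternary functor `A (B C)`. -/
def tensR (S : Bi X₂ X₃ X₂₃ o₃) (T : Bi X₁ X₂₃ Z o₄) :
    DblFun (X₁.prod (X₂.prod X₃)) Z (fun p => o₄ p.1 (o₃ p.2.1 p.2.2)) :=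
  ((DblFun.fst X₁ (X₂.prod X₃)).pair
    ((DblFun.snd X₁ (X₂.prod X₃)).comp S)).comp T

/-- Associators `(A B) C ⟶ A (B C)`. -/
abbrev Asc (S : Bi X₁ X₂ X₁₂ o₁) (T : Bi X₁₂ X₃ Z o₂) (S' : Bi X₂ X₃ X₂₃ o₃)
    (T' : Bi X₁ X₂₃ Z o₄) := HTrans (tensL S T) (tensR S' T')

/-- Associators `A (B C) ⟶ (A B) C`. -/
abbrev CoAsc (S : Bi X₁ X₂ X₁₂ o₁) (T : Bi X₁₂ X₃ Z o₂) (S' : Bi X₂ X₃ X₂₃ o₃)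
    (T' : Bi X₁ X₂₃ Z o₄) := HTrans (tensR S' T') (tensL S T)

namespace HTrans
variable {S : Bi X₁ X₂ X₁₂ o₁} {T : Bi X₁₂ X₃ Z o₂} {S' : Bi X₂ X₃ X₂₃ o₃} {T' : Bi X₁ X₂₃ Z o₄}

/-- 1-cell component of an associator. -/
def a3 (a : Asc S T S' T') (A : O₁) (B : O₂) (E : O₃) :
    Z.c (o₂ (o₁ A B) E) ⟶ Z.c (o₄ A (o₃ B E)) := a.app (A, B, E)

/-- Naturality of an associator. -/
def n3 (a : Asc S T S' T') {A A' : O₁} {B B' : O₂} {E E' : O₃} (f : X₁.c A ⟶ X₁.c A')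
    (g : X₂.c B ⟶ X₂.c B') (h : X₃.c E ⟶ X₃.c E') :
    T.bh (S.bh f g) h ≫ a.a3 A' B' E' ≅ a.a3 A B E ≫ T'.bh f (S'.bh g h) :=
  a.nat (A := (A, B, E)) (B := (A', B', E')) (f, g, h)

/-- Vertical squares of an associator. -/
def s3 (a : Asc S T S' T') {A A' : O₁} {B B' : O₂} {E E' : O₃} (s : X₁.pre.V A A')
    (t : X₂.pre.V B B') (r : X₃.pre.V E E') : Sq (a.a3 A B E) (a.a3 A' B' E') :=
  a.vsq (A := (A, B, E)) (A' := (A', B', E')) (s, t, r)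

lemma src_s3 (a : Asc S T S' T') {A A' : O₁} {B B' : O₂} {E E' : O₃} (s : X₁.pre.V A A')
    (t : X₂.pre.V B B') (r : X₃.pre.V E E') : Z.pre.src (a.s3 s t r) = T.bv (S.bv s t) r :=
  a.src_vsq (A := (A, B, E)) (A' := (A', B', E')) (s, t, r)

lemma tgt_s3 (a : Asc S T S' T') {A A' : O₁} {B B' : O₂} {E E' : O₃} (s : X₁.pre.V A A')
    (t : X₂.pre.V B B') (r : X₃.pre.V E E') : Z.pre.tgt (a.s3 s t r) = T'.bv s (S'.bv t r) :=
  a.tgt_vsq (A := (A, B, E)) (A' := (A', B', E')) (s, t, r)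

/-- Naturality of an associator in the first variable. -/
def nat₁ (a : Asc S T S' T') {A A' : O₁} (f : X₁.c A ⟶ X₁.c A') (B : O₂) (E : O₃) :
    T.bh (S.bh f (𝟙 (X₂.c B))) (𝟙 (X₃.c E)) ≫ a.a3 A' B E ⟶
      a.a3 A B E ≫ T'.bh f (𝟙 (X₂₃.c (o₃ B E))) :=
  (a.n3 f (𝟙 _) (𝟙 _)).hom ≫ a.a3 A B E ◁ T'.bg (𝟙 f) (S'.bu B E).inv

/-- Naturality of an associator in the second variable. -/
def nat₂ (a : Asc S T S' T') (A : O₁) {B B' : O₂} (g : X₂.c B ⟶ X₂.c B') (E : O₃) :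
    T.bh (S.bh (𝟙 (X₁.c A)) g) (𝟙 (X₃.c E)) ≫ a.a3 A B' E ⟶
      a.a3 A B E ≫ T'.bh (𝟙 (X₁.c A)) (S'.bh g (𝟙 (X₃.c E))) :=
  (a.n3 (𝟙 _) g (𝟙 _)).hom

/-- Naturality of an associator in the third variable. -/
def nat₃ (a : Asc S T S' T') (A : O₁) (B : O₂) {E E' : O₃} (h : X₃.c E ⟶ X₃.c E') :
    T.bh (𝟙 (X₁₂.c (o₁ A B))) h ≫ a.a3 A B E' ⟶
      a.a3 A B E ≫ T'.bh (𝟙 (X₁.c A)) (S'.bh (𝟙 (X₂.c B)) h) :=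
  T.bg (S.bu A B).hom (𝟙 h) ▷ a.a3 A B E' ≫ (a.n3 (𝟙 _) (𝟙 _) h).hom

/-- Inverse naturality of an associator in the third variable. -/
def nat₃' (a : Asc S T S' T') (A : O₁) (B : O₂) {E E' : O₃} (h : X₃.c E ⟶ X₃.c E') :
    a.a3 A B E ≫ T'.bh (𝟙 (X₁.c A)) (S'.bh (𝟙 (X₂.c B)) h) ⟶
      T.bh (𝟙 (X₁₂.c (o₁ A B))) h ≫ a.a3 A B E' :=
  (a.n3 (𝟙 _) (𝟙 _) h).inv ≫ T.bg (S.bu A B).inv (𝟙 h) ▷ a.a3 A B E'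

/-- Inverse naturality of an associator in the first variable. -/
def nat₁' (a : Asc S T S' T') {A A' : O₁} (f : X₁.c A ⟶ X₁.c A') (B : O₂) (E : O₃) :
    a.a3 A B E ≫ T'.bh f (𝟙 (X₂₃.c (o₃ B E))) ⟶
      T.bh (S.bh f (𝟙 (X₂.c B))) (𝟙 (X₃.c E)) ≫ a.a3 A' B E :=
  a.a3 A B E ◁ T'.bg (𝟙 f) (S'.bu B E).hom ≫ (a.n3 f (𝟙 _) (𝟙 _)).inv

/-- Inverse naturality of an associator in the second variable. -/
def nat₂' (a : Asc S T S' T') (A : O₁) {B B' : O₂} (g : X₂.c B ⟶ X₂.c B') (E : O₃) :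
    a.a3 A B E ≫ T'.bh (𝟙 (X₁.c A)) (S'.bh g (𝟙 (X₃.c E))) ⟶
      T.bh (S.bh (𝟙 (X₁.c A)) g) (𝟙 (X₃.c E)) ≫ a.a3 A B' E :=
  (a.n3 (𝟙 _) g (𝟙 _)).inv

/-- 1-cell component of a reversed associator. -/
def b3 (b : CoAsc S T S' T') (A : O₁) (B : O₂) (E : O₃) :
    Z.c (o₄ A (o₃ B E)) ⟶ Z.c (o₂ (o₁ A B) E) := b.app (A, B, E)

/-- Naturality of a reversed associator. -/
def m3 (b : CoAsc S T S' T') {A A' : O₁} {B B' : O₂} {E E' : O₃} (f : X₁.c A ⟶ X₁.c A')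
    (g : X₂.c B ⟶ X₂.c B') (h : X₃.c E ⟶ X₃.c E') :
    T'.bh f (S'.bh g h) ≫ b.b3 A' B' E' ≅ b.b3 A B E ≫ T.bh (S.bh f g) h :=
  b.nat (A := (A, B, E)) (B := (A', B', E')) (f, g, h)

/-- Vertical squares of a reversed associator. -/
def t3 (b : CoAsc S T S' T') {A A' : O₁} {B B' : O₂} {E E' : O₃} (s : X₁.pre.V A A')
    (t : X₂.pre.V B B') (r : X₃.pre.V E E') : Sq (b.b3 A B E) (b.b3 A' B' E') :=
  b.vsq (A := (A, B, E)) (A' := (A', B', E')) (s, t, r)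

lemma src_t3 (b : CoAsc S T S' T') {A A' : O₁} {B B' : O₂} {E E' : O₃} (s : X₁.pre.V A A')
    (t : X₂.pre.V B B') (r : X₃.pre.V E E') : Z.pre.src (b.t3 s t r) = T'.bv s (S'.bv t r) :=
  b.src_vsq (A := (A, B, E)) (A' := (A', B', E')) (s, t, r)

lemma tgt_t3 (b : CoAsc S T S' T') {A A' : O₁} {B B' : O₂} {E E' : O₃} (s : X₁.pre.V A A')
    (t : X₂.pre.V B B') (r : X₃.pre.V E E') : Z.pre.tgt (b.t3 s t r) = T.bv (S.bv s t) r :=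
  b.tgt_vsq (A := (A, B, E)) (A' := (A', B', E')) (s, t, r)
end HTrans
end

section
universe b₁ b₂ b₃
variable {B : Type b₁} [Bicategory.{b₂, b₃} B]

/-- Equality of the two pastings of the associahedron. -/
def Pasting5 {X₀ X₁ X₂ X₃ X₄ X₅ X₆ Y₁ Y₂ Y₃ Y₄ Y₅ Y₆ Y₇ : B}
    {a : X₀ ⟶ X₁} {b : X₁ ⟶ X₂} {c : X₂ ⟶ X₃} {d : X₃ ⟶ X₄} {e : X₄ ⟶ X₅} {f : X₅ ⟶ X₆}
    {g : X₀ ⟶ Y₁} {h : Y₁ ⟶ X₃} {i : Y₁ ⟶ Y₂} {j : Y₂ ⟶ X₅} {k : Y₂ ⟶ Y₃} {m : Y₃ ⟶ X₆}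
    {n : X₀ ⟶ Y₄} {q : Y₄ ⟶ Y₃} {s : X₂ ⟶ Y₅} {t : Y₅ ⟶ X₄} {x : Y₅ ⟶ Y₆} {y : Y₆ ⟶ X₆}
    {z : X₁ ⟶ Y₇} {w : Y₇ ⟶ Y₆} {v : Y₄ ⟶ Y₇}
    (φ₁ : a ≫ b ≫ c ⟶ g ≫ h) (φ₂ : h ≫ d ≫ e ⟶ i ≫ j) (σ₁ : j ≫ f ⟶ k ≫ m)
    (φ₃ : g ≫ i ≫ k ⟶ n ≫ q) (σ₂ : c ≫ d ⟶ s ≫ t) (φ₄ : t ≫ e ≫ f ⟶ x ≫ y)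
    (φ₅ : b ≫ s ≫ x ⟶ z ≫ w) (σ₃ : a ≫ z ⟶ n ≫ v) (φ₆ : v ≫ w ≫ y ⟶ q ≫ m) : Prop :=
  𝟙 (a ≫ b ≫ c ≫ d ≫ e ≫ f) ⊗≫ φ₁ ▷ (d ≫ e ≫ f) ⊗≫ g ◁ φ₂ ▷ f ⊗≫ g ◁ i ◁ σ₁ ⊗≫ φ₃ ▷ m ⊗≫
      𝟙 (n ≫ q ≫ m) =
    𝟙 (a ≫ b ≫ c ≫ d ≫ e ≫ f) ⊗≫ a ◁ b ◁ σ₂ ▷ (e ≫ f) ⊗≫ a ◁ b ◁ s ◁ φ₄ ⊗≫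
      a ◁ φ₅ ▷ y ⊗≫ σ₃ ▷ (w ≫ y) ⊗≫ n ◁ φ₆ ⊗≫ 𝟙 (n ≫ q ≫ m)

/-- Equality of the two pastings of the left normalization condition. -/
def PastingL {X₀ X₁ X₂ X₃ X₄ Y₁ Y₂ : B}
    {a : X₀ ⟶ X₁} {b : X₁ ⟶ X₂} {c : X₂ ⟶ X₃} {d : X₃ ⟶ X₄} {g : X₀ ⟶ Y₁} {h : Y₁ ⟶ X₃}
    {k : Y₁ ⟶ X₄} {m : X₀ ⟶ Y₂} {n : Y₂ ⟶ X₄} {s : X₂ ⟶ X₄} {t : X₁ ⟶ Y₂}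
    (φ : a ≫ b ≫ c ⟶ g ≫ h) (μ₁ : h ≫ d ⟶ k) (σ₁ : g ≫ k ⟶ m ≫ n)
    (l : c ≫ d ⟶ s) (σ₂ : b ≫ s ⟶ t ≫ n) (μ₂ : a ≫ t ⟶ m) : Prop :=
  𝟙 (a ≫ b ≫ c ≫ d) ⊗≫ φ ▷ d ⊗≫ g ◁ μ₁ ⊗≫ σ₁ =
    𝟙 (a ≫ b ≫ c ≫ d) ⊗≫ a ◁ b ◁ l ⊗≫ a ◁ σ₂ ⊗≫ μ₂ ▷ n

/-- Equality of the two pastings of the right normalization condition. -/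
def PastingR {X₀ X₁ X₂ X₃ X₄ Y₁ Y₂ : B}
    {a : X₀ ⟶ X₁} {b : X₁ ⟶ X₂} {c : X₂ ⟶ X₃} {d : X₃ ⟶ X₄} {g : X₀ ⟶ Y₁} {h : Y₁ ⟶ X₃}
    {k : Y₁ ⟶ Y₂} {n : Y₂ ⟶ X₄} {q : X₀ ⟶ Y₂} {s : X₂ ⟶ X₄} {t : X₁ ⟶ Y₂}
    (φ : a ≫ b ≫ c ⟶ g ≫ h) (σ₁ : h ≫ d ⟶ k ≫ n) (μ₁ : g ≫ k ⟶ q) (r : q ⟶ a ≫ t)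
    (μ₂ : c ≫ d ⟶ s) (σ₂ : b ≫ s ⟶ t ≫ n) : Prop :=
  𝟙 (a ≫ b ≫ c ≫ d) ⊗≫ φ ▷ d ⊗≫ g ◁ σ₁ ⊗≫ μ₁ ▷ n ⊗≫ r ▷ n ⊗≫ 𝟙 (a ≫ t ≫ n) =
    𝟙 (a ≫ b ≫ c ≫ d) ⊗≫ a ◁ b ◁ μ₂ ⊗≫ a ◁ σ₂

/-- Pasting of two naturality cells along a composite. -/
def paste {X₀ X₁ X₂ Y₀ Y₁ Y₂ : B} {x₀ : X₀ ⟶ Y₀} {x₁ : X₁ ⟶ Y₁} {x₂ : X₂ ⟶ Y₂}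
    {a₁ : X₀ ⟶ X₁} {a₂ : X₁ ⟶ X₂} {b₁ : Y₀ ⟶ Y₁} {b₂ : Y₁ ⟶ Y₂}
    (δ₁ : x₀ ≫ b₁ ⟶ a₁ ≫ x₁) (δ₂ : x₁ ≫ b₂ ⟶ a₂ ≫ x₂) :
    x₀ ≫ b₁ ≫ b₂ ⟶ (a₁ ≫ a₂) ≫ x₂ :=
  (α_ _ _ _).inv ≫ δ₁ ▷ b₂ ≫ (α_ _ _ _).hom ≫ a₁ ◁ δ₂ ≫ (α_ _ _ _).inv

/-- Naturality of 2-cells `φ`, `φ'` with respect to the naturality cells `δ`, `ζ` of the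
composites that are their domains and codomains. -/
def NatMod {X Y X' Y' : B} {x : X ⟶ X'} {y : Y ⟶ Y'} {a c : X ⟶ Y} {b d : X' ⟶ Y'}
    (φ : a ⟶ c) (φ' : b ⟶ d) (δ : x ≫ b ⟶ a ≫ y) (ζ : x ≫ d ⟶ c ≫ y) : Prop :=
  x ◁ φ' ≫ ζ = δ ≫ φ ▷ y
end

section
open DblCat

section
variable {Ob : Type u} {o : Ob → Ob → Ob} {X₁ X₂ X₃ X₄ X₁₂ X₂₃ X₃₄ X₁₂₃ X₂₃₄ Z : DblCat Ob}
  {T₁₂ : Bi X₁ X₂ X₁₂ o} {T₁₂_₃ : Bi X₁₂ X₃ X₁₂₃ o} {T₂₃ : Bi X₂ X₃ X₂₃ o}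
  {T₁_₂₃ : Bi X₁ X₂₃ X₁₂₃ o} {T₃₄ : Bi X₃ X₄ X₃₄ o} {T₂₃_₄ : Bi X₂₃ X₄ X₂₃₄ o}
  {T₂_₃₄ : Bi X₂ X₃₄ X₂₃₄ o} {T₁₂₃_₄ : Bi X₁₂₃ X₄ Z o} {T₁_₂₃₄ : Bi X₁ X₂₃₄ Z o}
  {T₁₂_₃₄ : Bi X₁₂ X₃₄ Z o}

/-- Components of a pentagon 2-cell
`[α_{ABC} D | α_{A,BC,D} | A α_{BCD}] ⇒ [α_{AB,C,D} | α_{A,B,CD}]`. -/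
abbrev PCell (a : Asc T₁₂ T₁₂_₃ T₂₃ T₁_₂₃) (a' : Asc T₁_₂₃ T₁₂₃_₄ T₂₃_₄ T₁_₂₃₄)
    (a'' : Asc T₂₃ T₂₃_₄ T₃₄ T₂_₃₄) (c : Asc T₁₂_₃ T₁₂₃_₄ T₃₄ T₁₂_₃₄)
    (c' : Asc T₁₂ T₁₂_₃₄ T₂_₃₄ T₁_₂₃₄) :=
  ∀ A B E G : Ob, T₁₂₃_₄.bh (a.a3 A B E) (𝟙 (X₄.c G)) ≫ a'.a3 A (o B E) G ≫
      T₁_₂₃₄.bh (𝟙 (X₁.c A)) (a''.a3 B E G) ≅ c.a3 (o A B) E G ≫ c'.a3 A B (o E G)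

/-- The components `p` form a horizontal modification. -/
structure PMod (a : Asc T₁₂ T₁₂_₃ T₂₃ T₁_₂₃) (a' : Asc T₁_₂₃ T₁₂₃_₄ T₂₃_₄ T₁_₂₃₄)
    (a'' : Asc T₂₃ T₂₃_₄ T₃₄ T₂_₃₄) (c : Asc T₁₂_₃ T₁₂₃_₄ T₃₄ T₁₂_₃₄)
    (c' : Asc T₁₂ T₁₂_₃₄ T₂_₃₄ T₁_₂₃₄) (p : PCell a a' a'' c c') : Prop where
  nat_h : ∀ {A A' B B' E E' G G' : Ob} (f : X₁.c A ⟶ X₁.c A') (g : X₂.c B ⟶ X₂.c B')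
    (h : X₃.c E ⟶ X₃.c E') (k : X₄.c G ⟶ X₄.c G'),
    NatMod (p A B E G).hom (p A' B' E' G').hom
      (paste (T₁₂₃_₄.natL (a.n3 f g h).hom k)
        (paste (a'.n3 f (T₂₃.bh g h) k).hom (T₁_₂₃₄.natR f (a''.n3 g h k).hom)))
      (paste (c.n3 (T₁₂.bh f g) h k).hom (c'.n3 f g (T₃₄.bh h k)).hom)
  nat_v : ∀ {A A' B B' E E' G G' : Ob} (s : X₁.pre.V A A') (t : X₂.pre.V B B')
    (r : X₃.pre.V E E') (q : X₄.pre.V G G'),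
    vc (hc (T₁₂₃_₄.bs (a.s3 s t r) (hi q))
        (hc (a'.s3 s (T₂₃.bv t r) q) (T₁_₂₃₄.bs (hi s) (a''.s3 t r q))
          (by rw [HTrans.tgt_s3, DblFun.src_bs, HTrans.src_s3, PreDbl.src_shid]))
        (by rw [PreDbl.src_shcomp, DblFun.tgt_bs, HTrans.tgt_s3, HTrans.src_s3, PreDbl.tgt_shid]))
      (sq (p A' B' E' G').hom) =
    vc (sq (p A B E G).hom)
      (hc (c.s3 (T₁₂.bv s t) r q) (c'.s3 s t (T₃₄.bv r q))
        (by rw [HTrans.tgt_s3, HTrans.src_s3]))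
end

section
variable {Ob : Type u} {o : Ob → Ob → Ob} {I : Ob} {X₁ X₂ X₃ Y Z : DblCat Ob}

/-- Components of a 2-cell `λ_A B ⇒ [α_{I,A,B} | λ_{AB}]`. -/
abbrev LCell {S : Bi X₁ X₂ X₂ o} {T : Bi X₂ X₃ Z o} {T' : Bi X₁ Z Z o} (a : Asc S T T T')
    (t : HTrans (S.sectL I) (DblFun.id X₂)) (t' : HTrans (T'.sectL I) (DblFun.id Z)) :=
  ∀ A B : Ob, T.bh (t.la A) (𝟙 (X₃.c B)) ≅ a.a3 I A B ≫ t'.la (o A B)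

/-- The components `l` form a horizontal modification. -/
structure LMod {S : Bi X₁ X₂ X₂ o} {T : Bi X₂ X₃ Z o} {T' : Bi X₁ Z Z o} (a : Asc S T T T')
    (t : HTrans (S.sectL I) (DblFun.id X₂)) (t' : HTrans (T'.sectL I) (DblFun.id Z))
    (l : LCell a t t') : Prop where
  nat_h : ∀ {A A' B B' : Ob} (f : X₂.c A ⟶ X₂.c A') (g : X₃.c B ⟶ X₃.c B'),
    NatMod (l A B).hom (l A' B').hom (T.natL (t.ln f).hom g)
      (paste (a.n3 (𝟙 (X₁.c I)) f g).hom (t'.ln (T.bh f g)).hom)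
  nat_v : ∀ {A A' B B' : Ob} (s : X₂.pre.V A A') (r : X₃.pre.V B B'),
    vc (T.bs (t.ls s) (hi r)) (sq (l A' B').hom) =
      vc (sq (l A B).hom) (hc (a.s3 (X₁.pre.vid I) s r) (t'.ls (T.bv s r))
        (by rw [HTrans.tgt_s3, HTrans.src_ls]))

/-- Components of a 2-cell `ρ_{AB} ⇒ [α_{A,B,I} | A ρ_B]`. -/
abbrev RCell {S : Bi X₁ X₂ Z o} {T : Bi Z Y Z o} {S' : Bi X₂ Y X₂ o} (a : Asc S T S' S)
    (t : HTrans (S'.sectR I) (DblFun.id X₂)) (t' : HTrans (T.sectR I) (DblFun.id Z)) :=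
  ∀ A B : Ob, t'.ra (o A B) ≅ a.a3 A B I ≫ S.bh (𝟙 (X₁.c A)) (t.ra B)

/-- The components `r` form a horizontal modification. -/
structure RMod {S : Bi X₁ X₂ Z o} {T : Bi Z Y Z o} {S' : Bi X₂ Y X₂ o} (a : Asc S T S' S)
    (t : HTrans (S'.sectR I) (DblFun.id X₂)) (t' : HTrans (T.sectR I) (DblFun.id Z))
    (r : RCell a t t') : Prop where
  nat_h : ∀ {A A' B B' : Ob} (f : X₁.c A ⟶ X₁.c A') (g : X₂.c B ⟶ X₂.c B'),
    NatMod (r A B).hom (r A' B').hom (t'.rn (S.bh f g)).hom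
      (paste (a.n3 f g (𝟙 (Y.c I))).hom (S.natR f (t.rn g).hom))
  nat_v : ∀ {A A' B B' : Ob} (s : X₁.pre.V A A') (q : X₂.pre.V B B'),
    vc (t'.rs (S.bv s q)) (sq (r A' B').hom) =
      vc (sq (r A B).hom) (hc (a.s3 s q (Y.pre.vid I)) (S.bs (hi s) (t.rs q))
        (by rw [HTrans.tgt_s3, DblFun.src_bs, HTrans.src_rs, PreDbl.src_shid]))

/-- Components of a 2-cell `[α_{A,I,B} | A λ_B] ⇒ ρ_A B`. -/
abbrev MCell {S : Bi X₁ Y X₁ o} {T : Bi X₁ X₂ Z o} {S' : Bi Y X₂ X₂ o} (a : Asc S T S' T)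
    (t : HTrans (S'.sectL I) (DblFun.id X₂)) (t' : HTrans (S.sectR I) (DblFun.id X₁)) :=
  ∀ A B : Ob, a.a3 A I B ≫ T.bh (𝟙 (X₁.c A)) (t.la B) ≅ T.bh (t'.ra A) (𝟙 (X₂.c B))

/-- The components `m` form a horizontal modification. -/
structure MMod {S : Bi X₁ Y X₁ o} {T : Bi X₁ X₂ Z o} {S' : Bi Y X₂ X₂ o} (a : Asc S T S' T)
    (t : HTrans (S'.sectL I) (DblFun.id X₂)) (t' : HTrans (S.sectR I) (DblFun.id X₁))
    (m : MCell a t t') : Prop where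
  nat_h : ∀ {A A' B B' : Ob} (f : X₁.c A ⟶ X₁.c A') (g : X₂.c B ⟶ X₂.c B'),
    NatMod (m A B).hom (m A' B').hom
      (paste (a.n3 f (𝟙 (Y.c I)) g).hom (T.natR f (t.ln g).hom)) (T.natL (t'.rn f).hom g)
  nat_v : ∀ {A A' B B' : Ob} (s : X₁.pre.V A A') (q : X₂.pre.V B B'),
    vc (hc (a.s3 s (Y.pre.vid I) q) (T.bs (hi s) (t.ls q))
        (by rw [HTrans.tgt_s3, DblFun.src_bs, HTrans.src_ls, PreDbl.src_shid]))
      (sq (m A' B').hom) =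
    vc (sq (m A B).hom) (T.bs (t'.rs s) (hi q))
end

/-- The data of a horizontally monoidal double category: tensor product with object map `o`,
unit object `I`, associativity and unit constraints `α`, `λ`, `ρ` and invertible 2-cells
`p : [α_{ABC} D | α_{A,BC,D} | A α_{BCD}] ⇒ [α_{AB,C,D} | α_{A,B,CD}]`,
`m : [α_{A,I,B} | A λ_B] ⇒ ρ_A B`, `l : λ_A B ⇒ [α_{I,A,B} | λ_{AB}]` and
`r : ρ_{AB} ⇒ [α_{A,B,I} | A ρ_B]`. -/
structure MonData {Ob : Type u} (D : DblCat.{u, v, w, x} Ob) (o : Ob → Ob → Ob) (I : Ob) where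
  T : Bi D D D o
  a : Asc T T T T
  lu : HTrans (T.sectL I) (DblFun.id D)
  ru : HTrans (T.sectR I) (DblFun.id D)
  p : PCell a a a a a
  m : MCell a lu ru
  l : LCell a lu lu
  r : RCell a ru ru

/-- The data of a left horizontal action of a monoidal `D` on `K` given by `T`. -/
structure LeftData {Ob : Type u} {D : DblCat.{u, v, w, x} Ob} {o : Ob → Ob → Ob} {I : Ob}
    (mD : MonData D o I) {K : DblCat.{u, v', w', x'} Ob} (T : Bi D K K o) where
  a : Asc mD.T T T T
  lu : HTrans (T.sectL I) (DblFun.id K)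
  p : PCell mD.a a a a a
  m : MCell a lu mD.ru
  l : LCell a mD.lu lu

/-- The data of a right horizontal action of a monoidal `D` on `K` given by `T`. -/
structure RightData {Ob : Type u} {D : DblCat.{u, v, w, x} Ob} {o : Ob → Ob → Ob} {I : Ob}
    (mD : MonData D o I) {K : DblCat.{u, v', w', x'} Ob} (T : Bi K D K o) where
  a : Asc T T mD.T T
  ru : HTrans (T.sectR I) (DblFun.id K)
  p : PCell a a mD.a a a
  m : MCell a mD.lu ru
  r : RCell a mD.ru ru

section
variable {Ob : Type u} {D : DblCat.{u, v, w, x} Ob} {o : Ob → Ob → Ob} {I : Ob}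
  {mD : MonData D o I} {K : DblCat.{u, v', w', x'} Ob}

/-- The laws of a left horizontal action: the constraints are horizontal equivalences, the 2-cells
are horizontal modifications, and the associahedron and left normalization axioms hold. -/
structure LeftLaws {T : Bi D K K o} (L : LeftData mD T) : Prop where
  a_equiv : L.a.IsEquiv
  lu_equiv : L.lu.IsEquiv
  p_mod : PMod _ _ _ _ _ L.p
  m_mod : MMod _ _ _ L.m
  l_mod : LMod _ _ _ L.l
  assoc5 : ∀ A B E G k : Ob,
    Pasting5 (T.whL (mD.p A B E G).hom k) (L.p A B (o E G) k).hom
      (L.a.nat₃' A B (L.a.a3 E G k)) (L.p (o A B) E G k).hom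
      (L.a.nat₂ A (mD.a.a3 B E G) k) (T.whR A (L.p B E G k).hom) (L.p A (o B E) G k).hom
      (L.a.nat₁ (mD.a.a3 A B E) G k) (L.p A B E (o G k)).hom
  normL : ∀ A B k : Ob,
    PastingL (L.p A I B k).hom (L.m A (o B k)).hom (L.a.nat₁' (mD.ru.ra A) B k)
      (T.r2 A (L.a.a3 I B k) (L.lu.la (o B k)) ≫ T.bg (𝟙 _) (L.l B k).inv)
      (L.a.nat₂' A (mD.lu.la B) k)
      (T.l2 (mD.a.a3 A I B) (mD.T.bh (𝟙 _) (mD.lu.la B)) k ≫ T.bg (mD.m A B).hom (𝟙 _))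

/-- The laws of a right horizontal action: the constraints are horizontal equivalences, the 2-cells
are horizontal modifications, and the associahedron and right normalization axioms hold. -/
structure RightLaws {T : Bi K D K o} (R : RightData mD T) : Prop where
  a_equiv : R.a.IsEquiv
  ru_equiv : R.ru.IsEquiv
  p_mod : PMod _ _ _ _ _ R.p
  m_mod : MMod _ _ _ R.m
  r_mod : RMod _ _ _ R.r
  assoc5 : ∀ k A B E G : Ob,
    Pasting5 (T.whL (R.p k A B E).hom G) (R.p k A (o B E) G).hom
      (R.a.nat₃' k A (mD.a.a3 B E G)) (R.p (o k A) B E G).hom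
      (R.a.nat₂ k (mD.a.a3 A B E) G) (T.whR k (mD.p A B E G).hom) (R.p k (o A B) E G).hom
      (R.a.nat₁ (R.a.a3 k A B) E G) (R.p k A B (o E G)).hom
  normR : ∀ k A B : Ob,
    PastingR (R.p k A I B).hom (R.a.nat₃' k A (mD.lu.la B)) (R.m (o k A) B).hom
      (T.bg (R.r k A).hom (𝟙 (𝟙 (D.c B))) ≫ T.l2' (R.a.a3 k A I) (T.bh (𝟙 _) (mD.ru.ra A)) B)
      (T.r2 k (mD.a.a3 A I B) (mD.T.bh (𝟙 _) (mD.lu.la B)) ≫ T.bg (𝟙 _) (mD.m A B).hom)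
      (R.a.nat₂' k (mD.ru.ra A) B)

/-- A monoidal structure as a left action of `D` on itself. -/
def MonData.left (mD : MonData D o I) : LeftData mD mD.T where
  a := mD.a
  lu := mD.lu
  p := mD.p
  m := mD.m
  l := mD.l

/-- A monoidal structure as a right action of `D` on itself. -/
def MonData.right (mD : MonData D o I) : RightData mD mD.T where
  a := mD.a
  ru := mD.ru
  p := mD.p
  m := mD.m
  r := mD.r
end

/-- Horizontally monoidal double categories: the constraints are horizontal equivalences, the
2-cells are horizontal modifications and the three axioms of a monoidal bicategory
(associahedron, left and right normalization) hold. -/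
structure HMonoidal {Ob : Type u} (D : DblCat.{u, v, w, x} Ob) (o : Ob → Ob → Ob) (I : Ob)
    extends MonData D o I where
  leftLaws : LeftLaws toMonData.left
  rightLaws : RightLaws toMonData.right
end

section
universe b₁ b₂ b₃
variable {B : Type b₁} [Bicategory.{b₂, b₃} B]

/-- Naturality cell of an identity 1-cell. -/
def natOne {X Y : B} (x : X ⟶ Y) : x ≫ 𝟙 Y ⟶ 𝟙 X ≫ x := (ρ_ x).hom ≫ (λ_ x).inv

/-- Equality of the two pastings of the associativity coherence of a lax action. -/
def PastingLax {X₀ X₁ X₂ X₃ Y₁ Y₂ Y₃ Y₄ Y₅ Y₆ Y₇ Y₈ : B}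
    {a : X₀ ⟶ X₁} {b : X₁ ⟶ X₂} {c : X₂ ⟶ X₃} {d : X₀ ⟶ Y₁} {e : Y₁ ⟶ Y₂} {f : Y₂ ⟶ X₂}
    {g : Y₂ ⟶ Y₃} {h : Y₃ ⟶ X₃} {i : Y₁ ⟶ Y₄} {j : Y₄ ⟶ Y₅} {k : Y₅ ⟶ Y₃}
    {l : X₀ ⟶ Y₆} {m : Y₆ ⟶ Y₇} {n : Y₇ ⟶ Y₄} {q : Y₇ ⟶ Y₈} {r : Y₈ ⟶ Y₅}
    {Z₁ Z₂ : B} {s : Y₈ ⟶ Z₁} {t : Z₁ ⟶ X₃} {x : X₁ ⟶ Z₂} {y : Z₂ ⟶ Z₁}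
    {z : Y₆ ⟶ Z₂}
    (φ₁ : a ≫ b ⟶ d ≫ e ≫ f) (σ₁ : f ≫ c ⟶ g ≫ h) (φ₂ : e ≫ g ⟶ i ≫ j ≫ k)
    (φ₃ : d ≫ i ⟶ l ≫ m ≫ n) (σ₂ : n ≫ j ⟶ q ≫ r) (φ₄ : r ≫ k ≫ h ⟶ s ≫ t)
    (φ₅ : b ≫ c ⟶ x ≫ y ≫ t) (σ₃ : a ≫ x ⟶ l ≫ z) (φ₆ : z ≫ y ⟶ m ≫ q ≫ s) : Prop :=
  𝟙 (a ≫ b ≫ c) ⊗≫ φ₁ ▷ c ⊗≫ d ◁ e ◁ σ₁ ⊗≫ d ◁ φ₂ ▷ h ⊗≫ φ₃ ▷ (j ≫ k ≫ h) ⊗≫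
      l ◁ m ◁ σ₂ ▷ (k ≫ h) ⊗≫ l ◁ m ◁ q ◁ φ₄ =
    a ◁ φ₅ ⊗≫ σ₃ ▷ (y ≫ t) ⊗≫ l ◁ φ₆ ▷ t ⊗≫ 𝟙 (l ≫ m ≫ q ≫ s ≫ t)

/-- Equality of the two pastings of the unit coherence of a lax action. -/
def PastingLaxUnit {X₀ X₁ X₂ X₃ X₄ Y₁ Y₂ : B}
    {a : X₀ ⟶ X₁} {b : X₁ ⟶ X₂} {c : X₂ ⟶ X₃} {d : X₃ ⟶ X₄} {e : X₂ ⟶ X₀} {f : X₀ ⟶ X₄}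
    {g : X₁ ⟶ Y₁} {h : Y₁ ⟶ Y₂} {i : Y₂ ⟶ X₃} {j : Y₂ ⟶ X₄} {k : Y₁ ⟶ X₀}
    (σ : c ≫ d ⟶ e ≫ f) (τ : a ≫ b ≫ e ⟶ 𝟙 X₀) (φ : b ≫ c ⟶ g ≫ h ≫ i)
    (μ : i ≫ d ⟶ j) (σ' : h ≫ j ⟶ k ≫ f) (τ' : a ≫ g ≫ k ⟶ 𝟙 X₀) : Prop :=
  a ◁ b ◁ σ ⊗≫ τ ▷ f ⊗≫ 𝟙 f =
    𝟙 (a ≫ b ≫ c ≫ d) ⊗≫ a ◁ φ ▷ d ⊗≫ a ◁ g ◁ h ◁ μ ⊗≫ a ◁ g ◁ σ' ⊗≫ τ' ▷ f ⊗≫ 𝟙 f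
end

open DblCat

lemma PreDbl.shcomp_congr {Ob : Type u} (D : PreDbl.{u, v, w, x} Ob) {A B E A' B' E' : Ob}
    {f : D.H A B} {f' : D.H A' B'} {g : D.H B E} {g' : D.H B' E'} {a a' : D.Sq f f'}
    {b b' : D.Sq g g'} (ha : a = a') (hb : b = b') (e : D.tgt a = D.src b)
    (e' : D.tgt a' = D.src b') : D.shcomp a b e = D.shcomp a' b' e' := by
  subst ha; subst hb; rfl

section
variable {ObM : Type u} {M : DblCat.{u, v, w, x} ObM} {oM : ObM → ObM → ObM} {J : ObM}
  {Ob : Type u'}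

/-- Horizontal lax actions of a horizontally monoidal double category `M` on `D`: a pseudo
double functor `F`, horizontal pseudonatural transformations (not necessarily equivalences)
`b : M (N E) ⟶ (M N) E` and `v : E ⟶ J E`, and invertible horizontal modifications
`p`, `l`, `m` subject to the associativity and unit coherence. -/
structure LaxAction (mM : HMonoidal M oM J) (D : DblCat.{u', v', w', x'} Ob)
    (oF : ObM → Ob → Ob) where
  F : Bi M D D oF
  b : CoAsc mM.T F F F
  v : HTrans (DblFun.id D) (F.sectL J)
  p : ∀ (A B C : ObM) (E : Ob), F.bh (𝟙 (M.c A)) (b.b3 B C E) ≫ b.b3 A (oM B C) E ≅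
    b.b3 A B (oF C E) ≫ b.b3 (oM A B) C E ≫ F.bh (mM.a.a3 A B C) (𝟙 (D.c E))
  l : ∀ (A : ObM) (E : Ob), v.va (oF A E) ≫ b.b3 J A E ≫ F.bh (mM.lu.la A) (𝟙 (D.c E)) ≅
    𝟙 (D.c (oF A E))
  m : ∀ (A : ObM) (E : Ob), F.bh (𝟙 (M.c A)) (v.va E) ≫ b.b3 A J E ≫
    F.bh (mM.ru.ra A) (𝟙 (D.c E)) ≅ 𝟙 (D.c (oF A E))
  p_nat_h : ∀ {A A' B B' C C' : ObM} {E E' : Ob} (f : M.c A ⟶ M.c A') (g : M.c B ⟶ M.c B')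
    (h : M.c C ⟶ M.c C') (k : D.c E ⟶ D.c E'),
    NatMod (p A B C E).hom (p A' B' C' E').hom
      (paste (F.natR f (b.m3 g h k).hom) (b.m3 f (mM.T.bh g h) k).hom)
      (paste (b.m3 f g (F.bh h k)).hom
        (paste (b.m3 (mM.T.bh f g) h k).hom (F.natL (mM.a.n3 f g h).hom k)))
  p_nat_v : ∀ {A A' B B' C C' : ObM} {E E' : Ob} (s : M.pre.V A A') (t : M.pre.V B B')
    (r : M.pre.V C C') (q : D.pre.V E E'),
    vc (hc (F.bs (hi s) (b.t3 t r q)) (b.t3 s (mM.T.bv t r) q)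
        (by rw [DblFun.tgt_bs, HTrans.tgt_t3, HTrans.src_t3, PreDbl.tgt_shid]))
      (sq (p A' B' C' E').hom) =
    vc (sq (p A B C E).hom)
      (hc (b.t3 s t (F.bv r q)) (hc (b.t3 (mM.T.bv s t) r q) (F.bs (mM.a.s3 s t r) (hi q))
          (by rw [HTrans.tgt_t3, DblFun.src_bs, HTrans.src_s3, PreDbl.src_shid]))
        (by rw [PreDbl.src_shcomp, HTrans.tgt_t3, HTrans.src_t3]))
  l_nat_h : ∀ {A A' : ObM} {E E' : Ob} (f : M.c A ⟶ M.c A') (k : D.c E ⟶ D.c E'),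
    NatMod (l A E).hom (l A' E').hom
      (paste (v.vn (F.bh f k)).hom (paste (b.m3 (𝟙 (M.c J)) f k).hom
        (F.natL (mM.lu.ln f).hom k))) (natOne (F.bh f k))
  l_nat_v : ∀ {A A' : ObM} {E E' : Ob} (s : M.pre.V A A') (q : D.pre.V E E'),
    vc (hc (v.vs (F.bv s q)) (hc (b.t3 (M.pre.vid J) s q) (F.bs (mM.lu.ls s) (hi q))
          (by rw [HTrans.tgt_t3, DblFun.src_bs, HTrans.src_ls, PreDbl.src_shid]))
        (by rw [PreDbl.src_shcomp, HTrans.tgt_vs, HTrans.src_t3]))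
      (sq (l A' E').hom) = vc (sq (l A E).hom) (hi (F.bv s q))
  m_nat_h : ∀ {A A' : ObM} {E E' : Ob} (f : M.c A ⟶ M.c A') (k : D.c E ⟶ D.c E'),
    NatMod (m A E).hom (m A' E').hom
      (paste (F.natR f (v.vn k).hom) (paste (b.m3 f (𝟙 (M.c J)) k).hom
        (F.natL (mM.ru.rn f).hom k))) (natOne (F.bh f k))
  m_nat_v : ∀ {A A' : ObM} {E E' : Ob} (s : M.pre.V A A') (q : D.pre.V E E'),
    vc (hc (F.bs (hi s) (v.vs q)) (hc (b.t3 s (M.pre.vid J) q) (F.bs (mM.ru.rs s) (hi q))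
          (by rw [HTrans.tgt_t3, DblFun.src_bs, HTrans.src_rs, PreDbl.src_shid]))
        (by rw [PreDbl.src_shcomp, DblFun.tgt_bs, HTrans.tgt_vs, HTrans.src_t3,
          PreDbl.tgt_shid]))
      (sq (m A' E').hom) = vc (sq (m A E).hom) (hi (F.bv s q))
  assoc5 : ∀ (A B C G : ObM) (E : Ob),
    PastingLax
      (F.r2 A (F.bh (𝟙 (M.c B)) (b.b3 C G E)) (b.b3 B (oM C G) E) ≫ F.bg (𝟙 _) (p B C G E).hom ≫
        F.r2' A _ _ ≫ F.bh (𝟙 (M.c A)) (b.b3 B C (oF G E)) ◁ F.r2' A _ _)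
      (b.m3 (𝟙 (M.c A)) (mM.a.a3 B C G) (𝟙 (D.c E))).hom
      (p A (oM B C) G E).hom
      (p A B C (oF G E)).hom
      (F.bg (𝟙 (mM.a.a3 A B C)) (F.bu G E).hom ▷ b.b3 (oM A (oM B C)) G E ≫
        (b.m3 (mM.a.a3 A B C) (𝟙 (M.c G)) (𝟙 (D.c E))).hom)
      (F.whL (mM.p A B C G).hom E)
      (p A B (oM C G) E).hom
      ((b.m3 (𝟙 (M.c A)) (𝟙 (M.c B)) (b.b3 C G E)).hom ≫
        b.b3 A B (oF C (oF G E)) ◁ F.bg (mM.T.bu A B).inv (𝟙 (b.b3 C G E)))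
      (p (oM A B) C G E).hom
  norm : ∀ (A B : ObM) (E : Ob),
    PastingLaxUnit
      (b.m3 (𝟙 (M.c A)) (mM.lu.la B) (𝟙 (D.c E))).inv
      (F.bh (𝟙 (M.c A)) (v.va (oF B E)) ◁ F.r2 A (b.b3 J B E) (F.bh (mM.lu.la B) (𝟙 (D.c E))) ≫
        F.r2 A (v.va (oF B E)) _ ≫ F.bg (𝟙 _) (l B E).hom ≫ (F.bu A (oF B E)).inv)
      (p A J B E).hom
      (F.l2 (mM.a.a3 A J B) (mM.T.bh (𝟙 (M.c A)) (mM.lu.la B)) E ≫ F.bg (mM.m A B).hom (𝟙 _))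
      ((b.m3 (mM.ru.ra A) (𝟙 (M.c B)) (𝟙 (D.c E))).inv ≫
        F.bg (𝟙 (mM.ru.ra A)) (F.bu B E).inv ▷ b.b3 A B E)
      (m A (oF B E)).hom

variable {mM : HMonoidal M oM J} {D : DblCat.{u', v', w', x'} Ob} {oF : ObM → Ob → Ob}

/-- Horizontal 1-cells `A ⟶ B` of the coPara construction: an object `P` of `M` and a horizontal
1-cell `A ⟶ P B` of `D`. -/
structure ParaH (D : DblCat.{u', v', w', x'} Ob) (oF : ObM → Ob → Ob) (A B : Ob) :
    Type (max u w') where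
  par : ObM
  hom : D.c A ⟶ D.c (oF par B)

/-- Squares of the coPara construction: vertical 1-cells `u` of `M` and `e` of `D`, and a square
of `D` whose right boundary is `u e`. -/
@[ext] structure ParaSq (F : LaxAction mM D oF) {A B A' B' : Ob} (f : ParaH D oF A B)
    (g : ParaH D oF A' B') : Type (max v v' x') where
  u : M.pre.V f.par g.par
  e : D.pre.V B B'
  cell : Sq f.hom g.hom
  tgt_cell : D.pre.tgt cell = F.F.bv u e

namespace LaxAction
variable (F : LaxAction mM D oF)

/-- Horizontal composite of squares. -/
def sqComp {A B E A' B' E' : Ob} {f : ParaH D oF A B} {f' : ParaH D oF A' B'}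
    {g : ParaH D oF B E} {g' : ParaH D oF B' E'} (a : ParaSq F f f') (b : ParaSq F g g')
    (h : a.e = D.pre.src b.cell) :
    Sq (f.hom ≫ F.F.bh (𝟙 (M.c f.par)) g.hom ≫ F.b.b3 f.par g.par E)
      (f'.hom ≫ F.F.bh (𝟙 (M.c f'.par)) g'.hom ≫ F.b.b3 f'.par g'.par E') :=
  hc a.cell (hc (F.F.bs (hi a.u) b.cell) (F.b.t3 a.u b.u b.e)
      (by rw [DblFun.tgt_bs, HTrans.src_t3, b.tgt_cell, PreDbl.tgt_shid]))
    (by rw [PreDbl.src_shcomp, a.tgt_cell, DblFun.src_bs, PreDbl.src_shid, h])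

lemma src_sqComp {A B E A' B' E' : Ob} {f : ParaH D oF A B} {f' : ParaH D oF A' B'}
    {g : ParaH D oF B E} {g' : ParaH D oF B' E'} (a : ParaSq F f f') (b : ParaSq F g g')
    (h : a.e = D.pre.src b.cell) : D.pre.src (F.sqComp a b h) = D.pre.src a.cell :=
  D.pre.src_shcomp _ _ _

lemma tgt_sqComp {A B E A' B' E' : Ob} {f : ParaH D oF A B} {f' : ParaH D oF A' B'}
    {g : ParaH D oF B E} {g' : ParaH D oF B' E'} (a : ParaSq F f f') (b : ParaSq F g g')
    (h : a.e = D.pre.src b.cell) :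
    D.pre.tgt (F.sqComp a b h) = F.F.bv (mM.T.bv a.u b.u) b.e :=
  (D.pre.tgt_shcomp _ _ _).trans ((D.pre.tgt_shcomp _ _ _).trans (F.b.tgt_t3 _ _ _))

/-- The cells and compositions of the double category `coPara_M(D)`. -/
def coParaPre : PreDbl.{u', v', max u w', max v v' x'} Ob where
  V := D.pre.V
  vid := D.pre.vid
  vcomp := D.pre.vcomp
  vid_vcomp := D.pre.vid_vcomp
  vcomp_vid := D.pre.vcomp_vid
  vcomp_assoc := D.pre.vcomp_assoc
  H A B := ParaH D oF A B
  hid A := ⟨J, F.v.va A⟩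
  hcomp f g := ⟨oM f.par g.par, f.hom ≫ F.F.bh (𝟙 (M.c f.par)) g.hom ≫ F.b.b3 f.par g.par _⟩
  Sq f g := ParaSq F f g
  src a := D.pre.src a.cell
  tgt a := a.e
  sid f := ⟨M.pre.vid _, D.pre.vid _, D.pre.sid _,
    (D.pre.tgt_sid _).trans (F.F.mapV_vid (f.par, _)).symm⟩
  scomp a b := ⟨M.pre.vcomp a.u b.u, D.pre.vcomp a.e b.e, D.pre.scomp a.cell b.cell, by
    rw [PreDbl.tgt_scomp, a.tgt_cell, b.tgt_cell]
    exact (F.F.mapV_vcomp (A := (_, _)) (B := (_, _)) (E := (_, _)) (a.u, a.e) (b.u, b.e)).symm⟩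
  sid_scomp a := ParaSq.ext (by simp) (by simp) (by simp)
  scomp_sid a := ParaSq.ext (by simp) (by simp) (by simp)
  scomp_assoc a b c := ParaSq.ext (by simp) (by simp) (by simp)
  src_sid f := by simp
  tgt_sid f := rfl
  src_scomp a b := by simp
  tgt_scomp a b := rfl
  shid s := ⟨M.pre.vid J, s, F.v.vs s, F.v.tgt_vs s⟩
  src_shid s := F.v.src_vs s
  tgt_shid s := rfl
  shid_vid A := ParaSq.ext rfl rfl (F.v.vsq_vid A)
  shid_vcomp s t := ParaSq.ext (by simp) rfl (F.v.vsq_vcomp s t)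
  shcomp a b h := ⟨mM.T.bv a.u b.u, b.e, F.sqComp a b h, F.tgt_sqComp a b h⟩
  src_shcomp a b h := F.src_sqComp a b h
  tgt_shcomp a b h := rfl
  shcomp_sid {_ _ E} f g h := by
    refine ParaSq.ext (mM.T.mapV_vid (f.par, g.par)) rfl ?_
    have h1 : F.F.bs (hi (M.pre.vid f.par)) (D.pre.sid g.hom) =
        D.pre.sid (F.F.bh (𝟙 (M.c f.par)) g.hom) :=
      (congrArg (fun s => F.F.bs s (D.pre.sid g.hom)) (M.pre.shid_vid f.par)).trans
        (F.F.mapSq_sid (A := (_, _)) (B := (_, _)) (𝟙 (M.c f.par), g.hom))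
    have h2 : F.b.t3 (M.pre.vid f.par) (M.pre.vid g.par) (D.pre.vid E) =
        D.pre.sid (F.b.b3 f.par g.par E) := F.b.vsq_vid (f.par, g.par, E)
    refine (D.pre.shcomp_congr rfl ((D.pre.shcomp_congr h1 h2 _ (by simp)).trans
      (D.pre.shcomp_sid _ _ _)) _ (by simp)).trans (D.pre.shcomp_sid _ _ _)
  interchange a a' b b' h h' h'' := by
    refine ParaSq.ext (mM.T.mapV_vcomp (A := (_, _)) (B := (_, _)) (E := (_, _))
      (a.u, b.u) (a'.u, b'.u)) rfl ?_
    have h1 : F.F.bs (hi (M.pre.vcomp a.u a'.u)) (D.pre.scomp b.cell b'.cell) =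
        D.pre.scomp (F.F.bs (hi a.u) b.cell) (F.F.bs (hi a'.u) b'.cell) :=
      (congrArg (fun s => F.F.bs s (D.pre.scomp b.cell b'.cell))
        (M.pre.shid_vcomp a.u a'.u)).trans
        (F.F.mapSq_scomp (A := (_, _)) (B := (_, _)) (A' := (_, _)) (B' := (_, _))
          (A'' := (_, _)) (B'' := (_, _)) (f := (_, _)) (g := (_, _)) (h := (_, _))
          (hi a.u, b.cell) (hi a'.u, b'.cell))
    have h2 : F.b.t3 (M.pre.vcomp a.u a'.u) (M.pre.vcomp b.u b'.u) (D.pre.vcomp b.e b'.e) =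
        D.pre.scomp (F.b.t3 a.u b.u b.e) (F.b.t3 a'.u b'.u b'.e) :=
      F.b.vsq_vcomp (A := (_, _, _)) (A' := (_, _, _)) (A'' := (_, _, _)) (a.u, b.u, b.e)
        (a'.u, b'.u, b'.e)
    have e1 : D.pre.tgt (F.F.bs (hi a.u) b.cell) = D.pre.src (F.b.t3 a.u b.u b.e) := by
      rw [DblFun.tgt_bs, HTrans.src_t3, b.tgt_cell, PreDbl.tgt_shid]
    have e2 : D.pre.tgt (F.F.bs (hi a'.u) b'.cell) = D.pre.src (F.b.t3 a'.u b'.u b'.e) := by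
      rw [DblFun.tgt_bs, HTrans.src_t3, b'.tgt_cell, PreDbl.tgt_shid]
    have e3 : D.pre.tgt (D.pre.scomp (F.F.bs (hi a.u) b.cell) (F.F.bs (hi a'.u) b'.cell)) =
        D.pre.src (D.pre.scomp (F.b.t3 a.u b.u b.e) (F.b.t3 a'.u b'.u b'.e)) := by
      rw [PreDbl.tgt_scomp, PreDbl.src_scomp, e1, e2]
    have e4 : D.pre.tgt (D.pre.scomp a.cell a'.cell) = D.pre.src (D.pre.scomp
        (D.pre.shcomp _ _ e1) (D.pre.shcomp _ _ e2)) := by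
      rw [PreDbl.tgt_scomp, PreDbl.src_scomp, PreDbl.src_shcomp, PreDbl.src_shcomp, a.tgt_cell,
        a'.tgt_cell, DblFun.src_bs, DblFun.src_bs, PreDbl.src_shid, PreDbl.src_shid, h, h']
    exact (D.pre.shcomp_congr rfl ((D.pre.shcomp_congr h1 h2 _ e3).trans
      (D.pre.interchange _ _ _ _ e1 e2 _)) _ e4).trans (D.pre.interchange _ _ _ _ _ _ _)
/-- The canonical embedding on cells: the identity on objects and vertical 1-cells, sending `f`
to `f` followed by the unit `v` of the lax action. -/
def embPre : PreFun D.pre F.coParaPre (fun A => A) where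
  mapV s := s
  mapH {_ B} f := ⟨J, (show D.c _ ⟶ D.c B from f) ≫ F.v.va B⟩
  mapSq {A B A' B' f g} a := ⟨M.pre.vid J, D.pre.tgt a,
    hc (f := (show D.c A ⟶ D.c B from f)) (f' := (show D.c A' ⟶ D.c B' from g)) a
      (F.v.vs (D.pre.tgt a)) (F.v.src_vs _).symm,
    (D.pre.tgt_shcomp _ _ _).trans (F.v.tgt_vs _)⟩
  src_mapSq a := D.pre.src_shcomp _ _ _
  tgt_mapSq a := rfl
  mapV_vid A := rfl
  mapV_vcomp s t := rfl
  mapSq_sid {A B} f := by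
    refine ParaSq.ext rfl (D.pre.tgt_sid f) ?_
    have h : F.v.vs (D.pre.tgt (D.pre.sid f)) = D.pre.sid (F.v.va B) :=
      (congrArg F.v.vs (D.pre.tgt_sid f)).trans (F.v.vsq_vid B)
    have e : D.pre.tgt (D.pre.sid f) = D.pre.src (D.pre.sid (F.v.va B)) := by
      rw [PreDbl.tgt_sid, PreDbl.src_sid]
    exact (D.pre.shcomp_congr rfl h _ e).trans (D.pre.shcomp_sid _ _ e)
  mapSq_scomp a b := by
    refine ParaSq.ext (M.pre.vid_vcomp _).symm (D.pre.tgt_scomp a b) ?_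
    have h : F.v.vs (D.pre.tgt (D.pre.scomp a b)) =
        D.pre.scomp (F.v.vs (D.pre.tgt a)) (F.v.vs (D.pre.tgt b)) :=
      (congrArg F.v.vs (D.pre.tgt_scomp a b)).trans (F.v.vsq_vcomp _ _)
    have e : D.pre.tgt (D.pre.scomp a b) = D.pre.src
        (D.pre.scomp (F.v.vs (D.pre.tgt a)) (F.v.vs (D.pre.tgt b))) := by
      rw [PreDbl.tgt_scomp, PreDbl.src_scomp, HTrans.src_vs, HTrans.src_vs]
    exact (D.pre.shcomp_congr rfl h _ e).trans (D.pre.interchange _ _ _ _ _ _ _)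

/-- The pseudo double category `coPara_M(D)` with a choice of horizontal constraint cells. -/
def coPara (c : F.coParaPre.Coherence) : DblCat.{u', v', max u w', max v v' x'} Ob :=
  ⟨F.coParaPre, c⟩

/-- The canonical embedding as a pseudo double functor, with a choice of compositors. -/
def emb (c : F.coParaPre.Coherence) (cP : FunCoh (C := D) (D := F.coPara c) F.embPre) :
    DblFun D (F.coPara c) (fun A => A) where
  toPreFun := F.embPre
  coh := cP
end LaxAction
end

section
variable {Ob : Type u} {D : DblCat.{u, v, w, x} Ob} {K : DblCat.{u, v', w', x'} Ob}
  {o : Ob → Ob → Ob} {I : Ob}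
open DblCat

/-- Horizontal composite of squares on identity 1-cells. -/
def hcu {A A' : Ob} (a b : Sq (𝟙 (K.c A)) (𝟙 (K.c A'))) (e : K.pre.tgt a = K.pre.src b) :
    Sq (𝟙 (K.c A)) (𝟙 (K.c A')) :=
  vc (sq (λ_ (𝟙 (K.c A))).inv) (vc (hc a b e) (sq (λ_ (𝟙 (K.c A'))).hom))

lemma tgt_hcu {A A' : Ob} (a b : Sq (𝟙 (K.c A)) (𝟙 (K.c A')))
    (e : K.pre.tgt a = K.pre.src b) : K.pre.tgt (hcu a b e) = K.pre.tgt b := by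
  refine (K.pre.tgt_scomp _ _).trans ?_
  rw [PreDbl.Glob.tgt_cell, K.pre.vid_vcomp, K.pre.tgt_scomp, PreDbl.Glob.tgt_cell,
    K.pre.vcomp_vid, K.pre.tgt_shcomp]

lemma src_hcu {A A' : Ob} (a b : Sq (𝟙 (K.c A)) (𝟙 (K.c A')))
    (e : K.pre.tgt a = K.pre.src b) : K.pre.src (hcu a b e) = K.pre.src a := by
  refine (K.pre.src_scomp _ _).trans ?_
  rw [PreDbl.Glob.src_cell, K.pre.vid_vcomp, K.pre.src_scomp, PreDbl.Glob.src_cell,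
    K.pre.vcomp_vid, K.pre.src_shcomp]
end

section
variable {Ob : Type u} {Ob' : Type u'} {Ob'' : Type u''} {X : DblCat.{u, v, w, x} Ob}
  {Y : DblCat.{u', v', w', x'} Ob'} {Z : DblCat.{u'', v'', w'', x''} Ob''}
  {o : Ob → Ob' → Ob''}
open DblCat

/-- Value of `T` on squares on identity 1-cells, as a square on identity 1-cells. -/
def DblFun.bsu (T : DblFun (X.prod Y) Z (fun p => o p.1 p.2)) {A A' : Ob} {B B' : Ob'}
    (a : Sq (𝟙 (X.c A)) (𝟙 (X.c A'))) (b : Sq (𝟙 (Y.c B)) (𝟙 (Y.c B'))) :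
    Sq (𝟙 (Z.c (o A B))) (𝟙 (Z.c (o A' B'))) :=
  vc (sq (T.bu A B).hom) (vc (T.bs a b) (sq (T.bu A' B').inv))

lemma DblFun.src_bsu (T : DblFun (X.prod Y) Z (fun p => o p.1 p.2)) {A A' : Ob} {B B' : Ob'}
    (a : Sq (𝟙 (X.c A)) (𝟙 (X.c A'))) (b : Sq (𝟙 (Y.c B)) (𝟙 (Y.c B'))) :
    Z.pre.src (T.bsu a b) = T.bv (X.pre.src a) (Y.pre.src b) := by
  refine (Z.pre.src_scomp _ _).trans ?_
  rw [PreDbl.Glob.src_cell, Z.pre.vid_vcomp, Z.pre.src_scomp, PreDbl.Glob.src_cell,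
    Z.pre.vcomp_vid, T.src_bs]

lemma DblFun.tgt_bsu (T : DblFun (X.prod Y) Z (fun p => o p.1 p.2)) {A A' : Ob} {B B' : Ob'}
    (a : Sq (𝟙 (X.c A)) (𝟙 (X.c A'))) (b : Sq (𝟙 (Y.c B)) (𝟙 (Y.c B'))) :
    Z.pre.tgt (T.bsu a b) = T.bv (X.pre.tgt a) (Y.pre.tgt b) := by
  refine (Z.pre.tgt_scomp _ _).trans ?_
  rw [PreDbl.Glob.tgt_cell, Z.pre.vid_vcomp, Z.pre.tgt_scomp, PreDbl.Glob.tgt_cell,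
    Z.pre.vcomp_vid, T.tgt_bs]
end

section
variable {Ob : Type u} {D : DblCat.{u, v, w, x} Ob} {K : DblCat.{u, v', w', x'} Ob}
  {o : Ob → Ob → Ob} {I : Ob}
open DblCat

/-- `A ▷ P B`. -/
def domL (P : DblFun D K (fun A => A)) (T : Bi D K K o) : Bi D D K o :=
  ((DblFun.fst D D).pair ((DblFun.snd D D).comp P)).comp T

/-- `P A ◁ B`. -/
def domR (P : DblFun D K (fun A => A)) (T : Bi K D K o) : Bi D D K o :=
  (((DblFun.fst D D).comp P).pair (DblFun.snd D D)).comp T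

/-- `P A ⊗ P B`. -/
def domM (P : DblFun D K (fun A => A)) (T : Bi K K K o) : Bi D D K o :=
  (((DblFun.fst D D).comp P).pair ((DblFun.snd D D).comp P)).comp T

/-- Precomposition of a tensor product on `K` with `P` in the first variable. -/
def actL (P : DblFun D K (fun A => A)) (T : Bi K K K o) : Bi D K K o :=
  (((DblFun.fst D K).comp P).pair (DblFun.snd D K)).comp T

/-- Precomposition of a tensor product on `K` with `P` in the second variable. -/
def actR (P : DblFun D K (fun A => A)) (T : Bi K K K o) : Bi K D K o :=
  ((DblFun.fst K D).pair ((DblFun.snd K D).comp P)).comp T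

/-- Composition of 2-cells into values of `P`, through the compositor of `P`. -/
def lift2 (P : DblFun D K (fun A => A)) {A B E : Ob} {f : D.c A ⟶ D.c B} {g : D.c B ⟶ D.c E}
    {k : K.c A ⟶ K.c B} {k' : K.c B ⟶ K.c E} (a : k ⟶ P.h f) (b : k' ⟶ P.h g) :
    k ≫ k' ⟶ P.h (f ≫ g) := a ▷ k' ≫ P.h f ◁ b ≫ (P.coh.mapComp f g).hom

/-- The 2-cell `n` of `K` lies over `P n₀` along `L` and `R`. -/
def Over2 (P : DblFun D K (fun A => A)) {A B : Ob} {k k' : K.c A ⟶ K.c B}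
    {f f' : D.c A ⟶ D.c B} (n : k ⟶ k') (n₀ : f ⟶ f') (L : k ⟶ P.h f) (R : k' ⟶ P.h f') : Prop :=
  n ≫ R = L ≫ P.g n₀

/-- The square `n` of `K`, followed on the right by `R`, equals the square `P n₀` preceded on the
left by `L`, up to unit constraints and along `e`, `e'`. -/
def OverSq (P : DblFun D K (fun A => A)) {A B A' B' : Ob} {k : K.c A ⟶ K.c B}
    {k' : K.c A' ⟶ K.c B'} {f : D.c A ⟶ D.c B} {f' : D.c A' ⟶ D.c B'} (n : Sq k k')
    (n₀ : Sq f f') (e : k ⟶ P.h f) (e' : k' ⟶ P.h f') (L : Sq (𝟙 (K.c A)) (𝟙 (K.c A')))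
    (R : Sq (𝟙 (K.c B)) (𝟙 (K.c B'))) (h : K.pre.tgt n = K.pre.src R)
    (h' : K.pre.tgt L = P.mapV (D.pre.src n₀)) : Prop :=
  vc (hc n R h) (sq ((ρ_ k').hom ≫ e')) =
    vc (sq ((ρ_ k).hom ≫ e ≫ (λ_ (P.h f)).inv)) (vc (hc L (P.s n₀) (h'.trans (P.src_mapSq n₀).symm)) (sq (λ_ (P.h f')).hom))

variable {P : DblFun D K (fun A => A)} {mD : MonData D o I}

section
variable {T : Bi D K K o} (θ : Icon (domL P T) (mD.T.comp P))

/-- The 2-cell `f ▷ k ⟶ P (f ⊗ g)` obtained from `k ⟶ P g` by the icon. -/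
def extL {A A' B B' : Ob} (f : D.c A ⟶ D.c A') {k : K.c B ⟶ K.c B'} {g : D.c B ⟶ D.c B'}
    (b : k ⟶ P.h g) : T.bh f k ⟶ P.h (mD.T.bh f g) :=
  T.bg (𝟙 f) b ≫ (θ.cell (A := (A, B)) (B := (A', B')) (f, g)).hom

/-- Squares of the icon on vertical 1-cells. -/
def vsqL {A A' B B' : Ob} (s : D.pre.V A A') (t : D.pre.V B B') :
    Sq (𝟙 (K.c (o A B))) (𝟙 (K.c (o A' B'))) := θ.vsq (A := (A, B)) (A' := (A', B')) (s, t)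

lemma src_vsqL {A A' B B' : Ob} (s : D.pre.V A A') (t : D.pre.V B B') :
    K.pre.src (vsqL θ s t) = T.bv s (P.mapV t) := θ.src_vsq (A := (A, B)) (A' := (A', B')) (s, t)

lemma tgt_vsqL {A A' B B' : Ob} (s : D.pre.V A A') (t : D.pre.V B B') :
    K.pre.tgt (vsqL θ s t) = P.mapV (mD.T.bv s t) :=
  θ.tgt_vsq (A := (A, B)) (A' := (A', B')) (s, t)
end

section
variable {T : Bi K D K o} (ξ : Icon (domR P T) (mD.T.comp P))

/-- The 2-cell `k ◁ g ⟶ P (f ⊗ g)` obtained from `k ⟶ P f` by the icon. -/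
def extR {A A' B B' : Ob} {k : K.c A ⟶ K.c A'} {f : D.c A ⟶ D.c A'} (a : k ⟶ P.h f)
    (g : D.c B ⟶ D.c B') : T.bh k g ⟶ P.h (mD.T.bh f g) :=
  T.bg a (𝟙 g) ≫ (ξ.cell (A := (A, B)) (B := (A', B')) (f, g)).hom

/-- Squares of the icon on vertical 1-cells. -/
def vsqR {A A' B B' : Ob} (s : D.pre.V A A') (t : D.pre.V B B') :
    Sq (𝟙 (K.c (o A B))) (𝟙 (K.c (o A' B'))) := ξ.vsq (A := (A, B)) (A' := (A', B')) (s, t)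

lemma src_vsqR {A A' B B' : Ob} (s : D.pre.V A A') (t : D.pre.V B B') :
    K.pre.src (vsqR ξ s t) = T.bv (P.mapV s) t := ξ.src_vsq (A := (A, B)) (A' := (A', B')) (s, t)

lemma tgt_vsqR {A A' B B' : Ob} (s : D.pre.V A A') (t : D.pre.V B B') :
    K.pre.tgt (vsqR ξ s t) = P.mapV (mD.T.bv s t) :=
  ξ.tgt_vsq (A := (A, B)) (A' := (A', B')) (s, t)
end

section
variable {T : Bi K K K o} (θ : Icon (domM P T) (mD.T.comp P))

/-- The 2-cell `k ⊗ k' ⟶ P (f ⊗ g)` obtained from `k ⟶ P f` and `k' ⟶ P g` by the icon. -/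
def extM {A A' B B' : Ob} {k : K.c A ⟶ K.c A'} {f : D.c A ⟶ D.c A'} (a : k ⟶ P.h f)
    {k' : K.c B ⟶ K.c B'} {g : D.c B ⟶ D.c B'} (b : k' ⟶ P.h g) :
    T.bh k k' ⟶ P.h (mD.T.bh f g) :=
  T.bg a b ≫ (θ.cell (A := (A, B)) (B := (A', B')) (f, g)).hom

/-- Squares of the icon on vertical 1-cells. -/
def vsqM {A A' B B' : Ob} (s : D.pre.V A A') (t : D.pre.V B B') :
    Sq (𝟙 (K.c (o A B))) (𝟙 (K.c (o A' B'))) := θ.vsq (A := (A, B)) (A' := (A', B')) (s, t)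

lemma src_vsqM {A A' B B' : Ob} (s : D.pre.V A A') (t : D.pre.V B B') :
    K.pre.src (vsqM θ s t) = T.bv (P.mapV s) (P.mapV t) :=
  θ.src_vsq (A := (A, B)) (A' := (A', B')) (s, t)

lemma tgt_vsqM {A A' B B' : Ob} (s : D.pre.V A A') (t : D.pre.V B B') :
    K.pre.tgt (vsqM θ s t) = P.mapV (mD.T.bv s t) :=
  θ.tgt_vsq (A := (A, B)) (A' := (A', B')) (s, t)
end

/-- The left action `L` with the icon `θ : A ▷ P B ⇒ P (A ⊗ B)` is an extension along `P` of the
canonical action of `D` on itself: `θ` is invertible, the constraint 1-cells of `L` are the images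
under `P` of those of `D`, and `θ` is compatible with all constraint cells. -/
structure IsLeftExt {T : Bi D K K o} (L : LeftData mD T)
    (θ : Icon (domL P T) (mD.T.comp P)) : Prop where
  inv : θ.Invertible
  a_app : ∀ A B E : Ob, L.a.a3 A B E = P.h (mD.a.a3 A B E)
  lu_app : ∀ A : Ob, L.lu.la A = P.h (mD.lu.la A)
  a_nat : ∀ {A A' B B' E E' : Ob} (f : D.c A ⟶ D.c A') (g : D.c B ⟶ D.c B')
    (h : D.c E ⟶ D.c E'),
    Over2 P (L.a.n3 f g (P.h h)).hom (mD.a.n3 f g h).hom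
      (lift2 P (extL θ (mD.T.bh f g) (𝟙 (P.h h))) (eqToHom (a_app A' B' E')))
      (lift2 P (eqToHom (a_app A B E)) (extL θ f (extL θ g (𝟙 (P.h h)))))
  lu_nat : ∀ {A A' : Ob} (f : D.c A ⟶ D.c A'),
    Over2 P (L.lu.ln (P.h f)).hom (mD.lu.ln f).hom
      (lift2 P (extL θ (𝟙 (D.c I)) (𝟙 (P.h f))) (eqToHom (lu_app A')))
      (lift2 P (eqToHom (lu_app A)) (𝟙 (P.h f)))
  a_vsq : ∀ {A A' B B' E E' : Ob} (s : D.pre.V A A') (t : D.pre.V B B') (r : D.pre.V E E'),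
    OverSq P (L.a.s3 s t (P.mapV r)) (mD.a.s3 s t r) (eqToHom (a_app A B E))
      (eqToHom (a_app A' B' E')) (vsqL θ (mD.T.bv s t) r)
      (hcu (T.bsu (hi s) (vsqL θ t r)) (vsqL θ s (mD.T.bv t r))
        (by rw [DblFun.tgt_bsu, tgt_vsqL, src_vsqL, PreDbl.tgt_shid]))
      (by rw [HTrans.tgt_s3, src_hcu, DblFun.src_bsu, src_vsqL, PreDbl.src_shid])
      (by rw [tgt_vsqL, HTrans.src_s3])
  lu_vsq : ∀ {A A' : Ob} (s : D.pre.V A A'),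
    OverSq P (L.lu.ls (P.mapV s)) (mD.lu.ls s) (eqToHom (lu_app A)) (eqToHom (lu_app A'))
      (vsqL θ (D.pre.vid I) s) (hi (P.mapV s))
      (by rw [HTrans.tgt_ls, PreDbl.src_shid])
      (by rw [tgt_vsqL, HTrans.src_ls])
  p : ∀ A B E G : Ob,
    Over2 P (L.p A B E G).hom (mD.p A B E G).hom
      (lift2 P (extL θ (mD.a.a3 A B E) (P.coh.mapId G).hom)
        (lift2 P (eqToHom (a_app A (o B E) G)) (extL θ (𝟙 (D.c A)) (eqToHom (a_app B E G)))))
      (lift2 P (eqToHom (a_app (o A B) E G)) (eqToHom (a_app A B (o E G))))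
  m : ∀ A B : Ob,
    Over2 P (L.m A B).hom (mD.m A B).hom
      (lift2 P (eqToHom (a_app A I B)) (extL θ (𝟙 (D.c A)) (eqToHom (lu_app B))))
      (extL θ (mD.ru.ra A) (P.coh.mapId B).hom)
  l : ∀ A B : Ob,
    Over2 P (L.l A B).hom (mD.l A B).hom
      (extL θ (mD.lu.la A) (P.coh.mapId B).hom)
      (lift2 P (eqToHom (a_app I A B)) (eqToHom (lu_app (o A B))))

/-- The right action `R` with the icon `ξ : P A ◁ B ⇒ P (A ⊗ B)` is an extension along `P` of the
canonical action of `D` on itself. -/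
structure IsRightExt {T : Bi K D K o} (R : RightData mD T)
    (ξ : Icon (domR P T) (mD.T.comp P)) : Prop where
  inv : ξ.Invertible
  a_app : ∀ A B E : Ob, R.a.a3 A B E = P.h (mD.a.a3 A B E)
  ru_app : ∀ A : Ob, R.ru.ra A = P.h (mD.ru.ra A)
  a_nat : ∀ {A A' B B' E E' : Ob} (f : D.c A ⟶ D.c A') (g : D.c B ⟶ D.c B')
    (h : D.c E ⟶ D.c E'),
    Over2 P (R.a.n3 (P.h f) g h).hom (mD.a.n3 f g h).hom
      (lift2 P (extR ξ (extR ξ (𝟙 (P.h f)) g) h) (eqToHom (a_app A' B' E')))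
      (lift2 P (eqToHom (a_app A B E)) (extR ξ (𝟙 (P.h f)) (mD.T.bh g h)))
  ru_nat : ∀ {A A' : Ob} (f : D.c A ⟶ D.c A'),
    Over2 P (R.ru.rn (P.h f)).hom (mD.ru.rn f).hom
      (lift2 P (extR ξ (𝟙 (P.h f)) (𝟙 (D.c I))) (eqToHom (ru_app A')))
      (lift2 P (eqToHom (ru_app A)) (𝟙 (P.h f)))
  a_vsq : ∀ {A A' B B' E E' : Ob} (s : D.pre.V A A') (t : D.pre.V B B') (r : D.pre.V E E'),
    OverSq P (R.a.s3 (P.mapV s) t r) (mD.a.s3 s t r) (eqToHom (a_app A B E))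
      (eqToHom (a_app A' B' E'))
      (hcu (T.bsu (vsqR ξ s t) (hi r)) (vsqR ξ (mD.T.bv s t) r)
        (by rw [DblFun.tgt_bsu, tgt_vsqR, src_vsqR, PreDbl.tgt_shid]))
      (vsqR ξ s (mD.T.bv t r))
      (by rw [HTrans.tgt_s3, src_vsqR])
      (by rw [tgt_hcu, tgt_vsqR, HTrans.src_s3])
  ru_vsq : ∀ {A A' : Ob} (s : D.pre.V A A'),
    OverSq P (R.ru.rs (P.mapV s)) (mD.ru.rs s) (eqToHom (ru_app A)) (eqToHom (ru_app A'))
      (vsqR ξ s (D.pre.vid I)) (hi (P.mapV s))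
      (by rw [HTrans.tgt_rs, PreDbl.src_shid])
      (by rw [tgt_vsqR, HTrans.src_rs])
  p : ∀ A B E G : Ob,
    Over2 P (R.p A B E G).hom (mD.p A B E G).hom
      (lift2 P (extR ξ (eqToHom (a_app A B E)) (𝟙 (D.c G)))
        (lift2 P (eqToHom (a_app A (o B E) G)) (extR ξ (P.coh.mapId A).hom (mD.a.a3 B E G))))
      (lift2 P (eqToHom (a_app (o A B) E G)) (eqToHom (a_app A B (o E G))))
  m : ∀ A B : Ob,
    Over2 P (R.m A B).hom (mD.m A B).hom
      (lift2 P (eqToHom (a_app A I B)) (extR ξ (P.coh.mapId A).hom (mD.lu.la B)))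
      (extR ξ (eqToHom (ru_app A)) (𝟙 (D.c B)))
  r : ∀ A B : Ob,
    Over2 P (R.r A B).hom (mD.r A B).hom
      (eqToHom (ru_app (o A B)))
      (lift2 P (eqToHom (a_app A B I)) (extR ξ (P.coh.mapId A).hom (mD.ru.ra B)))

/-- The monoidal structure `mK` with the icon `θ : P A ⊗ P B ⇒ P (A ⊗ B)` extends the monoidal
structure of `D` along `P`. -/
structure IsMonExt (mK : MonData K o I)
    (θ : Icon (domM P mK.T) (mD.T.comp P)) : Prop where
  inv : θ.Invertible
  a_app : ∀ A B E : Ob, mK.a.a3 A B E = P.h (mD.a.a3 A B E)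
  lu_app : ∀ A : Ob, mK.lu.la A = P.h (mD.lu.la A)
  ru_app : ∀ A : Ob, mK.ru.ra A = P.h (mD.ru.ra A)
  a_nat : ∀ {A A' B B' E E' : Ob} (f : D.c A ⟶ D.c A') (g : D.c B ⟶ D.c B')
    (h : D.c E ⟶ D.c E'),
    Over2 P (mK.a.n3 (P.h f) (P.h g) (P.h h)).hom (mD.a.n3 f g h).hom
      (lift2 P (extM θ (extM θ (𝟙 (P.h f)) (𝟙 (P.h g))) (𝟙 (P.h h)))
        (eqToHom (a_app A' B' E')))
      (lift2 P (eqToHom (a_app A B E))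
        (extM θ (𝟙 (P.h f)) (extM θ (𝟙 (P.h g)) (𝟙 (P.h h)))))
  lu_nat : ∀ {A A' : Ob} (f : D.c A ⟶ D.c A'),
    Over2 P (mK.lu.ln (P.h f)).hom (mD.lu.ln f).hom
      (lift2 P (extM θ (P.coh.mapId I).hom (𝟙 (P.h f))) (eqToHom (lu_app A')))
      (lift2 P (eqToHom (lu_app A)) (𝟙 (P.h f)))
  ru_nat : ∀ {A A' : Ob} (f : D.c A ⟶ D.c A'),
    Over2 P (mK.ru.rn (P.h f)).hom (mD.ru.rn f).hom
      (lift2 P (extM θ (𝟙 (P.h f)) (P.coh.mapId I).hom) (eqToHom (ru_app A')))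
      (lift2 P (eqToHom (ru_app A)) (𝟙 (P.h f)))
  a_vsq : ∀ {A A' B B' E E' : Ob} (s : D.pre.V A A') (t : D.pre.V B B') (r : D.pre.V E E'),
    OverSq P (mK.a.s3 (P.mapV s) (P.mapV t) (P.mapV r)) (mD.a.s3 s t r)
      (eqToHom (a_app A B E)) (eqToHom (a_app A' B' E'))
      (hcu (mK.T.bsu (vsqM θ s t) (hi (P.mapV r))) (vsqM θ (mD.T.bv s t) r)
        (by rw [DblFun.tgt_bsu, tgt_vsqM, src_vsqM, PreDbl.tgt_shid]))
      (hcu (mK.T.bsu (hi (P.mapV s)) (vsqM θ t r)) (vsqM θ s (mD.T.bv t r))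
        (by rw [DblFun.tgt_bsu, tgt_vsqM, src_vsqM, PreDbl.tgt_shid]))
      (by rw [HTrans.tgt_s3, src_hcu, DblFun.src_bsu, src_vsqM, PreDbl.src_shid])
      (by rw [tgt_hcu, tgt_vsqM, HTrans.src_s3])
  lu_vsq : ∀ {A A' : Ob} (s : D.pre.V A A'),
    OverSq P (mK.lu.ls (P.mapV s)) (mD.lu.ls s) (eqToHom (lu_app A)) (eqToHom (lu_app A'))
      (vsqM θ (D.pre.vid I) s) (hi (P.mapV s))
      (by rw [HTrans.tgt_ls, PreDbl.src_shid])
      (by rw [tgt_vsqM, HTrans.src_ls])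
  ru_vsq : ∀ {A A' : Ob} (s : D.pre.V A A'),
    OverSq P (mK.ru.rs (P.mapV s)) (mD.ru.rs s) (eqToHom (ru_app A)) (eqToHom (ru_app A'))
      (vsqM θ s (D.pre.vid I)) (hi (P.mapV s))
      (by rw [HTrans.tgt_rs, PreDbl.src_shid])
      (by rw [tgt_vsqM, HTrans.src_rs])
  p : ∀ A B E G : Ob,
    Over2 P (mK.p A B E G).hom (mD.p A B E G).hom
      (lift2 P (extM θ (eqToHom (a_app A B E)) (P.coh.mapId G).hom)
        (lift2 P (eqToHom (a_app A (o B E) G))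
          (extM θ (P.coh.mapId A).hom (eqToHom (a_app B E G)))))
      (lift2 P (eqToHom (a_app (o A B) E G)) (eqToHom (a_app A B (o E G))))
  m : ∀ A B : Ob,
    Over2 P (mK.m A B).hom (mD.m A B).hom
      (lift2 P (eqToHom (a_app A I B)) (extM θ (P.coh.mapId A).hom (eqToHom (lu_app B))))
      (extM θ (eqToHom (ru_app A)) (P.coh.mapId B).hom)
  l : ∀ A B : Ob,
    Over2 P (mK.l A B).hom (mD.l A B).hom
      (extM θ (eqToHom (lu_app A)) (P.coh.mapId B).hom)
      (lift2 P (eqToHom (a_app I A B)) (eqToHom (lu_app (o A B))))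
  r : ∀ A B : Ob,
    Over2 P (mK.r A B).hom (mD.r A B).hom
      (eqToHom (ru_app (o A B)))
      (lift2 P (eqToHom (a_app A B I)) (extM θ (P.coh.mapId A).hom (eqToHom (ru_app B))))

/-- The left extension `(L, θ)` and the right extension `(R, ξ)` form a biaction through the
pseudonatural transformation `κ : (A ▷ X) ◁ B ⇒ A ▷ (X ◁ B)`, `X` in `K`: `κ` is a horizontal
equivalence, its 1-cell components are the images under `P` of those of the associativity `α`
of `D`, and the five Freyd action axioms hold:
1. `κ` at values of `P` agrees through `θ` and `ξ` with the image under `P` of `α`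
  (`a_nat` for horizontal 1-cells, `a_vsq` for vertical 1-cells);
2. the 2-cells `P p`, transported along `θ` and `ξ`, form a modification in the case where the
  third of the four variables ranges over `K` (`p_third`),
3. and in the case where the second of the four variables ranges over `K` (`p_second`);
4. the 2-cells `P l` form a modification in the case where the first variable ranges over `K`
  (`l_unit`);
5. the 2-cells `P r` form a modification in the case where the second variable ranges over `K`
  (`r_unit`).
In 2 to 5 the condition on horizontal 1-cells is the field `nat_h` and the condition on vertical
1-cells the field `nat_v` of `PMod`, `LMod`, `RMod`. -/
structure IsBiaction {TL : Bi D K K o} {TR : Bi K D K o}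
    (L : LeftData mD TL) (R : RightData mD TR) (θ : Icon (domL P TL) (mD.T.comp P))
    (ξ : Icon (domR P TR) (mD.T.comp P)) (hL : IsLeftExt L θ) (hR : IsRightExt R ξ)
    (κ : Asc TL TR TR TL) : Prop where
  equiv : κ.IsEquiv
  a_app : ∀ A B E : Ob, κ.a3 A B E = P.h (mD.a.a3 A B E)
  a_nat : ∀ {A A' B B' E E' : Ob} (f : D.c A ⟶ D.c A') (g : D.c B ⟶ D.c B')
    (h : D.c E ⟶ D.c E'),
    Over2 P (κ.n3 f (P.h g) h).hom (mD.a.n3 f g h).hom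
      (lift2 P (extR ξ (extL θ f (𝟙 (P.h g))) h) (eqToHom (a_app A' B' E')))
      (lift2 P (eqToHom (a_app A B E)) (extL θ f (extR ξ (𝟙 (P.h g)) h)))
  a_vsq : ∀ {A A' B B' E E' : Ob} (s : D.pre.V A A') (t : D.pre.V B B') (r : D.pre.V E E'),
    OverSq P (κ.s3 s (P.mapV t) r) (mD.a.s3 s t r) (eqToHom (a_app A B E))
      (eqToHom (a_app A' B' E'))
      (hcu (TR.bsu (vsqL θ s t) (hi r)) (vsqR ξ (mD.T.bv s t) r)
        (by rw [DblFun.tgt_bsu, tgt_vsqL, src_vsqR, PreDbl.tgt_shid]))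
      (hcu (TL.bsu (hi s) (vsqR ξ t r)) (vsqL θ s (mD.T.bv t r))
        (by rw [DblFun.tgt_bsu, tgt_vsqR, src_vsqL, PreDbl.tgt_shid]))
      (by rw [HTrans.tgt_s3, src_hcu, DblFun.src_bsu, src_vsqR, PreDbl.src_shid])
      (by rw [tgt_hcu, tgt_vsqR, HTrans.src_s3])
  p_third : ∃ q : PCell L.a κ κ κ L.a, PMod _ _ _ _ _ q ∧ ∀ A B E G : Ob,
    Over2 P (q A B E G).hom (mD.p A B E G).hom
      (lift2 P (extR ξ (eqToHom (hL.a_app A B E)) (𝟙 (D.c G)))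
        (lift2 P (eqToHom (a_app A (o B E) G)) (extL θ (𝟙 (D.c A)) (eqToHom (a_app B E G)))))
      (lift2 P (eqToHom (a_app (o A B) E G)) (eqToHom (hL.a_app A B (o E G))))
  p_second : ∃ q : PCell κ κ R.a R.a κ, PMod _ _ _ _ _ q ∧ ∀ A B E G : Ob,
    Over2 P (q A B E G).hom (mD.p A B E G).hom
      (lift2 P (extR ξ (eqToHom (a_app A B E)) (𝟙 (D.c G)))
        (lift2 P (eqToHom (a_app A (o B E) G)) (extL θ (𝟙 (D.c A)) (eqToHom (hR.a_app B E G)))))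
      (lift2 P (eqToHom (hR.a_app (o A B) E G)) (eqToHom (a_app A B (o E G))))
  l_unit : ∃ q : LCell κ L.lu L.lu, LMod _ _ _ q ∧ ∀ A B : Ob,
    Over2 P (q A B).hom (mD.l A B).hom
      (extR ξ (eqToHom (hL.lu_app A)) (𝟙 (D.c B)))
      (lift2 P (eqToHom (a_app I A B)) (eqToHom (hL.lu_app (o A B))))
  r_unit : ∃ q : RCell κ R.ru R.ru, RMod _ _ _ q ∧ ∀ A B : Ob,
    Over2 P (q A B).hom (mD.r A B).hom
      (eqToHom (hR.ru_app (o A B)))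
      (lift2 P (eqToHom (a_app A B I)) (extL θ (𝟙 (D.c A)) (eqToHom (hR.ru_app B))))
end

/-! Write `K` for the coPara double category and `P` for the embedding. All the structure to be
found is the monoidal structure of `K` with some variables restricted along `P`: restricting the
tensor product in the first or the second variable gives the two actions, and restricting the
associator of `K` to values of `P` in variables 1 and 2, in variables 2 and 3, or in variables 1 and
3 gives the associator of the left action, that of the right action, and `κ`. Each axiom is then an
axiom of `K` with some variables restricted. The difficulty is that restricted cells do not match on
the nose: the image under `P` of a tensor product in `D` agrees with the tensor product of the
images only through the icon, the compositors and the unitors.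

The proof is therefore a calculus of correspondences. For globular 2-cells, `OV n n₀ L R` says that
`n` becomes `n₀` along invertible 2-cells `L`, `R`. For squares, `Tw n n₀ e e' L R` says the same
along 2-cells `e`, `e'` at top and bottom and along squares `L`, `R` on identity 1-cells at the
sides. Both relations are stable under composition, whiskering, constraint cells and pseudo double
functors, so a pasting of cells corresponds to the pasting of the corresponding cells, and an
equation between pastings is carried along. The squares on identity 1-cells are the morphisms of a
category `vertCat` whose objects are vertical 1-cells; an invertible icon provides isomorphisms
there, and the side squares are handled by composing and cancelling morphisms.

An invertible icon from `T (Φ -) (Ψ -)` to `Ω (S - -)` is recorded as `BOver Φ Ψ Ω T S`. It compares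
cells built with `S` to cells built with the tensor product `T` of `K`. The tensor product of `D`
lies over that of `K` through `P` and the given icon, and the two actions lie over it through icons
with identity components. `AOver`, `LOver`, `ROver`, `POver`, `LcOver`, `RcOver`, `McOver` say that
the constraints and coherence cells correspond. Constraints are restricted by precomposition
(`HTrans.pre`) followed by conjugation with icons (`HTrans.conj`), and both operations preserve
horizontal equivalences. The axioms are reflected by `POver.pMod`, `LcOver.lMod`, `RcOver.rMod`,
`McOver.mMod` and by `pasting5`, `pastingL`, `pastingR`, for any `Ω` injective on squares. They are
applied with `Ω` the identity of `K`, where the values of the actions lie, so that `P` need not be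
injective.

Finally, one cell of `K` corresponds both to a restricted cell and to the image under `P` of a cell
of `D`. Eliminating the cell of `K` (`Over2.of_OV` for 2-cells, `Tw.cancel` for squares) gives all
the compatibility conditions with `P`. The argument uses of `P` only that it is a pseudo double
functor which is the identity on objects. -/

/-! ### Correspondence of globular 2-cells along invertible 2-cells -/

section
universe b₁ b₂ b₃
variable {B : Type b₁} [Bicategory.{b₂, b₃} B]

/-- Horizontal composite of invertible 2-cells. -/
def hIso {a b c : B} {f f' : a ⟶ b} {g g' : b ⟶ c} (e : f ≅ f') (d : g ≅ g') :
    f ≫ g ≅ f' ≫ g' := whiskerRightIso e g ≪≫ whiskerLeftIso f' d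

infixr:80 " ⋆ₕ " => hIso

lemma hIso_hom {a b c : B} {f f' : a ⟶ b} {g g' : b ⟶ c} (e : f ≅ f') (d : g ≅ g') :
    (e ⋆ₕ d).hom = e.hom ▷ g ≫ f' ◁ d.hom := rfl

lemma hIso_hom' {a b c : B} {f f' : a ⟶ b} {g g' : b ⟶ c} (e : f ≅ f') (d : g ≅ g') :
    (e ⋆ₕ d).hom = f ◁ d.hom ≫ e.hom ▷ g' := by
  rw [hIso_hom, whisker_exchange]

/-- Interchange moves the two inner whiskerings past each other. Comparison isomorphisms for
composites are later factored by this. -/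
lemma hIso_trans {a b c : B} {f f' f'' : a ⟶ b} {g g' g'' : b ⟶ c} (e : f ≅ f') (e' : f' ≅ f'')
    (d : g ≅ g') (d' : g' ≅ g'') : (e ≪≫ e') ⋆ₕ (d ≪≫ d') = (e ⋆ₕ d) ≪≫ (e' ⋆ₕ d') := by
  ext
  simp only [hIso_hom, Iso.trans_hom, comp_whiskerRight, whiskerLeft_comp, Category.assoc,
    whisker_exchange_assoc]

lemma hIso_refl {a b c : B} (f : a ⟶ b) (g : b ⟶ c) :
    Iso.refl f ⋆ₕ Iso.refl g = Iso.refl (f ≫ g) := by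
  ext; simp [hIso_hom]

/-- The 2-cell `n` corresponds to `n₀` along invertible 2-cells `L` and `R`. -/
def OV {a b : B} {k k' f f' : a ⟶ b} (n : k ⟶ k') (n₀ : f ⟶ f') (L : k ≅ f) (R : k' ≅ f') :
    Prop := n ≫ R.hom = L.hom ≫ n₀

namespace OV
variable {a b c d : B}

lemma comp {k k' k'' f f' f'' : a ⟶ b} {n : k ⟶ k'} {n₀ : f ⟶ f'} {m : k' ⟶ k''}
    {m₀ : f' ⟶ f''} {L : k ≅ f} {M : k' ≅ f'} {R : k'' ≅ f''} (h : OV n n₀ L M)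
    (h' : OV m m₀ M R) : OV (n ≫ m) (n₀ ≫ m₀) L R := by
  unfold OV at *; rw [Category.assoc, h', reassoc_of% h]

lemma id {k f : a ⟶ b} (L : k ≅ f) : OV (𝟙 k) (𝟙 f) L L := by simp [OV]

lemma inv {k k' f f' : a ⟶ b} {n : k ≅ k'} {n₀ : f ≅ f'} {L : k ≅ f} {R : k' ≅ f'}
    (h : OV n.hom n₀.hom L R) : OV n.inv n₀.inv R L := by
  unfold OV at *; rw [Iso.inv_comp_eq, ← Category.assoc, h]; simp

/-- Stacks two correspondences. The typical use goes from an arbitrary cell of the target to its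
counterpart at values of a functor, and from there to the image of a cell. -/
lemma trans {k k' f f' g g' : a ⟶ b} {n : k ⟶ k'} {n₀ : f ⟶ f'} {n₁ : g ⟶ g'} {L : k ≅ f}
    {R : k' ≅ f'} {L' : f ≅ g} {R' : f' ≅ g'}
    (h : OV n n₀ L R) (h' : OV n₀ n₁ L' R') : OV n n₁ (L ≪≫ L') (R ≪≫ R') := by
  unfold OV at *; simp only [Iso.trans_hom]; rw [reassoc_of% h, h', Category.assoc]

/-- Along given isomorphisms the conjugate is the only corresponding cell. Transported cells are
defined as such conjugates, which makes their correspondence immediate. -/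
lemma of_iso {k k' f f' : a ⟶ b} (n : k ⟶ k') (L : k ≅ f) (R : k' ≅ f') :
    OV n (L.inv ≫ n ≫ R.hom) L R := by simp [OV]

/-- The whiskering 1-cell may change along `e` at the same time: by interchange `e` slides past the
2-cell, because `e ⋆ₕ L` can be read in either order of whiskering. -/
lemma wl {f f₀ : a ⟶ b} {k k' g g' : b ⟶ c} (e : f ≅ f₀) {n : k ⟶ k'} {n₀ : g ⟶ g'} {L : k ≅ g}
    {R : k' ≅ g'} (h : OV n n₀ L R) : OV (f ◁ n) (f₀ ◁ n₀) (e ⋆ₕ L) (e ⋆ₕ R) := by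
  unfold OV at *
  rw [hIso_hom', hIso_hom', ← whiskerLeft_comp_assoc, h, whiskerLeft_comp, Category.assoc,
    Category.assoc, whisker_exchange]

lemma wr {k k' g g' : a ⟶ b} {f f₀ : b ⟶ c} {n : k ⟶ k'} {n₀ : g ⟶ g'} {L : k ≅ g}
    {R : k' ≅ g'} (h : OV n n₀ L R) (e : f ≅ f₀) : OV (n ▷ f) (n₀ ▷ f₀) (L ⋆ₕ e) (R ⋆ₕ e) := by
  unfold OV at *
  rw [hIso_hom, hIso_hom, ← comp_whiskerRight_assoc, h, comp_whiskerRight, Category.assoc,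
    Category.assoc, ← whisker_exchange]

lemma assoc {f f₀ : a ⟶ b} {g g₀ : b ⟶ c} {h h₀ : c ⟶ d} (ef : f ≅ f₀) (eg : g ≅ g₀)
    (eh : h ≅ h₀) : OV (α_ f g h).hom (α_ f₀ g₀ h₀).hom ((ef ⋆ₕ eg) ⋆ₕ eh) (ef ⋆ₕ (eg ⋆ₕ eh)) := by
  unfold OV; simp [hIso_hom]

lemma assoc_inv {f f₀ : a ⟶ b} {g g₀ : b ⟶ c} {h h₀ : c ⟶ d} (ef : f ≅ f₀) (eg : g ≅ g₀)
    (eh : h ≅ h₀) : OV (α_ f g h).inv (α_ f₀ g₀ h₀).inv (ef ⋆ₕ (eg ⋆ₕ eh)) ((ef ⋆ₕ eg) ⋆ₕ eh) :=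
  (assoc ef eg eh).inv

lemma leftU {f f₀ : a ⟶ b} (e : f ≅ f₀) :
    OV (λ_ f).hom (λ_ f₀).hom (Iso.refl (𝟙 a) ⋆ₕ e) e := by
  unfold OV; simp [hIso_hom]

lemma leftU_inv {f f₀ : a ⟶ b} (e : f ≅ f₀) :
    OV (λ_ f).inv (λ_ f₀).inv e (Iso.refl (𝟙 a) ⋆ₕ e) := (leftU e).inv

lemma rightU {f f₀ : a ⟶ b} (e : f ≅ f₀) :
    OV (ρ_ f).hom (ρ_ f₀).hom (e ⋆ₕ Iso.refl (𝟙 b)) e := by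
  unfold OV; simp [hIso_hom]

lemma rightU_inv {f f₀ : a ⟶ b} (e : f ≅ f₀) :
    OV (ρ_ f).inv (ρ_ f₀).inv e (e ⋆ₕ Iso.refl (𝟙 b)) := (rightU e).inv

/-- Since `L` is invertible, the lower cell is determined by the upper one. Laws of transported
structures are deduced in this way: their two sides correspond to the two sides of a law already
known. -/
lemma eq_of_eq {k k' f f' : a ⟶ b} {n m : k ⟶ k'} {n₀ m₀ : f ⟶ f'} {L : k ≅ f} {R : k' ≅ f'}
    (h : OV n n₀ L R) (h' : OV m m₀ L R) (e : n = m) : n₀ = m₀ := by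
  unfold OV at *; subst e; rw [← cancel_epi L.hom, ← h, ← h']

end OV

end

/-! ### Squares with prescribed boundaries and the category of vertical 1-cells -/

open DblCat

/-- Squares with prescribed vertical boundaries. -/
@[ext] structure BSq {Ob : Type u} (K : DblCat.{u, v, w, x} Ob) {A B A' B' : Ob} (s : K.pre.V A A')
    (t : K.pre.V B B') (f : K.c A ⟶ K.c B) (g : K.c A' ⟶ K.c B') where
  cell : Sq f g
  src_cell : K.pre.src cell = s
  tgt_cell : K.pre.tgt cell = t

section
variable {Ob : Type u} {K : DblCat.{u, v, w, x} Ob}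

namespace BSq
variable {A B E A' B' E' A'' B'' E'' : Ob} {s : K.pre.V A A'} {t : K.pre.V B B'} {r : K.pre.V E E'}
  {s' : K.pre.V A' A''} {t' : K.pre.V B' B''} {r' : K.pre.V E' E''}
  {f : K.c A ⟶ K.c B} {g : K.c B ⟶ K.c E} {f' : K.c A' ⟶ K.c B'} {g' : K.c B' ⟶ K.c E'}
  {f'' : K.c A'' ⟶ K.c B''} {g'' : K.c B'' ⟶ K.c E''}

/-- A square with its own boundaries. -/
def of (a : Sq f f') : BSq K (K.pre.src a) (K.pre.tgt a) f f' := ⟨a, rfl, rfl⟩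

/-- Vertical composite. -/
def vc (n : BSq K s t f f') (m : BSq K s' t' f' f'') :
    BSq K (K.pre.vcomp s s') (K.pre.vcomp t t') f f'' :=
  ⟨DblCat.vc n.cell m.cell, by rw [PreDbl.src_scomp, n.src_cell, m.src_cell],
    by rw [PreDbl.tgt_scomp, n.tgt_cell, m.tgt_cell]⟩

/-- Horizontal composite. -/
def hc (n : BSq K s t f f') (m : BSq K t r g g') : BSq K s r (f ≫ g) (f' ≫ g') :=
  ⟨DblCat.hc n.cell m.cell (n.tgt_cell.trans m.src_cell.symm),
    (K.pre.src_shcomp _ _ _).trans n.src_cell, (K.pre.tgt_shcomp _ _ _).trans m.tgt_cell⟩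

/-- Horizontal identity. -/
def hid (s : K.pre.V A A') : BSq K s s (𝟙 (K.c A)) (𝟙 (K.c A')) :=
  ⟨hi s, K.pre.src_shid s, K.pre.tgt_shid s⟩

/-- Vertical identity. -/
def vid (f : K.c A ⟶ K.c B) : BSq K (K.pre.vid A) (K.pre.vid B) f f :=
  ⟨sq (𝟙 f), PreDbl.Glob.src_cell _, PreDbl.Glob.tgt_cell _⟩
end BSq

section
variable {A B A' B' : Ob}

lemma hc_congr {A B E A' B' E' : Ob} {f : K.c A ⟶ K.c B} {f' : K.c A' ⟶ K.c B'}
    {g : K.c B ⟶ K.c E} {g' : K.c B' ⟶ K.c E'} {a a' : Sq f f'} {b b' : Sq g g'}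
    (ha : a = a') (hb : b = b') (e : K.pre.tgt a = K.pre.src b)
    (e' : K.pre.tgt a' = K.pre.src b') : hc a b e = hc a' b' e' := by
  subst ha; subst hb; rfl

/-- Links the two languages: horizontal pasting of globular squares is whiskering on both sides in
the horizontal bicategory. -/
lemma sq_hIso {A B E : Ob} {f f' : K.c A ⟶ K.c B} {g g' : K.c B ⟶ K.c E} (φ : f ⟶ f')
    (ψ : g ⟶ g') : sq (φ ▷ g ≫ f' ◁ ψ) = hc (sq φ) (sq ψ) (by simp) := by
  have h : φ ▷ g ≫ f' ◁ ψ = PreDbl.gcomp φ ψ :=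
    (gcomp_comp (D := K) φ (𝟙 f') (𝟙 g) ψ).symm.trans (by rw [Category.comp_id, Category.id_comp])
  rw [h]; rfl

/-- The squares `n`, `m` correspond along the globular 2-cells `φ`, `ψ`. -/
def V2 {s : K.pre.V A A'} {t : K.pre.V B B'} {s₀ : K.pre.V A A'} {t₀ : K.pre.V B B'}
    {f g : K.c A ⟶ K.c B} {f' g' : K.c A' ⟶ K.c B'}
    (n : BSq K s t f f') (m : BSq K s₀ t₀ g g') (φ : f ⟶ g) (ψ : f' ⟶ g') : Prop :=
  vc n.cell (sq ψ) = vc (sq φ) m.cell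

namespace V2
variable {s : K.pre.V A A'} {t : K.pre.V B B'} {f g h : K.c A ⟶ K.c B} {f' g' h' : K.c A' ⟶ K.c B'}
  {n : BSq K s t f f'} {m : BSq K s t g g'} {l : BSq K s t h h'}

lemma comp {φ : f ⟶ g} {ψ : f' ⟶ g'} {φ' : g ⟶ h} {ψ' : g' ⟶ h'} (h₁ : V2 n m φ ψ)
    (h₂ : V2 m l φ' ψ') : V2 n l (φ ≫ φ') (ψ ≫ ψ') := by
  unfold V2 at *
  show vc n.cell (vc (sq ψ) (sq ψ')) = vc (vc (sq φ) (sq φ')) l.cell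
  refine (K.pre.scomp_assoc _ _ _).symm.trans ?_
  refine (congrArg (fun t => K.pre.scomp t _) h₁).trans ?_
  refine (K.pre.scomp_assoc _ _ _).trans ?_
  refine (congrArg (fun t => K.pre.scomp _ t) h₂).trans ?_
  exact (K.pre.scomp_assoc _ _ _).symm

lemma refl (n : BSq K s t f f') : V2 n n (𝟙 f) (𝟙 f') :=
  (K.pre.scomp_sid _).trans (K.pre.sid_scomp _).symm

lemma of_eq {n m : BSq K s t f f'} (h : n = m) : V2 n m (𝟙 f) (𝟙 f') := h ▸ refl n

lemma eq {n m : BSq K s t f f'} (h : V2 n m (𝟙 f) (𝟙 f')) : n = m :=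
  BSq.ext ((K.pre.scomp_sid _).symm.trans (Eq.trans h (K.pre.sid_scomp _)))

lemma inv {φ : f ≅ g} {ψ : f' ≅ g'} (h : V2 n m φ.hom ψ.hom) : V2 m n φ.inv ψ.inv := by
  unfold V2 at *
  have h1 : vc (sq φ.inv) (sq φ.hom) = sq (𝟙 g) := congrArg PreDbl.Glob.cell φ.inv_hom_id
  have h2 : vc (sq ψ.hom) (sq ψ.inv) = sq (𝟙 f') := congrArg PreDbl.Glob.cell ψ.hom_inv_id
  refine (congrArg (fun t => vc t _) ((K.pre.sid_scomp _).symm.trans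
    (congrArg (fun t => vc t _) h1.symm))).trans ?_
  refine (congrArg (fun t => vc t _) (K.pre.scomp_assoc _ _ _)).trans ?_
  refine (congrArg (fun t => vc (vc _ t) _) (Eq.symm h)).trans ?_
  refine (K.pre.scomp_assoc _ _ _).trans (congrArg (vc _) ?_)
  exact (K.pre.scomp_assoc _ _ _).trans ((congrArg (vc _) h2).trans (K.pre.scomp_sid _))

lemma congr {φ φ₁ : f ⟶ g} {ψ ψ₁ : f' ⟶ g'} (h : V2 n m φ ψ) (e : φ = φ₁) (e' : ψ = ψ₁) :
    V2 n m φ₁ ψ₁ := e ▸ e' ▸ h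

/-- The standard way to identify two squares: exhibit both as conjugates of one common square, then
check that the conjugating 2-cells agree, which is a matter of bicategorical coherence. -/
lemma unique {m' : BSq K s t g g'} {φ φ₁ : f ≅ g} {ψ ψ₁ : f' ≅ g'} (h : V2 n m φ.hom ψ.hom)
    (h' : V2 n m' φ₁.hom ψ₁.hom) (e : φ.hom = φ₁.hom) (e' : ψ.hom = ψ₁.hom) : m = m' :=
  eq ((h.inv.comp h').congr (by rw [← e, Iso.inv_hom_id]) (by rw [← e', Iso.inv_hom_id]))

lemma hc {E E' : Ob} {r : K.pre.V E E'} {k k₁ : K.c B ⟶ K.c E} {k' k₁' : K.c B' ⟶ K.c E'}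
    {p : BSq K t r k k'} {q : BSq K t r k₁ k₁'} {φ : f ⟶ g} {ψ : f' ⟶ g'} {φ' : k ⟶ k₁}
    {ψ' : k' ⟶ k₁'} (h₁ : V2 n m φ ψ) (h₂ : V2 p q φ' ψ') :
    V2 (n.hc p) (m.hc q) (φ ▷ k ≫ g ◁ φ') (ψ ▷ k' ≫ g' ◁ ψ') := by
  unfold V2 at *
  rw [sq_hIso, sq_hIso]
  refine (K.pre.interchange _ _ _ _ _ _ ?_).symm.trans
    (Eq.trans (hc_congr h₁ h₂ _ ?_) (K.pre.interchange _ _ _ _ _ _ _))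
  · simp [n.tgt_cell, p.src_cell]
  · simp [m.tgt_cell, q.src_cell]

lemma assoc {E F E' F' : Ob} {r : K.pre.V E E'} {z : K.pre.V F F'} {k : K.c B ⟶ K.c E}
    {k' : K.c B' ⟶ K.c E'} {p : K.c E ⟶ K.c F} {p' : K.c E' ⟶ K.c F'}
    (n : BSq K s t f f') (m : BSq K t r k k') (l : BSq K r z p p') :
    V2 ((n.hc m).hc l) (n.hc (m.hc l)) (α_ f k p).hom (α_ f' k' p').hom :=
  K.coh.assoc_nat _ _ _ _ _

lemma leftU (n : BSq K s t f f') : V2 ((BSq.hid s).hc n) n (λ_ f).hom (λ_ f').hom := by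
  -- The unit law of the double category concerns the horizontal identity on the actual boundary of
  -- a square, so the prescribed boundary is replaced by the actual one.
  obtain ⟨n, rfl, rfl⟩ := n; exact K.coh.leftU_nat n

lemma rightU (n : BSq K s t f f') : V2 (n.hc (BSq.hid t)) n (ρ_ f).hom (ρ_ f').hom := by
  obtain ⟨n, rfl, rfl⟩ := n; exact K.coh.rightU_nat n

end V2

lemma V2.vc {A'' B'' : Ob} {s : K.pre.V A A'} {t : K.pre.V B B'} {s' : K.pre.V A' A''}
    {t' : K.pre.V B' B''}
    {f g : K.c A ⟶ K.c B} {f' g' : K.c A' ⟶ K.c B'} {f'' g'' : K.c A'' ⟶ K.c B''}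
    {n : BSq K s t f f'} {m : BSq K s t g g'} {n' : BSq K s' t' f' f''} {m' : BSq K s' t' g' g''}
    {φ : f ⟶ g} {ψ : f' ⟶ g'} {ω : f'' ⟶ g''}
    (h : V2 n m φ ψ) (h' : V2 n' m' ψ ω) : V2 (n.vc n') (m.vc m') φ ω := by
  unfold V2 at *
  refine (K.pre.scomp_assoc _ _ _).trans ((congrArg (fun t => DblCat.vc _ t) h').trans ?_)
  refine (K.pre.scomp_assoc _ _ _).symm.trans ((congrArg (fun t => DblCat.vc t _) h).trans ?_)
  exact K.pre.scomp_assoc _ _ _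

namespace BSq

lemma hc_vc {A B E A' B' E' A'' B'' E'' : Ob} {s : K.pre.V A A'} {t : K.pre.V B B'}
    {r : K.pre.V E E'}
    {s' : K.pre.V A' A''} {t' : K.pre.V B' B''} {r' : K.pre.V E' E''}
    {f : K.c A ⟶ K.c B} {g : K.c B ⟶ K.c E} {f' : K.c A' ⟶ K.c B'} {g' : K.c B' ⟶ K.c E'}
    {f'' : K.c A'' ⟶ K.c B''} {g'' : K.c B'' ⟶ K.c E''} (a : BSq K s t f f')
    (a' : BSq K s' t' f' f'') (b : BSq K t r g g') (b' : BSq K t' r' g' g'') :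
    (a.vc a').hc (b.vc b') = (a.hc b).vc (a'.hc b') :=
  BSq.ext (K.pre.interchange _ _ _ _ _ _ _)

variable {s s₀ s₁ : K.pre.V A A'} {t t₀ t₁ : K.pre.V B B'} {f : K.c A ⟶ K.c B}
    {f' : K.c A' ⟶ K.c B'}

/-- Composite on the left with a square on identities. -/
def lact (L : BSq K s s₀ (𝟙 _) (𝟙 _)) (n : BSq K s₀ t f f') : BSq K s t f f' :=
  ⟨DblCat.vc (sq (λ_ f).inv) (DblCat.vc (L.hc n).cell (sq (λ_ f').hom)),
    by simp [(L.hc n).src_cell], by simp [(L.hc n).tgt_cell]⟩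

/-- Composite on the right with a square on identities. -/
def ract (n : BSq K s t f f') (R : BSq K t t₀ (𝟙 _) (𝟙 _)) : BSq K s t₀ f f' :=
  ⟨DblCat.vc (sq (ρ_ f).inv) (DblCat.vc (n.hc R).cell (sq (ρ_ f').hom)),
    by simp [(n.hc R).src_cell], by simp [(n.hc R).tgt_cell]⟩

/-- A square defined by conjugation corresponds to the original one along the conjugating 2-cells.
It serves for `lact`, `ract` and for the action `vmap` of functors, all defined by such a
conjugation. -/
lemma conj_aux {s t} {g : K.c A ⟶ K.c B} {g' : K.c A' ⟶ K.c B'} (n : BSq K s t f f')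
    (φ : f ≅ g) (ψ : f' ≅ g') (m : BSq K s t g g')
    (h : m.cell = DblCat.vc (sq φ.inv) (DblCat.vc n.cell (sq ψ.hom))) : V2 n m φ.hom ψ.hom := by
  unfold V2
  rw [h]
  have h1 : DblCat.vc (sq φ.hom) (sq φ.inv) = sq (𝟙 f) := congrArg PreDbl.Glob.cell φ.hom_inv_id
  refine Eq.symm ((K.pre.scomp_assoc _ _ _).symm.trans ?_)
  exact (congrArg (fun t => DblCat.vc t _) h1).trans (K.pre.sid_scomp _)

lemma lact_V2 (L : BSq K s s₀ (𝟙 _) (𝟙 _)) (n : BSq K s₀ t f f') :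
    V2 (L.hc n) (lact L n) (λ_ f).hom (λ_ f').hom := conj_aux _ _ _ _ rfl

lemma ract_V2 (n : BSq K s t f f') (R : BSq K t t₀ (𝟙 _) (𝟙 _)) :
    V2 (n.hc R) (ract n R) (ρ_ f).hom (ρ_ f').hom := conj_aux _ _ _ _ rfl

lemma lact_hid (n : BSq K s t f f') : lact (hid s) n = n :=
  (lact_V2 _ _).unique (V2.leftU n) rfl rfl

lemma ract_hid (n : BSq K s t f f') : ract n (hid t) = n :=
  (ract_V2 _ _).unique (V2.rightU n) rfl rfl

/-- Both sides come from the triple composite, once by absorbing units from the left and once after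
reassociation; the two resulting 2-cells agree by coherence. This becomes associativity in
`vertCat`. -/
lemma lact_lact (L : BSq K s s₀ (𝟙 _) (𝟙 _)) (L' : BSq K s₀ s₁ (𝟙 _) (𝟙 _)) (n : BSq K s₁ t f f') :
    lact (lact L L') n = lact L (lact L' n) := by
  refine V2.unique (φ := whiskerRightIso (λ_ (𝟙 _)) f ≪≫ whiskerLeftIso _ (Iso.refl _) ≪≫ λ_ f)
    (ψ := whiskerRightIso (λ_ (𝟙 _)) f' ≪≫ whiskerLeftIso _ (Iso.refl _) ≪≫ λ_ f')
    (φ₁ := α_ _ _ _ ≪≫ (Iso.refl _ ⋆ₕ λ_ f) ≪≫ λ_ f)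
    (ψ₁ := α_ _ _ _ ≪≫ (Iso.refl _ ⋆ₕ λ_ f') ≪≫ λ_ f')
    (n := (L.hc L').hc n) ?_ ?_ ?_ ?_
  · exact (((lact_V2 L L').hc (V2.refl n)).comp (lact_V2 _ _)).congr (by simp) (by simp)
  · exact (V2.assoc _ _ _).comp (((V2.refl L).hc (lact_V2 L' n)).comp (lact_V2 _ _))
  · simp only [Iso.trans_hom, hIso_hom, whiskerRightIso_hom, whiskerLeftIso_hom, Iso.refl_hom];
        bicategory
  · simp only [Iso.trans_hom, hIso_hom, whiskerRightIso_hom, whiskerLeftIso_hom, Iso.refl_hom];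
        bicategory

/-- On identity 1-cells the left and the right unitor coincide, so it does not matter on which side
the unit is absorbed. -/
lemma ract_eq_lact (L : BSq K s s₀ (𝟙 _) (𝟙 _)) (L' : BSq K s₀ s₁ (𝟙 _) (𝟙 _)) :
    ract L L' = lact L L' :=
  (ract_V2 _ _).unique (lact_V2 L L') (by simp [unitors_equal]) (by simp [unitors_equal])

/-- The triangle identity: a square on identities placed between two squares can be absorbed by
either neighbour. Horizontal composition of twisted correspondences rests on this. -/
lemma ract_hc_lact {E E' : Ob} {r : K.pre.V E E'} {g : K.c B ⟶ K.c E} {g' : K.c B' ⟶ K.c E'}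
    (n : BSq K s t f f') (R : BSq K t t₀ (𝟙 _) (𝟙 _)) (m : BSq K t₀ r g g') :
    (ract n R).hc m = n.hc (lact R m) := by
  refine V2.unique (φ := ρ_ f ⋆ₕ Iso.refl g) (ψ := ρ_ f' ⋆ₕ Iso.refl g')
    (φ₁ := α_ _ _ _ ≪≫ (Iso.refl _ ⋆ₕ λ_ g)) (ψ₁ := α_ _ _ _ ≪≫ (Iso.refl _ ⋆ₕ λ_ g'))
    (n := (n.hc R).hc m) ?_ ?_ ?_ ?_
  · exact (ract_V2 n R).hc (V2.refl m)
  · exact (V2.assoc _ _ _).comp ((V2.refl n).hc (lact_V2 R m))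
  · simp [hIso_hom]
  · simp [hIso_hom]

lemma lact_hc {E E' : Ob} {r : K.pre.V E E'} {g : K.c B ⟶ K.c E} {g' : K.c B' ⟶ K.c E'}
    (L : BSq K s s₀ (𝟙 _) (𝟙 _)) (n : BSq K s₀ t f f') (m : BSq K t r g g') :
    lact L (n.hc m) = (lact L n).hc m := by
  refine V2.unique (φ := λ_ _) (ψ := λ_ _)
    (φ₁ := (α_ _ _ _).symm ≪≫ (λ_ f ⋆ₕ Iso.refl _)) (ψ₁ := (α_ _ _ _).symm ≪≫ (λ_ f' ⋆ₕ Iso.refl _))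
    (n := L.hc (n.hc m)) ?_ ?_ ?_ ?_
  · exact lact_V2 _ _
  · exact (V2.assoc _ _ _).inv.comp ((lact_V2 L n).hc (V2.refl m))
  · simp [hIso_hom]
  · simp [hIso_hom]

lemma ract_hc {E E' : Ob} {r r₀ : K.pre.V E E'} {g : K.c B ⟶ K.c E} {g' : K.c B' ⟶ K.c E'}
    (n : BSq K s t f f') (m : BSq K t r g g') (R : BSq K r r₀ (𝟙 _) (𝟙 _)) :
    ract (n.hc m) R = n.hc (ract m R) := by
  refine V2.unique (φ := ρ_ _) (ψ := ρ_ _)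
    (φ₁ := (α_ _ _ _) ≪≫ (Iso.refl _ ⋆ₕ ρ_ g)) (ψ₁ := (α_ _ _ _) ≪≫ (Iso.refl _ ⋆ₕ ρ_ g'))
    (n := (n.hc m).hc R) ?_ ?_ ?_ ?_
  · exact ract_V2 _ _
  · exact (V2.assoc _ _ _).comp ((V2.refl n).hc (ract_V2 m R))
  · simp [hIso_hom]
  · simp [hIso_hom]

lemma lact_ract (L : BSq K s s₀ (𝟙 _) (𝟙 _)) (n : BSq K s₀ t f f') (R : BSq K t t₀ (𝟙 _) (𝟙 _)) :
    lact L (ract n R) = ract (lact L n) R := by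
  refine V2.unique (φ := (Iso.refl _ ⋆ₕ ρ_ f) ≪≫ λ_ f) (ψ := (Iso.refl _ ⋆ₕ ρ_ f') ≪≫ λ_ f')
    (φ₁ := λ_ _ ≪≫ ρ_ f) (ψ₁ := λ_ _ ≪≫ ρ_ f') (n := L.hc (n.hc R)) ?_ ?_ ?_ ?_
  · exact ((V2.refl L).hc (ract_V2 n R)).comp (lact_V2 _ _)
  · exact (lact_V2 _ _).comp ((V2.of_eq (lact_hc L n R)).comp (ract_V2 _ _)) |>.congr
      (by simp) (by simp)
  · simp only [Iso.trans_hom, hIso_hom, Iso.refl_hom]; bicategory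
  · simp only [Iso.trans_hom, hIso_hom, Iso.refl_hom]; bicategory

/-- The middle square `R` is passed from `n` to `R'` by `ract_hc_lact`, after which both sides are
conjugates of the same composite. -/
lemma ract_ract (n : BSq K s t f f') (R : BSq K t t₀ (𝟙 _) (𝟙 _)) (R' : BSq K t₀ t₁ (𝟙 _) (𝟙 _)) :
    ract (ract n R) R' = ract n (lact R R') := by
  refine V2.unique (φ := ρ_ f) (ψ := ρ_ f') (φ₁ := ρ_ f) (ψ₁ := ρ_ f')
    (n := (ract n R).hc R') (ract_V2 _ _) ?_ rfl rfl
  rw [ract_hc_lact]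
  exact ract_V2 _ _
end BSq

/-- Squares on identity 1-cells, as morphisms between vertical 1-cells. -/
instance vertCat (A A' : Ob) : Category (K.pre.V A A') where
  Hom s s' := BSq K s s' (𝟙 (K.c A)) (𝟙 (K.c A'))
  id s := BSq.hid s
  comp a b := BSq.lact a b
  id_comp := BSq.lact_hid
  -- Composition absorbs on the left, whereas this unit law is natural for absorption on the right;
  -- on identity 1-cells the two agree.
  comp_id a := (BSq.ract_eq_lact a _).symm.trans (BSq.ract_hid a)
  assoc a b c := BSq.lact_lact a b c

namespace BSq
variable {s s₀ s₁ : K.pre.V A A'} {t t₀ t₁ : K.pre.V B B'} {f g : K.c A ⟶ K.c B}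
  {f' g' : K.c A' ⟶ K.c B'}

/-- Composite on the left with a morphism of vertical 1-cells. -/
def la (L : s ⟶ s₀) (n : BSq K s₀ t f f') : BSq K s t f f' := lact L n

/-- Composite on the right with a morphism of vertical 1-cells. -/
def ra (n : BSq K s t f f') (R : t ⟶ t₀) : BSq K s t₀ f f' := ract n R

lemma la_id (n : BSq K s t f f') : la (𝟙 s) n = n := lact_hid n
lemma ra_id (n : BSq K s t f f') : ra n (𝟙 t) = n := ract_hid n
lemma la_comp (L : s ⟶ s₀) (L' : s₀ ⟶ s₁) (n : BSq K s₁ t f f') :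
    la (L ≫ L') n = la L (la L' n) := lact_lact L L' n
lemma ra_comp (n : BSq K s t f f') (R : t ⟶ t₀) (R' : t₀ ⟶ t₁) :
    ra n (R ≫ R') = ra (ra n R) R' := (ract_ract n R R').symm
lemma la_ra (L : s ⟶ s₀) (n : BSq K s₀ t f f') (R : t ⟶ t₀) :
    la L (ra n R) = ra (la L n) R := lact_ract L n R

lemma la_V2 (L : s ⟶ s₀) {n : BSq K s₀ t f f'} {m : BSq K s₀ t g g'} {φ : f ⟶ g} {ψ : f' ⟶ g'}
    (h : V2 n m φ ψ) : V2 (la L n) (la L m) φ ψ :=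
  ((lact_V2 L n).inv.comp (((V2.refl _).hc h).comp (lact_V2 L m))).congr (by simp) (by simp)

lemma ra_V2 {n : BSq K s t f f'} {m : BSq K s t g g'} {φ : f ⟶ g} {ψ : f' ⟶ g'}
    (h : V2 n m φ ψ) (R : t ⟶ t₀) : V2 (ra n R) (ra m R) φ ψ :=
  ((ract_V2 n R).inv.comp ((h.hc (V2.refl _)).comp (ract_V2 m R))).congr (by simp) (by simp)
end BSq

/-- `n` corresponds to `n₀` along `e`, `e'`, up to the squares `L`, `R` on identities. -/
def Tw {s s₀ : K.pre.V A A'} {t t₀ : K.pre.V B B'} {k f : K.c A ⟶ K.c B} {k' f' : K.c A' ⟶ K.c B'}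
    (n : BSq K s t k k') (n₀ : BSq K s₀ t₀ f f') (e : k ⟶ f) (e' : k' ⟶ f') (L : s ⟶ s₀)
    (R : t ⟶ t₀) : Prop := V2 (n.ra R) (BSq.la L n₀) e e'

namespace Tw
variable {s s₀ s₁ : K.pre.V A A'} {t t₀ t₁ : K.pre.V B B'} {k f g : K.c A ⟶ K.c B}
  {k' f' g' : K.c A' ⟶ K.c B'}

/-- The side squares of the two correspondences act on opposite sides of the middle square, so they
commute by `BSq.la_ra`. -/
lemma comp {n : BSq K s t k k'} {n₀ : BSq K s₀ t₀ f f'} {n₁ : BSq K s₁ t₁ g g'} {e : k ⟶ f}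
    {e' : k' ⟶ f'} {d : f ⟶ g} {d' : f' ⟶ g'} {L : s ⟶ s₀} {R : t ⟶ t₀} {L' : s₀ ⟶ s₁}
    {R' : t₀ ⟶ t₁} (h : Tw n n₀ e e' L R) (h' : Tw n₀ n₁ d d' L' R') :
    Tw n n₁ (e ≫ d) (e' ≫ d') (L ≫ L') (R ≫ R') := by
  unfold Tw at *
  rw [BSq.ra_comp, BSq.la_comp]
  have := BSq.ra_V2 h R'
  rw [← BSq.la_ra] at this
  exact this.comp (BSq.la_V2 L h')

lemma of_V2 {n : BSq K s t k k'} {n₀ : BSq K s t f f'} {e : k ⟶ f} {e' : k' ⟶ f'}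
    (h : V2 n n₀ e e') : Tw n n₀ e e' (𝟙 s) (𝟙 t) := by
  unfold Tw; rwa [BSq.ra_id, BSq.la_id]

lemma refl (n : BSq K s t k k') : Tw n n (𝟙 k) (𝟙 k') (𝟙 s) (𝟙 t) := of_V2 (V2.refl n)

lemma congr {n : BSq K s t k k'} {n₀ : BSq K s₀ t₀ f f'} {e d : k ⟶ f}
    {e' d' : k' ⟶ f'} {L L' : s ⟶ s₀} {R R' : t ⟶ t₀} (h : Tw n n₀ e e' L R)
    (he : e = d) (he' : e' = d') (hL : L = L') (hR : R = R') : Tw n n₀ d d' L' R' := by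
  subst he he' hL hR; exact h

lemma symm {n : BSq K s t k k'} {n₀ : BSq K s₀ t₀ f f'} {e : k ≅ f}
    {e' : k' ≅ f'} {L : s ≅ s₀} {R : t ≅ t₀} (h : Tw n n₀ e.hom e'.hom L.hom R.hom) :
    Tw n₀ n e.inv e'.inv L.inv R.inv := by
  unfold Tw at *
  have := BSq.la_V2 L.inv (BSq.ra_V2 h R.inv)
  rw [← BSq.ra_comp, R.hom_inv_id, BSq.ra_id, ← BSq.la_ra, ← BSq.la_comp, L.inv_hom_id,
    BSq.la_id] at this
  exact this.inv

/-- The same morphism `M` appears as right side of the first correspondence and left side of the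
second. In the composite it is carried across the common boundary by `BSq.ract_hc_lact` and
disappears. -/
lemma hc {E E' : Ob} {r r₀ : K.pre.V E E'} {l l₀ : K.c B ⟶ K.c E} {l' l₀' : K.c B' ⟶ K.c E'}
    {n : BSq K s t k k'} {n₀ : BSq K s₀ t₀ f f'} {e : k ⟶ f} {e' : k' ⟶ f'} {L : s ⟶ s₀}
    {M : t ⟶ t₀} {m : BSq K t r l l'} {m₀ : BSq K t₀ r₀ l₀ l₀'} {d : l ⟶ l₀} {d' : l' ⟶ l₀'}
    {R : r ⟶ r₀} (h : Tw n n₀ e e' L M) (h' : Tw m m₀ d d' M R) :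
    Tw (n.hc m) (n₀.hc m₀) (e ▷ l ≫ f ◁ d) (e' ▷ l' ≫ f' ◁ d') L R := by
  unfold Tw at *
  have h1 := (V2.of_eq (BSq.ract_hc n m R)).comp ((V2.refl n).hc h')
  have h2 := (h.hc (V2.refl m₀)).comp (V2.of_eq (BSq.lact_hc L n₀ m₀).symm)
  refine (h1.comp ((V2.of_eq (BSq.ract_hc_lact n M m₀).symm).comp h2)).congr ?_ ?_ <;>
  simp [whisker_exchange]

/-- Absorbing an identity square leaves `L` on both sides, so a morphism of `vertCat` relates the
identity squares on its source and target. -/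
lemma hid (L : s ⟶ s₀) : Tw (BSq.hid s) (BSq.hid s₀) (𝟙 _) (𝟙 _) L L := by
  have h1 : BSq.ra (BSq.hid s) L = L := (BSq.ract_eq_lact _ _).trans (BSq.lact_hid _)
  have h2 : BSq.la L (BSq.hid s₀) = L := (BSq.ract_eq_lact _ _).symm.trans (BSq.ract_hid _)
  unfold Tw; rw [h1, h2]; exact V2.refl _

/-- The counterpart of `OV.eq_of_eq` for squares. Both correspondences have the same side squares;
after applying `R` on the right and the inverse of `L` on the left, only the 2-cells at top and
bottom remain, and these are transported by `OV`. Only `L` has to be invertible. -/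
lemma transfer {n : BSq K s t k k'} {m : BSq K s t g g'} {f₁ : K.c A ⟶ K.c B}
    {f₁' : K.c A' ⟶ K.c B'} {n₀ : BSq K s₀ t₀ f f'}
    {m₀ : BSq K s₀ t₀ f₁ f₁'} {φ : k ⟶ g} {ψ : k' ⟶ g'} {φ₀ : f ⟶ f₁} {ψ₀ : f' ⟶ f₁'}
    {e : k ≅ f} {e' : k' ≅ f'} {d : g ≅ f₁} {d' : g' ≅ f₁'} {L : s ≅ s₀} {R : t ⟶ t₀}
    (h : V2 n m φ ψ) (hn : Tw n n₀ e.hom e'.hom L.hom R) (hm : Tw m m₀ d.hom d'.hom L.hom R)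
    (hφ : OV φ φ₀ e d) (hψ : OV ψ ψ₀ e' d') : V2 n₀ m₀ φ₀ ψ₀ := by
  unfold Tw at *
  have h1 := BSq.la_V2 L.inv (hn.inv.comp ((BSq.ra_V2 h R).comp hm))
  rw [← BSq.la_comp, ← BSq.la_comp, L.inv_hom_id, BSq.la_id, BSq.la_id] at h1
  exact h1.congr ((Iso.inv_comp_eq _).2 hφ) ((Iso.inv_comp_eq _).2 hψ)
end Tw
end
end

/-! ### Pseudo double functors acting on correspondences -/

section
variable {Ob : Type u} {Ob' : Type u'} {C : DblCat.{u, v, w, x} Ob}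
  {K : DblCat.{u', v', w', x'} Ob'} {o : Ob → Ob'}

namespace DblFun

/-- Action on squares with prescribed boundaries. -/
def bsq (F : DblFun C K o) {A B A' B' : Ob} {s : C.pre.V A A'} {t : C.pre.V B B'}
    {f : C.c A ⟶ C.c B} {g : C.c A' ⟶ C.c B'} (n : BSq C s t f g) :
    BSq K (F.mapV s) (F.mapV t) (F.h f) (F.h g) :=
  ⟨F.s n.cell, (F.src_mapSq _).trans (congrArg _ n.src_cell),
    (F.tgt_mapSq _).trans (congrArg _ n.tgt_cell)⟩

section
variable (F : DblFun C K o) {A B E A' B' E' : Ob} {s s₀ s₁ : C.pre.V A A'} {t t₀ t₁ : C.pre.V B B'}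
  {r : C.pre.V E E'} {f f₀ : C.c A ⟶ C.c B} {g g₀ : C.c A' ⟶ C.c B'}

lemma bsq_V2 {n : BSq C s t f g} {m : BSq C s t f₀ g₀} {φ : f ⟶ f₀} {ψ : g ⟶ g₀}
    (h : V2 n m φ ψ) : V2 (F.bsq n) (F.bsq m) (F.g φ) (F.g ψ) :=
  (F.mapSq_scomp _ _).symm.trans ((congrArg F.mapSq h).trans (F.mapSq_scomp _ _))

lemma bsq_hc {k : C.c B ⟶ C.c E} {k' : C.c B' ⟶ C.c E'} (n : BSq C s t f g) (m : BSq C t r k k') :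
    V2 ((F.bsq n).hc (F.bsq m)) (F.bsq (n.hc m)) (F.coh.mapComp f k).hom
      (F.coh.mapComp g k').hom := F.coh.mapComp_nat _ _ _

lemma bsq_hid (s : C.pre.V A A') : V2 (BSq.hid (F.mapV s)) (F.bsq (BSq.hid s))
    (F.coh.mapId A).hom (F.coh.mapId A').hom := F.coh.mapId_nat s

/-- Action on squares on identities. -/
def vmap (L : s ⟶ s₀) : F.mapV s ⟶ F.mapV s₀ :=
  BSq.mk (vc (sq (F.coh.mapId A).hom) (vc (F.bsq L).cell (sq (F.coh.mapId A').inv)))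
    (by simp [(F.bsq L).src_cell]) (by simp [(F.bsq L).tgt_cell])

lemma vmap_V2 (L : s ⟶ s₀) :
    V2 (F.bsq L) (F.vmap L) (F.coh.mapId A).inv (F.coh.mapId A').inv :=
  BSq.conj_aux _ (F.coh.mapId A).symm (F.coh.mapId A').symm _ rfl

lemma vmap_id (s : C.pre.V A A') : F.vmap (𝟙 s) = 𝟙 (F.mapV s) :=
  (F.vmap_V2 (𝟙 s)).unique (φ := (F.coh.mapId A).symm) (ψ := (F.coh.mapId A').symm)
    (F.bsq_hid s).inv rfl rfl

/-- Out of the composite of the images of `L` and `n` there are two comparisons: through the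
compositor and the image of the unitor, or through the unitor of `F` and the unitor of the target.
The left unit axiom of `F` says that they are equal. -/
lemma bsq_la (L : s ⟶ s₀) (n : BSq C s₀ t f g) : F.bsq (BSq.la L n) = BSq.la (F.vmap L) (F.bsq n)
    := by
  refine V2.unique (φ := F.coh.mapComp _ _ ≪≫ F.gi (λ_ f)) (ψ := F.coh.mapComp _ _ ≪≫ F.gi (λ_ g))
    (φ₁ := ((F.coh.mapId A).symm ⋆ₕ Iso.refl _) ≪≫ λ_ _)
    (ψ₁ := ((F.coh.mapId A').symm ⋆ₕ Iso.refl _) ≪≫ λ_ _)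
    (n := (F.bsq L).hc (F.bsq n)) ?_ ?_ ?_ ?_
  · exact (F.bsq_hc L n).comp (F.bsq_V2 (BSq.lact_V2 L n))
  · exact ((F.vmap_V2 L).hc (V2.refl _)).comp (BSq.lact_V2 _ _)
  · simp [hIso_hom, ← F.coh.map_leftUnitor f]
  · simp [hIso_hom, ← F.coh.map_leftUnitor g]

lemma bsq_ra (n : BSq C s t f g) (R : t ⟶ t₀) : F.bsq (BSq.ra n R) = BSq.ra (F.bsq n) (F.vmap R) :=
    by
  refine V2.unique (φ := F.coh.mapComp _ _ ≪≫ F.gi (ρ_ f)) (ψ := F.coh.mapComp _ _ ≪≫ F.gi (ρ_ g))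
    (φ₁ := (Iso.refl _ ⋆ₕ (F.coh.mapId B).symm) ≪≫ ρ_ _)
    (ψ₁ := (Iso.refl _ ⋆ₕ (F.coh.mapId B').symm) ≪≫ ρ_ _)
    (n := (F.bsq n).hc (F.bsq R)) ?_ ?_ ?_ ?_
  · exact (F.bsq_hc n R).comp (F.bsq_V2 (BSq.ract_V2 n R))
  · exact ((V2.refl _).hc (F.vmap_V2 R)).comp (BSq.ract_V2 _ _)
  · simp [hIso_hom, ← F.coh.map_rightUnitor f]
  · simp [hIso_hom, ← F.coh.map_rightUnitor g]

/-- Composition in `vertCat` is absorption on the left, which `F` preserves by `bsq_la`. Hence `F`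
acts as a functor on these categories, and in particular preserves their isomorphisms. -/
lemma vmap_comp (L : s ⟶ s₀) (L' : s₀ ⟶ s₁) : F.vmap (L ≫ L') = F.vmap L ≫ F.vmap L' := by
  refine (F.vmap_V2 (L ≫ L')).unique (φ := (F.coh.mapId A).symm) (ψ := (F.coh.mapId A').symm)
    (φ₁ := (F.coh.mapId A).symm) (ψ₁ := (F.coh.mapId A').symm) ?_ rfl rfl
  have h := BSq.la_V2 (F.vmap L) (F.vmap_V2 L')
  rw [← F.bsq_la] at h
  exact h

/-- Action on invertible squares on identities. -/
@[simps] def vmapI (L : s ≅ s₀) : F.mapV s ≅ F.mapV s₀ where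
  hom := F.vmap L.hom
  inv := F.vmap L.inv
  hom_inv_id := by rw [← F.vmap_comp, L.hom_inv_id, F.vmap_id]
  inv_hom_id := by rw [← F.vmap_comp, L.inv_hom_id, F.vmap_id]

lemma bsq_Tw {n : BSq C s t f g} {m : BSq C s₀ t₀ f₀ g₀} {φ : f ⟶ f₀} {ψ : g ⟶ g₀} {L : s ⟶ s₀}
    {R : t ⟶ t₀} (h : Tw n m φ ψ L R) :
    Tw (F.bsq n) (F.bsq m) (F.g φ) (F.g ψ) (F.vmap L) (F.vmap R) := by
  unfold Tw at *
  rw [← F.bsq_la, ← F.bsq_ra]; exact F.bsq_V2 h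

/-- Composite of invertible 2-cells into values of `F`, through the compositor. -/
def lift2I {k : K.c (o A) ⟶ K.c (o B)} {k' : K.c (o B) ⟶ K.c (o E)} {f : C.c A ⟶ C.c B}
    {f' : C.c B ⟶ C.c E} (e : k ≅ F.h f) (d : k' ≅ F.h f') : k ≫ k' ≅ F.h (f ≫ f') :=
  (e ⋆ₕ d) ≪≫ F.coh.mapComp f f'

/-- Correspondence with a square in the image of `F` is stable under horizontal composition, the
compositor being absorbed into the comparison `lift2I`. The nesting of `lift2I` then follows the
bracketing of the composites. -/
lemma Tw_hc {k : K.c (o A) ⟶ K.c (o B)} {k' : K.c (o A') ⟶ K.c (o B')}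
    {l : K.c (o B) ⟶ K.c (o E)} {l' : K.c (o B') ⟶ K.c (o E')}
    {p : C.c B ⟶ C.c E} {q : C.c B' ⟶ C.c E'}
    {z : K.pre.V (o A) (o A')} {z' : K.pre.V (o B) (o B')} {z'' : K.pre.V (o E) (o E')}
    {n : BSq K z z' k k'} {n₀ : BSq C s t f g} {m : BSq K z' z'' l l'} {m₀ : BSq C t r p q}
    {e : k ≅ F.h f} {e' : k' ≅ F.h g} {d : l ≅ F.h p} {d' : l' ≅ F.h q}
    {L : z ⟶ F.mapV s} {M : z' ⟶ F.mapV t} {R : z'' ⟶ F.mapV r}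
    (h : Tw n (F.bsq n₀) e.hom e'.hom L M) (h' : Tw m (F.bsq m₀) d.hom d'.hom M R) :
    Tw (n.hc m) (F.bsq (n₀.hc m₀)) (F.lift2I e d).hom (F.lift2I e' d').hom L R :=
  ((h.hc h').comp (Tw.of_V2 (F.bsq_hc n₀ m₀))).congr rfl rfl (Category.comp_id _)
    (Category.comp_id _)

lemma Tw_hid {z : K.pre.V (o A) (o A')} (L : z ⟶ F.mapV s) :
    Tw (BSq.hid z) (F.bsq (BSq.hid s)) (F.coh.mapId A).hom (F.coh.mapId A').hom L L := by
  exact ((Tw.hid L).comp (Tw.of_V2 (F.bsq_hid s))).congr (Category.id_comp _) (Category.id_comp _)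
    (Category.comp_id _) (Category.comp_id _)
end

section
variable {F : DblFun C K o} {A B E G : Ob}

/-- Whiskering in the target matches whiskering in the source because compositors are natural. This
lemma and its neighbours make correspondence with an image under `F` stable under every operation of
a bicategory. -/
lemma OV_wl {f : C.c A ⟶ C.c B} {g g' : C.c B ⟶ C.c E} {k : K.c (o A) ⟶ K.c (o B)}
    {l l' : K.c (o B) ⟶ K.c (o E)} {n : l ⟶ l'} {n₀ : g ⟶ g'} (e : k ≅ F.h f) {L : l ≅ F.h g}
    {R : l' ≅ F.h g'} (h : OV n (F.g n₀) L R) :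
    OV (k ◁ n) (F.g (f ◁ n₀)) (F.lift2I e L) (F.lift2I e R) :=
  (OV.wl e h).trans (F.coh.g_whiskerLeft f n₀)

lemma OV_wr {f f' : C.c A ⟶ C.c B} {g : C.c B ⟶ C.c E} {k k' : K.c (o A) ⟶ K.c (o B)}
    {l : K.c (o B) ⟶ K.c (o E)} {n : k ⟶ k'} {n₀ : f ⟶ f'} {L : k ≅ F.h f}
    {R : k' ≅ F.h f'} (h : OV n (F.g n₀) L R) (e : l ≅ F.h g) :
    OV (n ▷ l) (F.g (n₀ ▷ g)) (F.lift2I L e) (F.lift2I R e) :=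
  (OV.wr h e).trans (F.coh.g_whiskerRight n₀ g)

lemma OV_comp {f f' f'' : C.c A ⟶ C.c B} {k k' k'' : K.c (o A) ⟶ K.c (o B)}
    {n : k ⟶ k'} {n₀ : f ⟶ f'} {m : k' ⟶ k''} {m₀ : f' ⟶ f''} {L : k ≅ F.h f} {M : k' ≅ F.h f'}
    {R : k'' ≅ F.h f''} (h : OV n (F.g n₀) L M) (h' : OV m (F.g m₀) M R) :
    OV (n ≫ m) (F.g (n₀ ≫ m₀)) L R := by
  rw [F.g_comp]; exact h.comp h'

lemma OV_id {f : C.c A ⟶ C.c B} {k : K.c (o A) ⟶ K.c (o B)} (L : k ≅ F.h f) :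
    OV (𝟙 k) (F.g (𝟙 f)) L L := by
  rw [F.g_id]; exact OV.id L

lemma OV_inv {f f' : C.c A ⟶ C.c B} {k k' : K.c (o A) ⟶ K.c (o B)}
    {n : k ≅ k'} {n₀ : f ≅ f'} {L : k ≅ F.h f} {M : k' ≅ F.h f'}
    (h : OV n.hom (F.g n₀.hom) L M) : OV n.inv (F.g n₀.inv) M L :=
  OV.inv (n₀ := F.gi n₀) h

/-- With compositors hidden in `lift2I`, the associativity axiom of `F` says precisely that
associators correspond. -/
lemma OV_assoc {f : C.c A ⟶ C.c B} {g : C.c B ⟶ C.c E} {h : C.c E ⟶ C.c G}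
    {k : K.c (o A) ⟶ K.c (o B)} {l : K.c (o B) ⟶ K.c (o E)} {m : K.c (o E) ⟶ K.c (o G)}
    (e : k ≅ F.h f) (d : l ≅ F.h g) (c : m ≅ F.h h) :
    OV (α_ k l m).hom (F.g (α_ f g h).hom) (F.lift2I (F.lift2I e d) c)
      (F.lift2I e (F.lift2I d c)) := by
  have h1 := OV.assoc e d c
  have h2 := F.coh.map_assoc f g h
  unfold OV at *
  simp only [lift2I, Iso.trans_hom, hIso_hom, comp_whiskerRight, whiskerLeft_comp,
    Category.assoc] at *
  rw [reassoc_of% h1, ← h2, whisker_exchange_assoc]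

lemma OV_assoc_inv {f : C.c A ⟶ C.c B} {g : C.c B ⟶ C.c E} {h : C.c E ⟶ C.c G}
    {k : K.c (o A) ⟶ K.c (o B)} {l : K.c (o B) ⟶ K.c (o E)} {m : K.c (o E) ⟶ K.c (o G)}
    (e : k ≅ F.h f) (d : l ≅ F.h g) (c : m ≅ F.h h) :
    OV (α_ k l m).inv (F.g (α_ f g h).inv) (F.lift2I e (F.lift2I d c))
      (F.lift2I (F.lift2I e d) c) := OV_inv (OV_assoc e d c)

/-- The unit axiom of `F` in the same form. It forces an identity 1-cell to be compared with its
image through the unitor `mapId`, a convention kept throughout. -/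
lemma OV_leftU {f : C.c A ⟶ C.c B} {k : K.c (o A) ⟶ K.c (o B)} (e : k ≅ F.h f) :
    OV (λ_ k).hom (F.g (λ_ f).hom) (F.lift2I (F.coh.mapId A) e) e := by
  unfold OV
  simp only [lift2I, Iso.trans_hom, hIso_hom', Category.assoc]
  rw [F.coh.map_leftUnitor, leftUnitor_naturality]

lemma OV_leftU_inv {f : C.c A ⟶ C.c B} {k : K.c (o A) ⟶ K.c (o B)} (e : k ≅ F.h f) :
    OV (λ_ k).inv (F.g (λ_ f).inv) e (F.lift2I (F.coh.mapId A) e) := OV_inv (OV_leftU e)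

lemma OV_rightU {f : C.c A ⟶ C.c B} {k : K.c (o A) ⟶ K.c (o B)} (e : k ≅ F.h f) :
    OV (ρ_ k).hom (F.g (ρ_ f).hom) (F.lift2I e (F.coh.mapId B)) e := by
  unfold OV
  simp only [lift2I, Iso.trans_hom, hIso_hom, Category.assoc]
  rw [F.coh.map_rightUnitor, rightUnitor_naturality]

end
end DblFun

/-! ### Vertical composition and inverses of squares on identities -/

section
variable {A B A' B' : Ob'}

/-- Interchange, with the unitors of the intermediate 1-cells cancelling. -/
lemma BSq.lact_vc {A'' B'' : Ob'} {s s₀ : K.pre.V A A'} {s' s₀' : K.pre.V A' A''}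
    {t : K.pre.V B B'} {t' : K.pre.V B' B''} {f : K.c A ⟶ K.c B} {f' : K.c A' ⟶ K.c B'}
    {f'' : K.c A'' ⟶ K.c B''}
    (a : BSq K s s₀ (𝟙 _) (𝟙 _)) (a' : BSq K s' s₀' (𝟙 _) (𝟙 _)) (n : BSq K s₀ t f f')
    (n' : BSq K s₀' t' f' f'') :
    BSq.lact (a.vc a') (n.vc n') = (BSq.lact a n).vc (BSq.lact a' n') := by
  refine V2.unique (φ := λ_ f) (ψ := λ_ f'') (φ₁ := λ_ f) (ψ₁ := λ_ f'')
    (n := (a.vc a').hc (n.vc n')) (BSq.lact_V2 _ _) ?_ rfl rfl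
  rw [BSq.hc_vc]
  exact V2.vc (BSq.lact_V2 a n) (BSq.lact_V2 a' n')

lemma BSq.ract_vc {A'' B'' : Ob'} {s : K.pre.V A A'} {s' : K.pre.V A' A''}
    {t t₀ : K.pre.V B B'} {t' t₀' : K.pre.V B' B''} {f : K.c A ⟶ K.c B} {f' : K.c A' ⟶ K.c B'}
    {f'' : K.c A'' ⟶ K.c B''}
    (n : BSq K s t f f') (n' : BSq K s' t' f' f'') (a : BSq K t t₀ (𝟙 _) (𝟙 _))
    (a' : BSq K t' t₀' (𝟙 _) (𝟙 _)) :
    BSq.ract (n.vc n') (a.vc a') = (BSq.ract n a).vc (BSq.ract n' a') := by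
  refine V2.unique (φ := ρ_ f) (ψ := ρ_ f'') (φ₁ := ρ_ f) (ψ₁ := ρ_ f'')
    (n := (n.vc n').hc (a.vc a')) (BSq.ract_V2 _ _) ?_ rfl rfl
  rw [BSq.hc_vc]
  exact V2.vc (BSq.ract_V2 n a) (BSq.ract_V2 n' a')

lemma BSq.cell_eqToHom {s t : K.pre.V A A'} (h : s = t) : (eqToHom h).cell = hi s := by
  subst h; rfl

lemma BSq.eq_vid {s t : K.pre.V A A} {f : K.c A ⟶ K.c B} {t : K.pre.V B B} (n : BSq K s t f f)
    (h : n.cell = sq (𝟙 f)) : s = K.pre.vid A ∧ t = K.pre.vid B :=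
  ⟨n.src_cell.symm.trans ((congrArg _ h).trans (PreDbl.Glob.src_cell _)),
    n.tgt_cell.symm.trans ((congrArg _ h).trans (PreDbl.Glob.tgt_cell _))⟩

/-- A functor sends a vertical identity to one only up to a propositional equality. A morphism of
`vertCat` whose cell is the identity square is therefore not literally an identity, but the
transport along that equality. -/
lemma BSq.hom_eq_eqToHom {s t : K.pre.V A A} (a : s ⟶ t) (h : a.cell = sq (𝟙 (𝟙 (K.c A)))) :
    ∃ e : s = t, a = eqToHom e := by
  obtain ⟨rfl, rfl⟩ := BSq.eq_vid (s := s) (t := t) a h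
  exact ⟨rfl, BSq.ext (h.trans (K.pre.shid_vid A).symm)⟩

/-- Icons state compatibility with vertical composition for the squares themselves; conjugation also
uses their inverses. By interchange the vertical composite of the inverses is an inverse, and
inverses are unique. The statement compares bare cells because the boundaries are only
propositionally equal. -/
lemma BSq.inv_cell_vcomp {A'' : Ob'} {s t : K.pre.V A A'} {s' t' : K.pre.V A' A''}
    {z z' : K.pre.V A A''} (I : z ≅ z') (I₁ : s ≅ t) (I₂ : s' ≅ t')
    (h : I.hom.cell = DblCat.vc I₁.hom.cell I₂.hom.cell) :
    I.inv.cell = DblCat.vc I₁.inv.cell I₂.inv.cell := by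
  have hz : z = K.pre.vcomp s s' := by
    rw [← I.hom.src_cell, h, K.pre.src_scomp, I₁.hom.src_cell, I₂.hom.src_cell]
  have hz' : z' = K.pre.vcomp t t' := by
    rw [← I.hom.tgt_cell, h, K.pre.tgt_scomp, I₁.hom.tgt_cell, I₂.hom.tgt_cell]
  subst hz hz'
  have h1 : I.hom = BSq.vc I₁.hom I₂.hom := BSq.ext h
  have h2 : I.hom ≫ (BSq.vc I₁.inv I₂.inv : BSq K _ _ _ _) = 𝟙 _ := by
    rw [h1]
    refine (BSq.lact_vc I₁.hom I₂.hom I₁.inv I₂.inv).trans (BSq.ext ?_)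
    exact (congrArg₂ DblCat.vc (congrArg BSq.cell I₁.hom_inv_id)
        (congrArg BSq.cell I₂.hom_inv_id)).trans
      (K.pre.shid_vcomp s s').symm
  exact congrArg BSq.cell ((cancel_epi I.hom).1 (I.hom_inv_id.trans h2.symm))

lemma BSq.inv_cell_vid {z z' : K.pre.V A A} (I : z ≅ z') (h : I.hom.cell = sq (𝟙 (𝟙 (K.c A)))) :
    I.inv.cell = sq (𝟙 (𝟙 (K.c A))) := by
  obtain ⟨e, h1⟩ := BSq.hom_eq_eqToHom I.hom h
  have h2 : I.inv = eqToHom e.symm := by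
    rw [← cancel_epi I.hom, I.hom_inv_id, h1, eqToHom_trans, eqToHom_refl]
  obtain ⟨rfl, rfl⟩ := BSq.eq_vid (s := z) (t := z') I.hom h
  rw [h2]
  exact K.pre.shid_vid A

/-- When the side squares only transport along equalities, the twisted correspondence is a plain
equation of squares. It is the bridge back from `Tw` to globular 2-cells and to strictly agreeing
functors. -/
lemma Tw.eqToHom_iff {s s₀ : K.pre.V A A'} {t t₀ : K.pre.V B B'} {k f : K.c A ⟶ K.c B}
    {k' f' : K.c A' ⟶ K.c B'} {n : BSq K s t k k'} {n₀ : BSq K s₀ t₀ f f'} {e : k ⟶ f}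
    {e' : k' ⟶ f'} (hs : s = s₀) (ht : t = t₀) :
    Tw n n₀ e e' (eqToHom hs) (eqToHom ht) ↔ vc n.cell (sq e') = vc (sq e) n₀.cell := by
  subst hs ht
  unfold Tw
  rw [eqToHom_refl, eqToHom_refl, BSq.ra_id, BSq.la_id]; rfl
end

/-! ### Invertible icons -/

/-- Invertible icons, with their squares as isomorphisms of vertical 1-cells. -/
structure OIcon (F G : DblFun C K o) where
  c : ∀ {A B : Ob} (f : C.c A ⟶ C.c B), F.h f ≅ G.h f
  v : ∀ {A A' : Ob} (s : C.pre.V A A'), F.mapV s ≅ G.mapV s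
  c_comp : ∀ {A B E : Ob} (f : C.c A ⟶ C.c B) (g : C.c B ⟶ C.c E),
    OV (F.coh.mapComp f g).hom (G.coh.mapComp f g).hom (c f ⋆ₕ c g) (c (f ≫ g))
  c_id : ∀ A : Ob, (F.coh.mapId A).hom ≫ (c (𝟙 (C.c A))).hom = (G.coh.mapId A).hom
  v_vcomp : ∀ {A A' A'' : Ob} (s : C.pre.V A A') (t : C.pre.V A' A''),
    (v (C.pre.vcomp s t)).hom.cell = vc (v s).hom.cell (v t).hom.cell
  v_vid : ∀ A : Ob, (v (C.pre.vid A)).hom.cell = sq (𝟙 (𝟙 (K.c (o A))))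
  c_sq : ∀ {A B A' B' : Ob} {s : C.pre.V A A'} {t : C.pre.V B B'} {f : C.c A ⟶ C.c B}
    {g : C.c A' ⟶ C.c B'} (n : BSq C s t f g),
    Tw (F.bsq n) (G.bsq n) (c f).hom (c g).hom (v s).hom (v t).hom

lemma SqInv.hcu_eq {A A' : Ob'} {a b : Sq (𝟙 (K.c A)) (𝟙 (K.c A'))} (e : K.pre.tgt a = K.pre.src b)
    (h : vc (hc a b e) (sq (λ_ (𝟙 (K.c A'))).hom) =
      vc (sq (λ_ (𝟙 (K.c A))).hom) (hi (K.pre.src a))) : hcu a b e = hi (K.pre.src a) := by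
  unfold hcu
  refine (congrArg (vc _) h).trans ((K.pre.scomp_assoc _ _ _).symm.trans ?_)
  have : vc (sq (λ_ (𝟙 (K.c A))).inv) (sq (λ_ (𝟙 (K.c A))).hom) = sq (𝟙 (𝟙 (K.c A))) :=
    congrArg PreDbl.Glob.cell (λ_ (𝟙 (K.c A))).inv_hom_id
  exact (congrArg (fun t => vc t _) this).trans (K.pre.sid_scomp _)

/-- A square on identities, as a morphism of vertical 1-cells. -/
def BSq.vhom {A A' : Ob'} {s t : K.pre.V A A'} (a : Sq (𝟙 (K.c A)) (𝟙 (K.c A')))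
    (hs : K.pre.src a = s) (ht : K.pre.tgt a = t) : s ⟶ t := BSq.mk a hs ht

/-- An inverse for horizontal composition of squares, once the unitor is absorbed, is an inverse in
`vertCat`. The resulting isomorphism keeps the given square as its underlying cell. -/
lemma SqInv.isIso {A A' : Ob'} {s t : K.pre.V A A'} {a : Sq (𝟙 (K.c A)) (𝟙 (K.c A'))}
    (hs : K.pre.src a = s) (ht : K.pre.tgt a = t) (h : ∃ b, SqInv a b) :
    IsIso (BSq.vhom a hs ht) := by
  obtain ⟨b, e, e', h1, h2⟩ := h
  subst hs ht
  exact ⟨BSq.vhom b e.symm e', BSq.ext (hcu_eq e h1),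
    BSq.ext ((hcu_eq e' h2).trans (congrArg hi e.symm))⟩

/-- Invertible icons with their squares as isomorphisms. -/
noncomputable def Icon.toOIcon {F G : DblFun C K o} (θ : Icon F G) (h : θ.Invertible) :
    OIcon F G where
  c := θ.cell
  v s := @asIso _ _ _ _ _ (SqInv.isIso (θ.src_vsq s) (θ.tgt_vsq s) (h s))
  c_comp f g := by
    have := θ.cell_comp f g
    unfold OV; rw [hIso_hom, this, Category.assoc]
  c_id := θ.cell_id
  v_vcomp := θ.vsq_vcomp
  v_vid := θ.vsq_vid
  c_sq {A B A' B' s t f g} n := by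
    obtain ⟨n, rfl, rfl⟩ := n
    -- The naturality law of an icon keeps the unitors outside. Absorbing the icon squares into
    -- their neighbours removes them and leaves the twisted correspondence.
    have h1 : V2 ((F.bsq (BSq.of n)).hc (BSq.vhom (θ.vsq _) (θ.src_vsq _) (θ.tgt_vsq _)))
      (BSq.hc (BSq.vhom (θ.vsq _) (θ.src_vsq _) (θ.tgt_vsq _)) (G.bsq (BSq.of n)))
      ((ρ_ (F.h f)).hom ≫ (θ.cell f).hom ≫ (λ_ (G.h f)).inv)
      ((ρ_ (F.h g)).hom ≫ (θ.cell g).hom ≫ (λ_ (G.h g)).inv) := θ.cell_sq n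
    exact (((BSq.ract_V2 _ _).inv.comp (h1.comp (BSq.lact_V2 _ _)))).congr (by simp) (by simp)

namespace OIcon

/-- The icon with identity cells between functors with equal compositors. -/
def ofEq {F G : DblFun C K o} (c : ∀ {A B : Ob} (f : C.c A ⟶ C.c B), F.h f ≅ G.h f)
    (v : ∀ {A A' : Ob} (s : C.pre.V A A'), F.mapV s = G.mapV s)
    (c_comp : ∀ {A B E : Ob} (f : C.c A ⟶ C.c B) (g : C.c B ⟶ C.c E),
      OV (F.coh.mapComp f g).hom (G.coh.mapComp f g).hom (c f ⋆ₕ c g) (c (f ≫ g)))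
    (c_id : ∀ A : Ob, (F.coh.mapId A).hom ≫ (c (𝟙 (C.c A))).hom = (G.coh.mapId A).hom)
    (c_sq : ∀ {A B A' B' : Ob} {s : C.pre.V A A'} {t : C.pre.V B B'} {f : C.c A ⟶ C.c B}
      {g : C.c A' ⟶ C.c B'} (n : BSq C s t f g),
      vc (F.s n.cell) (sq (c g).hom) = vc (sq (c f).hom) (G.s n.cell)) : OIcon F G where
  c := c
  v s := eqToIso (v s)
  c_comp := c_comp
  c_id := c_id
  v_vcomp s t := by
    refine (BSq.cell_eqToHom (v _)).trans ((congrArg hi (F.mapV_vcomp s t)).trans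
      ((K.pre.shid_vcomp _ _).trans ?_))
    exact (congrArg₂ vc (BSq.cell_eqToHom (v s)) (BSq.cell_eqToHom (v t))).symm
  v_vid A := (BSq.cell_eqToHom (v _)).trans ((congrArg hi (F.mapV_vid A)).trans (K.pre.shid_vid _))
  c_sq n := (Tw.eqToHom_iff (v _) (v _)).2 (c_sq n)

variable {F G : DblFun C K o}

end OIcon
end

/-! ### Restriction and conjugation of horizontal transformations -/

section
variable {Ob : Type u} {Ob' : Type u'} {C : DblCat.{u, v, w, x} Ob}
  {K : DblCat.{u', v', w', x'} Ob'} {oF oG : Ob → Ob'}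

/-- Stated for cells, since the squares compared may have different, only propositionally equal,
vertical boundaries and so belong to different types. -/
lemma BSq.lact_cell_congr {A A' B B' : Ob'} {s s₀ z z₀ : K.pre.V A A'} {t z' : K.pre.V B B'}
    {f : K.c A ⟶ K.c B} {f' : K.c A' ⟶ K.c B'} {L : BSq K s s₀ (𝟙 _) (𝟙 _)} {n : BSq K s₀ t f f'}
    {L' : BSq K z z₀ (𝟙 _) (𝟙 _)} {n' : BSq K z₀ z' f f'} (h : L.cell = L'.cell)
    (h' : n.cell = n'.cell) : (lact L n).cell = (lact L' n').cell :=
  congrArg (fun a => DblCat.vc _ (DblCat.vc a _)) (hc_congr h h' _ _)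

lemma BSq.ract_cell_congr {A A' B B' : Ob'} {s z : K.pre.V A A'} {t t₀ z' z₀ : K.pre.V B B'}
    {f : K.c A ⟶ K.c B} {f' : K.c A' ⟶ K.c B'} {R : BSq K t t₀ (𝟙 _) (𝟙 _)} {n : BSq K s t f f'}
    {R' : BSq K z' z₀ (𝟙 _) (𝟙 _)} {n' : BSq K z z' f f'} (h' : n.cell = n'.cell)
    (h : R.cell = R'.cell) : (ract n R).cell = (ract n' R').cell :=
  congrArg (fun a => DblCat.vc _ (DblCat.vc a _)) (hc_congr h' h _ _)

namespace HTrans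
section
variable {F : DblFun C K oF} {G : DblFun C K oG} (α : HTrans F G)

/-- The square of a transformation at a vertical 1-cell. -/
def bsq {A A' : Ob} (s : C.pre.V A A') : BSq K (F.mapV s) (G.mapV s) (α.app A) (α.app A') :=
  ⟨α.vsq s, α.src_vsq s, α.tgt_vsq s⟩

lemma nat_bsq {A B A' B' : Ob} {s : C.pre.V A A'} {t : C.pre.V B B'} {f : C.c A ⟶ C.c B}
    {g : C.c A' ⟶ C.c B'} (n : BSq C s t f g) :
    V2 ((F.bsq n).hc (α.bsq t)) ((α.bsq s).hc (G.bsq n)) (α.nat f).hom (α.nat g).hom := by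
  obtain ⟨n, rfl, rfl⟩ := n; exact α.nat_sq n

/-- Naturality at a globular square: its vertical boundaries are identities, where the squares of
the transformation are identity squares. -/
lemma nat_g {A B : Ob} {f g : C.c A ⟶ C.c B} (φ : f ⟶ g) :
    F.g φ ▷ α.app B ≫ (α.nat g).hom = (α.nat f).hom ≫ α.app A ◁ G.g φ := by
  have h := α.nat_bsq (BSq.mk (s := C.pre.vid A) (t := C.pre.vid B) (sq φ) φ.src_cell φ.tgt_cell)
  have h1 : ((F.bsq (BSq.mk (s := C.pre.vid A) (t := C.pre.vid B) (sq φ) φ.src_cell φ.tgt_cell)).hc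
      (α.bsq (C.pre.vid B))).cell = sq (F.g φ ▷ α.app B) :=
    hc_congr rfl (α.vsq_vid B) _ (by rw [PreDbl.Glob.src_cell]; exact (F.g φ).tgt_cell)
  have h2 : ((α.bsq (C.pre.vid A)).hc
      (G.bsq (BSq.mk (s := C.pre.vid A) (t := C.pre.vid B) (sq φ) φ.src_cell φ.tgt_cell))).cell =
      sq (α.app A ◁ G.g φ) :=
    hc_congr (α.vsq_vid A) rfl _ (by rw [PreDbl.Glob.tgt_cell]; exact (G.g φ).src_cell.symm)
  refine PreDbl.Glob.ext ?_
  exact (congrArg (fun t => vc t _) h1.symm).trans (h.trans (congrArg (vc _) h2))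
end

section
variable {Ob'' : Type u''} {C' : DblCat.{u'', v'', w'', x''} Ob''} {q : Ob'' → Ob}
  {F : DblFun C K oF} {G : DblFun C K oG}

/-- Precomposition of a transformation with a pseudo double functor. -/
def pre (Q : DblFun C' C q) (α : HTrans F G) : HTrans (Q.comp F) (Q.comp G) where
  app A := α.app (q A)
  vsq s := α.vsq (Q.mapV s)
  src_vsq s := α.src_vsq _
  tgt_vsq s := α.tgt_vsq _
  nat f := α.nat (Q.h f)
  nat_comp {A B E} f g := by
    show ((F.coh.mapComp (Q.h f) (Q.h g)).hom ≫ F.g (Q.coh.mapComp f g).hom) ▷ α.app (q E) ≫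
      (α.nat (Q.h (f ≫ g))).hom =
      (α_ _ _ _).hom ≫ F.h (Q.h f) ◁ (α.nat (Q.h g)).hom ≫ (α_ _ _ _).inv ≫
        (α.nat (Q.h f)).hom ▷ G.h (Q.h g) ≫ (α_ _ _ _).hom ≫
        α.app (q A) ◁ ((G.coh.mapComp (Q.h f) (Q.h g)).hom ≫ G.g (Q.coh.mapComp f g).hom)
    have h := α.nat_comp (Q.h f) (Q.h g)
    -- The compositor of the composite functor is a compositor of `F` followed by the image of one
    -- of `Q`; naturality in globular 2-cells moves the latter through the transformation.
    rw [comp_whiskerRight, Category.assoc, α.nat_g, reassoc_of% h, whiskerLeft_comp]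
  nat_id A := by
    show ((F.coh.mapId (q A)).hom ≫ F.g (Q.coh.mapId A).hom) ▷ α.app (q A) ≫
      (α.nat (Q.h (𝟙 _))).hom = (λ_ (α.app (q A))).hom ≫ (ρ_ (α.app (q A))).inv ≫
        α.app (q A) ◁ ((G.coh.mapId (q A)).hom ≫ G.g (Q.coh.mapId A).hom)
    have h := α.nat_id (q A)
    rw [comp_whiskerRight, Category.assoc, α.nat_g, reassoc_of% h, whiskerLeft_comp]
  vsq_vcomp s t := (congrArg α.vsq (Q.mapV_vcomp s t)).trans (α.vsq_vcomp _ _)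
  vsq_vid A := (congrArg α.vsq (Q.mapV_vid A)).trans (α.vsq_vid _)
  nat_sq {A B A' B' f g} a := α.nat_bsq (Q.bsq (BSq.of a))

/-- The inverse transformation and both modifications restrict along `Q` by evaluation at images. -/
lemma IsEquiv.pre {α : HTrans F G} (h : α.IsEquiv) (Q : DblFun C' C q) : (α.pre Q).IsEquiv := by
  obtain ⟨β, η, ζ, h1, h2⟩ := h
  exact ⟨β.pre Q, fun A => η (q A), fun A => ζ (q A),
    ⟨fun f => h1.nat_h (Q.h f), fun s => h1.nat_v (Q.mapV s)⟩,
    ⟨fun f => h2.nat_h (Q.h f), fun s => h2.nat_v (Q.mapV s)⟩⟩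
end

section
variable {F F' : DblFun C K oF} {G G' : DblFun C K oG} (α : HTrans F G) (i : OIcon F F')
  (j : OIcon G G')

/-- Naturality cells of a conjugate transformation. -/
def conjNat {A B : Ob} (f : C.c A ⟶ C.c B) : F'.h f ≫ α.app B ≅ α.app A ≫ G'.h f :=
  (i.c f ⋆ₕ Iso.refl (α.app B)).symm ≪≫ α.nat f ≪≫ (Iso.refl (α.app A) ⋆ₕ j.c f)

/-- Squares of a conjugate transformation. -/
def conjSq {A A' : Ob} (s : C.pre.V A A') : BSq K (F'.mapV s) (G'.mapV s) (α.app A) (α.app A') :=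
  BSq.la (i.v s).inv (BSq.ra (α.bsq s) (j.v s).hom)

lemma conjNat_OV {A B : Ob} (f : C.c A ⟶ C.c B) :
    OV (α.nat f).hom (α.conjNat i j f).hom (i.c f ⋆ₕ Iso.refl (α.app B))
      (Iso.refl (α.app A) ⋆ₕ j.c f) := OV.of_iso _ _ _

lemma conjSq_Tw {A A' : Ob} (s : C.pre.V A A') :
    Tw (α.bsq s) (α.conjSq i j s) (𝟙 _) (𝟙 _) (i.v s).hom (j.v s).hom := by
  unfold Tw conjSq
  rw [← BSq.la_comp, Iso.hom_inv_id, BSq.la_id]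
  exact V2.refl _

lemma OIcon.id_OV {F F' : DblFun C K oF} (i : OIcon F F') (A : Ob) :
    OV (F.coh.mapId A).hom (F'.coh.mapId A).hom (Iso.refl _) (i.c (𝟙 (C.c A))) :=
  (i.c_id A).trans (Category.id_comp _).symm

/-- The transformation obtained by composing with icons on both sides. -/
def conj : HTrans F' G' where
  app := α.app
  vsq s := (α.conjSq i j s).cell
  src_vsq s := (α.conjSq i j s).src_cell
  tgt_vsq s := (α.conjSq i j s).tgt_cell
  nat := α.conjNat i j
  -- Each side of the law for `α` corresponds to the same side of the law for the conjugate, factor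
  -- by factor, along comparisons that depend only on the two ends. The 1-cell components do not
  -- change and are compared by identities.
  nat_comp f g := by
    refine OV.eq_of_eq (L := (i.c f ⋆ₕ i.c g) ⋆ₕ Iso.refl _) (R := Iso.refl _ ⋆ₕ j.c (f ≫ g)) ?_ ?_
      (α.nat_comp f g)
    · exact ((i.c_comp f g).wr _).comp (α.conjNat_OV i j _)
    · exact (OV.assoc _ _ _).comp (((α.conjNat_OV i j g).wl _).comp ((OV.assoc_inv _ _ _).comp
        (((α.conjNat_OV i j f).wr _).comp ((OV.assoc _ _ _).comp ((j.c_comp f g).wl _)))))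
  nat_id A := by
    refine OV.eq_of_eq (L := Iso.refl _ ⋆ₕ Iso.refl _) (R := Iso.refl _ ⋆ₕ j.c (𝟙 (C.c A))) ?_ ?_
      (α.nat_id A)
    · exact ((OIcon.id_OV i A).wr _).comp (α.conjNat_OV i j _)
    · exact (OV.leftU _).comp ((OV.rightU_inv _).comp ((OIcon.id_OV j A).wl _))
  vsq_vcomp {A A' A''} s t := by
    refine Eq.trans ?_ (congrArg BSq.cell ((congrArg (BSq.lact _) (BSq.ract_vc (α.bsq s) (α.bsq t)
      (j.v s).hom (j.v t).hom)).trans (BSq.lact_vc (i.v s).inv (i.v t).inv _ _)))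
    -- The conjugate square contains the inverse of the square of `i`, so compatibility with
    -- vertical composition is needed for inverses as well.
    exact BSq.lact_cell_congr (BSq.inv_cell_vcomp _ _ _ (i.v_vcomp s t))
      (BSq.ract_cell_congr (α.vsq_vcomp s t) (j.v_vcomp s t))
  vsq_vid A := by
    refine Eq.trans (b := (BSq.lact (BSq.hid _) (BSq.ract (BSq.vid (α.app A)) (BSq.hid _))).cell)
      (BSq.lact_cell_congr ((BSq.inv_cell_vid _ (i.v_vid A)).trans (K.pre.shid_vid _).symm)
        (BSq.ract_cell_congr (α.vsq_vid A) ((j.v_vid A).trans (K.pre.shid_vid _).symm))) ?_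
    rw [BSq.lact_hid, BSq.ract_hid]; rfl
  nat_sq {A B A' B' f g} a := by
    -- The sides of the two composites come from `i` on the left and from `j` on the right; the
    -- middle comparison cancels in each horizontal composite.
    exact Tw.transfer (α.nat_bsq (BSq.of a))
      (e := i.c f ⋆ₕ Iso.refl _) (e' := i.c g ⋆ₕ Iso.refl _)
      (d := Iso.refl _ ⋆ₕ j.c f) (d' := Iso.refl _ ⋆ₕ j.c g)
      ((i.c_sq (BSq.of a)).hc (α.conjSq_Tw i j _))
      ((α.conjSq_Tw i j _).hc (j.c_sq (BSq.of a))) (α.conjNat_OV i j f) (α.conjNat_OV i j g)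

/-- Conjugation keeps the 1-cell components, so the same 2-cells `η` are used; in the composite of
the two conjugates the icon `j` in the middle cancels. -/
lemma _root_.IsUnitMod.conj {α : HTrans F G} {β : HTrans G F}
    {η : ∀ A : Ob, 𝟙 (K.c (oF A)) ≅ α.app A ≫ β.app A} (h : IsUnitMod α β η) :
    IsUnitMod (α.conj i j) (β.conj j i) η where
  nat_h {A B} f := by
    have hη : ∀ A, OV (η A).hom (η A).hom (Iso.refl _)
        (Iso.refl (α.app A) ⋆ₕ Iso.refl (β.app A)) := fun A => by
      unfold OV; rw [hIso_refl]; simp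
    refine OV.eq_of_eq (L := i.c f) (R := Iso.refl _ ⋆ₕ (Iso.refl _ ⋆ₕ i.c f)) ?_ ?_ (h.nat_h f)
    · exact (OV.rightU_inv _).comp (((hη B).wl _).comp ((OV.assoc_inv _ _ _).comp
        (((α.conjNat_OV i j f).wr _).comp ((OV.assoc _ _ _).comp ((β.conjNat_OV j i f).wl _)))))
    · exact (OV.leftU_inv _).comp (((hη A).wr _).comp (OV.assoc _ _ _))
  nat_v {A A'} s := by
    refine Tw.transfer (n := BSq.hid (F.mapV s)) (m := (α.bsq s).hc (β.bsq s))
      (n₀ := BSq.hid (F'.mapV s)) (m₀ := (α.conjSq i j s).hc (β.conjSq j i s))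
      (L := i.v s) (R := (i.v s).hom) (φ := (η A).hom) (ψ := (η A').hom)
      (e := Iso.refl _) (e' := Iso.refl _) (d := Iso.refl _ ⋆ₕ Iso.refl _)
      (d' := Iso.refl _ ⋆ₕ Iso.refl _) (h.nat_v s) (Tw.hid _)
      ((α.conjSq_Tw i j s).hc (β.conjSq_Tw j i s)) ?_ ?_ <;>
    · unfold OV; rw [hIso_refl]; simp

lemma IsEquiv.conj {α : HTrans F G} (h : α.IsEquiv) : (α.conj i j).IsEquiv := by
  obtain ⟨β, η, ζ, h1, h2⟩ := h
  exact ⟨β.conj j i, η, ζ, h1.conj i j, h2.conj j i⟩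
end
end HTrans
end

/-- A globular 2-cell is a square with identity sides. There the squares of the icon are transports
along equalities, and the twisted naturality law reduces to an equation of 2-cells. -/
lemma OIcon.c_g {Ob : Type u} {Ob' : Type u'} {C : DblCat.{u, v, w, x} Ob}
    {K : DblCat.{u', v', w', x'} Ob'} {o : Ob → Ob'} {F G : DblFun C K o} (i : OIcon F G)
    {A B : Ob} {f g : C.c A ⟶ C.c B} (φ : f ⟶ g) :
    OV (F.g φ) (G.g φ) (i.c f) (i.c g) := by
  have h := i.c_sq (BSq.mk (s := C.pre.vid A) (t := C.pre.vid B) (sq φ) φ.src_cell φ.tgt_cell)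
  obtain ⟨e₁, h₁⟩ := BSq.hom_eq_eqToHom (i.v (C.pre.vid A)).hom (i.v_vid A)
  obtain ⟨e₂, h₂⟩ := BSq.hom_eq_eqToHom (i.v (C.pre.vid B)).hom (i.v_vid B)
  rw [h₁, h₂, Tw.eqToHom_iff] at h
  exact PreDbl.Glob.ext h

/-! ### Functors of two variables -/

section
variable {Ob : Type u} {Ob' : Type u'} {Ob'' : Type u''} {X : DblCat.{u, v, w, x} Ob}
  {Y : DblCat.{u', v', w', x'} Ob'} {Z : DblCat.{u'', v'', w'', x''} Ob''}
  {o : Ob → Ob' → Ob''}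

namespace BSq
variable {A B A' B' : Ob} {Q R Q' R' : Ob'} {s : X.pre.V A A'} {t : X.pre.V B B'}
  {z : Y.pre.V Q Q'} {y : Y.pre.V R R'} {f : X.c A ⟶ X.c B} {f' : X.c A' ⟶ X.c B'}
  {g : Y.c Q ⟶ Y.c R} {g' : Y.c Q' ⟶ Y.c R'}

/-- Pairs of squares. -/
def prod (n : BSq X s t f f') (m : BSq Y z y g g') :
    BSq (X.prod Y) (A := (A, Q)) (B := (B, R)) (A' := (A', Q')) (B' := (B', R')) (s, z) (t, y)
      (f, g) (f', g') :=
  ⟨(n.cell, m.cell), Prod.ext n.src_cell m.src_cell, Prod.ext n.tgt_cell m.tgt_cell⟩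

/-- Pairs of squares on identities. -/
def vprod {s s₀ : X.pre.V A A'} {z z₀ : Y.pre.V Q Q'} (a : s ⟶ s₀) (b : z ⟶ z₀) :
    Quiver.Hom (V := (X.prod Y).pre.V (A, Q) (A', Q')) (s, z) (s₀, z₀) := BSq.prod a b

lemma prod_V2 {k : X.c A ⟶ X.c B} {k' : X.c A' ⟶ X.c B'} {l : Y.c Q ⟶ Y.c R}
    {l' : Y.c Q' ⟶ Y.c R'} {n : BSq X s t f f'} {m : BSq Y z y g g'} {n' : BSq X s t k k'}
    {m' : BSq Y z y l l'} {φ : f ⟶ k} {ψ : f' ⟶ k'} {φ' : g ⟶ l} {ψ' : g' ⟶ l'} (h : V2 n n' φ ψ)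
    (h' : V2 m m' φ' ψ') : V2 (K := X.prod Y) (A := (A, Q)) (B := (B, R)) (n.prod m) (n'.prod m')
      ⟨(sq φ, sq φ'), Prod.ext φ.src_cell φ'.src_cell, Prod.ext φ.tgt_cell φ'.tgt_cell⟩
      ⟨(sq ψ, sq ψ'), Prod.ext ψ.src_cell ψ'.src_cell, Prod.ext ψ.tgt_cell ψ'.tgt_cell⟩ :=
  Prod.ext h h'

lemma vprod_comp {s s₀ s₁ : X.pre.V A A'} {z z₀ z₁ : Y.pre.V Q Q'} (a : s ⟶ s₀) (a' : s₀ ⟶ s₁)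
    (b : z ⟶ z₀) (b' : z₀ ⟶ z₁) : vprod (a ≫ a') (b ≫ b') = vprod a b ≫ vprod a' b' := rfl

lemma vprod_id (s : X.pre.V A A') (z : Y.pre.V Q Q') : vprod (𝟙 s) (𝟙 z) = 𝟙 _ := rfl

/-- Pairs of invertible squares on identities. -/
@[simps] def vprodI {s s₀ : X.pre.V A A'} {z z₀ : Y.pre.V Q Q'} (a : s ≅ s₀) (b : z ≅ z₀) :
    Iso (C := (X.prod Y).pre.V (A, Q) (A', Q')) (s, z) (s₀, z₀) where
  hom := vprod a.hom b.hom
  inv := vprod a.inv b.inv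
  hom_inv_id := by rw [← vprod_comp, a.hom_inv_id, b.hom_inv_id, vprod_id]
  inv_hom_id := by rw [← vprod_comp, a.inv_hom_id, b.inv_hom_id, vprod_id]
end BSq

namespace DblFun
variable (T : DblFun (X.prod Y) Z (fun p => o p.1 p.2))

section
variable {A B E : Ob} {Q R G : Ob'} {f f' f'' : X.c A ⟶ X.c B} {g g' g'' : Y.c Q ⟶ Y.c R}

lemma bg_comp (a : f ⟶ f') (a' : f' ⟶ f'') (b : g ⟶ g') (b' : g' ⟶ g'') :
    T.bg (a ≫ a') (b ≫ b') = T.bg a b ≫ T.bg a' b' :=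
  T.g_comp (A := (A, Q)) (B := (B, R)) (f := (f, g)) (f' := (f', g')) (f'' := (f'', g''))
    ⟨(sq a, sq b), Prod.ext a.src_cell b.src_cell, Prod.ext a.tgt_cell b.tgt_cell⟩
    ⟨(sq a', sq b'), Prod.ext a'.src_cell b'.src_cell, Prod.ext a'.tgt_cell b'.tgt_cell⟩

lemma bg_id (f : X.c A ⟶ X.c B) (g : Y.c Q ⟶ Y.c R) : T.bg (𝟙 f) (𝟙 g) = 𝟙 (T.bh f g) :=
  T.g_id (A := (A, Q)) (B := (B, R)) (f, g)

/-- Value on invertible globular 2-cells. -/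
@[simps] def bgI (a : f ≅ f') (b : g ≅ g') : T.bh f g ≅ T.bh f' g' where
  hom := T.bg a.hom b.hom
  inv := T.bg a.inv b.inv
  hom_inv_id := by rw [← bg_comp, a.hom_inv_id, b.hom_inv_id, bg_id]
  inv_hom_id := by rw [← bg_comp, a.inv_hom_id, b.inv_hom_id, bg_id]

lemma bgI_trans (a : f ≅ f') (a' : f' ≅ f'') (b : g ≅ g') (b' : g' ≅ g'') :
    T.bgI (a ≪≫ a') (b ≪≫ b') = T.bgI a b ≪≫ T.bgI a' b' := Iso.ext (T.bg_comp _ _ _ _)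

lemma bgI_refl (f : X.c A ⟶ X.c B) (g : Y.c Q ⟶ Y.c R) :
    T.bgI (Iso.refl f) (Iso.refl g) = Iso.refl (T.bh f g) := Iso.ext (T.bg_id _ _)

/-- Naturality of the compositor in all four 1-cells at once, in the form needed to pass from values
at `Φ f`, `Ψ g` to values at isomorphic 1-cells. -/
lemma bc_nat {k k' : X.c B ⟶ X.c E} {l l' : Y.c R ⟶ Y.c G} (a : f ≅ f') (b : g ≅ g')
    (a' : k ≅ k') (b' : l ≅ l') :
    OV (T.bc f g k l).hom (T.bc f' g' k' l').hom (T.bgI a b ⋆ₕ T.bgI a' b')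
      (T.bgI (a ⋆ₕ a') (b ⋆ₕ b')) := by
  have h1 := T.coh.g_whiskerRight (A := (A, Q)) (B := (B, R)) (B' := (E, G)) (f := (f, g))
    (f' := (f', g'))
    ⟨(sq a.hom, sq b.hom), Prod.ext a.hom.src_cell b.hom.src_cell,
      Prod.ext a.hom.tgt_cell b.hom.tgt_cell⟩ (k, l)
  have h2 := T.coh.g_whiskerLeft (A := (A, Q)) (B := (B, R)) (B' := (E, G)) (f', g')
    (g := (k, l)) (g' := (k', l'))
    ⟨(sq a'.hom, sq b'.hom), Prod.ext a'.hom.src_cell b'.hom.src_cell,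
      Prod.ext a'.hom.tgt_cell b'.hom.tgt_cell⟩
  have h1' : T.bg a.hom b.hom ▷ T.bh k l ≫ (T.bc f' g' k l).hom =
    (T.bc f g k l).hom ≫ T.bg (a.hom ▷ k) (b.hom ▷ l) := h1
  have h2' : T.bh f' g' ◁ T.bg a'.hom b'.hom ≫ (T.bc f' g' k' l').hom =
    (T.bc f' g' k l).hom ≫ T.bg (f' ◁ a'.hom) (g' ◁ b'.hom) := h2
  unfold OV
  simp only [hIso_hom, bgI_hom, bg_comp]
  rw [Category.assoc, h2', reassoc_of% h1']
end

section
variable {A B A' B' : Ob} {Q R Q' R' : Ob'} {s : X.pre.V A A'} {t : X.pre.V B B'}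
  {z : Y.pre.V Q Q'} {y : Y.pre.V R R'} {f : X.c A ⟶ X.c B} {f' : X.c A' ⟶ X.c B'}
  {g : Y.c Q ⟶ Y.c R} {g' : Y.c Q' ⟶ Y.c R'}

/-- Value on squares with prescribed boundaries. -/
def bq (n : BSq X s t f f') (m : BSq Y z y g g') :
    BSq Z (T.bv s z) (T.bv t y) (T.bh f g) (T.bh f' g') :=
  T.bsq (A := (A, Q)) (B := (B, R)) (A' := (A', Q')) (B' := (B', R')) (n.prod m)

/-- Value on invertible squares on identities. -/
def bvI {s s₀ : X.pre.V A A'} {z z₀ : Y.pre.V Q Q'} (a : s ≅ s₀) (b : z ≅ z₀) :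
    T.bv s z ≅ T.bv s₀ z₀ :=
  T.vmapI (A := (A, Q)) (A' := (A', Q')) (s := (s, z)) (s₀ := (s₀, z₀)) (BSq.vprodI a b)

lemma bvI_trans {s s₀ s₁ : X.pre.V A A'} {z z₀ z₁ : Y.pre.V Q Q'} (a : s ≅ s₀) (a' : s₀ ≅ s₁)
    (b : z ≅ z₀) (b' : z₀ ≅ z₁) : T.bvI (a ≪≫ a') (b ≪≫ b') = T.bvI a b ≪≫ T.bvI a' b' :=
  Iso.ext (T.vmap_comp (A := (A, Q)) (A' := (A', Q')) (s := (s, z)) (s₀ := (s₀, z₀))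
    (s₁ := (s₁, z₁)) (BSq.vprod a.hom b.hom) (BSq.vprod a'.hom b'.hom))

lemma bvI_refl (s : X.pre.V A A') (z : Y.pre.V Q Q') :
    T.bvI (Iso.refl s) (Iso.refl z) = Iso.refl (T.bv s z) :=
  Iso.ext (T.vmap_id (A := (A, Q)) (A' := (A', Q')) (s, z))

/-- In a product double category a pair of twisted correspondences is a twisted correspondence of
pairs, and pseudo double functors preserve these. -/
lemma bq_Tw {s₀ : X.pre.V A A'} {t₀ : X.pre.V B B'} {z₀ : Y.pre.V Q Q'} {y₀ : Y.pre.V R R'}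
    {k : X.c A ⟶ X.c B} {k' : X.c A' ⟶ X.c B'} {l : Y.c Q ⟶ Y.c R}
    {l' : Y.c Q' ⟶ Y.c R'} {n : BSq X s t f f'} {m : BSq Y z y g g'} {n' : BSq X s₀ t₀ k k'}
    {m' : BSq Y z₀ y₀ l l'} {φ : f ≅ k} {ψ : f' ≅ k'} {φ' : g ≅ l} {ψ' : g' ≅ l'}
    {L : s ≅ s₀} {R : t ≅ t₀} {L' : z ≅ z₀} {R' : y ≅ y₀} (h : Tw n n' φ.hom ψ.hom L.hom R.hom)
    (h' : Tw m m' φ'.hom ψ'.hom L'.hom R'.hom) :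
    Tw (T.bq n m) (T.bq n' m') (T.bgI φ φ').hom (T.bgI ψ ψ').hom (T.bvI L L').hom
      (T.bvI R R').hom :=
  T.bsq_Tw (L := BSq.vprod L.hom L'.hom) (R := BSq.vprod R.hom R'.hom) (BSq.prod_V2 h h')
end
end DblFun
end

/-! ### Icons between functors of two variables -/

section
variable {Ob : Type u} {o : Ob → Ob → Ob} {X Y Z X' Y' Z' : DblCat Ob}

/-- Invertible icons `T (Φ -) (Ψ -) ⇒ Ω (S - -)`. -/
abbrev BOver (Φ : DblFun X' X (fun A => A)) (Ψ : DblFun Y' Y (fun A => A))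
    (Ω : DblFun Z' Z (fun A => A)) (T : Bi X Y Z o) (S : Bi X' Y' Z' o) :=
  OIcon (C := X'.prod Y') (K := Z) (o := fun p => o p.1 p.2)
    ((((DblFun.fst X' Y').comp Φ).pair ((DblFun.snd X' Y').comp Ψ)).comp T) (S.comp Ω)

namespace BOver
variable {Φ : DblFun X' X (fun A => A)} {Ψ : DblFun Y' Y (fun A => A)}
  {Ω : DblFun Z' Z (fun A => A)} {T : Bi X Y Z o} {S : Bi X' Y' Z' o} (θ : BOver Φ Ψ Ω T S)
  {A B E A' B' E' Q R G Q' R' G' : Ob}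

/-- Components on horizontal 1-cells. -/
def bc (f : X'.c A ⟶ X'.c B) (g : Y'.c Q ⟶ Y'.c R) :
    T.bh (Φ.h f) (Ψ.h g) ≅ Ω.h (S.bh f g) := θ.c (A := (A, Q)) (B := (B, R)) (f, g)

/-- Components on vertical 1-cells. -/
def bw (s : X'.pre.V A A') (t : Y'.pre.V Q Q') :
    T.bv (Φ.mapV s) (Ψ.mapV t) ≅ Ω.mapV (S.bv s t) := θ.v (A := (A, Q)) (A' := (A', Q')) (s, t)

/-- The invertible 2-cell `T k l ≅ Ω (S f g)` induced by `k ≅ Φ f` and `l ≅ Ψ g`. -/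
def ext {k : X.c A ⟶ X.c B} {l : Y.c Q ⟶ Y.c R} {f : X'.c A ⟶ X'.c B} {g : Y'.c Q ⟶ Y'.c R}
    (e : k ≅ Φ.h f) (d : l ≅ Ψ.h g) : T.bh k l ≅ Ω.h (S.bh f g) := T.bgI e d ≪≫ θ.bc f g

/-- The invertible square `T z y ≅ Ω (S s t)` on identities induced by `z ≅ Φ s` and `y ≅ Ψ t`. -/
def vext {z : X.pre.V A A'} {y : Y.pre.V Q Q'} {s : X'.pre.V A A'} {t : Y'.pre.V Q Q'}
    (a : z ≅ Φ.mapV s) (b : y ≅ Ψ.mapV t) : T.bv z y ≅ Ω.mapV (S.bv s t) :=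
  T.bvI a b ≪≫ θ.bw s t

lemma ext_trans {k k' : X.c A ⟶ X.c B} {l l' : Y.c Q ⟶ Y.c R} {f : X'.c A ⟶ X'.c B}
    {g : Y'.c Q ⟶ Y'.c R} (i : k' ≅ k) (j : l' ≅ l) (e : k ≅ Φ.h f) (d : l ≅ Ψ.h g) :
    θ.ext (i ≪≫ e) (j ≪≫ d) = T.bgI i j ≪≫ θ.ext e d := by
  simp [ext, DblFun.bgI_trans]

lemma vext_trans {z z' : X.pre.V A A'} {y y' : Y.pre.V Q Q'} {s : X'.pre.V A A'}
    {t : Y'.pre.V Q Q'} (i : z' ≅ z) (j : y' ≅ y) (a : z ≅ Φ.mapV s) (b : y ≅ Ψ.mapV t) :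
    θ.vext (i ≪≫ a) (j ≪≫ b) = T.bvI i j ≪≫ θ.vext a b := by
  simp [vext, DblFun.bvI_trans]

/-- The composition law of the icon, with the compositors of `Φ` and `Ψ` absorbed into `ext` and
that of `Ω` into `lift2I`. -/
lemma bc_comp (f : X'.c A ⟶ X'.c B) (f' : X'.c B ⟶ X'.c E) (g : Y'.c Q ⟶ Y'.c R)
    (g' : Y'.c R ⟶ Y'.c G) :
    OV (T.bc (Φ.h f) (Ψ.h g) (Φ.h f') (Ψ.h g')).hom (Ω.g (S.bc f g f' g').hom)
      (Ω.lift2I (θ.bc f g) (θ.bc f' g')) (θ.ext (Φ.coh.mapComp f f') (Ψ.coh.mapComp g g')) := by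
  have h := θ.c_comp (A := (A, Q)) (B := (B, R)) (E := (E, G)) (f, g) (f', g')
  have h1 : OV ((T.bc (Φ.h f) (Ψ.h g) (Φ.h f') (Ψ.h g')).hom ≫
      T.bg ((Φ.coh.mapComp f f').hom ≫ Φ.g (𝟙 _)) ((Ψ.coh.mapComp g g').hom ≫ Ψ.g (𝟙 _)))
      ((Ω.coh.mapComp (S.bh f g) (S.bh f' g')).hom ≫ Ω.g (S.bc f g f' g').hom)
      (θ.bc f g ⋆ₕ θ.bc f' g') (θ.bc (f ≫ f') (g ≫ g')) := h
  -- The projections from the product have identity compositors; their images under `Φ` and `Ψ` are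
  -- removed here.
  rw [Φ.g_id, Ψ.g_id, Category.comp_id, Category.comp_id] at h1
  unfold OV at *
  simp only [DblFun.lift2I, ext, Iso.trans_hom, DblFun.bgI_hom, Category.assoc] at *
  exact h1

lemma bc_id (A Q : Ob) :
    OV (T.bu A Q).hom (Ω.g (S.bu A Q).hom) (Ω.coh.mapId (o A Q))
      (θ.ext (Φ.coh.mapId A) (Ψ.coh.mapId Q)) := by
  have h := θ.c_id (A, Q)
  have h1 : ((T.bu A Q).hom ≫
      T.bg ((Φ.coh.mapId A).hom ≫ Φ.g (𝟙 _)) ((Ψ.coh.mapId Q).hom ≫ Ψ.g (𝟙 _))) ≫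
      (θ.bc (𝟙 _) (𝟙 _)).hom = (Ω.coh.mapId (o A Q)).hom ≫ Ω.g (S.bu A Q).hom := h
  rw [Φ.g_id, Ψ.g_id, Category.comp_id, Category.comp_id, Category.assoc] at h1
  exact h1

lemma bc_bg {f f' : X'.c A ⟶ X'.c B} {g g' : Y'.c Q ⟶ Y'.c R} (a : f ⟶ f') (b : g ⟶ g') :
    OV (T.bg (Φ.g a) (Ψ.g b)) (Ω.g (S.bg a b)) (θ.bc f g) (θ.bc f' g') :=
  θ.c_g (A := (A, Q)) (B := (B, R)) (f := (f, g)) (g := (f', g'))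
    ⟨(sq a, sq b), Prod.ext a.src_cell b.src_cell, Prod.ext a.tgt_cell b.tgt_cell⟩

lemma bc_bq {s : X'.pre.V A A'} {t : X'.pre.V B B'} {z : Y'.pre.V Q Q'} {y : Y'.pre.V R R'}
    {f : X'.c A ⟶ X'.c B} {f' : X'.c A' ⟶ X'.c B'} {g : Y'.c Q ⟶ Y'.c R} {g' : Y'.c Q' ⟶ Y'.c R'}
    (n : BSq X' s t f f') (m : BSq Y' z y g g') :
    Tw (T.bq (Φ.bsq n) (Ψ.bsq m)) (Ω.bsq (S.bq n m)) (θ.bc f g).hom (θ.bc f' g').hom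
      (θ.bw s z).hom (θ.bw t y).hom :=
  θ.c_sq (A := (A, Q)) (B := (B, R)) (A' := (A', Q')) (B' := (B', R')) (n.prod m)

section
variable {k k' : X.c A ⟶ X.c B} {l l' : Y.c Q ⟶ Y.c R} {f f' : X'.c A ⟶ X'.c B}
  {g g' : Y'.c Q ⟶ Y'.c R}

lemma OV_bg {δ : k ⟶ k'} {ζ : l ⟶ l'} {δ₀ : f ⟶ f'} {ζ₀ : g ⟶ g'} {e : k ≅ Φ.h f}
    {e' : k' ≅ Φ.h f'} {d : l ≅ Ψ.h g} {d' : l' ≅ Ψ.h g'} (h : OV δ (Φ.g δ₀) e e')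
    (h' : OV ζ (Ψ.g ζ₀) d d') :
    OV (T.bg δ ζ) (Ω.g (S.bg δ₀ ζ₀)) (θ.ext e d) (θ.ext e' d') := by
  refine OV.trans (n₀ := T.bg (Φ.g δ₀) (Ψ.g ζ₀)) ?_ (θ.bc_bg δ₀ ζ₀)
  unfold OV at *
  simp only [DblFun.bgI_hom]
  rw [← DblFun.bg_comp, ← DblFun.bg_comp, h, h']

/-- Combines naturality of the compositor of `T` in the given isomorphisms with the composition law
of the icon at values of `Φ` and `Ψ`. Factoring `ext` through `bgI` makes the two steps fit. -/
lemma OV_bc {m : X.c B ⟶ X.c E} {n : Y.c R ⟶ Y.c G} {p : X'.c B ⟶ X'.c E} {q : Y'.c R ⟶ Y'.c G}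
    (e : k ≅ Φ.h f) (d : l ≅ Ψ.h g) (e' : m ≅ Φ.h p) (d' : n ≅ Ψ.h q) :
    OV (T.bc k l m n).hom (Ω.g (S.bc f g p q).hom) (Ω.lift2I (θ.ext e d) (θ.ext e' d'))
      (θ.ext (Φ.lift2I e e') (Ψ.lift2I d d')) := by
  have h := (T.bc_nat e d e' d').trans (θ.bc_comp f p g q)
  have h1 : (T.bgI e d ⋆ₕ T.bgI e' d') ≪≫ Ω.lift2I (θ.bc f g) (θ.bc p q) =
      Ω.lift2I (θ.ext e d) (θ.ext e' d') := by
    simp only [DblFun.lift2I, ext, hIso_trans, Iso.trans_assoc]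
  rwa [h1, ← ext_trans] at h

lemma OV_bu (A Q : Ob) :
    OV (T.bu A Q).hom (Ω.g (S.bu A Q).hom) (Ω.coh.mapId (o A Q))
      (θ.ext (Φ.coh.mapId A) (Ψ.coh.mapId Q)) := θ.bc_id A Q
end

/-- The analogue of `OV_bg` for squares: first `T` is applied to the given correspondences, then the
naturality of the icon at squares in the images of `Φ` and `Ψ`. -/
lemma Tw_bq {s₀ : X'.pre.V A A'} {t₀ : X'.pre.V B B'} {z₀ : Y'.pre.V Q Q'} {y₀ : Y'.pre.V R R'}
    {f : X'.c A ⟶ X'.c B} {f' : X'.c A' ⟶ X'.c B'} {g : Y'.c Q ⟶ Y'.c R} {g' : Y'.c Q' ⟶ Y'.c R'}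
    {s : X.pre.V A A'} {t : X.pre.V B B'} {z : Y.pre.V Q Q'} {y : Y.pre.V R R'}
    {k : X.c A ⟶ X.c B} {k' : X.c A' ⟶ X.c B'} {l : Y.c Q ⟶ Y.c R} {l' : Y.c Q' ⟶ Y.c R'}
    {n : BSq X s t k k'} {n₀ : BSq X' s₀ t₀ f f'} {m : BSq Y z y l l'} {m₀ : BSq Y' z₀ y₀ g g'}
    {e : k ≅ Φ.h f} {e' : k' ≅ Φ.h f'} {d : l ≅ Ψ.h g} {d' : l' ≅ Ψ.h g'}
    {a : s ≅ Φ.mapV s₀} {a' : t ≅ Φ.mapV t₀} {b : z ≅ Ψ.mapV z₀} {b' : y ≅ Ψ.mapV y₀}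
    (h : Tw n (Φ.bsq n₀) e.hom e'.hom a.hom a'.hom)
    (h' : Tw m (Ψ.bsq m₀) d.hom d'.hom b.hom b'.hom) :
    Tw (T.bq n m) (Ω.bsq (S.bq n₀ m₀)) (θ.ext e d).hom (θ.ext e' d').hom (θ.vext a b).hom
      (θ.vext a' b').hom := (T.bq_Tw h h').comp (θ.bc_bq n₀ m₀)

section
variable {C F H J : Ob}

/-- The action on a naturality cell is a compositor, a value of the functor and an inverse
compositor, and each of these corresponds. The unitors of `k` make the identity slot appear, so that
it is compared through `mapId`. -/
lemma OV_natL {f : X.c A ⟶ X.c B} {b : X.c B ⟶ X.c E} {a : X.c A ⟶ X.c G} {f' : X.c G ⟶ X.c E}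
    {f₀ : X'.c A ⟶ X'.c B} {b₀ : X'.c B ⟶ X'.c E} {a₀ : X'.c A ⟶ X'.c G} {f₀' : X'.c G ⟶ X'.c E}
    {δ : f ≫ b ⟶ a ≫ f'} {δ₀ : f₀ ≫ b₀ ⟶ a₀ ≫ f₀'} {k : Y.c Q ⟶ Y.c R} {k₀ : Y'.c Q ⟶ Y'.c R}
    {ef : f ≅ Φ.h f₀} {eb : b ≅ Φ.h b₀} {ea : a ≅ Φ.h a₀} {ef' : f' ≅ Φ.h f₀'}
    (h : OV δ (Φ.g δ₀) (Φ.lift2I ef eb) (Φ.lift2I ea ef')) (ek : k ≅ Ψ.h k₀) :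
    OV (T.natL δ k) (Ω.g (S.natL δ₀ k₀))
      (Ω.lift2I (θ.ext ef ek) (θ.ext eb (Ψ.coh.mapId R)))
      (Ω.lift2I (θ.ext ea (Ψ.coh.mapId Q)) (θ.ext ef' ek)) :=
  DblFun.OV_comp (F := Ω) (θ.OV_bc _ _ _ _) (DblFun.OV_comp (F := Ω)
    (θ.OV_bg h (DblFun.OV_comp (F := Ψ) (DblFun.OV_rightU (F := Ψ) _)
        (DblFun.OV_leftU_inv (F := Ψ) _)))
    (DblFun.OV_inv (F := Ω) (θ.OV_bc _ _ _ _)))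

lemma OV_natR {f : Y.c A ⟶ Y.c B} {b : Y.c B ⟶ Y.c E} {a : Y.c A ⟶ Y.c G} {f' : Y.c G ⟶ Y.c E}
    {f₀ : Y'.c A ⟶ Y'.c B} {b₀ : Y'.c B ⟶ Y'.c E} {a₀ : Y'.c A ⟶ Y'.c G} {f₀' : Y'.c G ⟶ Y'.c E}
    {δ : f ≫ b ⟶ a ≫ f'} {δ₀ : f₀ ≫ b₀ ⟶ a₀ ≫ f₀'} {k : X.c Q ⟶ X.c R} {k₀ : X'.c Q ⟶ X'.c R}
    {ef : f ≅ Ψ.h f₀} {eb : b ≅ Ψ.h b₀} {ea : a ≅ Ψ.h a₀} {ef' : f' ≅ Ψ.h f₀'}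
    (ek : k ≅ Φ.h k₀) (h : OV δ (Ψ.g δ₀) (Ψ.lift2I ef eb) (Ψ.lift2I ea ef')) :
    OV (T.natR k δ) (Ω.g (S.natR k₀ δ₀))
      (Ω.lift2I (θ.ext ek ef) (θ.ext (Φ.coh.mapId R) eb))
      (Ω.lift2I (θ.ext (Φ.coh.mapId Q) ea) (θ.ext ek ef')) :=
  DblFun.OV_comp (F := Ω) (θ.OV_bc _ _ _ _) (DblFun.OV_comp (F := Ω)
    (θ.OV_bg (DblFun.OV_comp (F := Φ) (DblFun.OV_rightU (F := Φ) _)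
        (DblFun.OV_leftU_inv (F := Φ) _)) h)
    (DblFun.OV_inv (F := Ω) (θ.OV_bc _ _ _ _)))

lemma OV_l2 {f : X.c A ⟶ X.c B} {g : X.c B ⟶ X.c E} {f₀ : X'.c A ⟶ X'.c B}
    {g₀ : X'.c B ⟶ X'.c E} (e : f ≅ Φ.h f₀) (d : g ≅ Φ.h g₀) (Q : Ob) :
    OV (T.l2 f g Q) (Ω.g (S.l2 f₀ g₀ Q))
      (Ω.lift2I (θ.ext e (Ψ.coh.mapId Q)) (θ.ext d (Ψ.coh.mapId Q)))
      (θ.ext (Φ.lift2I e d) (Ψ.coh.mapId Q)) :=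
  DblFun.OV_comp (F := Ω) (θ.OV_bc _ _ _ _) (θ.OV_bg (DblFun.OV_id (F := Φ) _)
      (DblFun.OV_leftU (F := Ψ) _))

lemma OV_l2' {f : X.c A ⟶ X.c B} {g : X.c B ⟶ X.c E} {f₀ : X'.c A ⟶ X'.c B}
    {g₀ : X'.c B ⟶ X'.c E} (e : f ≅ Φ.h f₀) (d : g ≅ Φ.h g₀) (Q : Ob) :
    OV (T.l2' f g Q) (Ω.g (S.l2' f₀ g₀ Q))
      (θ.ext (Φ.lift2I e d) (Ψ.coh.mapId Q))
      (Ω.lift2I (θ.ext e (Ψ.coh.mapId Q)) (θ.ext d (Ψ.coh.mapId Q))) :=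
  DblFun.OV_comp (F := Ω) (θ.OV_bg (DblFun.OV_id (F := Φ) _) (DblFun.OV_leftU_inv (F := Ψ) _))
    (DblFun.OV_inv (F := Ω) (θ.OV_bc _ _ _ _))

lemma OV_r2 {f : Y.c A ⟶ Y.c B} {g : Y.c B ⟶ Y.c E} {f₀ : Y'.c A ⟶ Y'.c B}
    {g₀ : Y'.c B ⟶ Y'.c E} (Q : Ob) (e : f ≅ Ψ.h f₀) (d : g ≅ Ψ.h g₀) :
    OV (T.r2 Q f g) (Ω.g (S.r2 Q f₀ g₀))
      (Ω.lift2I (θ.ext (Φ.coh.mapId Q) e) (θ.ext (Φ.coh.mapId Q) d))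
      (θ.ext (Φ.coh.mapId Q) (Ψ.lift2I e d)) :=
  DblFun.OV_comp (F := Ω) (θ.OV_bc _ _ _ _) (θ.OV_bg (DblFun.OV_leftU (F := Φ) _)
      (DblFun.OV_id (F := Ψ) _))

lemma OV_r2' {f : Y.c A ⟶ Y.c B} {g : Y.c B ⟶ Y.c E} {f₀ : Y'.c A ⟶ Y'.c B}
    {g₀ : Y'.c B ⟶ Y'.c E} (Q : Ob) (e : f ≅ Ψ.h f₀) (d : g ≅ Ψ.h g₀) :
    OV (T.r2' Q f g) (Ω.g (S.r2' Q f₀ g₀))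
      (θ.ext (Φ.coh.mapId Q) (Ψ.lift2I e d))
      (Ω.lift2I (θ.ext (Φ.coh.mapId Q) e) (θ.ext (Φ.coh.mapId Q) d)) :=
  DblFun.OV_comp (F := Ω) (θ.OV_bg (DblFun.OV_leftU_inv (F := Φ) _) (DblFun.OV_id (F := Ψ) _))
    (DblFun.OV_inv (F := Ω) (θ.OV_bc _ _ _ _))

/-- Decomposes the action on a pentagon cell into compositors and one value of the functor. The
comparison isomorphisms at the two ends are nested exactly as the 1-cells are. -/
lemma OV_whL {a : X.c A ⟶ X.c B} {b : X.c B ⟶ X.c E} {c : X.c E ⟶ X.c H} {g : X.c A ⟶ X.c G}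
    {h : X.c G ⟶ X.c H} {δ : a ≫ b ≫ c ⟶ g ≫ h}
    {a₀ : X'.c A ⟶ X'.c B} {b₀ : X'.c B ⟶ X'.c E} {c₀ : X'.c E ⟶ X'.c H} {g₀ : X'.c A ⟶ X'.c G}
    {h₀ : X'.c G ⟶ X'.c H} {δ₀ : a₀ ≫ b₀ ≫ c₀ ⟶ g₀ ≫ h₀}
    {ea : a ≅ Φ.h a₀} {eb : b ≅ Φ.h b₀} {ec : c ≅ Φ.h c₀} {eg : g ≅ Φ.h g₀} {eh : h ≅ Φ.h h₀}
    (H : OV δ (Φ.g δ₀) (Φ.lift2I ea (Φ.lift2I eb ec)) (Φ.lift2I eg eh)) (Q : Ob) :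
    OV (T.whL δ Q) (Ω.g (S.whL δ₀ Q))
      (Ω.lift2I (θ.ext ea (Ψ.coh.mapId Q)) (Ω.lift2I (θ.ext eb (Ψ.coh.mapId Q))
        (θ.ext ec (Ψ.coh.mapId Q))))
      (Ω.lift2I (θ.ext eg (Ψ.coh.mapId Q)) (θ.ext eh (Ψ.coh.mapId Q))) :=
  DblFun.OV_comp (F := Ω) (DblFun.OV_wl (F := Ω) _ (θ.OV_l2 _ _ _))
      (DblFun.OV_comp (F := Ω) (θ.OV_l2 _ _ _)
    (DblFun.OV_comp (F := Ω) (θ.OV_bg H (DblFun.OV_id (F := Ψ) _)) (θ.OV_l2' _ _ _)))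

lemma OV_whR {a : Y.c A ⟶ Y.c B} {b : Y.c B ⟶ Y.c E} {c : Y.c E ⟶ Y.c H} {g : Y.c A ⟶ Y.c G}
    {h : Y.c G ⟶ Y.c H} {δ : a ≫ b ≫ c ⟶ g ≫ h}
    {a₀ : Y'.c A ⟶ Y'.c B} {b₀ : Y'.c B ⟶ Y'.c E} {c₀ : Y'.c E ⟶ Y'.c H} {g₀ : Y'.c A ⟶ Y'.c G}
    {h₀ : Y'.c G ⟶ Y'.c H} {δ₀ : a₀ ≫ b₀ ≫ c₀ ⟶ g₀ ≫ h₀}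
    {ea : a ≅ Ψ.h a₀} {eb : b ≅ Ψ.h b₀} {ec : c ≅ Ψ.h c₀} {eg : g ≅ Ψ.h g₀} {eh : h ≅ Ψ.h h₀}
    (Q : Ob) (H : OV δ (Ψ.g δ₀) (Ψ.lift2I ea (Ψ.lift2I eb ec)) (Ψ.lift2I eg eh)) :
    OV (T.whR Q δ) (Ω.g (S.whR Q δ₀))
      (Ω.lift2I (θ.ext (Φ.coh.mapId Q) ea) (Ω.lift2I (θ.ext (Φ.coh.mapId Q) eb)
        (θ.ext (Φ.coh.mapId Q) ec)))
      (Ω.lift2I (θ.ext (Φ.coh.mapId Q) eg) (θ.ext (Φ.coh.mapId Q) eh)) :=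
  DblFun.OV_comp (F := Ω) (DblFun.OV_wl (F := Ω) _ (θ.OV_r2 _ _ _))
      (DblFun.OV_comp (F := Ω) (θ.OV_r2 _ _ _)
    (DblFun.OV_comp (F := Ω) (θ.OV_bg (DblFun.OV_id (F := Φ) _) H) (θ.OV_r2' _ _ _)))
end
end BOver
end

/-! ### Reflection of equations along faithful functors -/

section
variable {Ob : Type u} {Ob' : Type u'} {C : DblCat.{u, v, w, x} Ob}
  {K : DblCat.{u', v', w', x'} Ob'} {o : Ob → Ob'} {F : DblFun C K o}

/-- Functors that are injective on squares. -/
def DblFun.Faithful (F : DblFun C K o) : Prop :=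
  ∀ {A B A' B' : Ob} {f : C.c A ⟶ C.c B} {g : C.c A' ⟶ C.c B'} (a b : Sq f g),
    F.s a = F.s b → a = b

namespace DblFun
lemma OV_paste {X₀ X₁ X₂ Y₀ Y₁ Y₂ : Ob}
    {x₀ : K.c (o X₀) ⟶ K.c (o Y₀)} {x₁ : K.c (o X₁) ⟶ K.c (o Y₁)} {x₂ : K.c (o X₂) ⟶ K.c (o Y₂)}
    {a₁ : K.c (o X₀) ⟶ K.c (o X₁)} {a₂ : K.c (o X₁) ⟶ K.c (o X₂)} {b₁ : K.c (o Y₀) ⟶ K.c (o Y₁)}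
    {b₂ : K.c (o Y₁) ⟶ K.c (o Y₂)}
    {x₀' : C.c X₀ ⟶ C.c Y₀} {x₁' : C.c X₁ ⟶ C.c Y₁} {x₂' : C.c X₂ ⟶ C.c Y₂}
    {a₁' : C.c X₀ ⟶ C.c X₁} {a₂' : C.c X₁ ⟶ C.c X₂} {b₁' : C.c Y₀ ⟶ C.c Y₁} {b₂' : C.c Y₁ ⟶ C.c Y₂}
    {δ₁ : x₀ ≫ b₁ ⟶ a₁ ≫ x₁} {δ₂ : x₁ ≫ b₂ ⟶ a₂ ≫ x₂}
    {δ₁' : x₀' ≫ b₁' ⟶ a₁' ≫ x₁'} {δ₂' : x₁' ≫ b₂' ⟶ a₂' ≫ x₂'}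
    {e₀ : x₀ ≅ F.h x₀'} {e₁ : x₁ ≅ F.h x₁'} {e₂ : x₂ ≅ F.h x₂'} {i₁ : a₁ ≅ F.h a₁'}
    {i₂ : a₂ ≅ F.h a₂'} {j₁ : b₁ ≅ F.h b₁'} {j₂ : b₂ ≅ F.h b₂'}
    (h₁ : OV δ₁ (F.g δ₁') (F.lift2I e₀ j₁) (F.lift2I i₁ e₁))
    (h₂ : OV δ₂ (F.g δ₂') (F.lift2I e₁ j₂) (F.lift2I i₂ e₂)) :
    OV (paste δ₁ δ₂) (F.g (paste δ₁' δ₂')) (F.lift2I e₀ (F.lift2I j₁ j₂))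
      (F.lift2I (F.lift2I i₁ i₂) e₂) :=
  OV_comp (OV_assoc_inv _ _ _) (OV_comp (OV_wr h₁ _) (OV_comp (OV_assoc _ _ _)
    (OV_comp (OV_wl _ h₂) (OV_assoc_inv _ _ _))))

namespace Faithful
lemma g_inj (hF : F.Faithful) {A B : Ob} {f g : C.c A ⟶ C.c B} {a b : f ⟶ g}
    (h : F.g a = F.g b) : a = b := PreDbl.Glob.ext (hF _ _ (congrArg PreDbl.Glob.cell h))

/-- Equal cells upstairs force equal images under `F`, since the comparisons are invertible;
faithfulness removes `F`. -/
lemma eq_of_OV (hF : F.Faithful) {A B : Ob} {k k' : K.c (o A) ⟶ K.c (o B)} {f f' : C.c A ⟶ C.c B}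
    {n m : k ⟶ k'} {n₀ m₀ : f ⟶ f'} {L : k ≅ F.h f} {R : k' ≅ F.h f'}
    (h : OV n (F.g n₀) L R) (h' : OV m (F.g m₀) L R) (e : n = m) : n₀ = m₀ :=
  hF.g_inj (h.eq_of_eq h' e)

lemma V2_of_Tw (hF : F.Faithful) {A B A' B' : Ob} {s : K.pre.V (o A) (o A')}
    {t : K.pre.V (o B) (o B')} {s₀ : C.pre.V A A'} {t₀ : C.pre.V B B'}
    {k l : K.c (o A) ⟶ K.c (o B)} {k' l' : K.c (o A') ⟶ K.c (o B')} {f g : C.c A ⟶ C.c B}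
    {f' g' : C.c A' ⟶ C.c B'} {n : BSq K s t k k'} {m : BSq K s t l l'} {n₀ : BSq C s₀ t₀ f f'}
    {m₀ : BSq C s₀ t₀ g g'} {φ : k ⟶ l} {ψ : k' ⟶ l'} {φ₀ : f ⟶ g} {ψ₀ : f' ⟶ g'}
    {e : k ≅ F.h f} {e' : k' ≅ F.h f'} {d : l ≅ F.h g} {d' : l' ≅ F.h g'} {L : s ≅ F.mapV s₀}
    {R : t ≅ F.mapV t₀} (h : V2 n m φ ψ) (hn : Tw n (F.bsq n₀) e.hom e'.hom L.hom R.hom)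
    (hm : Tw m (F.bsq m₀) d.hom d'.hom L.hom R.hom) (hφ : OV φ (F.g φ₀) e d)
    (hψ : OV ψ (F.g ψ₀) e' d') : V2 n₀ m₀ φ₀ ψ₀ :=
  hF _ _ ((F.mapSq_scomp _ _).trans ((Tw.transfer h hn hm hφ hψ).trans (F.mapSq_scomp _ _).symm))

/-- A modification condition is an equation between two pastings of two cells each, so it is
reflected as soon as its four ingredients correspond. -/
lemma natMod (hF : F.Faithful) {X Y X' Y' : Ob}
    {x : K.c (o X) ⟶ K.c (o X')} {y : K.c (o Y) ⟶ K.c (o Y')} {a c : K.c (o X) ⟶ K.c (o Y)}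
    {b d : K.c (o X') ⟶ K.c (o Y')} {x₀ : C.c X ⟶ C.c X'} {y₀ : C.c Y ⟶ C.c Y'}
    {a₀ c₀ : C.c X ⟶ C.c Y} {b₀ d₀ : C.c X' ⟶ C.c Y'}
    {φ : a ⟶ c} {φ' : b ⟶ d} {δ : x ≫ b ⟶ a ≫ y} {ζ : x ≫ d ⟶ c ≫ y}
    {φ₀ : a₀ ⟶ c₀} {φ₀' : b₀ ⟶ d₀} {δ₀ : x₀ ≫ b₀ ⟶ a₀ ≫ y₀} {ζ₀ : x₀ ≫ d₀ ⟶ c₀ ≫ y₀}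
    {ex : x ≅ F.h x₀} {ey : y ≅ F.h y₀} {ea : a ≅ F.h a₀} {eb : b ≅ F.h b₀} {ec : c ≅ F.h c₀}
    {ed : d ≅ F.h d₀}
    (h : NatMod φ φ' δ ζ) (hφ : OV φ (F.g φ₀) ea ec) (hφ' : OV φ' (F.g φ₀') eb ed)
    (hδ : OV δ (F.g δ₀) (F.lift2I ex eb) (F.lift2I ea ey))
    (hζ : OV ζ (F.g ζ₀) (F.lift2I ex ed) (F.lift2I ec ey)) :
    NatMod φ₀ φ₀' δ₀ ζ₀ :=
  hF.eq_of_OV (OV_comp (OV_wl ex hφ') hζ) (OV_comp hδ (OV_wr hφ ey)) h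

/-- Each of the nine 2-cells of the associahedron corresponds to its primed version, with one
comparison chosen for each 1-cell of the diagram. Hence both pastings correspond along the same two
outer comparisons, and the equation is reflected. -/
theorem pasting5 (hF : F.Faithful) {X₀ X₁ X₂ X₃ X₄ X₅ X₆ Y₁ Y₂ Y₃ Y₄ Y₅ Y₆ Y₇ : Ob}
    {a : K.c (o X₀) ⟶ K.c (o X₁)} {b : K.c (o X₁) ⟶ K.c (o X₂)} {c : K.c (o X₂) ⟶ K.c (o X₃)}
    {d : K.c (o X₃) ⟶ K.c (o X₄)} {e : K.c (o X₄) ⟶ K.c (o X₅)} {f : K.c (o X₅) ⟶ K.c (o X₆)}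
    {g : K.c (o X₀) ⟶ K.c (o Y₁)} {h : K.c (o Y₁) ⟶ K.c (o X₃)} {i : K.c (o Y₁) ⟶ K.c (o Y₂)}
    {j : K.c (o Y₂) ⟶ K.c (o X₅)} {k : K.c (o Y₂) ⟶ K.c (o Y₃)} {m : K.c (o Y₃) ⟶ K.c (o X₆)}
    {n : K.c (o X₀) ⟶ K.c (o Y₄)} {q : K.c (o Y₄) ⟶ K.c (o Y₃)} {s : K.c (o X₂) ⟶ K.c (o Y₅)}
    {t : K.c (o Y₅) ⟶ K.c (o X₄)} {x : K.c (o Y₅) ⟶ K.c (o Y₆)} {y : K.c (o Y₆) ⟶ K.c (o X₆)}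
    {z : K.c (o X₁) ⟶ K.c (o Y₇)} {w : K.c (o Y₇) ⟶ K.c (o Y₆)} {v : K.c (o Y₄) ⟶ K.c (o Y₇)}
    {a' : C.c X₀ ⟶ C.c X₁} {b' : C.c X₁ ⟶ C.c X₂} {c' : C.c X₂ ⟶ C.c X₃} {d' : C.c X₃ ⟶ C.c X₄}
    {e' : C.c X₄ ⟶ C.c X₅} {f' : C.c X₅ ⟶ C.c X₆} {g' : C.c X₀ ⟶ C.c Y₁} {h' : C.c Y₁ ⟶ C.c X₃}
    {i' : C.c Y₁ ⟶ C.c Y₂} {j' : C.c Y₂ ⟶ C.c X₅} {k' : C.c Y₂ ⟶ C.c Y₃} {m' : C.c Y₃ ⟶ C.c X₆}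
    {n' : C.c X₀ ⟶ C.c Y₄} {q' : C.c Y₄ ⟶ C.c Y₃} {s' : C.c X₂ ⟶ C.c Y₅} {t' : C.c Y₅ ⟶ C.c X₄}
    {x' : C.c Y₅ ⟶ C.c Y₆} {y' : C.c Y₆ ⟶ C.c X₆} {z' : C.c X₁ ⟶ C.c Y₇} {w' : C.c Y₇ ⟶ C.c Y₆}
    {v' : C.c Y₄ ⟶ C.c Y₇}
    {φ₁ : a ≫ b ≫ c ⟶ g ≫ h} {φ₂ : h ≫ d ≫ e ⟶ i ≫ j} {σ₁ : j ≫ f ⟶ k ≫ m}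
    {φ₃ : g ≫ i ≫ k ⟶ n ≫ q} {σ₂ : c ≫ d ⟶ s ≫ t} {φ₄ : t ≫ e ≫ f ⟶ x ≫ y}
    {φ₅ : b ≫ s ≫ x ⟶ z ≫ w} {σ₃ : a ≫ z ⟶ n ≫ v} {φ₆ : v ≫ w ≫ y ⟶ q ≫ m}
    {φ₁' : a' ≫ b' ≫ c' ⟶ g' ≫ h'} {φ₂' : h' ≫ d' ≫ e' ⟶ i' ≫ j'} {σ₁' : j' ≫ f' ⟶ k' ≫ m'}
    {φ₃' : g' ≫ i' ≫ k' ⟶ n' ≫ q'} {σ₂' : c' ≫ d' ⟶ s' ≫ t'} {φ₄' : t' ≫ e' ≫ f' ⟶ x' ≫ y'}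
    {φ₅' : b' ≫ s' ≫ x' ⟶ z' ≫ w'} {σ₃' : a' ≫ z' ⟶ n' ≫ v'} {φ₆' : v' ≫ w' ≫ y' ⟶ q' ≫ m'}
    {ia : a ≅ F.h a'} {ib : b ≅ F.h b'} {ic : c ≅ F.h c'} {id : d ≅ F.h d'} {ie : e ≅ F.h e'}
    {jf : f ≅ F.h f'} {ig : g ≅ F.h g'} {ih : h ≅ F.h h'} {ii : i ≅ F.h i'} {ij : j ≅ F.h j'}
    {ik : k ≅ F.h k'} {im : m ≅ F.h m'} {jn : n ≅ F.h n'} {iq : q ≅ F.h q'} {is : s ≅ F.h s'}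
    {it : t ≅ F.h t'} {ix : x ≅ F.h x'} {iy : y ≅ F.h y'}
    {iz : z ≅ F.h z'} {iw : w ≅ F.h w'} {iv : v ≅ F.h v'}
    (H : Pasting5 φ₁ φ₂ σ₁ φ₃ σ₂ φ₄ φ₅ σ₃ φ₆)
    (h₁ : OV φ₁ (F.g φ₁') (F.lift2I ia (F.lift2I ib ic)) (F.lift2I ig ih))
    (h₂ : OV φ₂ (F.g φ₂') (F.lift2I ih (F.lift2I id ie)) (F.lift2I ii ij))
    (s₁ : OV σ₁ (F.g σ₁') (F.lift2I ij jf) (F.lift2I ik im))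
    (h₃ : OV φ₃ (F.g φ₃') (F.lift2I ig (F.lift2I ii ik)) (F.lift2I jn iq))
    (s₂ : OV σ₂ (F.g σ₂') (F.lift2I ic id) (F.lift2I is it))
    (h₄ : OV φ₄ (F.g φ₄') (F.lift2I it (F.lift2I ie jf)) (F.lift2I ix iy))
    (h₅ : OV φ₅ (F.g φ₅') (F.lift2I ib (F.lift2I is ix)) (F.lift2I iz iw))
    (s₃ : OV σ₃ (F.g σ₃') (F.lift2I ia iz) (F.lift2I jn iv))
    (h₆ : OV φ₆ (F.g φ₆') (F.lift2I iv (F.lift2I iw iy)) (F.lift2I iq im)) :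
    Pasting5 φ₁' φ₂' σ₁' φ₃' σ₂' φ₄' φ₅' σ₃' φ₆' := by
  unfold Pasting5 at *
  -- The coherence isomorphisms hidden in `⊗≫` are unfolded into explicit associators and
  -- whiskerings, for which stability lemmas are available.
  simp only [bicategoricalComp, BicategoricalCoherence.whiskerLeft_iso,
    BicategoricalCoherence.assoc_iso, BicategoricalCoherence.assoc'_iso, Iso.trans_hom,
    Iso.symm_hom, whiskerLeftIso_hom, Category.id_comp] at *
  refine hF.eq_of_OV (L := F.lift2I ia (F.lift2I ib (F.lift2I ic (F.lift2I id (F.lift2I ie jf)))))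
    (R := F.lift2I jn (F.lift2I iq im)) ?_ ?_ H
  all_goals
    -- The search follows the syntax of the pasting. The given 2-cells are closed by the hypotheses,
    -- and unification with them determines the intermediate comparisons.
    repeat first
      | assumption
      | apply OV_assoc
      | apply OV_assoc_inv
      | apply OV_wl
      | apply OV_wr
      | apply OV_comp
      | exact OV_id _

theorem pastingL (hF : F.Faithful) {X₀ X₁ X₂ X₃ X₄ Y₁ Y₂ : Ob}
    {a : K.c (o X₀) ⟶ K.c (o X₁)} {b : K.c (o X₁) ⟶ K.c (o X₂)} {c : K.c (o X₂) ⟶ K.c (o X₃)}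
    {d : K.c (o X₃) ⟶ K.c (o X₄)} {g : K.c (o X₀) ⟶ K.c (o Y₁)} {h : K.c (o Y₁) ⟶ K.c (o X₃)}
    {k : K.c (o Y₁) ⟶ K.c (o X₄)} {m : K.c (o X₀) ⟶ K.c (o Y₂)} {n : K.c (o Y₂) ⟶ K.c (o X₄)}
    {s : K.c (o X₂) ⟶ K.c (o X₄)} {t : K.c (o X₁) ⟶ K.c (o Y₂)}
    {a' : C.c X₀ ⟶ C.c X₁} {b' : C.c X₁ ⟶ C.c X₂} {c' : C.c X₂ ⟶ C.c X₃} {d' : C.c X₃ ⟶ C.c X₄}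
    {g' : C.c X₀ ⟶ C.c Y₁} {h' : C.c Y₁ ⟶ C.c X₃} {k' : C.c Y₁ ⟶ C.c X₄} {m' : C.c X₀ ⟶ C.c Y₂}
    {n' : C.c Y₂ ⟶ C.c X₄} {s' : C.c X₂ ⟶ C.c X₄} {t' : C.c X₁ ⟶ C.c Y₂}
    {φ : a ≫ b ≫ c ⟶ g ≫ h} {μ₁ : h ≫ d ⟶ k} {σ₁ : g ≫ k ⟶ m ≫ n}
    {l : c ≫ d ⟶ s} {σ₂ : b ≫ s ⟶ t ≫ n} {μ₂ : a ≫ t ⟶ m}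
    {φ' : a' ≫ b' ≫ c' ⟶ g' ≫ h'} {μ₁' : h' ≫ d' ⟶ k'} {σ₁' : g' ≫ k' ⟶ m' ≫ n'}
    {l' : c' ≫ d' ⟶ s'} {σ₂' : b' ≫ s' ⟶ t' ≫ n'} {μ₂' : a' ≫ t' ⟶ m'}
    {ia : a ≅ F.h a'} {ib : b ≅ F.h b'} {ic : c ≅ F.h c'} {id : d ≅ F.h d'} {ig : g ≅ F.h g'}
    {ih : h ≅ F.h h'} {ik : k ≅ F.h k'} {im : m ≅ F.h m'} {jn : n ≅ F.h n'} {is : s ≅ F.h s'}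
    {it : t ≅ F.h t'}
    (H : PastingL φ μ₁ σ₁ l σ₂ μ₂)
    (h₁ : OV φ (F.g φ') (F.lift2I ia (F.lift2I ib ic)) (F.lift2I ig ih))
    (h₂ : OV μ₁ (F.g μ₁') (F.lift2I ih id) ik)
    (h₃ : OV σ₁ (F.g σ₁') (F.lift2I ig ik) (F.lift2I im jn))
    (h₄ : OV l (F.g l') (F.lift2I ic id) is)
    (h₅ : OV σ₂ (F.g σ₂') (F.lift2I ib is) (F.lift2I it jn))
    (h₆ : OV μ₂ (F.g μ₂') (F.lift2I ia it) im) :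
    PastingL φ' μ₁' σ₁' l' σ₂' μ₂' := by
  unfold PastingL at *
  simp only [bicategoricalComp, BicategoricalCoherence.whiskerLeft_iso,
    BicategoricalCoherence.assoc_iso, BicategoricalCoherence.assoc'_iso, Iso.trans_hom,
    Iso.symm_hom, whiskerLeftIso_hom, Category.id_comp] at *
  refine hF.eq_of_OV (L := F.lift2I ia (F.lift2I ib (F.lift2I ic id)))
    (R := F.lift2I im jn) ?_ ?_ H
  all_goals
    repeat first
      | assumption
      | apply OV_assoc
      | apply OV_assoc_inv
      | apply OV_wl
      | apply OV_wr
      | apply OV_comp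
      | exact OV_id _

theorem pastingR (hF : F.Faithful) {X₀ X₁ X₂ X₃ X₄ Y₁ Y₂ : Ob}
    {a : K.c (o X₀) ⟶ K.c (o X₁)} {b : K.c (o X₁) ⟶ K.c (o X₂)} {c : K.c (o X₂) ⟶ K.c (o X₃)}
    {d : K.c (o X₃) ⟶ K.c (o X₄)} {g : K.c (o X₀) ⟶ K.c (o Y₁)} {h : K.c (o Y₁) ⟶ K.c (o X₃)}
    {k : K.c (o Y₁) ⟶ K.c (o Y₂)} {n : K.c (o Y₂) ⟶ K.c (o X₄)} {q : K.c (o X₀) ⟶ K.c (o Y₂)}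
    {s : K.c (o X₂) ⟶ K.c (o X₄)} {t : K.c (o X₁) ⟶ K.c (o Y₂)}
    {a' : C.c X₀ ⟶ C.c X₁} {b' : C.c X₁ ⟶ C.c X₂} {c' : C.c X₂ ⟶ C.c X₃} {d' : C.c X₃ ⟶ C.c X₄}
    {g' : C.c X₀ ⟶ C.c Y₁} {h' : C.c Y₁ ⟶ C.c X₃} {k' : C.c Y₁ ⟶ C.c Y₂} {n' : C.c Y₂ ⟶ C.c X₄}
    {q' : C.c X₀ ⟶ C.c Y₂} {s' : C.c X₂ ⟶ C.c X₄} {t' : C.c X₁ ⟶ C.c Y₂}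
    {φ : a ≫ b ≫ c ⟶ g ≫ h} {σ₁ : h ≫ d ⟶ k ≫ n} {μ₁ : g ≫ k ⟶ q} {r : q ⟶ a ≫ t}
    {μ₂ : c ≫ d ⟶ s} {σ₂ : b ≫ s ⟶ t ≫ n}
    {φ' : a' ≫ b' ≫ c' ⟶ g' ≫ h'} {σ₁' : h' ≫ d' ⟶ k' ≫ n'} {μ₁' : g' ≫ k' ⟶ q'}
    {r' : q' ⟶ a' ≫ t'} {μ₂' : c' ≫ d' ⟶ s'} {σ₂' : b' ≫ s' ⟶ t' ≫ n'}
    {ia : a ≅ F.h a'} {ib : b ≅ F.h b'} {ic : c ≅ F.h c'} {id : d ≅ F.h d'} {ig : g ≅ F.h g'}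
    {ih : h ≅ F.h h'} {ik : k ≅ F.h k'} {jn : n ≅ F.h n'} {iq : q ≅ F.h q'} {is : s ≅ F.h s'}
    {it : t ≅ F.h t'}
    (H : PastingR φ σ₁ μ₁ r μ₂ σ₂)
    (h₁ : OV φ (F.g φ') (F.lift2I ia (F.lift2I ib ic)) (F.lift2I ig ih))
    (h₂ : OV σ₁ (F.g σ₁') (F.lift2I ih id) (F.lift2I ik jn))
    (h₃ : OV μ₁ (F.g μ₁') (F.lift2I ig ik) iq) (h₄ : OV r (F.g r') iq (F.lift2I ia it))
    (h₅ : OV μ₂ (F.g μ₂') (F.lift2I ic id) is)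
    (h₆ : OV σ₂ (F.g σ₂') (F.lift2I ib is) (F.lift2I it jn)) :
    PastingR φ' σ₁' μ₁' r' μ₂' σ₂' := by
  unfold PastingR at *
  simp only [bicategoricalComp, BicategoricalCoherence.whiskerLeft_iso,
    BicategoricalCoherence.assoc_iso, BicategoricalCoherence.assoc'_iso, Iso.trans_hom,
    Iso.symm_hom, whiskerLeftIso_hom, Category.id_comp] at *
  refine hF.eq_of_OV (L := F.lift2I ia (F.lift2I ib (F.lift2I ic id)))
    (R := F.lift2I ia (F.lift2I it jn)) ?_ ?_ H
  all_goals
    repeat first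
      | assumption
      | apply OV_assoc
      | apply OV_assoc_inv
      | apply OV_wl
      | apply OV_wr
      | apply OV_comp
      | exact OV_id _
end Faithful

lemma id_faithful : (DblFun.id C).Faithful := fun _ _ h => h
end DblFun

/-- Naturality of the squares of a transformation with respect to squares on identities. -/
lemma HTrans.bsq_vmap {oF oG : Ob → Ob'} {F : DblFun C K oF} {G : DblFun C K oG} (α : HTrans F G)
    {A A' : Ob} {s s₀ : C.pre.V A A'} (L : s ⟶ s₀) :
    BSq.ra (α.bsq s) (G.vmap L) = BSq.la (F.vmap L) (α.bsq s₀) := by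
  -- By the unit law of `α`, its naturality cell at an identity 1-cell is the comparison of the two
  -- unitors, once the unitors of `F` and `G` are taken off.
  have h (A : Ob) : OV (α.nat (𝟙 (C.c A))).hom ((λ_ (α.app A)).hom ≫ (ρ_ (α.app A)).inv)
      ((F.coh.mapId A).symm ⋆ₕ Iso.refl _) (Iso.refl _ ⋆ₕ (G.coh.mapId A).symm) := by
    have h := α.nat_id A
    unfold OV
    rw [hIso_hom, hIso_hom, Iso.symm_hom, Iso.symm_hom]
    simp only [Iso.refl_hom, whiskerLeft_id, id_whiskerRight, Category.id_comp, Category.comp_id]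
    rw [← cancel_epi ((F.coh.mapId A).hom ▷ α.app A), reassoc_of% h, ← comp_whiskerRight_assoc]
    simp
  -- Naturality at the square `L`, transported along the unitors of `F` and `G`, relates the two
  -- composites of `α` with the values of `L`. Absorbing the units turns this into the claimed
  -- equation.
  have h1 := Tw.transfer (α.nat_bsq (F := F) (G := G) L)
    (n₀ := BSq.hc (F.vmap L) (α.bsq s₀)) (m₀ := (α.bsq s).hc (G.vmap L))
    (L := Iso.refl _) (R := 𝟙 _) (e := (F.coh.mapId A).symm ⋆ₕ Iso.refl _)
    (e' := (F.coh.mapId A').symm ⋆ₕ Iso.refl _) (d := Iso.refl _ ⋆ₕ (G.coh.mapId A).symm)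
    (d' := Iso.refl _ ⋆ₕ (G.coh.mapId A').symm) (Tw.of_V2 ((F.vmap_V2 L).hc (V2.refl _)))
    (Tw.of_V2 ((V2.refl _).hc (G.vmap_V2 L))) (h A) (h A')
  refine (((BSq.ract_V2 (α.bsq s) (G.vmap L)).unique (φ := ρ_ _) (ψ := ρ_ _)
    (φ₁ := (λ_ (α.app A) ≪≫ (ρ_ (α.app A)).symm).symm ≪≫ λ_ _)
    (ψ₁ := (λ_ (α.app A') ≪≫ (ρ_ (α.app A')).symm).symm ≪≫ λ_ _)
    ((h1.inv (φ := λ_ (α.app A) ≪≫ (ρ_ (α.app A)).symm)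
      (ψ := λ_ (α.app A') ≪≫ (ρ_ (α.app A')).symm)).comp (BSq.lact_V2 _ _)) ?_ ?_)) <;> simp
end

/-! ### Values of standard functors on squares on identities -/

section
variable {Ob : Type u} {Ob' : Type u'} {Ob'' : Type u''} {C : DblCat.{u, v, w, x} Ob}
  {D : DblCat.{u', v', w', x'} Ob'} {E : DblCat.{u'', v'', w'', x''} Ob''}

namespace DblFun
-- The value `vmap L` is determined as the conjugate of the image of `L` by the unitor, so it can be
-- recognized instead of computed.
lemma vmap_of_id {o : Ob → Ob'} {F : DblFun C D o} {A A' : Ob} {s s₀ : C.pre.V A A'} (L : s ⟶ s₀)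
    (m : F.mapV s ⟶ F.mapV s₀)
    (h : V2 (F.bsq L) m (F.coh.mapId A).inv (F.coh.mapId A').inv) : F.vmap L = m :=
  (F.vmap_V2 L).unique (φ := (F.coh.mapId A).symm) (ψ := (F.coh.mapId A').symm)
    (φ₁ := (F.coh.mapId A).symm) (ψ₁ := (F.coh.mapId A').symm) h rfl rfl

lemma comp_vmap {o : Ob → Ob'} {o' : Ob' → Ob''} (F : DblFun C D o) (G : DblFun D E o') {A A' : Ob}
    {s s₀ : C.pre.V A A'} (L : s ⟶ s₀) : (F.comp G).vmap L = G.vmap (F.vmap L) :=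
  vmap_of_id (F := F.comp G) _ _ ((G.bsq_V2 (F.vmap_V2 L)).comp (G.vmap_V2 (F.vmap L)))

lemma pair_vmap {o : Ob → Ob'} {o' : Ob → Ob''} (F : DblFun C D o) (G : DblFun C E o') {A A' : Ob}
    {s s₀ : C.pre.V A A'} (L : s ⟶ s₀) :
    (F.pair G).vmap L = BSq.vprod (F.vmap L) (G.vmap L) := rfl

lemma fst_vmap {A A' : Ob} {B B' : Ob'} {s s₀ : C.pre.V A A'} {t t₀ : D.pre.V B B'} (a : s ⟶ s₀)
    (b : t ⟶ t₀) : (DblFun.fst C D).vmap (BSq.vprod a b) = a :=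
  vmap_of_id (F := DblFun.fst C D) (A := (A, B)) (A' := (A', B')) _ _ (V2.refl a)

lemma snd_vmap {A A' : Ob} {B B' : Ob'} {s s₀ : C.pre.V A A'} {t t₀ : D.pre.V B B'} (a : s ⟶ s₀)
    (b : t ⟶ t₀) : (DblFun.snd C D).vmap (BSq.vprod a b) = b :=
  vmap_of_id (F := DblFun.snd C D) (A := (A, B)) (A' := (A', B')) _ _ (V2.refl b)

lemma id_vmap {A A' : Ob} {s s₀ : C.pre.V A A'} (a : s ⟶ s₀) : (DblFun.id C).vmap a = a :=
  vmap_of_id (F := DblFun.id C) _ _ (V2.refl a)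

lemma const_vmap (I : Ob') {A A' : Ob} {s s₀ : C.pre.V A A'} (a : s ⟶ s₀) :
    (DblFun.const C D I).vmap a = 𝟙 (D.pre.vid I) :=
  vmap_of_id (F := DblFun.const C D I) _ _
    ((DblFun.const C D I).bsq_hid s).inv
end DblFun
end

/-! ### Associators compared along icons -/

section
variable {Ob : Type u} {o : Ob → Ob → Ob} {X₁ X₂ X₃ X₁₂ X₂₃ Z : DblCat Ob}
  {S₁₂ : Bi X₁ X₂ X₁₂ o} {S₁₂_₃ : Bi X₁₂ X₃ Z o} {S₂₃ : Bi X₂ X₃ X₂₃ o} {S₁_₂₃ : Bi X₁ X₂₃ Z o}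

namespace HTrans
section
variable (a : Asc S₁₂ S₁₂_₃ S₂₃ S₁_₂₃) {A A' B B' E E' : Ob}

/-- The square of an associator at vertical 1-cells. -/
def q3 (s : X₁.pre.V A A') (t : X₂.pre.V B B') (r : X₃.pre.V E E') :
    BSq Z (S₁₂_₃.bv (S₁₂.bv s t) r) (S₁_₂₃.bv s (S₂₃.bv t r)) (a.a3 A B E) (a.a3 A' B' E') :=
  a.bsq (A := (A, B, E)) (A' := (A', B', E')) (s, t, r)

lemma n3_nat {f f' : X₁.c A ⟶ X₁.c A'} {g g' : X₂.c B ⟶ X₂.c B'} {h h' : X₃.c E ⟶ X₃.c E'}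
    (e₁ : f ≅ f') (e₂ : g ≅ g') (e₃ : h ≅ h') :
    OV (a.n3 f g h).hom (a.n3 f' g' h').hom (S₁₂_₃.bgI (S₁₂.bgI e₁ e₂) e₃ ⋆ₕ Iso.refl _)
      (Iso.refl _ ⋆ₕ S₁_₂₃.bgI e₁ (S₂₃.bgI e₂ e₃)) := by
  have h0 := a.nat_g (A := (A, B, E)) (B := (A', B', E')) (f := (f, g, h)) (g := (f', g', h'))
    ⟨(sq e₁.hom, sq e₂.hom, sq e₃.hom),
      Prod.ext e₁.hom.src_cell (Prod.ext e₂.hom.src_cell e₃.hom.src_cell),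
      Prod.ext e₁.hom.tgt_cell (Prod.ext e₂.hom.tgt_cell e₃.hom.tgt_cell)⟩
  have h1 : S₁₂_₃.bg (S₁₂.bg e₁.hom e₂.hom) e₃.hom ▷ a.a3 A' B' E' ≫ (a.n3 f' g' h').hom =
    (a.n3 f g h).hom ≫ a.a3 A B E ◁ S₁_₂₃.bg e₁.hom (S₂₃.bg e₂.hom e₃.hom) := h0
  unfold OV
  simp only [hIso_hom, Iso.refl_hom, whiskerLeft_id, id_whiskerRight, Category.id_comp,
    Category.comp_id, DblFun.bgI_hom]
  exact h1.symm

/-- Naturality of the associator in vertical isomorphisms. The work is to identify the values of the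
two ternary functors on a triple of squares with iterated values of the functors of two variables.
-/
lemma q3_vmap {s s₀ : X₁.pre.V A A'} {t t₀ : X₂.pre.V B B'} {r r₀ : X₃.pre.V E E'}
    (α : s ≅ s₀) (β : t ≅ t₀) (γ : r ≅ r₀) :
    Tw (a.q3 s t r) (a.q3 s₀ t₀ r₀) (𝟙 _) (𝟙 _) (S₁₂_₃.bvI (S₁₂.bvI α β) γ).hom
      (S₁_₂₃.bvI α (S₂₃.bvI β γ)).hom := by
  have h := a.bsq_vmap (A := (A, B, E)) (A' := (A', B', E')) (s := (s, t, r))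
    (s₀ := (s₀, t₀, r₀)) (BSq.vprod α.hom (BSq.vprod β.hom γ.hom))
  have h1 : (tensL S₁₂ S₁₂_₃).vmap (A := (A, B, E)) (A' := (A', B', E')) (s := (s, t, r))
    (s₀ := (s₀, t₀, r₀)) (BSq.vprod α.hom (BSq.vprod β.hom γ.hom)) =
      (S₁₂_₃.bvI (S₁₂.bvI α β) γ).hom := by
    have e1 : ((DblFun.snd X₁ (X₂.prod X₃)).comp (DblFun.fst X₂ X₃)).vmap (A := (A, B, E))
        (A' := (A', B', E')) (s := (s, t, r)) (s₀ := (s₀, t₀, r₀))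
        (BSq.vprod α.hom (BSq.vprod β.hom γ.hom)) = β.hom :=
      (DblFun.comp_vmap _ _ _).trans ((congrArg _ (DblFun.snd_vmap _ _)).trans
        (DblFun.fst_vmap _ _))
    have e2 : ((DblFun.snd X₁ (X₂.prod X₃)).comp (DblFun.snd X₂ X₃)).vmap (A := (A, B, E))
        (A' := (A', B', E')) (s := (s, t, r)) (s₀ := (s₀, t₀, r₀))
        (BSq.vprod α.hom (BSq.vprod β.hom γ.hom)) = γ.hom :=
      (DblFun.comp_vmap _ _ _).trans ((congrArg _ (DblFun.snd_vmap _ _)).trans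
        (DblFun.snd_vmap _ _))
    have e3 : (((DblFun.fst X₁ (X₂.prod X₃)).pair
        ((DblFun.snd X₁ (X₂.prod X₃)).comp (DblFun.fst X₂ X₃))).comp S₁₂).vmap (A := (A, B, E))
        (A' := (A', B', E')) (s := (s, t, r)) (s₀ := (s₀, t₀, r₀))
        (BSq.vprod α.hom (BSq.vprod β.hom γ.hom)) = (S₁₂.bvI α β).hom :=
      (DblFun.comp_vmap _ _ _).trans (congrArg S₁₂.vmap (congrArg₂ BSq.vprod
        (DblFun.fst_vmap _ _) e1))
    exact (DblFun.comp_vmap _ _ _).trans (congrArg S₁₂_₃.vmap (congrArg₂ BSq.vprod e3 e2))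
  have h2 : (tensR S₂₃ S₁_₂₃).vmap (A := (A, B, E)) (A' := (A', B', E')) (s := (s, t, r))
    (s₀ := (s₀, t₀, r₀)) (BSq.vprod α.hom (BSq.vprod β.hom γ.hom)) =
      (S₁_₂₃.bvI α (S₂₃.bvI β γ)).hom := by
    exact (DblFun.comp_vmap _ _ _).trans (congrArg S₁_₂₃.vmap (congrArg₂ BSq.vprod
      (DblFun.fst_vmap _ _) ((DblFun.comp_vmap _ _ _).trans
        (congrArg S₂₃.vmap (DblFun.snd_vmap _ _)))))
  rw [h1, h2] at h
  exact V2.of_eq h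
end
end HTrans

section
variable {K : DblCat Ob} {T : Bi K K K o}
  {Φ₁ : DblFun X₁ K (fun A => A)} {Φ₂ : DblFun X₂ K (fun A => A)} {Φ₃ : DblFun X₃ K (fun A => A)}
  {Φ₁₂ : DblFun X₁₂ K (fun A => A)} {Φ₂₃ : DblFun X₂₃ K (fun A => A)}
  {Ω : DblFun Z K (fun A => A)}

/-- The associator `a` corresponds to `aK` along invertible icons. -/
structure AOver (θ₁₂ : BOver Φ₁ Φ₂ Φ₁₂ T S₁₂) (θ₁₂_₃ : BOver Φ₁₂ Φ₃ Ω T S₁₂_₃)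
    (θ₂₃ : BOver Φ₂ Φ₃ Φ₂₃ T S₂₃) (θ₁_₂₃ : BOver Φ₁ Φ₂₃ Ω T S₁_₂₃) (aK : Asc T T T T)
    (a : Asc S₁₂ S₁₂_₃ S₂₃ S₁_₂₃) where
  i : ∀ A B E : Ob, aK.a3 A B E ≅ Ω.h (a.a3 A B E)
  n : ∀ {A A' B B' E E' : Ob} (f : X₁.c A ⟶ X₁.c A') (g : X₂.c B ⟶ X₂.c B')
    (h : X₃.c E ⟶ X₃.c E'),
    OV (aK.n3 (Φ₁.h f) (Φ₂.h g) (Φ₃.h h)).hom (Ω.g (a.n3 f g h).hom)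
      (Ω.lift2I (θ₁₂_₃.ext (θ₁₂.bc f g) (Iso.refl _)) (i A' B' E'))
      (Ω.lift2I (i A B E) (θ₁_₂₃.ext (Iso.refl _) (θ₂₃.bc g h)))
  s : ∀ {A A' B B' E E' : Ob} (s : X₁.pre.V A A') (t : X₂.pre.V B B') (r : X₃.pre.V E E'),
    Tw (aK.q3 (Φ₁.mapV s) (Φ₂.mapV t) (Φ₃.mapV r)) (Ω.bsq (a.q3 s t r)) (i A B E).hom
      (i A' B' E').hom (θ₁₂_₃.vext (θ₁₂.bw s t) (Iso.refl _)).hom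
      (θ₁_₂₃.vext (Iso.refl _) (θ₂₃.bw t r)).hom

namespace AOver
variable {θ₁₂ : BOver Φ₁ Φ₂ Φ₁₂ T S₁₂} {θ₁₂_₃ : BOver Φ₁₂ Φ₃ Ω T S₁₂_₃}
  {θ₂₃ : BOver Φ₂ Φ₃ Φ₂₃ T S₂₃} {θ₁_₂₃ : BOver Φ₁ Φ₂₃ Ω T S₁_₂₃} {aK : Asc T T T T}
  {a : Asc S₁₂ S₁₂_₃ S₂₃ S₁_₂₃} (u : AOver θ₁₂ θ₁₂_₃ θ₂₃ θ₁_₂₃ aK a) {A A' B B' E E' : Ob}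

/-- The field `n` covers only values of the functors `Φᵢ`; naturality of `aK` extends it to 1-cells
isomorphic to such values. The extension is indispensable, because a tensor product of values is in
general only isomorphic to a value. -/
lemma OV_n3 {k₁ : K.c A ⟶ K.c A'} {k₂ : K.c B ⟶ K.c B'} {k₃ : K.c E ⟶ K.c E'}
    {f : X₁.c A ⟶ X₁.c A'} {g : X₂.c B ⟶ X₂.c B'} {h : X₃.c E ⟶ X₃.c E'} (e₁ : k₁ ≅ Φ₁.h f)
    (e₂ : k₂ ≅ Φ₂.h g) (e₃ : k₃ ≅ Φ₃.h h) :
    OV (aK.n3 k₁ k₂ k₃).hom (Ω.g (a.n3 f g h).hom)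
      (Ω.lift2I (θ₁₂_₃.ext (θ₁₂.ext e₁ e₂) e₃) (u.i A' B' E'))
      (Ω.lift2I (u.i A B E) (θ₁_₂₃.ext e₁ (θ₂₃.ext e₂ e₃))) := by
  have h1 := (aK.n3_nat e₁ e₂ e₃).trans (u.n f g h)
  have h2 : (T.bgI (T.bgI e₁ e₂) e₃ ⋆ₕ Iso.refl _) ≪≫
      Ω.lift2I (θ₁₂_₃.ext (θ₁₂.bc f g) (Iso.refl _)) (u.i A' B' E') =
      Ω.lift2I (θ₁₂_₃.ext (θ₁₂.ext e₁ e₂) e₃) (u.i A' B' E') := by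
    simp only [DblFun.lift2I]
    rw [← Iso.trans_assoc, ← hIso_trans, ← BOver.ext_trans, Iso.trans_refl, Iso.refl_trans]; rfl
  have h3 : (Iso.refl _ ⋆ₕ T.bgI e₁ (T.bgI e₂ e₃)) ≪≫
      Ω.lift2I (u.i A B E) (θ₁_₂₃.ext (Iso.refl _) (θ₂₃.bc g h)) =
      Ω.lift2I (u.i A B E) (θ₁_₂₃.ext e₁ (θ₂₃.ext e₂ e₃)) := by
    simp only [DblFun.lift2I]
    rw [← Iso.trans_assoc, ← hIso_trans, ← BOver.ext_trans, Iso.trans_refl, Iso.refl_trans]; rfl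
  rwa [h2, h3] at h1

/-- The vertical counterpart of `OV_n3`, with isomorphisms in `vertCat` in place of invertible
2-cells. -/
lemma Tw_q3 {z₁ : K.pre.V A A'} {z₂ : K.pre.V B B'} {z₃ : K.pre.V E E'} {s : X₁.pre.V A A'}
    {t : X₂.pre.V B B'} {r : X₃.pre.V E E'} (α : z₁ ≅ Φ₁.mapV s) (β : z₂ ≅ Φ₂.mapV t)
    (γ : z₃ ≅ Φ₃.mapV r) :
    Tw (aK.q3 z₁ z₂ z₃) (Ω.bsq (a.q3 s t r)) (u.i A B E).hom (u.i A' B' E').hom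
      (θ₁₂_₃.vext (θ₁₂.vext α β) γ).hom (θ₁_₂₃.vext α (θ₂₃.vext β γ)).hom := by
  refine ((aK.q3_vmap α β γ).comp (u.s s t r)).congr (Category.id_comp _) (Category.id_comp _) ?_ ?_
  · rw [← Iso.trans_hom, ← BOver.vext_trans, Iso.trans_refl]; rfl
  · rw [← Iso.trans_hom, ← BOver.vext_trans, Iso.trans_refl]; rfl

/-- Naturality in a single variable is the full naturality cell at identities in the other two,
corrected by a unitor. The identities are compared through `mapId`, and the unitor corresponds by
the unit law of the icon. -/
lemma OV_nat₁ {k : K.c A ⟶ K.c A'} {f : X₁.c A ⟶ X₁.c A'} (e : k ≅ Φ₁.h f) (B E : Ob) :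
    OV (aK.nat₁ k B E) (Ω.g (a.nat₁ f B E))
      (Ω.lift2I (θ₁₂_₃.ext (θ₁₂.ext e (Φ₂.coh.mapId B)) (Φ₃.coh.mapId E)) (u.i A' B E))
      (Ω.lift2I (u.i A B E) (θ₁_₂₃.ext e (Φ₂₃.coh.mapId (o B E)))) :=
  DblFun.OV_comp (F := Ω) (u.OV_n3 _ _ _) (DblFun.OV_wl (F := Ω) _
    (θ₁_₂₃.OV_bg (DblFun.OV_id (F := Φ₁) _) (DblFun.OV_inv (F := Φ₂₃) (θ₂₃.OV_bu B E))))

lemma OV_nat₁' {k : K.c A ⟶ K.c A'} {f : X₁.c A ⟶ X₁.c A'} (e : k ≅ Φ₁.h f) (B E : Ob) :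
    OV (aK.nat₁' k B E) (Ω.g (a.nat₁' f B E))
      (Ω.lift2I (u.i A B E) (θ₁_₂₃.ext e (Φ₂₃.coh.mapId (o B E))))
      (Ω.lift2I (θ₁₂_₃.ext (θ₁₂.ext e (Φ₂.coh.mapId B)) (Φ₃.coh.mapId E)) (u.i A' B E)) :=
  DblFun.OV_comp (F := Ω) (DblFun.OV_wl (F := Ω) _
    (θ₁_₂₃.OV_bg (DblFun.OV_id (F := Φ₁) _) (θ₂₃.OV_bu B E)))
    (DblFun.OV_inv (F := Ω) (u.OV_n3 _ _ _))

lemma OV_nat₂ (A : Ob) {k : K.c B ⟶ K.c B'} {g : X₂.c B ⟶ X₂.c B'} (e : k ≅ Φ₂.h g) (E : Ob) :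
    OV (aK.nat₂ A k E) (Ω.g (a.nat₂ A g E))
      (Ω.lift2I (θ₁₂_₃.ext (θ₁₂.ext (Φ₁.coh.mapId A) e) (Φ₃.coh.mapId E)) (u.i A B' E))
      (Ω.lift2I (u.i A B E) (θ₁_₂₃.ext (Φ₁.coh.mapId A) (θ₂₃.ext e (Φ₃.coh.mapId E)))) :=
  u.OV_n3 _ _ _

lemma OV_nat₂' (A : Ob) {k : K.c B ⟶ K.c B'} {g : X₂.c B ⟶ X₂.c B'} (e : k ≅ Φ₂.h g) (E : Ob) :
    OV (aK.nat₂' A k E) (Ω.g (a.nat₂' A g E))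
      (Ω.lift2I (u.i A B E) (θ₁_₂₃.ext (Φ₁.coh.mapId A) (θ₂₃.ext e (Φ₃.coh.mapId E))))
      (Ω.lift2I (θ₁₂_₃.ext (θ₁₂.ext (Φ₁.coh.mapId A) e) (Φ₃.coh.mapId E)) (u.i A B' E)) :=
  DblFun.OV_inv (F := Ω) (u.OV_n3 _ _ _)

lemma OV_nat₃' (A B : Ob) {k : K.c E ⟶ K.c E'} {h : X₃.c E ⟶ X₃.c E'} (e : k ≅ Φ₃.h h) :
    OV (aK.nat₃' A B k) (Ω.g (a.nat₃' A B h))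
      (Ω.lift2I (u.i A B E) (θ₁_₂₃.ext (Φ₁.coh.mapId A) (θ₂₃.ext (Φ₂.coh.mapId B) e)))
      (Ω.lift2I (θ₁₂_₃.ext (Φ₁₂.coh.mapId (o A B)) e) (u.i A B E')) :=
  DblFun.OV_comp (F := Ω) (DblFun.OV_inv (F := Ω) (u.OV_n3 _ _ _)) (DblFun.OV_wr (F := Ω)
    (θ₁₂_₃.OV_bg (DblFun.OV_inv (F := Φ₁₂) (θ₁₂.OV_bu A B)) (DblFun.OV_id (F := Φ₃) _)) _)
end AOver
end
end

/-! ### Unit constraints compared along icons -/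

/-- The comparison of the vertical identity with its image. -/
def DblFun.vidI {Ob : Type u} {Ob' : Type u'} {C : DblCat.{u, v, w, x} Ob}
    {K : DblCat.{u', v', w', x'} Ob'} {o : Ob → Ob'} (F : DblFun C K o) (A : Ob) :
    K.pre.vid (o A) ≅ F.mapV (C.pre.vid A) := eqToIso (F.mapV_vid A).symm

section
variable {Ob : Type u} {o : Ob → Ob → Ob} {I : Ob} {X Y K : DblCat Ob}

namespace HTrans
section
variable {T : Bi Y X X o} (t : HTrans (T.sectL I) (DblFun.id X)) {A A' : Ob}

/-- The square of a left unit constraint at a vertical 1-cell. -/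
def lq (s : X.pre.V A A') : BSq X (T.bv (Y.pre.vid I) s) s (t.la A) (t.la A') := t.bsq s

lemma ln_nat {f f' : X.c A ⟶ X.c A'} (e : f ≅ f') :
    OV (t.ln f).hom (t.ln f').hom (T.bgI (Iso.refl _) e ⋆ₕ Iso.refl _) (Iso.refl _ ⋆ₕ e) := by
  have h1 : T.bg (𝟙 _) e.hom ▷ t.la A' ≫ (t.ln f').hom = (t.ln f).hom ≫ t.la A ◁ e.hom :=
    t.nat_g e.hom
  unfold OV
  simp only [hIso_hom, Iso.refl_hom, whiskerLeft_id, id_whiskerRight, Category.id_comp,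
    Category.comp_id, DblFun.bgI_hom]
  exact h1.symm

/-- Naturality in squares on identities, where the slot of the unit object contributes the identity
because a constant functor sends every square to an identity. -/
lemma lq_vmap {s s₀ : X.pre.V A A'} (α : s ≅ s₀) :
    Tw (t.lq s) (t.lq s₀) (𝟙 _) (𝟙 _) (T.bvI (Iso.refl _) α).hom α.hom := by
  have h := t.bsq_vmap α.hom
  have h1 : (T.sectL I).vmap α.hom = (T.bvI (Iso.refl _) α).hom :=
    (DblFun.comp_vmap _ _ _).trans (congrArg T.vmap (congrArg₂ BSq.vprod
      (DblFun.const_vmap I α.hom) (DblFun.id_vmap α.hom)))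
  rw [h1, DblFun.id_vmap] at h
  exact V2.of_eq h
end

section
variable {T : Bi X Y X o} (t : HTrans (T.sectR I) (DblFun.id X)) {A A' : Ob}

/-- The square of a right unit constraint at a vertical 1-cell. -/
def rq (s : X.pre.V A A') : BSq X (T.bv s (Y.pre.vid I)) s (t.ra A) (t.ra A') := t.bsq s

lemma rn_nat {f f' : X.c A ⟶ X.c A'} (e : f ≅ f') :
    OV (t.rn f).hom (t.rn f').hom (T.bgI e (Iso.refl _) ⋆ₕ Iso.refl _) (Iso.refl _ ⋆ₕ e) := by
  have h1 : T.bg e.hom (𝟙 _) ▷ t.ra A' ≫ (t.rn f').hom = (t.rn f).hom ≫ t.ra A ◁ e.hom :=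
    t.nat_g e.hom
  unfold OV
  simp only [hIso_hom, Iso.refl_hom, whiskerLeft_id, id_whiskerRight, Category.id_comp,
    Category.comp_id, DblFun.bgI_hom]
  exact h1.symm

lemma rq_vmap {s s₀ : X.pre.V A A'} (α : s ≅ s₀) :
    Tw (t.rq s) (t.rq s₀) (𝟙 _) (𝟙 _) (T.bvI α (Iso.refl _)).hom α.hom := by
  have h := t.bsq_vmap α.hom
  have h1 : (T.sectR I).vmap α.hom = (T.bvI α (Iso.refl _)).hom :=
    (DblFun.comp_vmap _ _ _).trans (congrArg T.vmap (congrArg₂ BSq.vprod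
      (DblFun.id_vmap α.hom) (DblFun.const_vmap I α.hom)))
  rw [h1, DblFun.id_vmap] at h
  exact V2.of_eq h
end
end HTrans

section
variable {Ψ : DblFun Y K (fun A => A)} {Φ : DblFun X K (fun A => A)} {T : Bi K K K o}

/-- The left unit constraint `t` corresponds to `tK` along an invertible icon. -/
structure LOver {S : Bi Y X X o} (θ : BOver Ψ Φ Φ T S) (tK : HTrans (T.sectL I) (DblFun.id K))
    (t : HTrans (S.sectL I) (DblFun.id X)) where
  i : ∀ A : Ob, tK.la A ≅ Φ.h (t.la A)
  n : ∀ {A A' : Ob} (f : X.c A ⟶ X.c A'),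
    OV (tK.ln (Φ.h f)).hom (Φ.g (t.ln f).hom)
      (Φ.lift2I (θ.ext (Ψ.coh.mapId I) (Iso.refl _)) (i A')) (Φ.lift2I (i A) (Iso.refl _))
  s : ∀ {A A' : Ob} (s : X.pre.V A A'),
    Tw (tK.lq (Φ.mapV s)) (Φ.bsq (t.lq s)) (i A).hom (i A').hom
      (θ.vext (Ψ.vidI I) (Iso.refl _)).hom (Iso.refl (Φ.mapV s)).hom

/-- The right unit constraint `t` corresponds to `tK` along an invertible icon. -/
structure ROver {S : Bi X Y X o} (θ : BOver Φ Ψ Φ T S) (tK : HTrans (T.sectR I) (DblFun.id K))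
    (t : HTrans (S.sectR I) (DblFun.id X)) where
  i : ∀ A : Ob, tK.ra A ≅ Φ.h (t.ra A)
  n : ∀ {A A' : Ob} (f : X.c A ⟶ X.c A'),
    OV (tK.rn (Φ.h f)).hom (Φ.g (t.rn f).hom)
      (Φ.lift2I (θ.ext (Iso.refl _) (Ψ.coh.mapId I)) (i A')) (Φ.lift2I (i A) (Iso.refl _))
  s : ∀ {A A' : Ob} (s : X.pre.V A A'),
    Tw (tK.rq (Φ.mapV s)) (Φ.bsq (t.rq s)) (i A).hom (i A').hom
      (θ.vext (Iso.refl _) (Ψ.vidI I)).hom (Iso.refl (Φ.mapV s)).hom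

namespace LOver
variable {S : Bi Y X X o} {θ : BOver Ψ Φ Φ T S} {tK : HTrans (T.sectL I) (DblFun.id K)}
  {t : HTrans (S.sectL I) (DblFun.id X)} (u : LOver θ tK t) {A A' : Ob}

/-- As for associators, naturality of `tK` extends the correspondence from values of `Φ` to all
1-cells isomorphic to such values. -/
lemma OV_ln {k : K.c A ⟶ K.c A'} {f : X.c A ⟶ X.c A'} (e : k ≅ Φ.h f) :
    OV (tK.ln k).hom (Φ.g (t.ln f).hom) (Φ.lift2I (θ.ext (Ψ.coh.mapId I) e) (u.i A'))
      (Φ.lift2I (u.i A) e) := by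
  have h1 := (tK.ln_nat e).trans (u.n f)
  have h2 : (T.bgI (Iso.refl _) e ⋆ₕ Iso.refl _) ≪≫
      Φ.lift2I (θ.ext (Ψ.coh.mapId I) (Iso.refl _)) (u.i A') =
      Φ.lift2I (θ.ext (Ψ.coh.mapId I) e) (u.i A') := by
    simp only [DblFun.lift2I]
    rw [← Iso.trans_assoc, ← hIso_trans, ← BOver.ext_trans, Iso.trans_refl, Iso.refl_trans,
      Iso.refl_trans]
  have h3 : (Iso.refl _ ⋆ₕ e) ≪≫ Φ.lift2I (u.i A) (Iso.refl _) = Φ.lift2I (u.i A) e := by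
    simp only [DblFun.lift2I]
    rw [← Iso.trans_assoc, ← hIso_trans, Iso.trans_refl, Iso.refl_trans]
  rwa [h2, h3] at h1

lemma Tw_lq {z : K.pre.V A A'} {s : X.pre.V A A'} (α : z ≅ Φ.mapV s) :
    Tw (tK.lq z) (Φ.bsq (t.lq s)) (u.i A).hom (u.i A').hom (θ.vext (Ψ.vidI I) α).hom α.hom := by
  refine ((tK.lq_vmap α).comp (u.s s)).congr (Category.id_comp _) (Category.id_comp _) ?_ ?_
  · rw [← Iso.trans_hom, ← BOver.vext_trans, Iso.trans_refl, Iso.refl_trans]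
  · rw [Iso.refl_hom, Category.comp_id]
end LOver

namespace ROver
variable {S : Bi X Y X o} {θ : BOver Φ Ψ Φ T S} {tK : HTrans (T.sectR I) (DblFun.id K)}
  {t : HTrans (S.sectR I) (DblFun.id X)} (u : ROver θ tK t) {A A' : Ob}

lemma OV_rn {k : K.c A ⟶ K.c A'} {f : X.c A ⟶ X.c A'} (e : k ≅ Φ.h f) :
    OV (tK.rn k).hom (Φ.g (t.rn f).hom) (Φ.lift2I (θ.ext e (Ψ.coh.mapId I)) (u.i A'))
      (Φ.lift2I (u.i A) e) := by
  have h1 := (tK.rn_nat e).trans (u.n f)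
  have h2 : (T.bgI e (Iso.refl _) ⋆ₕ Iso.refl _) ≪≫
      Φ.lift2I (θ.ext (Iso.refl _) (Ψ.coh.mapId I)) (u.i A') =
      Φ.lift2I (θ.ext e (Ψ.coh.mapId I)) (u.i A') := by
    simp only [DblFun.lift2I]
    rw [← Iso.trans_assoc, ← hIso_trans, ← BOver.ext_trans, Iso.trans_refl, Iso.refl_trans,
      Iso.refl_trans]
  have h3 : (Iso.refl _ ⋆ₕ e) ≪≫ Φ.lift2I (u.i A) (Iso.refl _) = Φ.lift2I (u.i A) e := by
    simp only [DblFun.lift2I]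
    rw [← Iso.trans_assoc, ← hIso_trans, Iso.trans_refl, Iso.refl_trans]
  rwa [h2, h3] at h1

lemma Tw_rq {z : K.pre.V A A'} {s : X.pre.V A A'} (α : z ≅ Φ.mapV s) :
    Tw (tK.rq z) (Φ.bsq (t.rq s)) (u.i A).hom (u.i A').hom (θ.vext α (Ψ.vidI I)).hom α.hom := by
  refine ((tK.rq_vmap α).comp (u.s s)).congr (Category.id_comp _) (Category.id_comp _) ?_ ?_
  · rw [← Iso.trans_hom, ← BOver.vext_trans, Iso.trans_refl, Iso.refl_trans]
  · rw [Iso.refl_hom, Category.comp_id]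
end ROver
end
end

/-! ### Reflection of the modification conditions -/

section
variable {Ob : Type u} {o : Ob → Ob → Ob} {X₁ X₂ X₃ X₄ X₁₂ X₂₃ X₃₄ X₁₂₃ X₂₃₄ Z K : DblCat Ob}
  {T₁₂ : Bi X₁ X₂ X₁₂ o} {T₁₂_₃ : Bi X₁₂ X₃ X₁₂₃ o} {T₂₃ : Bi X₂ X₃ X₂₃ o}
  {T₁_₂₃ : Bi X₁ X₂₃ X₁₂₃ o} {T₃₄ : Bi X₃ X₄ X₃₄ o} {T₂₃_₄ : Bi X₂₃ X₄ X₂₃₄ o}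
  {T₂_₃₄ : Bi X₂ X₃₄ X₂₃₄ o} {T₁₂₃_₄ : Bi X₁₂₃ X₄ Z o} {T₁_₂₃₄ : Bi X₁ X₂₃₄ Z o}
  {T₁₂_₃₄ : Bi X₁₂ X₃₄ Z o} {T : Bi K K K o}
  {Φ₁ : DblFun X₁ K (fun A => A)} {Φ₂ : DblFun X₂ K (fun A => A)} {Φ₃ : DblFun X₃ K (fun A => A)}
  {Φ₄ : DblFun X₄ K (fun A => A)} {Φ₁₂ : DblFun X₁₂ K (fun A => A)}
  {Φ₂₃ : DblFun X₂₃ K (fun A => A)} {Φ₃₄ : DblFun X₃₄ K (fun A => A)}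
  {Φ₁₂₃ : DblFun X₁₂₃ K (fun A => A)} {Φ₂₃₄ : DblFun X₂₃₄ K (fun A => A)}
  {Ω : DblFun Z K (fun A => A)}
  {θ₁₂ : BOver Φ₁ Φ₂ Φ₁₂ T T₁₂} {θ₁₂_₃ : BOver Φ₁₂ Φ₃ Φ₁₂₃ T T₁₂_₃} {θ₂₃ : BOver Φ₂ Φ₃ Φ₂₃ T T₂₃}
  {θ₁_₂₃ : BOver Φ₁ Φ₂₃ Φ₁₂₃ T T₁_₂₃} {θ₃₄ : BOver Φ₃ Φ₄ Φ₃₄ T T₃₄}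
  {θ₂₃_₄ : BOver Φ₂₃ Φ₄ Φ₂₃₄ T T₂₃_₄} {θ₂_₃₄ : BOver Φ₂ Φ₃₄ Φ₂₃₄ T T₂_₃₄}
  {θ₁₂₃_₄ : BOver Φ₁₂₃ Φ₄ Ω T T₁₂₃_₄} {θ₁_₂₃₄ : BOver Φ₁ Φ₂₃₄ Ω T T₁_₂₃₄}
  {θ₁₂_₃₄ : BOver Φ₁₂ Φ₃₄ Ω T T₁₂_₃₄} {aK : Asc T T T T}
  {a : Asc T₁₂ T₁₂_₃ T₂₃ T₁_₂₃} {a' : Asc T₁_₂₃ T₁₂₃_₄ T₂₃_₄ T₁_₂₃₄}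
  {a'' : Asc T₂₃ T₂₃_₄ T₃₄ T₂_₃₄} {c : Asc T₁₂_₃ T₁₂₃_₄ T₃₄ T₁₂_₃₄}
  {c' : Asc T₁₂ T₁₂_₃₄ T₂_₃₄ T₁_₂₃₄}

/-- The pentagon cells `q` correspond to `pK`. -/
def POver (u : AOver θ₁₂ θ₁₂_₃ θ₂₃ θ₁_₂₃ aK a) (u' : AOver θ₁_₂₃ θ₁₂₃_₄ θ₂₃_₄ θ₁_₂₃₄ aK a')
    (u'' : AOver θ₂₃ θ₂₃_₄ θ₃₄ θ₂_₃₄ aK a'') (y : AOver θ₁₂_₃ θ₁₂₃_₄ θ₃₄ θ₁₂_₃₄ aK c)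
    (y' : AOver θ₁₂ θ₁₂_₃₄ θ₂_₃₄ θ₁_₂₃₄ aK c') (pK : PCell aK aK aK aK aK)
    (q : PCell a a' a'' c c') : Prop := ∀ A B E G : Ob,
  OV (pK A B E G).hom (Ω.g (q A B E G).hom)
    (Ω.lift2I (θ₁₂₃_₄.ext (u.i A B E) (Φ₄.coh.mapId G)) (Ω.lift2I (u'.i A (o B E) G)
      (θ₁_₂₃₄.ext (Φ₁.coh.mapId A) (u''.i B E G))))
    (Ω.lift2I (y.i (o A B) E G) (y'.i A B (o E G)))

variable {u : AOver θ₁₂ θ₁₂_₃ θ₂₃ θ₁_₂₃ aK a} {u' : AOver θ₁_₂₃ θ₁₂₃_₄ θ₂₃_₄ θ₁_₂₃₄ aK a'}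
    {u'' : AOver θ₂₃ θ₂₃_₄ θ₃₄ θ₂_₃₄ aK a''} {y : AOver θ₁₂_₃ θ₁₂₃_₄ θ₃₄ θ₁₂_₃₄ aK c}
    {y' : AOver θ₁₂ θ₁₂_₃₄ θ₂_₃₄ θ₁_₂₃₄ aK c'} {pK : PCell aK aK aK aK aK}
    {q : PCell a a' a'' c c'}

/-- The condition for `pK` is taken at the images of the given cells. All naturality cells and
squares entering it correspond by `OV_n3` and `Tw_q3`, the pentagon cells by `hq`, so the condition
for `q` follows from faithfulness of `Ω`. -/
theorem POver.pMod (hq : POver u u' u'' y y' pK q) (hΩ : Ω.Faithful) (hp : PMod _ _ _ _ _ pK) :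
    PMod _ _ _ _ _ q where
  nat_h f g h k := by
    refine hΩ.natMod (hp.nat_h (Φ₁.h f) (Φ₂.h g) (Φ₃.h h) (Φ₄.h k)) (hq _ _ _ _) (hq _ _ _ _)
      (DblFun.OV_paste (F := Ω) (θ₁₂₃_₄.OV_natL (u.OV_n3 (Iso.refl _) (Iso.refl _) (Iso.refl _))
        (Iso.refl _)) (DblFun.OV_paste (F := Ω)
          (u'.OV_n3 (Iso.refl _) (θ₂₃.ext (Iso.refl _) (Iso.refl _)) (Iso.refl _))
          (θ₁_₂₃₄.OV_natR (Iso.refl _) (u''.OV_n3 (Iso.refl _) (Iso.refl _) (Iso.refl _)))))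
      (DblFun.OV_paste (F := Ω)
        (y.OV_n3 (θ₁₂.ext (Iso.refl _) (Iso.refl _)) (Iso.refl _) (Iso.refl _))
        (y'.OV_n3 (Iso.refl _) (Iso.refl _) (θ₃₄.ext (Iso.refl _) (Iso.refl _))))
  nat_v s t r z := by
    refine hΩ.V2_of_Tw (hp.nat_v (Φ₁.mapV s) (Φ₂.mapV t) (Φ₃.mapV r) (Φ₄.mapV z))
      (n := (T.bq (aK.q3 _ _ _) (BSq.hid _)).hc ((aK.q3 _ (T.bv _ _) _).hc
        (T.bq (BSq.hid _) (aK.q3 _ _ _))))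
      (n₀ := (T₁₂₃_₄.bq (a.q3 _ _ _) (BSq.hid _)).hc ((a'.q3 _ (T₂₃.bv _ _) _).hc
        (T₁_₂₃₄.bq (BSq.hid _) (a''.q3 _ _ _))))
      (m := (aK.q3 (T.bv _ _) _ _).hc (aK.q3 _ _ (T.bv _ _)))
      (m₀ := (c.q3 (T₁₂.bv _ _) _ _).hc (c'.q3 _ _ (T₃₄.bv _ _)))
      (Ω.Tw_hc (θ₁₂₃_₄.Tw_bq (u.Tw_q3 (Iso.refl _) (Iso.refl _) (Iso.refl _))
        (Φ₄.Tw_hid (Iso.refl _).hom)) (Ω.Tw_hc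
          (u'.Tw_q3 (Iso.refl _) (θ₂₃.vext (Iso.refl _) (Iso.refl _)) (Iso.refl _))
          (θ₁_₂₃₄.Tw_bq (Φ₁.Tw_hid (Iso.refl _).hom)
            (u''.Tw_q3 (Iso.refl _) (Iso.refl _) (Iso.refl _)))))
      (Ω.Tw_hc (y.Tw_q3 (θ₁₂.vext (Iso.refl _) (Iso.refl _)) (Iso.refl _) (Iso.refl _))
        (y'.Tw_q3 (Iso.refl _) (Iso.refl _) (θ₃₄.vext (Iso.refl _) (Iso.refl _))))
      (hq _ _ _ _) (hq _ _ _ _)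
end

section
variable {Ob : Type u} {o : Ob → Ob → Ob} {I : Ob} {X₁ X₂ X₃ Y Z K : DblCat Ob} {T : Bi K K K o}
  {aK : Asc T T T T} {lK : HTrans (T.sectL I) (DblFun.id K)} {rK : HTrans (T.sectR I) (DblFun.id K)}
  {Φ₁ : DblFun X₁ K (fun A => A)} {Φ₂ : DblFun X₂ K (fun A => A)} {Φ₃ : DblFun X₃ K (fun A => A)}
  {Ψ : DblFun Y K (fun A => A)} {Ω : DblFun Z K (fun A => A)}

section
variable {S : Bi X₁ X₂ X₂ o} {R : Bi X₂ X₃ Z o} {R' : Bi X₁ Z Z o} {a : Asc S R R R'}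
  {t : HTrans (S.sectL I) (DblFun.id X₂)} {t' : HTrans (R'.sectL I) (DblFun.id Z)}
  {θ : BOver Φ₁ Φ₂ Φ₂ T S} {η : BOver Φ₂ Φ₃ Ω T R} {η' : BOver Φ₁ Ω Ω T R'}

/-- The left unit cells `q` correspond to `pK`. -/
def LcOver (u : AOver θ η η η' aK a) (w : LOver θ lK t) (w' : LOver η' lK t')
    (pK : LCell aK lK lK) (q : LCell a t t') : Prop := ∀ A B : Ob,
  OV (pK A B).hom (Ω.g (q A B).hom) (η.ext (w.i A) (Φ₃.coh.mapId B))
    (Ω.lift2I (u.i I A B) (w'.i (o A B)))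

variable {u : AOver θ η η η' aK a} {w : LOver θ lK t} {w' : LOver η' lK t'}
    {pK : LCell aK lK lK} {q : LCell a t t'}

/-- The same reflection for unit cells. The slot of the unit object is compared through `mapId`
horizontally and through `vidI` vertically. -/
theorem LcOver.lMod (hq : LcOver u w w' pK q) (hΩ : Ω.Faithful) (hp : LMod _ _ _ pK) :
    LMod _ _ _ q where
  nat_h f g := by
    refine hΩ.natMod (hp.nat_h (Φ₂.h f) (Φ₃.h g)) (hq _ _) (hq _ _)
      (η.OV_natL (w.OV_ln (Iso.refl _)) (Iso.refl _))
      (DblFun.OV_paste (F := Ω) (u.OV_n3 (Φ₁.coh.mapId I) (Iso.refl _) (Iso.refl _))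
        (w'.OV_ln (η.ext (Iso.refl _) (Iso.refl _))))
  nat_v s r := by
    refine hΩ.V2_of_Tw (hp.nat_v (Φ₂.mapV s) (Φ₃.mapV r))
      (n := T.bq (lK.lq _) (BSq.hid _)) (n₀ := R.bq (t.lq _) (BSq.hid _))
      (m := (aK.q3 _ _ _).hc (lK.lq (T.bv _ _))) (m₀ := (a.q3 _ _ _).hc (t'.lq (R.bv _ _)))
      (η.Tw_bq (w.Tw_lq (Iso.refl _)) (Φ₃.Tw_hid (Iso.refl _).hom))
      (Ω.Tw_hc (u.Tw_q3 (Φ₁.vidI I) (Iso.refl _) (Iso.refl _))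
        (w'.Tw_lq (η.vext (Iso.refl _) (Iso.refl _))))
      (hq _ _) (hq _ _)
end

section
variable {S : Bi X₁ X₂ Z o} {R : Bi Z Y Z o} {S' : Bi X₂ Y X₂ o} {a : Asc S R S' S}
  {t : HTrans (S'.sectR I) (DblFun.id X₂)} {t' : HTrans (R.sectR I) (DblFun.id Z)}
  {θ : BOver Φ₁ Φ₂ Ω T S} {η : BOver Ω Ψ Ω T R} {θ' : BOver Φ₂ Ψ Φ₂ T S'}

/-- The right unit cells `q` correspond to `pK`. -/
def RcOver (u : AOver θ η θ' θ aK a) (w : ROver θ' rK t) (w' : ROver η rK t')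
    (pK : RCell aK rK rK) (q : RCell a t t') : Prop := ∀ A B : Ob,
  OV (pK A B).hom (Ω.g (q A B).hom) (w'.i (o A B))
    (Ω.lift2I (u.i A B I) (θ.ext (Φ₁.coh.mapId A) (w.i B)))

variable {u : AOver θ η θ' θ aK a} {w : ROver θ' rK t} {w' : ROver η rK t'}
  {pK : RCell aK rK rK} {q : RCell a t t'}

theorem RcOver.rMod (hq : RcOver u w w' pK q) (hΩ : Ω.Faithful) (hp : RMod _ _ _ pK) :
    RMod _ _ _ q where
  nat_h f g := by
    refine hΩ.natMod (hp.nat_h (Φ₁.h f) (Φ₂.h g)) (hq _ _) (hq _ _)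
      (w'.OV_rn (θ.ext (Iso.refl _) (Iso.refl _)))
      (DblFun.OV_paste (F := Ω) (u.OV_n3 (Iso.refl _) (Iso.refl _) (Ψ.coh.mapId I))
        (θ.OV_natR (Iso.refl _) (w.OV_rn (Iso.refl _))))
  nat_v s r := by
    refine hΩ.V2_of_Tw (hp.nat_v (Φ₁.mapV s) (Φ₂.mapV r))
      (n := rK.rq (T.bv _ _)) (n₀ := t'.rq (S.bv _ _))
      (m := (aK.q3 _ _ _).hc (T.bq (BSq.hid _) (rK.rq _)))
      (m₀ := (a.q3 _ _ _).hc (S.bq (BSq.hid _) (t.rq _)))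
      (w'.Tw_rq (θ.vext (Iso.refl _) (Iso.refl _)))
      (Ω.Tw_hc (u.Tw_q3 (Iso.refl _) (Iso.refl _) (Ψ.vidI I))
        (θ.Tw_bq (Φ₁.Tw_hid (Iso.refl _).hom) (w.Tw_rq (Iso.refl _))))
      (hq _ _) (hq _ _)
end

section
variable {S : Bi X₁ Y X₁ o} {R : Bi X₁ X₂ Z o} {S' : Bi Y X₂ X₂ o} {a : Asc S R S' R}
  {t : HTrans (S'.sectL I) (DblFun.id X₂)} {t' : HTrans (S.sectR I) (DblFun.id X₁)}
  {θ : BOver Φ₁ Ψ Φ₁ T S} {η : BOver Φ₁ Φ₂ Ω T R} {θ' : BOver Ψ Φ₂ Φ₂ T S'}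

/-- The middle unit cells `q` correspond to `pK`. -/
def McOver (u : AOver θ η θ' η aK a) (w : LOver θ' lK t) (w' : ROver θ rK t')
    (pK : MCell aK lK rK) (q : MCell a t t') : Prop := ∀ A B : Ob,
  OV (pK A B).hom (Ω.g (q A B).hom) (Ω.lift2I (u.i A I B) (η.ext (Φ₁.coh.mapId A) (w.i B)))
    (η.ext (w'.i A) (Φ₂.coh.mapId B))

variable {u : AOver θ η θ' η aK a} {w : LOver θ' lK t} {w' : ROver θ rK t'}
  {pK : MCell aK lK rK} {q : MCell a t t'}

theorem McOver.mMod (hq : McOver u w w' pK q) (hΩ : Ω.Faithful) (hp : MMod _ _ _ pK) :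
    MMod _ _ _ q where
  nat_h f g := by
    refine hΩ.natMod (hp.nat_h (Φ₁.h f) (Φ₂.h g)) (hq _ _) (hq _ _)
      (DblFun.OV_paste (F := Ω) (u.OV_n3 (Iso.refl _) (Ψ.coh.mapId I) (Iso.refl _))
        (η.OV_natR (Iso.refl _) (w.OV_ln (Iso.refl _))))
      (η.OV_natL (w'.OV_rn (Iso.refl _)) (Iso.refl _))
  nat_v s r := by
    refine hΩ.V2_of_Tw (hp.nat_v (Φ₁.mapV s) (Φ₂.mapV r))
      (n := (aK.q3 _ _ _).hc (T.bq (BSq.hid _) (lK.lq _)))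
      (n₀ := (a.q3 _ _ _).hc (R.bq (BSq.hid _) (t.lq _)))
      (m := T.bq (rK.rq _) (BSq.hid _)) (m₀ := R.bq (t'.rq _) (BSq.hid _))
      (Ω.Tw_hc (u.Tw_q3 (Iso.refl _) (Ψ.vidI I) (Iso.refl _))
        (η.Tw_bq (Φ₁.Tw_hid (Iso.refl _).hom) (w.Tw_lq (Iso.refl _))))
      (η.Tw_bq (w'.Tw_rq (Iso.refl _)) (Φ₂.Tw_hid (Iso.refl _).hom))
      (hq _ _) (hq _ _)
end
end

/-! ### Reflection of the associahedron and normalization axioms -/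

section
variable {Ob : Type u} {o : Ob → Ob → Ob} {I : Ob} {X Z : DblCat Ob} {K : DblCat.{u, v', w', x'} Ob}
  {mX : MonData X o I} {mK : MonData K o I}
  {Φ : DblFun X K (fun A => A)} {Ω : DblFun Z K (fun A => A)}
  {θ : BOver Φ Φ Φ mK.T mX.T} {u₀ : AOver θ θ θ θ mK.a mX.a} {l₀ : LOver θ mK.lu mX.lu}
  {r₀ : ROver θ mK.ru mX.ru}

section
variable {S : Bi X Z Z o} {L : LeftData mX S} {η : BOver Φ Ω Ω mK.T S}
  {y : AOver θ η η η mK.a L.a} {t : LOver η mK.lu L.lu}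

/-- The associahedron of the action mixes pentagon cells of the action with the pentagon cell of the
monoidal structure `mX`. All of them lie over pentagon cells of `mK`, so the equation is the
reflection of the associahedron of `mK`. -/
theorem LeftData.assoc5_of_over (h₀ : POver u₀ u₀ u₀ u₀ u₀ mK.p mX.p)
    (h : POver u₀ y y y y mK.p L.p) (hΩ : Ω.Faithful) (H : LeftLaws mK.left) (A B E G k : Ob) :
    Pasting5 (S.whL (mX.p A B E G).hom k) (L.p A B (o E G) k).hom
      (L.a.nat₃' A B (L.a.a3 E G k)) (L.p (o A B) E G k).hom
      (L.a.nat₂ A (mX.a.a3 B E G) k) (S.whR A (L.p B E G k).hom) (L.p A (o B E) G k).hom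
      (L.a.nat₁ (mX.a.a3 A B E) G k) (L.p A B E (o G k)).hom :=
  hΩ.pasting5 (H.assoc5 A B E G k) (η.OV_whL (h₀ A B E G) k) (h A B (o E G) k)
    (y.OV_nat₃' A B (y.i E G k)) (h (o A B) E G k) (y.OV_nat₂ A (u₀.i B E G) k)
    (η.OV_whR A (h B E G k)) (h A (o B E) G k) (y.OV_nat₁ (u₀.i A B E) G k) (h A B E (o G k))

/-- Left normalization involves the middle unit cell both of the action and of the acting structure,
whence the two hypotheses `hm` and `hm₀`. The left unit cell enters through its inverse. -/
theorem LeftData.normL_of_over (hp : POver u₀ y y y y mK.p L.p) (hm₀ : McOver u₀ l₀ r₀ mK.m mX.m)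
    (hm : McOver y t r₀ mK.m L.m) (hl : LcOver y l₀ t mK.l L.l) (hΩ : Ω.Faithful)
    (H : LeftLaws mK.left) (A B k : Ob) :
    PastingL (L.p A I B k).hom (L.m A (o B k)).hom (L.a.nat₁' (mX.ru.ra A) B k)
      (S.r2 A (L.a.a3 I B k) (L.lu.la (o B k)) ≫ S.bg (𝟙 _) (L.l B k).inv)
      (L.a.nat₂' A (mX.lu.la B) k)
      (S.l2 (mX.a.a3 A I B) (mX.T.bh (𝟙 _) (mX.lu.la B)) k ≫ S.bg (mX.m A B).hom (𝟙 _)) :=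
  hΩ.pastingL (H.normL A B k) (hp A I B k) (hm A (o B k)) (y.OV_nat₁' (r₀.i A) B k)
    (DblFun.OV_comp (F := Ω) (η.OV_r2 _ _ _)
      (η.OV_bg (DblFun.OV_id (F := Φ) _) (DblFun.OV_inv (F := Ω) (hl B k))))
    (y.OV_nat₂' A (l₀.i B) k)
    (DblFun.OV_comp (F := Ω) (η.OV_l2 _ _ _) (η.OV_bg (hm₀ A B) (DblFun.OV_id (F := Ω) _)))
end

section
variable {S : Bi Z X Z o} {R : RightData mX S} {η : BOver Ω Φ Ω mK.T S}
  {y : AOver η η θ η mK.a R.a} {t : ROver η mK.ru R.ru}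

theorem RightData.assoc5_of_over (h₀ : POver u₀ u₀ u₀ u₀ u₀ mK.p mX.p)
    (h : POver y y u₀ y y mK.p R.p) (hΩ : Ω.Faithful) (H : RightLaws mK.right) (k A B E G : Ob) :
    Pasting5 (S.whL (R.p k A B E).hom G) (R.p k A (o B E) G).hom
      (R.a.nat₃' k A (mX.a.a3 B E G)) (R.p (o k A) B E G).hom
      (R.a.nat₂ k (mX.a.a3 A B E) G) (S.whR k (mX.p A B E G).hom) (R.p k (o A B) E G).hom
      (R.a.nat₁ (R.a.a3 k A B) E G) (R.p k A B (o E G)).hom :=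
  hΩ.pasting5 (H.assoc5 k A B E G) (η.OV_whL (h k A B E) G) (h k A (o B E) G)
    (y.OV_nat₃' k A (u₀.i B E G)) (h (o k A) B E G) (y.OV_nat₂ k (u₀.i A B E) G)
    (η.OV_whR k (h₀ A B E G)) (h k (o A B) E G) (y.OV_nat₁ (y.i k A B) E G) (h k A B (o E G))

/-- Mirror image of the left case: the right unit cell of the action now enters directly, and the
acting structure contributes its middle unit cell in the second variable. -/
theorem RightData.normR_of_over (hp : POver y y u₀ y y mK.p R.p) (hm₀ : McOver u₀ l₀ r₀ mK.m mX.m)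
    (hm : McOver y l₀ t mK.m R.m) (hr : RcOver y r₀ t mK.r R.r) (hΩ : Ω.Faithful)
    (H : RightLaws mK.right) (k A B : Ob) :
    PastingR (R.p k A I B).hom (R.a.nat₃' k A (mX.lu.la B)) (R.m (o k A) B).hom
      (S.bg (R.r k A).hom (𝟙 (𝟙 (X.c B))) ≫ S.l2' (R.a.a3 k A I) (S.bh (𝟙 _) (mX.ru.ra A)) B)
      (S.r2 k (mX.a.a3 A I B) (mX.T.bh (𝟙 _) (mX.lu.la B)) ≫ S.bg (𝟙 _) (mX.m A B).hom)
      (R.a.nat₂' k (mX.ru.ra A) B) :=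
  hΩ.pastingR (H.normR k A B) (hp k A I B) (y.OV_nat₃' k A (l₀.i B)) (hm (o k A) B)
    (DblFun.OV_comp (F := Ω) (η.OV_bg (hr k A) (DblFun.OV_id (F := Φ) _)) (η.OV_l2' _ _ _))
    (DblFun.OV_comp (F := Ω) (η.OV_r2 _ _ _)
      (η.OV_bg (DblFun.OV_id (F := Ω) _) (hm₀ A B)))
    (y.OV_nat₂' k (r₀.i A) B)
end
end

/-! ### Identity icons and products of functors -/

section
variable {Ob : Type u} {Ob' : Type u'} {C : DblCat.{u, v, w, x} Ob}
  {K : DblCat.{u', v', w', x'} Ob'} {o : Ob → Ob'}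

/-- The unitors in the middle of the vertical composite cancel, leaving conjugation of the composed
image by the outer unitors. -/
lemma DblFun.vmap_vcomp (F : DblFun C K o) {A A' A'' : Ob} {s t : C.pre.V A A'}
    {s' t' : C.pre.V A' A''} {z z' : C.pre.V A A''} (a : z ⟶ z') (b : s ⟶ t) (b' : s' ⟶ t')
    (h : a.cell = vc b.cell b'.cell) : (F.vmap a).cell = vc (F.vmap b).cell (F.vmap b').cell := by
  have h1 := V2.vc (F.vmap_V2 b) (F.vmap_V2 b')
  have h2 := F.vmap_V2 a
  have h3 : (F.bsq a).cell = (BSq.vc (F.bsq b) (F.bsq b')).cell :=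
    (congrArg F.mapSq h).trans (F.mapSq_scomp _ _)
  have h4 : vc (sq (F.coh.mapId A).inv) (F.vmap a).cell =
      vc (sq (F.coh.mapId A).inv) (vc (F.vmap b).cell (F.vmap b').cell) :=
    (Eq.symm h2).trans ((congrArg (fun t => vc t _) h3).trans h1)
  have h5 : vc (sq (F.coh.mapId A).hom) (sq (F.coh.mapId A).inv) = sq (𝟙 (𝟙 (K.c (o A)))) :=
    congrArg PreDbl.Glob.cell (F.coh.mapId A).hom_inv_id
  have h6 {X Y : K.Cell} {f : X ⟶ Y} (n : Sq (𝟙 (K.c (o A))) f) :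
      vc (sq (F.coh.mapId A).hom) (vc (sq (F.coh.mapId A).inv) n) = n :=
    (K.pre.scomp_assoc _ _ _).symm.trans ((congrArg (fun t => vc t _) h5).trans
      (K.pre.sid_scomp _))
  exact (h6 _).symm.trans ((congrArg (vc _) h4).trans (h6 _))

lemma DblFun.vmap_vid (F : DblFun C K o) {A : Ob} {z z' : C.pre.V A A} (a : z ⟶ z')
    (h : a.cell = sq (𝟙 (𝟙 (C.c A)))) : (F.vmap a).cell = sq (𝟙 (𝟙 (K.c (o A)))) := by
  have h1 : (F.bsq a).cell = sq (𝟙 (F.h (𝟙 (C.c A)))) := (congrArg F.mapSq h).trans (F.mapSq_sid _)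
  refine (congrArg (fun t => vc (sq (F.coh.mapId A).hom) (vc t (sq (F.coh.mapId A).inv)))
    h1).trans ?_
  refine (congrArg (vc _) (K.pre.sid_scomp _)).trans ?_
  exact congrArg PreDbl.Glob.cell (F.coh.mapId A).hom_inv_id

lemma DblFun.refl_cell_vcomp (F : DblFun C K o) {A A' A'' : Ob} (s : C.pre.V A A')
    (s' : C.pre.V A' A'') : (Iso.refl (F.mapV (C.pre.vcomp s s'))).hom.cell =
      vc (Iso.refl (F.mapV s)).hom.cell (Iso.refl (F.mapV s')).hom.cell :=
  (congrArg hi (F.mapV_vcomp s s')).trans (K.pre.shid_vcomp _ _)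

lemma DblFun.refl_cell_vid (F : DblFun C K o) (A : Ob) :
    (Iso.refl (F.mapV (C.pre.vid A))).hom.cell = sq (𝟙 (𝟙 (K.c (o A)))) :=
  (congrArg hi (F.mapV_vid A)).trans (K.pre.shid_vid _)

lemma DblFun.vidI_cell (F : DblFun C K o) (A : Ob) :
    (F.vidI A).hom.cell = sq (𝟙 (𝟙 (K.c (o A)))) :=
  (BSq.cell_eqToHom (F.mapV_vid A).symm).trans (K.pre.shid_vid _)

/-- The identity icon. -/
def OIcon.refl (F : DblFun C K o) : OIcon F F where
  c f := Iso.refl _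
  v s := Iso.refl _
  c_comp f g := by rw [hIso_refl]; unfold OV; simp
  c_id A := Category.comp_id _
  v_vcomp s t := DblFun.refl_cell_vcomp F s t
  v_vid A := DblFun.refl_cell_vid F A
  c_sq n := Tw.refl _

/-- Read through `lift2I`, which already contains it, a compositor corresponds to an identity.
Compositors of the functors `Φᵢ` thus drop out of later computations. -/
lemma DblFun.OV_mapComp (F : DblFun C K o) {A B E : Ob} (f : C.c A ⟶ C.c B) (g : C.c B ⟶ C.c E) :
    OV (F.coh.mapComp f g).hom (F.g (𝟙 (f ≫ g))) (F.lift2I (Iso.refl _) (Iso.refl _))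
      (Iso.refl _) := by
  unfold OV
  rw [F.g_id, DblFun.lift2I, hIso_refl]; simp

lemma DblFun.OV_mapId (F : DblFun C K o) (A : Ob) :
    OV (F.coh.mapId A).hom (F.g (𝟙 (𝟙 (C.c A)))) (F.coh.mapId A) (Iso.refl _) := by
  unfold OV
  rw [F.g_id]; rfl

lemma DblFun.id_lift2I {A B E : Ob} {k f : C.c A ⟶ C.c B} {l g : C.c B ⟶ C.c E} (e : k ≅ f)
    (d : l ≅ g) : (DblFun.id C).lift2I e d = e ⋆ₕ d := Iso.trans_refl _

/-- The product of two pseudo double functors. -/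
def DblFun.prodMap {Ob₁ : Type u''} {Ob₂ : Type*} {C' : DblCat.{u'', v'', w'', x''} Ob₁}
    {K' : DblCat Ob₂} {o' : Ob₁ → Ob₂} (F : DblFun C K o) (G : DblFun C' K' o') :
    DblFun (C.prod C') (K.prod K') (fun p => (o p.1, o' p.2)) where
  mapV s := (F.mapV s.1, G.mapV s.2)
  mapH f := (F.mapH f.1, G.mapH f.2)
  mapSq a := (F.mapSq a.1, G.mapSq a.2)
  src_mapSq _ := Prod.ext (F.src_mapSq _) (G.src_mapSq _)
  tgt_mapSq _ := Prod.ext (F.tgt_mapSq _) (G.tgt_mapSq _)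
  mapV_vid _ := Prod.ext (F.mapV_vid _) (G.mapV_vid _)
  mapV_vcomp _ _ := Prod.ext (F.mapV_vcomp _ _) (G.mapV_vcomp _ _)
  mapSq_sid _ := Prod.ext (F.mapSq_sid _) (G.mapSq_sid _)
  mapSq_scomp _ _ := Prod.ext (F.mapSq_scomp _ _) (G.mapSq_scomp _ _)
  coh :=
  { mapComp f g := PreDbl.prodIso (F.coh.mapComp f.1 g.1) (G.coh.mapComp f.2 g.2)
    mapId A := PreDbl.prodIso (F.coh.mapId A.1) (G.coh.mapId A.2)
    mapComp_nat a b e := Prod.ext (F.coh.mapComp_nat a.1 b.1 (congrArg Prod.fst e))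
      (G.coh.mapComp_nat a.2 b.2 (congrArg Prod.snd e))
    mapId_nat s := Prod.ext (F.coh.mapId_nat s.1) (G.coh.mapId_nat s.2)
    map_assoc f g k := PreDbl.Glob.ext (Prod.ext
      (congrArg PreDbl.Glob.cell (F.coh.map_assoc f.1 g.1 k.1))
      (congrArg PreDbl.Glob.cell (G.coh.map_assoc f.2 g.2 k.2)))
    map_leftUnitor f := PreDbl.Glob.ext (Prod.ext
      (congrArg PreDbl.Glob.cell (F.coh.map_leftUnitor f.1))
      (congrArg PreDbl.Glob.cell (G.coh.map_leftUnitor f.2)))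
    map_rightUnitor f := PreDbl.Glob.ext (Prod.ext
      (congrArg PreDbl.Glob.cell (F.coh.map_rightUnitor f.1))
      (congrArg PreDbl.Glob.cell (G.coh.map_rightUnitor f.2))) }
end

/-! ### Side squares of icons under vertical composition -/

namespace BOver
variable {Ob : Type u} {o : Ob → Ob → Ob} {X Y Z X' Y' Z' : DblCat Ob}
  {Φ : DblFun X' X (fun A => A)} {Ψ : DblFun Y' Y (fun A => A)}
  {Ω : DblFun Z' Z (fun A => A)} {T : Bi X Y Z o} {S : Bi X' Y' Z' o} (θ : BOver Φ Ψ Ω T S)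
  {A A' A'' Q Q' Q'' : Ob}

lemma ext_refl {B R : Ob} (f : X'.c A ⟶ X'.c B) (g : Y'.c Q ⟶ Y'.c R) :
    θ.ext (Iso.refl (Φ.h f)) (Iso.refl (Ψ.h g)) = θ.bc f g := by
  rw [ext, DblFun.bgI_refl, Iso.refl_trans]

lemma vext_refl (s : X'.pre.V A A') (t : Y'.pre.V Q Q') :
    θ.vext (Iso.refl (Φ.mapV s)) (Iso.refl (Ψ.mapV t)) = θ.bw s t := by
  rw [vext, DblFun.bvI_refl, Iso.refl_trans]

/-- Both factors of `vext`, a value of `T` and a square of the icon, respect vertical composition,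
and interchange combines them. The equations `hs`, `ht` are hypotheses because nested uses meet
vertical composites that are only propositionally of the required form. -/
lemma vext_vcomp {z : X.pre.V A A'} {z' : X.pre.V A' A''} {z'' : X.pre.V A A''}
    {y : Y.pre.V Q Q'} {y' : Y.pre.V Q' Q''} {y'' : Y.pre.V Q Q''} {s : X'.pre.V A A'}
    {s' : X'.pre.V A' A''} {t : Y'.pre.V Q Q'} {t' : Y'.pre.V Q' Q''}
    {s'' : X'.pre.V A A''} {t'' : Y'.pre.V Q Q''} (hs : s'' = X'.pre.vcomp s s')
    (ht : t'' = Y'.pre.vcomp t t') {a : z ≅ Φ.mapV s} {a' : z' ≅ Φ.mapV s'} {a'' : z'' ≅ Φ.mapV s''}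
    {b : y ≅ Ψ.mapV t} {b' : y' ≅ Ψ.mapV t'} {b'' : y'' ≅ Ψ.mapV t''}
    (ha : a''.hom.cell = vc a.hom.cell a'.hom.cell)
    (hb : b''.hom.cell = vc b.hom.cell b'.hom.cell) :
    (θ.vext a'' b'').hom.cell = vc (θ.vext a b).hom.cell (θ.vext a' b').hom.cell := by
  subst hs ht
  refine Eq.trans (BSq.lact_cell_congr (L' := BSq.vc (T.bvI a b).hom (T.bvI a' b').hom)
    (n' := BSq.vc (θ.bw s t).hom (θ.bw s' t').hom)
    (T.vmap_vcomp (A := (A, Q)) (A' := (A', Q')) (A'' := (A'', Q''))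
      (BSq.vprod a''.hom b''.hom) (BSq.vprod a.hom b.hom) (BSq.vprod a'.hom b'.hom)
      (Prod.ext ha hb))
    (θ.v_vcomp (A := (A, Q)) (A' := (A', Q')) (A'' := (A'', Q'')) (s, t) (s', t'))) ?_
  exact congrArg BSq.cell (BSq.lact_vc (T.bvI a b).hom (T.bvI a' b').hom (θ.bw s t).hom
    (θ.bw s' t').hom)

lemma vext_vid {z : X.pre.V A A} {y : Y.pre.V Q Q} {s : X'.pre.V A A} {t : Y'.pre.V Q Q}
    (hs : s = X'.pre.vid A) (ht : t = Y'.pre.vid Q) {a : z ≅ Φ.mapV s} {b : y ≅ Ψ.mapV t}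
    (ha : a.hom.cell = sq (𝟙 (𝟙 (X.c A)))) (hb : b.hom.cell = sq (𝟙 (𝟙 (Y.c Q)))) :
    (θ.vext a b).hom.cell = sq (𝟙 (𝟙 (Z.c (o A Q)))) := by
  subst hs ht
  refine Eq.trans (BSq.lact_cell_congr (L' := BSq.hid (Z.pre.vid (o A Q)))
    (n' := BSq.hid (Z.pre.vid (o A Q)))
    ((T.vmap_vid (A := (A, Q)) (BSq.vprod a.hom b.hom) (Prod.ext ha hb)).trans
      (Z.pre.shid_vid _).symm)
    ((θ.v_vid (A, Q)).trans (Z.pre.shid_vid _).symm)) ?_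
  rw [BSq.lact_hid]; exact Z.pre.shid_vid _
end BOver

/-! ### Icons between ternary functors -/

section
variable {Ob : Type u} {o : Ob → Ob → Ob} {X₁ X₂ X₃ X₁₂ X₂₃ K : DblCat Ob}

section
variable {S₁₂ : Bi X₁ X₂ X₁₂ o} {S₁₂_₃ : Bi X₁₂ X₃ K o} {S₂₃ : Bi X₂ X₃ X₂₃ o}
  {S₁_₂₃ : Bi X₁ X₂₃ K o} {A A' A'' B B' B'' E E' E'' : Ob}

/-- In the compositor of the iterated composite functor the projections contribute only identities;
what remains is the outer compositor followed by the value at the inner one. -/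
lemma tensL_mapComp (f : X₁.c A ⟶ X₁.c A') (g : X₂.c B ⟶ X₂.c B') (h : X₃.c E ⟶ X₃.c E')
    (f' : X₁.c A' ⟶ X₁.c A'') (g' : X₂.c B' ⟶ X₂.c B'') (h' : X₃.c E' ⟶ X₃.c E'') :
    ((tensL S₁₂ S₁₂_₃).coh.mapComp (A := (A, B, E)) (B := (A', B', E')) (E := (A'', B'', E''))
      (f, g, h) (f', g', h')).hom =
      (S₁₂_₃.bc (S₁₂.bh f g) h (S₁₂.bh f' g') h').hom ≫ S₁₂_₃.bg (S₁₂.bc f g f' g').hom (𝟙 _) := by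
  show _ ≫ S₁₂_₃.bg ((S₁₂.bc f g f' g').hom ≫ S₁₂.bg (𝟙 _) (𝟙 _ ≫ 𝟙 _)) (𝟙 _ ≫ 𝟙 _) = _
  rw [Category.comp_id, Category.comp_id, DblFun.bg_id, Category.comp_id]; rfl

lemma tensR_mapComp (f : X₁.c A ⟶ X₁.c A') (g : X₂.c B ⟶ X₂.c B') (h : X₃.c E ⟶ X₃.c E')
    (f' : X₁.c A' ⟶ X₁.c A'') (g' : X₂.c B' ⟶ X₂.c B'') (h' : X₃.c E' ⟶ X₃.c E'') :
    ((tensR S₂₃ S₁_₂₃).coh.mapComp (A := (A, B, E)) (B := (A', B', E')) (E := (A'', B'', E''))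
      (f, g, h) (f', g', h')).hom =
      (S₁_₂₃.bc f (S₂₃.bh g h) f' (S₂₃.bh g' h')).hom ≫ S₁_₂₃.bg (𝟙 _) (S₂₃.bc g h g' h').hom := by
  show _ ≫ S₁_₂₃.bg (𝟙 _) ((S₂₃.bc g h g' h').hom ≫ S₂₃.bg (𝟙 _) (𝟙 _)) = _
  rw [DblFun.bg_id, Category.comp_id]; rfl

lemma tensL_mapId (A B E : Ob) :
    ((tensL S₁₂ S₁₂_₃).coh.mapId (A, B, E)).hom =
      (S₁₂_₃.bu (o A B) E).hom ≫ S₁₂_₃.bg (S₁₂.bu A B).hom (𝟙 _) := by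
  show _ ≫ S₁₂_₃.bg ((S₁₂.bu A B).hom ≫ S₁₂.bg (𝟙 _) (𝟙 _ ≫ 𝟙 _)) (𝟙 _ ≫ 𝟙 _) = _
  rw [Category.comp_id, Category.comp_id, DblFun.bg_id, Category.comp_id]; rfl

lemma tensR_mapId (A B E : Ob) :
    ((tensR S₂₃ S₁_₂₃).coh.mapId (A, B, E)).hom =
      (S₁_₂₃.bu A (o B E)).hom ≫ S₁_₂₃.bg (𝟙 _) (S₂₃.bu B E).hom := by
  show _ ≫ S₁_₂₃.bg (𝟙 _) ((S₂₃.bu B E).hom ≫ S₂₃.bg (𝟙 _) (𝟙 _)) = _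
  rw [DblFun.bg_id, Category.comp_id]; rfl
end

/-- Removes the identity functor and superfluous identity cells, which occur because the codomain of
the ternary functors lies over `K` by the identity. -/
lemma OV.of_idFun {A B E : Ob} {k f : K.c A ⟶ K.c B} {l g : K.c B ⟶ K.c E} {m p q : K.c A ⟶ K.c E}
    {e : k ≅ f} {d : l ≅ g} {n : k ≫ l ⟶ m} {a : f ≫ g ⟶ p} {b : p ⟶ q} {R : m ≅ q}
    (h : OV n (((DblFun.id K).g a ≫ (DblFun.id K).g b) ≫ (DblFun.id K).g (𝟙 q))
      ((DblFun.id K).lift2I e d) R) : OV n (a ≫ b) (e ⋆ₕ d) R := by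
  have h' : n ≫ R.hom = ((e ⋆ₕ d).hom ≫ 𝟙 _) ≫ ((a ≫ b) ≫ 𝟙 _) := h
  rw [Category.comp_id, Category.comp_id] at h'
  exact h'

variable {T : Bi K K K o} {Φ₁ : DblFun X₁ K (fun A => A)} {Φ₂ : DblFun X₂ K (fun A => A)}
  {Φ₃ : DblFun X₃ K (fun A => A)} {Φ₁₂ : DblFun X₁₂ K (fun A => A)}
  {Φ₂₃ : DblFun X₂₃ K (fun A => A)} {S₁₂ : Bi X₁ X₂ X₁₂ o} {S₁₂_₃ : Bi X₁₂ X₃ K o}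
  {S₂₃ : Bi X₂ X₃ X₂₃ o} {S₁_₂₃ : Bi X₁ X₂₃ K o}

namespace BOver
section
variable (θ : BOver Φ₁ Φ₂ Φ₁₂ T S₁₂) (η : BOver Φ₁₂ Φ₃ (DblFun.id K) T S₁₂_₃)
  {A A' A'' B B' B'' E E' E'' : Ob}

/-- Three correspondences are composed: for the outer compositor, for the inner one, and for the
compositors of the functors `Φᵢ`, which correspond to identities. -/
lemma tensL_comp (f : X₁.c A ⟶ X₁.c A') (g : X₂.c B ⟶ X₂.c B') (h : X₃.c E ⟶ X₃.c E')
    (f' : X₁.c A' ⟶ X₁.c A'') (g' : X₂.c B' ⟶ X₂.c B'') (h' : X₃.c E' ⟶ X₃.c E'') :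
    OV (((T.bc _ _ _ _).hom ≫ T.bg (T.bc _ _ _ _).hom (𝟙 _)) ≫
        T.bg (T.bg (Φ₁.coh.mapComp f f').hom (Φ₂.coh.mapComp g g').hom) (Φ₃.coh.mapComp h h').hom)
      ((S₁₂_₃.bc (S₁₂.bh f g) h (S₁₂.bh f' g') h').hom ≫ S₁₂_₃.bg (S₁₂.bc f g f' g').hom (𝟙 _))
      (η.ext (θ.bc f g) (Iso.refl (Φ₃.h h)) ⋆ₕ η.ext (θ.bc f' g') (Iso.refl (Φ₃.h h')))
      (η.ext (θ.bc (f ≫ f') (g ≫ g')) (Iso.refl (Φ₃.h (h ≫ h')))) := by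
  have h1 := η.OV_bc (θ.ext (Iso.refl (Φ₁.h f)) (Iso.refl (Φ₂.h g))) (Iso.refl (Φ₃.h h))
    (θ.ext (Iso.refl (Φ₁.h f')) (Iso.refl (Φ₂.h g'))) (Iso.refl (Φ₃.h h'))
  have h2 := η.OV_bg (θ.OV_bc (Iso.refl (Φ₁.h f)) (Iso.refl (Φ₂.h g)) (Iso.refl (Φ₁.h f'))
    (Iso.refl (Φ₂.h g'))) (DblFun.OV_id (F := Φ₃)
      (Φ₃.lift2I (Iso.refl (Φ₃.h h)) (Iso.refl (Φ₃.h h'))))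
  have h3 := η.OV_bg (θ.OV_bg (Φ₁.OV_mapComp f f') (Φ₂.OV_mapComp g g')) (Φ₃.OV_mapComp h h')
  have h4 := (h1.comp h2).comp h3
  rw [DblFun.bg_id, DblFun.bg_id, ext_refl, ext_refl, ext_refl] at h4
  exact OV.of_idFun h4

lemma prodMap_tensL_mapComp (f : X₁.c A ⟶ X₁.c A') (g : X₂.c B ⟶ X₂.c B') (h : X₃.c E ⟶ X₃.c E')
    (f' : X₁.c A' ⟶ X₁.c A'') (g' : X₂.c B' ⟶ X₂.c B'') (h' : X₃.c E' ⟶ X₃.c E'') :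
    (((Φ₁.prodMap (Φ₂.prodMap Φ₃)).comp (_root_.tensL T T)).coh.mapComp (A := (A, B, E))
      (B := (A', B', E')) (E := (A'', B'', E'')) (f, g, h) (f', g', h')).hom =
      ((T.bc (T.bh (Φ₁.h f) (Φ₂.h g)) (Φ₃.h h) (T.bh (Φ₁.h f') (Φ₂.h g')) (Φ₃.h h')).hom ≫
        T.bg (T.bc (Φ₁.h f) (Φ₂.h g) (Φ₁.h f') (Φ₂.h g')).hom (𝟙 _)) ≫
        T.bg (T.bg (Φ₁.coh.mapComp f f').hom (Φ₂.coh.mapComp g g').hom) (Φ₃.coh.mapComp h h').hom :=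
  congrArg (fun t => t ≫ T.bg (T.bg (Φ₁.coh.mapComp f f').hom (Φ₂.coh.mapComp g g').hom)
    (Φ₃.coh.mapComp h h').hom) (tensL_mapComp (S₁₂ := T) (S₁₂_₃ := T) (Φ₁.h f) (Φ₂.h g) (Φ₃.h h)
      (Φ₁.h f') (Φ₂.h g') (Φ₃.h h'))

lemma tensL_comp' (f : X₁.c A ⟶ X₁.c A') (g : X₂.c B ⟶ X₂.c B') (h : X₃.c E ⟶ X₃.c E')
    (f' : X₁.c A' ⟶ X₁.c A'') (g' : X₂.c B' ⟶ X₂.c B'') (h' : X₃.c E' ⟶ X₃.c E'') :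
    OV (((Φ₁.prodMap (Φ₂.prodMap Φ₃)).comp (_root_.tensL T T)).coh.mapComp (A := (A, B, E))
      (B := (A', B', E')) (E := (A'', B'', E'')) (f, g, h) (f', g', h')).hom
      ((_root_.tensL S₁₂ S₁₂_₃).coh.mapComp (A := (A, B, E))
      (B := (A', B', E')) (E := (A'', B'', E'')) (f, g, h) (f', g', h')).hom
      (η.ext (θ.bc f g) (Iso.refl (Φ₃.h h)) ⋆ₕ η.ext (θ.bc f' g') (Iso.refl (Φ₃.h h')))
      (η.ext (θ.bc (f ≫ f') (g ≫ g')) (Iso.refl (Φ₃.h (h ≫ h')))) := by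
  have h1 := θ.tensL_comp η f g h f' g' h'
  unfold OV at h1 ⊢
  rw [prodMap_tensL_mapComp, tensL_mapComp]
  exact h1

lemma prodMap_tensL_mapId (A B E : Ob) :
    (((Φ₁.prodMap (Φ₂.prodMap Φ₃)).comp (_root_.tensL T T)).coh.mapId (A, B, E)).hom =
      ((T.bu (o A B) E).hom ≫ T.bg (T.bu A B).hom (𝟙 _)) ≫
        T.bg (T.bg (Φ₁.coh.mapId A).hom (Φ₂.coh.mapId B).hom) (Φ₃.coh.mapId E).hom :=
  congrArg (fun t => t ≫ T.bg (T.bg (Φ₁.coh.mapId A).hom (Φ₂.coh.mapId B).hom)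
    (Φ₃.coh.mapId E).hom) (tensL_mapId (S₁₂ := T) (S₁₂_₃ := T) A B E)

/-- The same three layers as for compositors, now with unitors. -/
lemma tensL_id (A B E : Ob) :
    (((Φ₁.prodMap (Φ₂.prodMap Φ₃)).comp (_root_.tensL T T)).coh.mapId (A, B, E)).hom ≫
        (η.ext (θ.bc (𝟙 (X₁.c A)) (𝟙 (X₂.c B))) (Iso.refl (Φ₃.h (𝟙 (X₃.c E))))).hom =
      ((_root_.tensL S₁₂ S₁₂_₃).coh.mapId (A, B, E)).hom := by
  have h1 := η.OV_bu (o A B) E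
  have h2 := η.OV_bg (θ.OV_bu A B) (DblFun.OV_id (F := Φ₃) (Φ₃.coh.mapId E))
  have h3 := η.OV_bg (θ.OV_bg (Φ₁.OV_mapId A) (Φ₂.OV_mapId B)) (Φ₃.OV_mapId E)
  have h4 := (h1.comp h2).comp h3
  rw [DblFun.bg_id, DblFun.bg_id, ext_refl] at h4
  unfold OV at h4
  rw [prodMap_tensL_mapId, tensL_mapId]
  exact h4.trans ((Category.id_comp _).trans (Category.comp_id _))

lemma tensL_vcomp (s : X₁.pre.V A A') (t : X₂.pre.V B B') (r : X₃.pre.V E E')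
    (s' : X₁.pre.V A' A'') (t' : X₂.pre.V B' B'') (r' : X₃.pre.V E' E'') :
    (η.vext (θ.bw (X₁.pre.vcomp s s') (X₂.pre.vcomp t t'))
        (Iso.refl (Φ₃.mapV (X₃.pre.vcomp r r')))).hom.cell =
      vc (η.vext (θ.bw s t) (Iso.refl (Φ₃.mapV r))).hom.cell
        (η.vext (θ.bw s' t') (Iso.refl (Φ₃.mapV r'))).hom.cell :=
  η.vext_vcomp (S₁₂.mapV_vcomp (A := (A, B)) (B := (A', B')) (E := (A'', B'')) (s, t) (s', t')) rfl
    (θ.v_vcomp (A := (A, B)) (A' := (A', B')) (A'' := (A'', B'')) (s, t) (s', t'))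
    (Φ₃.refl_cell_vcomp r r')

lemma tensR_vcomp (θ : BOver Φ₂ Φ₃ Φ₂₃ T S₂₃) (η : BOver Φ₁ Φ₂₃ (DblFun.id K) T S₁_₂₃)
    (s : X₁.pre.V A A') (t : X₂.pre.V B B') (r : X₃.pre.V E E')
    (s' : X₁.pre.V A' A'') (t' : X₂.pre.V B' B'') (r' : X₃.pre.V E' E'') :
    (η.vext (Iso.refl (Φ₁.mapV (X₁.pre.vcomp s s')))
        (θ.bw (X₂.pre.vcomp t t') (X₃.pre.vcomp r r'))).hom.cell =
      vc (η.vext (Iso.refl (Φ₁.mapV s)) (θ.bw t r)).hom.cell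
        (η.vext (Iso.refl (Φ₁.mapV s')) (θ.bw t' r')).hom.cell :=
  η.vext_vcomp rfl (S₂₃.mapV_vcomp (A := (B, E)) (B := (B', E')) (E := (B'', E'')) (t, r) (t', r'))
    (Φ₁.refl_cell_vcomp s s')
    (θ.v_vcomp (A := (B, E)) (A' := (B', E')) (A'' := (B'', E'')) (t, r) (t', r'))

lemma tensR_comp (θ : BOver Φ₂ Φ₃ Φ₂₃ T S₂₃) (η : BOver Φ₁ Φ₂₃ (DblFun.id K) T S₁_₂₃)
    (f : X₁.c A ⟶ X₁.c A') (g : X₂.c B ⟶ X₂.c B') (h : X₃.c E ⟶ X₃.c E')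
    (f' : X₁.c A' ⟶ X₁.c A'') (g' : X₂.c B' ⟶ X₂.c B'') (h' : X₃.c E' ⟶ X₃.c E'') :
    OV (((T.bc _ _ _ _).hom ≫ T.bg (𝟙 _) (T.bc _ _ _ _).hom) ≫
        T.bg (Φ₁.coh.mapComp f f').hom (T.bg (Φ₂.coh.mapComp g g').hom (Φ₃.coh.mapComp h h').hom))
      ((S₁_₂₃.bc f (S₂₃.bh g h) f' (S₂₃.bh g' h')).hom ≫ S₁_₂₃.bg (𝟙 _) (S₂₃.bc g h g' h').hom)
      (η.ext (Iso.refl (Φ₁.h f)) (θ.bc g h) ⋆ₕ η.ext (Iso.refl (Φ₁.h f')) (θ.bc g' h'))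
      (η.ext (Iso.refl (Φ₁.h (f ≫ f'))) (θ.bc (g ≫ g') (h ≫ h'))) := by
  have h1 := η.OV_bc (Iso.refl (Φ₁.h f)) (θ.ext (Iso.refl (Φ₂.h g)) (Iso.refl (Φ₃.h h)))
    (Iso.refl (Φ₁.h f')) (θ.ext (Iso.refl (Φ₂.h g')) (Iso.refl (Φ₃.h h')))
  have h2 := η.OV_bg (DblFun.OV_id (F := Φ₁)
      (Φ₁.lift2I (Iso.refl (Φ₁.h f)) (Iso.refl (Φ₁.h f')))) (θ.OV_bc (Iso.refl (Φ₂.h g))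
    (Iso.refl (Φ₃.h h)) (Iso.refl (Φ₂.h g')) (Iso.refl (Φ₃.h h')))
  have h3 := η.OV_bg (Φ₁.OV_mapComp f f') (θ.OV_bg (Φ₂.OV_mapComp g g') (Φ₃.OV_mapComp h h'))
  have h4 := (h1.comp h2).comp h3
  rw [DblFun.bg_id, DblFun.bg_id, ext_refl, ext_refl, ext_refl] at h4
  exact OV.of_idFun h4

lemma prodMap_tensR_mapComp (f : X₁.c A ⟶ X₁.c A') (g : X₂.c B ⟶ X₂.c B') (h : X₃.c E ⟶ X₃.c E')
    (f' : X₁.c A' ⟶ X₁.c A'') (g' : X₂.c B' ⟶ X₂.c B'') (h' : X₃.c E' ⟶ X₃.c E'') :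
    (((Φ₁.prodMap (Φ₂.prodMap Φ₃)).comp (_root_.tensR T T)).coh.mapComp (A := (A, B, E))
      (B := (A', B', E')) (E := (A'', B'', E'')) (f, g, h) (f', g', h')).hom =
      ((T.bc (Φ₁.h f) (T.bh (Φ₂.h g) (Φ₃.h h)) (Φ₁.h f') (T.bh (Φ₂.h g') (Φ₃.h h'))).hom ≫
        T.bg (𝟙 _) (T.bc (Φ₂.h g) (Φ₃.h h) (Φ₂.h g') (Φ₃.h h')).hom) ≫
        T.bg (Φ₁.coh.mapComp f f').hom
          (T.bg (Φ₂.coh.mapComp g g').hom (Φ₃.coh.mapComp h h').hom) :=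
  congrArg (fun t => t ≫ T.bg (Φ₁.coh.mapComp f f').hom
      (T.bg (Φ₂.coh.mapComp g g').hom (Φ₃.coh.mapComp h h').hom))
    (tensR_mapComp (S₂₃ := T) (S₁_₂₃ := T) (Φ₁.h f) (Φ₂.h g) (Φ₃.h h)
      (Φ₁.h f') (Φ₂.h g') (Φ₃.h h'))

lemma prodMap_tensR_mapId (A B E : Ob) :
    (((Φ₁.prodMap (Φ₂.prodMap Φ₃)).comp (_root_.tensR T T)).coh.mapId (A, B, E)).hom =
      ((T.bu A (o B E)).hom ≫ T.bg (𝟙 _) (T.bu B E).hom) ≫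
        T.bg (Φ₁.coh.mapId A).hom (T.bg (Φ₂.coh.mapId B).hom (Φ₃.coh.mapId E).hom) :=
  congrArg (fun t => t ≫ T.bg (Φ₁.coh.mapId A).hom
    (T.bg (Φ₂.coh.mapId B).hom (Φ₃.coh.mapId E).hom))
    (tensR_mapId (S₂₃ := T) (S₁_₂₃ := T) A B E)

lemma tensR_comp' (θ : BOver Φ₂ Φ₃ Φ₂₃ T S₂₃) (η : BOver Φ₁ Φ₂₃ (DblFun.id K) T S₁_₂₃)
    (f : X₁.c A ⟶ X₁.c A') (g : X₂.c B ⟶ X₂.c B') (h : X₃.c E ⟶ X₃.c E')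
    (f' : X₁.c A' ⟶ X₁.c A'') (g' : X₂.c B' ⟶ X₂.c B'') (h' : X₃.c E' ⟶ X₃.c E'') :
    OV (((Φ₁.prodMap (Φ₂.prodMap Φ₃)).comp (_root_.tensR T T)).coh.mapComp (A := (A, B, E))
      (B := (A', B', E')) (E := (A'', B'', E'')) (f, g, h) (f', g', h')).hom
      ((_root_.tensR S₂₃ S₁_₂₃).coh.mapComp (A := (A, B, E))
      (B := (A', B', E')) (E := (A'', B'', E'')) (f, g, h) (f', g', h')).hom
      (η.ext (Iso.refl (Φ₁.h f)) (θ.bc g h) ⋆ₕ η.ext (Iso.refl (Φ₁.h f')) (θ.bc g' h'))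
      (η.ext (Iso.refl (Φ₁.h (f ≫ f'))) (θ.bc (g ≫ g') (h ≫ h'))) := by
  have h1 := tensR_comp θ η f g h f' g' h'
  unfold OV at h1 ⊢
  rw [prodMap_tensR_mapComp, tensR_mapComp]
  exact h1

lemma tensR_id (θ : BOver Φ₂ Φ₃ Φ₂₃ T S₂₃) (η : BOver Φ₁ Φ₂₃ (DblFun.id K) T S₁_₂₃)
    (A B E : Ob) :
    (((Φ₁.prodMap (Φ₂.prodMap Φ₃)).comp (_root_.tensR T T)).coh.mapId (A, B, E)).hom ≫
        (η.ext (Iso.refl (Φ₁.h (𝟙 (X₁.c A)))) (θ.bc (𝟙 (X₂.c B)) (𝟙 (X₃.c E)))).hom =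
      ((_root_.tensR S₂₃ S₁_₂₃).coh.mapId (A, B, E)).hom := by
  have h1 := η.OV_bu A (o B E)
  have h2 := η.OV_bg (DblFun.OV_id (F := Φ₁) (Φ₁.coh.mapId A)) (θ.OV_bu B E)
  have h3 := η.OV_bg (Φ₁.OV_mapId A) (θ.OV_bg (Φ₂.OV_mapId B) (Φ₃.OV_mapId E))
  have h4 := (h1.comp h2).comp h3
  rw [DblFun.bg_id, DblFun.bg_id, ext_refl] at h4
  unfold OV at h4
  rw [prodMap_tensR_mapId, tensR_mapId]
  exact h4.trans ((Category.id_comp _).trans (Category.comp_id _))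
end
end BOver
end

section
variable {Ob : Type u} {o : Ob → Ob → Ob} {X₁ X₂ X₃ X₁₂ X₂₃ K : DblCat Ob}

variable {T : Bi K K K o} {Φ₁ : DblFun X₁ K (fun A => A)} {Φ₂ : DblFun X₂ K (fun A => A)}
  {Φ₃ : DblFun X₃ K (fun A => A)} {Φ₁₂ : DblFun X₁₂ K (fun A => A)}
  {Φ₂₃ : DblFun X₂₃ K (fun A => A)} {S₁₂ : Bi X₁ X₂ X₁₂ o} {S₁₂_₃ : Bi X₁₂ X₃ K o}
  {S₂₃ : Bi X₂ X₃ X₂₃ o} {S₁_₂₃ : Bi X₁ X₂₃ K o}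

namespace BOver
section
variable (θ : BOver Φ₁ Φ₂ Φ₁₂ T S₁₂) (η : BOver Φ₁₂ Φ₃ (DblFun.id K) T S₁₂_₃)
  {A A' A'' B B' B'' E E' E'' : Ob}

variable {A₁ A₂ A₃ B₁ B₂ B₃ A₁' A₂' A₃' B₁' B₂' B₃' : Ob} {s₁ : X₁.pre.V A₁ A₁'}
    {s₂ : X₂.pre.V A₂ A₂'} {s₃ : X₃.pre.V A₃ A₃'}
   {t₁ : X₁.pre.V B₁ B₁'} {t₂ : X₂.pre.V B₂ B₂'} {t₃ : X₃.pre.V B₃ B₃'}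
    {f₁ : X₁.c A₁ ⟶ X₁.c B₁} {f₂ : X₂.c A₂ ⟶ X₂.c B₂} {f₃ : X₃.c A₃ ⟶ X₃.c B₃}
   {g₁ : X₁.c A₁' ⟶ X₁.c B₁'} {g₂ : X₂.c A₂' ⟶ X₂.c B₂'} {g₃ : X₃.c A₃' ⟶ X₃.c B₃'}
   (n₁ : BSq X₁ s₁ t₁ f₁ g₁) (n₂ : BSq X₂ s₂ t₂ f₂ g₂) (n₃ : BSq X₃ s₃ t₃ f₃ g₃)

lemma tensL_sq : Tw (((Φ₁.prodMap (Φ₂.prodMap Φ₃)).comp (_root_.tensL T T)).bsq (A := (A₁, A₂, A₃))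
      (A' := (A₁', A₂', A₃')) (B := (B₁, B₂, B₃)) (B' := (B₁', B₂', B₃'))
      (BSq.prod n₁ (BSq.prod n₂ n₃)))
    ((_root_.tensL S₁₂ S₁₂_₃).bsq (A := (A₁, A₂, A₃)) (A' := (A₁', A₂', A₃'))
      (B := (B₁, B₂, B₃)) (B' := (B₁', B₂', B₃')) (BSq.prod n₁ (BSq.prod n₂ n₃)))
    (η.ext (θ.bc f₁ f₂) (Iso.refl (Φ₃.h f₃))).hom (η.ext (θ.bc g₁ g₂) (Iso.refl (Φ₃.h g₃))).hom
    (η.vext (θ.bw s₁ s₂) (Iso.refl (Φ₃.mapV s₃))).hom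
    (η.vext (θ.bw t₁ t₂) (Iso.refl (Φ₃.mapV t₃))).hom := by
  have h := η.Tw_bq (θ.bc_bq n₁ n₂) (d := Iso.refl _) (b := Iso.refl _) (b' := Iso.refl _)
    (d' := Iso.refl _) (Tw.refl (Φ₃.bsq n₃))
  exact h

lemma tensR_sq (θ : BOver Φ₂ Φ₃ Φ₂₃ T S₂₃) (η : BOver Φ₁ Φ₂₃ (DblFun.id K) T S₁_₂₃) :
  Tw (((Φ₁.prodMap (Φ₂.prodMap Φ₃)).comp (_root_.tensR T T)).bsq (A := (A₁, A₂, A₃))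
      (A' := (A₁', A₂', A₃')) (B := (B₁, B₂, B₃)) (B' := (B₁', B₂', B₃'))
      (BSq.prod n₁ (BSq.prod n₂ n₃)))
    ((_root_.tensR S₂₃ S₁_₂₃).bsq (A := (A₁, A₂, A₃)) (A' := (A₁', A₂', A₃'))
      (B := (B₁, B₂, B₃)) (B' := (B₁', B₂', B₃')) (BSq.prod n₁ (BSq.prod n₂ n₃)))
    (η.ext (Iso.refl (Φ₁.h f₁)) (θ.bc f₂ f₃)).hom (η.ext (Iso.refl (Φ₁.h g₁)) (θ.bc g₂ g₃)).hom
    (η.vext (Iso.refl (Φ₁.mapV s₁)) (θ.bw s₂ s₃)).hom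
    (η.vext (Iso.refl (Φ₁.mapV t₁)) (θ.bw t₂ t₃)).hom := by
  have h := η.Tw_bq (e := Iso.refl _) (a := Iso.refl _) (a' := Iso.refl _)
    (e' := Iso.refl _) (Tw.refl (Φ₁.bsq n₁)) (θ.bc_bq n₂ n₃)
  exact h
end

/-- The icon `(Φ₁ A Φ₂ B) Φ₃ C ⇒ (A B) C`. -/
def tensL (θ : BOver Φ₁ Φ₂ Φ₁₂ T S₁₂) (η : BOver Φ₁₂ Φ₃ (DblFun.id K) T S₁₂_₃) :
    OIcon ((Φ₁.prodMap (Φ₂.prodMap Φ₃)).comp (_root_.tensL T T)) (_root_.tensL S₁₂ S₁₂_₃) where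
  c f := η.ext (θ.bc f.1 f.2.1) (Iso.refl (Φ₃.h f.2.2))
  v s := η.vext (θ.bw s.1 s.2.1) (Iso.refl (Φ₃.mapV s.2.2))
  c_comp f g := θ.tensL_comp' η f.1 f.2.1 f.2.2 g.1 g.2.1 g.2.2
  c_id A := θ.tensL_id η A.1 A.2.1 A.2.2
  v_vcomp s t := θ.tensL_vcomp η s.1 s.2.1 s.2.2 t.1 t.2.1 t.2.2
  v_vid A := η.vext_vid (S₁₂.mapV_vid (A.1, A.2.1)) rfl (θ.v_vid (A.1, A.2.1))
      (Φ₃.refl_cell_vid A.2.2)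
  c_sq {A B A' B' s t f g} n := by
    -- A square of the triple product is split into its components, because the naturality of the
    -- icons is formulated for separate squares.
    let n₁ : BSq X₁ s.1 t.1 f.1 g.1 :=
      ⟨n.cell.1, congrArg Prod.fst n.src_cell, congrArg Prod.fst n.tgt_cell⟩
    let n₂ : BSq X₂ s.2.1 t.2.1 f.2.1 g.2.1 :=
      ⟨n.cell.2.1, congrArg (fun p => p.2.1) n.src_cell, congrArg (fun p => p.2.1) n.tgt_cell⟩
    let n₃ : BSq X₃ s.2.2 t.2.2 f.2.2 g.2.2 :=
      ⟨n.cell.2.2, congrArg (fun p => p.2.2) n.src_cell, congrArg (fun p => p.2.2) n.tgt_cell⟩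
    exact θ.tensL_sq η n₁ n₂ n₃

/-- The icon `Φ₁ A (Φ₂ B Φ₃ C) ⇒ A (B C)`. -/
def tensR (θ : BOver Φ₂ Φ₃ Φ₂₃ T S₂₃) (η : BOver Φ₁ Φ₂₃ (DblFun.id K) T S₁_₂₃) :
    OIcon ((Φ₁.prodMap (Φ₂.prodMap Φ₃)).comp (_root_.tensR T T)) (_root_.tensR S₂₃ S₁_₂₃) where
  c f := η.ext (Iso.refl (Φ₁.h f.1)) (θ.bc f.2.1 f.2.2)
  v s := η.vext (Iso.refl (Φ₁.mapV s.1)) (θ.bw s.2.1 s.2.2)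
  c_comp f g := tensR_comp' θ η f.1 f.2.1 f.2.2 g.1 g.2.1 g.2.2
  c_id A := tensR_id θ η A.1 A.2.1 A.2.2
  v_vcomp s t := tensR_vcomp θ η s.1 s.2.1 s.2.2 t.1 t.2.1 t.2.2
  v_vid A := η.vext_vid rfl (S₂₃.mapV_vid A.2) (Φ₁.refl_cell_vid A.1) (θ.v_vid A.2)
  c_sq {A B A' B' s t f g} n := by
    let n₁ : BSq X₁ s.1 t.1 f.1 g.1 :=
      ⟨n.cell.1, congrArg Prod.fst n.src_cell, congrArg Prod.fst n.tgt_cell⟩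
    let n₂ : BSq X₂ s.2.1 t.2.1 f.2.1 g.2.1 :=
      ⟨n.cell.2.1, congrArg (fun p => p.2.1) n.src_cell, congrArg (fun p => p.2.1) n.tgt_cell⟩
    let n₃ : BSq X₃ s.2.2 t.2.2 f.2.2 g.2.2 :=
      ⟨n.cell.2.2, congrArg (fun p => p.2.2) n.src_cell, congrArg (fun p => p.2.2) n.tgt_cell⟩
    exact tensR_sq n₁ n₂ n₃ θ η
end BOver
end

/-! ### Icons after fixing the unit object -/

section
variable {Ob : Type u} {o : Ob → Ob → Ob} {I : Ob} {Y K : DblCat Ob}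

section
variable {A B E : Ob}

lemma sectL_mapComp {X Z : DblCat Ob} (S : Bi Y X Z o) (f : X.c A ⟶ X.c B) (g : X.c B ⟶ X.c E) :
    ((S.sectL I).coh.mapComp f g).hom =
      (S.bc (𝟙 (Y.c I)) f (𝟙 (Y.c I)) g).hom ≫ S.bg (λ_ (𝟙 (Y.c I))).hom (𝟙 (f ≫ g)) := rfl

lemma sectR_mapComp {X Z : DblCat Ob} (S : Bi X Y Z o) (f : X.c A ⟶ X.c B) (g : X.c B ⟶ X.c E) :
    ((S.sectR I).coh.mapComp f g).hom =
      (S.bc f (𝟙 (Y.c I)) g (𝟙 (Y.c I))).hom ≫ S.bg (𝟙 (f ≫ g)) (λ_ (𝟙 (Y.c I))).hom := rfl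

lemma sectL_mapId {X Z : DblCat Ob} (S : Bi Y X Z o) (A : Ob) :
    ((S.sectL I).coh.mapId A).hom = (S.bu I A).hom := by
  show (S.bu I A).hom ≫ S.bg (𝟙 (𝟙 (Y.c I))) (𝟙 (𝟙 (X.c A))) = _
  rw [DblFun.bg_id, Category.comp_id]

lemma sectR_mapId {X Z : DblCat Ob} (S : Bi X Y Z o) (A : Ob) :
    ((S.sectR I).coh.mapId A).hom = (S.bu A I).hom := by
  show (S.bu A I).hom ≫ S.bg (𝟙 (𝟙 (X.c A))) (𝟙 (𝟙 (Y.c I))) = _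
  rw [DblFun.bg_id, Category.comp_id]
end

/-- The identity square of the horizontal identity, along the unitor of a pseudo double functor. -/
lemma DblFun.Tw_vid (Ψ : DblFun Y K (fun A => A)) (I : Ob) :
    Tw (BSq.vid (𝟙 (K.c I))) (Ψ.bsq (BSq.vid (𝟙 (Y.c I)))) (Ψ.coh.mapId I).hom
      (Ψ.coh.mapId I).hom (Ψ.vidI I).hom (Ψ.vidI I).hom := by
  refine (Tw.eqToHom_iff (Ψ.mapV_vid I).symm (Ψ.mapV_vid I).symm).2 ?_
  exact (K.pre.sid_scomp _).trans ((K.pre.scomp_sid _).symm.trans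
    (congrArg (vc _) (Ψ.mapSq_sid _).symm))

lemma DblFun.vidI_cell_vcomp (Ψ : DblFun Y K (fun A => A)) (I : Ob) :
    (Ψ.vidI I).hom.cell = vc (Ψ.vidI I).hom.cell (Ψ.vidI I).hom.cell := by
  rw [Ψ.vidI_cell I]; exact (K.pre.sid_scomp _).symm

lemma OV.of_id_lift2I {A B E : Ob} {k f : K.c A ⟶ K.c B} {l g : K.c B ⟶ K.c E}
    {m p : K.c A ⟶ K.c E} {e : k ≅ f} {d : l ≅ g} {n : k ≫ l ⟶ m} {a : f ≫ g ⟶ p} {R : m ≅ p}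
    (h : OV n a ((DblFun.id K).lift2I e d) R) : OV n a (e ⋆ₕ d) R :=
  Eq.trans h (congrArg (fun t => Iso.hom t ≫ a) (DblFun.id_lift2I e d))

namespace BOver
variable {T : Bi K K K o} {Ψ : DblFun Y K (fun A => A)}

section
variable {S : Bi Y K K o} (θ : BOver Ψ (DblFun.id K) (DblFun.id K) T S)

/-- The constant functor has the left unitor of the identity as compositor. In the fixed slot the
required correspondence is therefore the left unit law of `Ψ`. -/
lemma sectL_comp {A B E : Ob} (f : K.c A ⟶ K.c B) (g : K.c B ⟶ K.c E) :
    OV ((T.sectL I).coh.mapComp f g).hom ((S.sectL I).coh.mapComp f g).hom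
      (θ.ext (Ψ.coh.mapId I) (Iso.refl f) ⋆ₕ θ.ext (Ψ.coh.mapId I) (Iso.refl g))
      (θ.ext (Ψ.coh.mapId I) (Iso.refl (f ≫ g))) := by
  have h1 := θ.OV_bc (Ψ.coh.mapId I) (Iso.refl f) (Ψ.coh.mapId I) (Iso.refl g)
  have h2 := θ.OV_bg (DblFun.OV_leftU (F := Ψ) (Ψ.coh.mapId I))
    ((DblFun.id K).OV_mapComp f g)
  have h3 := h1.comp h2
  rw [sectL_mapComp, sectL_mapComp]
  exact h3.of_id_lift2I

lemma sectL_id (A : Ob) : ((T.sectL I).coh.mapId A).hom ≫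
      (θ.ext (Ψ.coh.mapId I) (Iso.refl (𝟙 (K.c A)))).hom = ((S.sectL I).coh.mapId A).hom := by
  rw [sectL_mapId, sectL_mapId]
  exact Eq.trans (θ.OV_bu I A) (Category.id_comp _)

/-- The icon between the functors obtained by fixing the unit object in the first variable. -/
def sectL (I : Ob) : OIcon (T.sectL I) (S.sectL I) where
  c f := θ.ext (Ψ.coh.mapId I) (Iso.refl f)
  v s := θ.vext (Ψ.vidI I) (Iso.refl s)
  c_comp f g := θ.sectL_comp f g
  c_id A := θ.sectL_id A
  -- In the fixed slot the vertical identity is written as a composite of itself with itself.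
  v_vcomp s t := θ.vext_vcomp (Y.pre.vid_vcomp _).symm rfl (Ψ.vidI_cell_vcomp I)
    ((DblFun.id K).refl_cell_vcomp s t)
  v_vid A := θ.vext_vid rfl rfl (Ψ.vidI_cell I) ((DblFun.id K).refl_cell_vid A)
  c_sq n := θ.Tw_bq (Ψ.Tw_vid I) (d := Iso.refl _) (b := Iso.refl _) (b' := Iso.refl _)
    (d' := Iso.refl _) (Tw.refl ((DblFun.id K).bsq n))
end
section
variable {S : Bi K Y K o} (θ : BOver (DblFun.id K) Ψ (DblFun.id K) T S)

lemma sectR_comp {A B E : Ob} (f : K.c A ⟶ K.c B) (g : K.c B ⟶ K.c E) :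
    OV ((T.sectR I).coh.mapComp f g).hom ((S.sectR I).coh.mapComp f g).hom
      (θ.ext (Iso.refl f) (Ψ.coh.mapId I) ⋆ₕ θ.ext (Iso.refl g) (Ψ.coh.mapId I))
      (θ.ext (Iso.refl (f ≫ g)) (Ψ.coh.mapId I)) := by
  have h1 := θ.OV_bc (Iso.refl f) (Ψ.coh.mapId I) (Iso.refl g) (Ψ.coh.mapId I)
  have h2 := θ.OV_bg ((DblFun.id K).OV_mapComp f g)
    (DblFun.OV_leftU (F := Ψ) (Ψ.coh.mapId I))
  have h3 := h1.comp h2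
  rw [sectR_mapComp, sectR_mapComp]
  exact h3.of_id_lift2I

lemma sectR_id (A : Ob) : ((T.sectR I).coh.mapId A).hom ≫
      (θ.ext (Iso.refl (𝟙 (K.c A))) (Ψ.coh.mapId I)).hom = ((S.sectR I).coh.mapId A).hom := by
  rw [sectR_mapId, sectR_mapId]
  exact Eq.trans (θ.OV_bu A I) (Category.id_comp _)

/-- The icon between the functors obtained by fixing the unit object in the second variable. -/
def sectR (I : Ob) : OIcon (T.sectR I) (S.sectR I) where
  c f := θ.ext (Iso.refl f) (Ψ.coh.mapId I)
  v s := θ.vext (Iso.refl s) (Ψ.vidI I)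
  c_comp f g := θ.sectR_comp f g
  c_id A := θ.sectR_id A
  v_vcomp s t := θ.vext_vcomp rfl (Y.pre.vid_vcomp _).symm
    ((DblFun.id K).refl_cell_vcomp s t) (Ψ.vidI_cell_vcomp I)
  v_vid A := θ.vext_vid rfl rfl ((DblFun.id K).refl_cell_vid A) (Ψ.vidI_cell I)
  c_sq n := θ.Tw_bq (e := Iso.refl _) (a := Iso.refl _) (a' := Iso.refl _)
    (e' := Iso.refl _) (Tw.refl ((DblFun.id K).bsq n)) (Ψ.Tw_vid I)
end
end BOver
end

/-! ### Restriction of associators and unit constraints -/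

section
variable {Ob : Type u} {o : Ob → Ob → Ob} {X₁ X₂ X₃ X₁₂ X₂₃ K : DblCat Ob}

/-- The identity functor has identity compositors, so conjugation along plain horizontal composites
is already correspondence in the sense of `AOver`, `LOver` and `ROver`. -/
lemma OV.id_lift2I {A B B' E : Ob} {k f : K.c A ⟶ K.c B} {l g : K.c B ⟶ K.c E}
    {k' f' : K.c A ⟶ K.c B'} {l' g' : K.c B' ⟶ K.c E}
    {n : k ≫ l ⟶ k' ≫ l'} {a : f ≫ g ⟶ f' ≫ g'} {e : k ≅ f} {d : l ≅ g} {e' : k' ≅ f'}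
    {d' : l' ≅ g'} (h : OV n a (e ⋆ₕ d) (e' ⋆ₕ d')) :
    OV n a ((DblFun.id K).lift2I e d) ((DblFun.id K).lift2I e' d') := by
  rw [← DblFun.id_lift2I e d, ← DblFun.id_lift2I e' d'] at h
  exact h

variable {T : Bi K K K o} {Φ₁ : DblFun X₁ K (fun A => A)} {Φ₂ : DblFun X₂ K (fun A => A)}
  {Φ₃ : DblFun X₃ K (fun A => A)} {Φ₁₂ : DblFun X₁₂ K (fun A => A)}
  {Φ₂₃ : DblFun X₂₃ K (fun A => A)} {S₁₂ : Bi X₁ X₂ X₁₂ o} {S₁₂_₃ : Bi X₁₂ X₃ K o}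
  {S₂₃ : Bi X₂ X₃ X₂₃ o} {S₁_₂₃ : Bi X₁ X₂₃ K o}

namespace HTrans
section
variable (θ₁₂ : BOver Φ₁ Φ₂ Φ₁₂ T S₁₂) (θ₁₂_₃ : BOver Φ₁₂ Φ₃ (DblFun.id K) T S₁₂_₃)
    (θ₂₃ : BOver Φ₂ Φ₃ Φ₂₃ T S₂₃) (θ₁_₂₃ : BOver Φ₁ Φ₂₃ (DblFun.id K) T S₁_₂₃) (aK : Asc T T T T)

/-- The restriction of an associator along pseudo double functors. -/
def ascRestrict : Asc S₁₂ S₁₂_₃ S₂₃ S₁_₂₃ :=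
  (aK.pre (Φ₁.prodMap (Φ₂.prodMap Φ₃))).conj (θ₁₂.tensL θ₁₂_₃) (θ₂₃.tensR θ₁_₂₃)

/-- Restriction along functors and conjugation by invertible icons both preserve horizontal
equivalences. -/
lemma ascRestrict_isEquiv {aK : Asc T T T T} (h : aK.IsEquiv) :
    (ascRestrict θ₁₂ θ₁₂_₃ θ₂₃ θ₁_₂₃ aK).IsEquiv :=
  (h.pre (Φ₁.prodMap (Φ₂.prodMap Φ₃))).conj (θ₁₂.tensL θ₁₂_₃) (θ₂₃.tensR θ₁_₂₃)

/-- The restricted associator corresponds to the given one. -/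
def ascRestrict_over : AOver θ₁₂ θ₁₂_₃ θ₂₃ θ₁_₂₃ aK (ascRestrict θ₁₂ θ₁₂_₃ θ₂₃ θ₁_₂₃ aK) where
  i A B E := Iso.refl _
  n {A A' B B' E E'} f g h :=
    ((aK.pre (Φ₁.prodMap (Φ₂.prodMap Φ₃))).conjNat_OV (θ₁₂.tensL θ₁₂_₃) (θ₂₃.tensR θ₁_₂₃)
      (A := (A, B, E)) (B := (A', B', E')) (f, g, h)).id_lift2I
  s {A A' B B' E E'} s t r :=
    (aK.pre (Φ₁.prodMap (Φ₂.prodMap Φ₃))).conjSq_Tw (θ₁₂.tensL θ₁₂_₃) (θ₂₃.tensR θ₁_₂₃)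
      (A := (A, B, E)) (A' := (A', B', E')) (s, t, r)
end

section
variable {I : Ob} {Y : DblCat Ob} {Ψ : DblFun Y K (fun A => A)}

section
variable {S : Bi Y K K o} (θ : BOver Ψ (DblFun.id K) (DblFun.id K) T S)
  (t : HTrans (T.sectL I) (DblFun.id K))

/-- The restriction of a left unit constraint. -/
def luRestrict : HTrans (S.sectL I) (DblFun.id K) := t.conj (θ.sectL I) (OIcon.refl _)

lemma luRestrict_isEquiv {t : HTrans (T.sectL I) (DblFun.id K)} (h : t.IsEquiv) :
    (luRestrict θ t).IsEquiv := h.conj (θ.sectL I) (OIcon.refl _)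

/-- The restricted left unit constraint corresponds to the given one. -/
def luRestrict_over : LOver θ t (luRestrict θ t) where
  i A := Iso.refl _
  n f := (t.conjNat_OV (θ.sectL I) (OIcon.refl _) f).id_lift2I
  s s := t.conjSq_Tw (θ.sectL I) (OIcon.refl _) s
end

section
variable {S : Bi K Y K o} (θ : BOver (DblFun.id K) Ψ (DblFun.id K) T S)
  (t : HTrans (T.sectR I) (DblFun.id K))

/-- The restriction of a right unit constraint. -/
def ruRestrict : HTrans (S.sectR I) (DblFun.id K) := t.conj (θ.sectR I) (OIcon.refl _)

lemma ruRestrict_isEquiv {t : HTrans (T.sectR I) (DblFun.id K)} (h : t.IsEquiv) :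
    (ruRestrict θ t).IsEquiv := h.conj (θ.sectR I) (OIcon.refl _)

/-- The restricted right unit constraint corresponds to the given one. -/
def ruRestrict_over : ROver θ t (ruRestrict θ t) where
  i A := Iso.refl _
  n f := (t.conjNat_OV (θ.sectR I) (OIcon.refl _) f).id_lift2I
  s s := t.conjSq_Tw (θ.sectR I) (OIcon.refl _) s
end
end
end HTrans
end

/-! ### The two actions as functors over the tensor product -/

section
variable {Ob : Type u} {Ob' : Type u'} {C : DblCat.{u, v, w, x} Ob}
  {K : DblCat.{u', v', w', x'} Ob'} {o : Ob → Ob'}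

/-- The icon with identity cells between functors which agree on cells and have equal
compositors. -/
def OIcon.ofRefl {F G : DblFun C K o} (h₀ : F.toPreFun = G.toPreFun)
    (h₁ : ∀ {A B E : Ob} (f : C.c A ⟶ C.c B) (g : C.c B ⟶ C.c E),
      sq (F.coh.mapComp f g).hom ≍ sq (G.coh.mapComp f g).hom)
    (h₂ : ∀ A : Ob, sq (F.coh.mapId A).hom ≍ sq (G.coh.mapId A).hom) : OIcon F G := by
  -- Splitting off the compositors allows the underlying functors to be identified, after which the
  -- heterogeneous equalities become equalities.
  obtain ⟨F, cF⟩ := F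
  obtain ⟨G, cG⟩ := G
  subst h₀
  exact OIcon.ofEq (fun f => Iso.refl _) (fun s => rfl)
    (fun f g => by
      have := PreDbl.Glob.ext (eq_of_heq (h₁ f g))
      unfold OV; rw [hIso_refl]; simp only [Iso.refl_hom]; rw [Category.comp_id, Category.id_comp];
          exact this)
    (fun A => (Category.comp_id _).trans (PreDbl.Glob.ext (eq_of_heq (h₂ A))))
    (fun n => (K.pre.scomp_sid _).trans (K.pre.sid_scomp _).symm)
end

section
variable {Ob : Type u} {o : Ob → Ob → Ob} {D K : DblCat Ob} (P : DblFun D K (fun A => A))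
  (T : Bi K K K o)

lemma actL_mapComp {A A' A'' B B' B'' : Ob} (f : D.c A ⟶ D.c A') (g : K.c B ⟶ K.c B')
    (f' : D.c A' ⟶ D.c A'') (g' : K.c B' ⟶ K.c B'') :
    ((actL P T).bc f g f' g').hom = (T.bc (P.h f) g (P.h f') g').hom ≫
      T.bg (P.coh.mapComp f f').hom (𝟙 _) := by
  show _ ≫ T.bg ((P.coh.mapComp f f').hom ≫ P.g (𝟙 _)) (𝟙 _) = _
  rw [P.g_id, Category.comp_id]; rfl

lemma actR_mapComp {A A' A'' B B' B'' : Ob} (f : K.c A ⟶ K.c A') (g : D.c B ⟶ D.c B')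
    (f' : K.c A' ⟶ K.c A'') (g' : D.c B' ⟶ D.c B'') :
    ((actR P T).bc f g f' g').hom = (T.bc f (P.h g) f' (P.h g')).hom ≫
      T.bg (𝟙 _) (P.coh.mapComp g g').hom := by
  show _ ≫ T.bg (𝟙 _) ((P.coh.mapComp g g').hom ≫ P.g (𝟙 _)) = _
  rw [P.g_id, Category.comp_id]; rfl

lemma actL_mapId (A B : Ob) :
    ((actL P T).bu A B).hom = (T.bu A B).hom ≫ T.bg (P.coh.mapId A).hom (𝟙 _) := by
  show _ ≫ T.bg ((P.coh.mapId A).hom ≫ P.g (𝟙 _)) (𝟙 _) = _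
  rw [P.g_id, Category.comp_id]; rfl

lemma actR_mapId (A B : Ob) :
    ((actR P T).bu A B).hom = (T.bu A B).hom ≫ T.bg (𝟙 _) (P.coh.mapId B).hom := by
  show _ ≫ T.bg (𝟙 _) ((P.coh.mapId B).hom ≫ P.g (𝟙 _)) = _
  rw [P.g_id, Category.comp_id]; rfl

lemma domM_mapComp {A A' A'' B B' B'' : Ob} (f : D.c A ⟶ D.c A') (g : D.c B ⟶ D.c B')
    (f' : D.c A' ⟶ D.c A'') (g' : D.c B' ⟶ D.c B'') :
    ((domM P T).bc f g f' g').hom = (T.bc (P.h f) (P.h g) (P.h f') (P.h g')).hom ≫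
      T.bg (P.coh.mapComp f f').hom (P.coh.mapComp g g').hom := by
  show _ ≫ T.bg ((P.coh.mapComp f f').hom ≫ P.g (𝟙 _)) ((P.coh.mapComp g g').hom ≫ P.g (𝟙 _)) = _
  rw [P.g_id, P.g_id, Category.comp_id, Category.comp_id]; rfl

lemma domM_mapId (A B : Ob) :
    ((domM P T).bu A B).hom = (T.bu A B).hom ≫ T.bg (P.coh.mapId A).hom (P.coh.mapId B).hom := by
  show _ ≫ T.bg ((P.coh.mapId A).hom ≫ P.g (𝟙 _)) ((P.coh.mapId B).hom ≫ P.g (𝟙 _)) = _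
  rw [P.g_id, P.g_id, Category.comp_id, Category.comp_id]; rfl

section
variable {A A' A'' B B' B'' : Ob}

/-- The left side is the unfolded compositor of `T` precomposed with `P` and the identity; the right
side is that of the action followed by the identity functor. They differ by identities, which is why
the icon over `T` can have identity components. -/
lemma actL_over_mapComp (f : D.c A ⟶ D.c A') (g : K.c B ⟶ K.c B') (f' : D.c A' ⟶ D.c A'')
    (g' : K.c B' ⟶ K.c B'') :
    (T.bc (P.h f) g (P.h f') g').hom ≫ T.bg ((P.coh.mapComp f f').hom ≫ P.g (𝟙 _))
      (𝟙 (g ≫ g') ≫ 𝟙 (g ≫ g')) = 𝟙 _ ≫ ((actL P T).bc f g f' g').hom := by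
  refine Eq.trans ?_ (Category.id_comp _).symm
  rw [actL_mapComp, P.g_id, Category.comp_id, Category.comp_id]

lemma actR_over_mapComp (f : K.c A ⟶ K.c A') (g : D.c B ⟶ D.c B') (f' : K.c A' ⟶ K.c A'')
    (g' : D.c B' ⟶ D.c B'') :
    (T.bc f (P.h g) f' (P.h g')).hom ≫ T.bg (𝟙 (f ≫ f') ≫ 𝟙 (f ≫ f'))
      ((P.coh.mapComp g g').hom ≫ P.g (𝟙 _)) = 𝟙 _ ≫ ((actR P T).bc f g f' g').hom := by
  refine Eq.trans ?_ (Category.id_comp _).symm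
  rw [actR_mapComp, P.g_id, Category.comp_id, Category.comp_id]

lemma actL_over_mapId (A B : Ob) :
    (T.bu A B).hom ≫ T.bg ((P.coh.mapId A).hom ≫ P.g (𝟙 _))
      (𝟙 (𝟙 (K.c B)) ≫ 𝟙 (𝟙 (K.c B))) = 𝟙 _ ≫ ((actL P T).bu A B).hom := by
  refine Eq.trans ?_ (Category.id_comp _).symm
  rw [actL_mapId, P.g_id, Category.comp_id, Category.comp_id]

lemma actR_over_mapId (A B : Ob) :
    (T.bu A B).hom ≫ T.bg (𝟙 (𝟙 (K.c A)) ≫ 𝟙 (𝟙 (K.c A)))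
      ((P.coh.mapId B).hom ≫ P.g (𝟙 _)) = 𝟙 _ ≫ ((actR P T).bu A B).hom := by
  refine Eq.trans ?_ (Category.id_comp _).symm
  rw [actR_mapId, P.g_id, Category.comp_id, Category.comp_id]
end

/-- The action obtained by precomposition lies over the tensor product. -/
def actL_over : BOver P (DblFun.id K) (DblFun.id K) T (actL P T) :=
  OIcon.ofRefl rfl
    (fun f g => heq_of_eq (congrArg sq (actL_over_mapComp P T f.1 f.2 g.1 g.2)))
    (fun A => heq_of_eq (congrArg sq (actL_over_mapId P T A.1 A.2)))

/-- The action obtained by precomposition lies over the tensor product. -/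
def actR_over : BOver (DblFun.id K) P (DblFun.id K) T (actR P T) :=
  OIcon.ofRefl rfl
    (fun f g => heq_of_eq (congrArg sq (actR_over_mapComp P T f.1 f.2 g.1 g.2)))
    (fun A => heq_of_eq (congrArg sq (actR_over_mapId P T A.1 A.2)))
end

/-! ### The extension hypothesis as correspondence of all structure -/

section
variable {Ob : Type u} {D : DblCat.{u, v, w, x} Ob} {K : DblCat.{u, v', w', x'} Ob}
  {o : Ob → Ob → Ob} {I : Ob} {P : DblFun D K (fun A => A)}

lemma DblFun.lift2I_hom {A B E : Ob} {f : D.c A ⟶ D.c B} {g : D.c B ⟶ D.c E}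
    {k : K.c A ⟶ K.c B} {l : K.c B ⟶ K.c E} (e : k ≅ P.h f) (d : l ≅ P.h g) :
    (P.lift2I e d).hom = lift2 P e.hom d.hom := by
  unfold lift2 DblFun.lift2I
  rw [Iso.trans_hom, hIso_hom, Category.assoc]

/-- The two conditions differ only in where the right unitor of `k` stands: outside the horizontal
composite in `OverSq`, absorbed in `Tw`. Moving this invertible cell across the equation passes from
one to the other. -/
lemma overSq_iff {A B A' B' : Ob} {s : K.pre.V A A'} {t : K.pre.V B B'} {s₀ : D.pre.V A A'}
    {t₀ : D.pre.V B B'} {k : K.c A ⟶ K.c B}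
    {k' : K.c A' ⟶ K.c B'} {f : D.c A ⟶ D.c B} {f' : D.c A' ⟶ D.c B'} (n : BSq K s t k k')
    (n₀ : BSq D s₀ t₀ f f') (e : k ⟶ P.h f) (e' : k' ⟶ P.h f') (L : s ⟶ P.mapV s₀)
    (R : t ⟶ P.mapV t₀) (h : K.pre.tgt n.cell = K.pre.src R.cell)
    (h' : K.pre.tgt L.cell = P.mapV (D.pre.src n₀.cell)) :
    OverSq P n.cell n₀.cell e e' L.cell R.cell h h' ↔ Tw n (P.bsq n₀) e e' L R := by
  -- An invertible globular cell can be moved to the other side of an equation of squares.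
  have key {E F A B : K.Cell} {k₁ k₂ : E ⟶ F} {l₁ : A ⟶ B}
      (i : k₁ ≅ k₂) (x : Sq k₁ l₁) (y : Sq k₂ l₁) :
      x = vc (sq i.hom) y ↔ vc (sq i.inv) x = y := by
    have h1 : vc (sq i.inv) (sq i.hom) = sq (𝟙 k₂) := congrArg PreDbl.Glob.cell i.inv_hom_id
    have h2 : vc (sq i.hom) (sq i.inv) = sq (𝟙 k₁) := congrArg PreDbl.Glob.cell i.hom_inv_id
    constructor
    · rintro rfl
      exact (K.pre.scomp_assoc _ _ _).symm.trans ((congrArg (fun t => vc t y) h1).trans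
        (K.pre.sid_scomp y))
    · rintro rfl
      exact ((K.pre.scomp_assoc _ _ _).symm.trans ((congrArg (fun t => vc t x) h2).trans
        (K.pre.sid_scomp x))).symm
  have e1 : OverSq P n.cell n₀.cell e e' L.cell R.cell h h' ↔
      vc (n.hc R).cell (sq ((ρ_ k').hom ≫ e')) = vc (sq (ρ_ k).hom) (vc (sq e)
        (vc (sq (λ_ (P.h f)).inv) (vc (BSq.hc L (P.bsq n₀)).cell (sq (λ_ (P.h f')).hom)))) := by
    have : vc (sq ((ρ_ k).hom ≫ e ≫ (λ_ (P.h f)).inv))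
        (vc (BSq.hc L (P.bsq n₀)).cell (sq (λ_ (P.h f')).hom)) = _ :=
      (K.pre.scomp_assoc _ _ _).trans (congrArg (vc _) (K.pre.scomp_assoc _ _ _))
    rw [← this]; rfl
  have e2 : Tw n (P.bsq n₀) e e' L R ↔
      vc (sq (ρ_ k).inv) (vc (n.hc R).cell (sq ((ρ_ k').hom ≫ e'))) = vc (sq e)
        (vc (sq (λ_ (P.h f)).inv) (vc (BSq.hc L (P.bsq n₀)).cell (sq (λ_ (P.h f')).hom))) := by
    have : vc (vc (sq (ρ_ k).inv) (vc (n.hc R).cell (sq (ρ_ k').hom))) (sq e') =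
        vc (sq (ρ_ k).inv) (vc (n.hc R).cell (sq ((ρ_ k').hom ≫ e'))) :=
      (K.pre.scomp_assoc _ _ _).trans (congrArg (vc _) (K.pre.scomp_assoc _ _ _))
    rw [← this]; rfl
  rw [e1, e2]
  exact key (ρ_ k) _ _

namespace BOver
variable {X Y Z X' Y' Z' : DblCat Ob}
  {Φ : DblFun X' X (fun A => A)} {Ψ : DblFun Y' Y (fun A => A)}
  {Ω : DblFun Z' Z (fun A => A)} {T : Bi X Y Z o} {S : Bi X' Y' Z' o} (θ : BOver Φ Ψ Ω T S)
  {A A' Q Q' : Ob}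

lemma vext_eqToIso_cell {z : X.pre.V A A'} {y : Y.pre.V Q Q'} {s : X'.pre.V A A'}
    {t : Y'.pre.V Q Q'} (hs : z = Φ.mapV s) (ht : y = Ψ.mapV t) :
    (θ.vext (eqToIso hs) (eqToIso ht)).hom.cell = (θ.bw s t).hom.cell := by
  subst hs ht
  exact congrArg (fun t => BSq.cell (Iso.hom t)) (θ.vext_refl s t)
end BOver

section
variable {mD : MonData D o I} {mK : MonData K o I} {θ : Icon (domM P mK.T) (mD.T.comp P)}
  (hθ : IsMonExt mK θ)

namespace IsMonExt

/-- The icon of an extension. -/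
noncomputable def icon : BOver P P P mK.T mD.T := θ.toOIcon hθ.inv

lemma ext_hom {A A' B B' : Ob} {k : K.c A ⟶ K.c A'} {l : K.c B ⟶ K.c B'} {f : D.c A ⟶ D.c A'}
    {g : D.c B ⟶ D.c B'} (e : k ≅ P.h f) (d : l ≅ P.h g) :
    (hθ.icon.ext e d).hom = extM θ e.hom d.hom := rfl

lemma bc_hom {A A' B B' : Ob} (f : D.c A ⟶ D.c A') (g : D.c B ⟶ D.c B') :
    (hθ.icon.bc f g).hom = extM θ (𝟙 (P.h f)) (𝟙 (P.h g)) := by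
  rw [← hθ.icon.ext_refl]; rfl

/-- The associators of an extension correspond. -/
noncomputable def asc_over : AOver hθ.icon hθ.icon hθ.icon hθ.icon mK.a mD.a where
  i A B E := eqToIso (hθ.a_app A B E)
  n f g h := by
    unfold OV
    rw [DblFun.lift2I_hom, DblFun.lift2I_hom, ext_hom, ext_hom, bc_hom, bc_hom]
    exact hθ.a_nat f g h
  -- The composites `hcu` and values `bsu` in the extension condition are by definition composition
  -- in `vertCat` and the action `vmap` on it, so the side squares already have the form required by
  -- `AOver`.
  s s t r := (overSq_iff (mK.a.q3 (P.mapV s) (P.mapV t) (P.mapV r)) (mD.a.q3 s t r) _ _ _ _ _ _).1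
    (hθ.a_vsq s t r)

/-- The left unit constraints of an extension correspond. -/
noncomputable def lu_over : LOver hθ.icon mK.lu mD.lu where
  i A := eqToIso (hθ.lu_app A)
  n f := by
    unfold OV
    rw [DblFun.lift2I_hom, DblFun.lift2I_hom, ext_hom]
    exact hθ.lu_nat f
  s s := by
    refine (overSq_iff (mK.lu.lq (P.mapV s)) (mD.lu.lq s) _ _ _ _
        (by rw [BSq.src_cell, BSq.tgt_cell]) (by rw [BSq.src_cell, BSq.tgt_cell])).1 ?_
    have h := hθ.lu_vsq s
    -- The condition uses the icon at the vertical identity of `D`, the correspondence also the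
    -- comparison of the vertical identity of `K` with its image. That comparison is a transport, so
    -- the cells are equal.
    have e : vsqM θ (D.pre.vid I) s =
      (hθ.icon.vext (P.vidI I) (Iso.refl (P.mapV s))).hom.cell :=
      (hθ.icon.vext_eqToIso_cell (P.mapV_vid I).symm rfl).symm
    simp only [e] at h
    exact h

/-- The right unit constraints of an extension correspond. -/
noncomputable def ru_over : ROver hθ.icon mK.ru mD.ru where
  i A := eqToIso (hθ.ru_app A)
  n f := by
    unfold OV
    rw [DblFun.lift2I_hom, DblFun.lift2I_hom, ext_hom]
    exact hθ.ru_nat f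
  s s := by
    refine (overSq_iff (mK.ru.rq (P.mapV s)) (mD.ru.rq s) _ _ _ _
        (by rw [BSq.src_cell, BSq.tgt_cell]) (by rw [BSq.src_cell, BSq.tgt_cell])).1 ?_
    have h := hθ.ru_vsq s
    have e : vsqM θ s (D.pre.vid I) =
      (hθ.icon.vext (Iso.refl (P.mapV s)) (P.vidI I)).hom.cell :=
      (hθ.icon.vext_eqToIso_cell rfl (P.mapV_vid I).symm).symm
    simp only [e] at h
    exact h

lemma p_over : POver hθ.asc_over hθ.asc_over hθ.asc_over hθ.asc_over hθ.asc_over mK.p mD.p := by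
  intro A B E G
  unfold OV
  rw [DblFun.lift2I_hom, DblFun.lift2I_hom, DblFun.lift2I_hom, ext_hom, ext_hom]
  exact hθ.p A B E G

lemma m_over : McOver hθ.asc_over hθ.lu_over hθ.ru_over mK.m mD.m := by
  intro A B
  unfold OV
  rw [DblFun.lift2I_hom, ext_hom, ext_hom]
  exact hθ.m A B

lemma l_over : LcOver hθ.asc_over hθ.lu_over hθ.lu_over mK.l mD.l := by
  intro A B
  unfold OV
  rw [DblFun.lift2I_hom, ext_hom]
  exact hθ.l A B

lemma r_over : RcOver hθ.asc_over hθ.ru_over hθ.ru_over mK.r mD.r := by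
  intro A B
  unfold OV
  rw [DblFun.lift2I_hom, ext_hom]
  exact hθ.r A B
end IsMonExt
end
end

/-! ### Coherence cells obtained by transport -/

section
variable {Ob : Type u} {o : Ob → Ob → Ob} {X₁ X₂ X₃ X₄ X₁₂ X₂₃ X₃₄ X₁₂₃ X₂₃₄ K : DblCat Ob}
  {T₁₂ : Bi X₁ X₂ X₁₂ o} {T₁₂_₃ : Bi X₁₂ X₃ X₁₂₃ o} {T₂₃ : Bi X₂ X₃ X₂₃ o}
  {T₁_₂₃ : Bi X₁ X₂₃ X₁₂₃ o} {T₃₄ : Bi X₃ X₄ X₃₄ o} {T₂₃_₄ : Bi X₂₃ X₄ X₂₃₄ o}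
  {T₂_₃₄ : Bi X₂ X₃₄ X₂₃₄ o} {T₁₂₃_₄ : Bi X₁₂₃ X₄ K o} {T₁_₂₃₄ : Bi X₁ X₂₃₄ K o}
  {T₁₂_₃₄ : Bi X₁₂ X₃₄ K o} {T : Bi K K K o}
  {Φ₁ : DblFun X₁ K (fun A => A)} {Φ₂ : DblFun X₂ K (fun A => A)} {Φ₃ : DblFun X₃ K (fun A => A)}
  {Φ₄ : DblFun X₄ K (fun A => A)} {Φ₁₂ : DblFun X₁₂ K (fun A => A)}
  {Φ₂₃ : DblFun X₂₃ K (fun A => A)} {Φ₃₄ : DblFun X₃₄ K (fun A => A)}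
  {Φ₁₂₃ : DblFun X₁₂₃ K (fun A => A)} {Φ₂₃₄ : DblFun X₂₃₄ K (fun A => A)}
  {θ₁₂ : BOver Φ₁ Φ₂ Φ₁₂ T T₁₂} {θ₁₂_₃ : BOver Φ₁₂ Φ₃ Φ₁₂₃ T T₁₂_₃} {θ₂₃ : BOver Φ₂ Φ₃ Φ₂₃ T T₂₃}
  {θ₁_₂₃ : BOver Φ₁ Φ₂₃ Φ₁₂₃ T T₁_₂₃} {θ₃₄ : BOver Φ₃ Φ₄ Φ₃₄ T T₃₄}
  {θ₂₃_₄ : BOver Φ₂₃ Φ₄ Φ₂₃₄ T T₂₃_₄} {θ₂_₃₄ : BOver Φ₂ Φ₃₄ Φ₂₃₄ T T₂_₃₄}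
  {θ₁₂₃_₄ : BOver Φ₁₂₃ Φ₄ (DblFun.id K) T T₁₂₃_₄} {θ₁_₂₃₄ : BOver Φ₁ Φ₂₃₄ (DblFun.id K) T T₁_₂₃₄}
  {θ₁₂_₃₄ : BOver Φ₁₂ Φ₃₄ (DblFun.id K) T T₁₂_₃₄} {aK : Asc T T T T}
  {a : Asc T₁₂ T₁₂_₃ T₂₃ T₁_₂₃} {a' : Asc T₁_₂₃ T₁₂₃_₄ T₂₃_₄ T₁_₂₃₄}
  {a'' : Asc T₂₃ T₂₃_₄ T₃₄ T₂_₃₄} {c : Asc T₁₂_₃ T₁₂₃_₄ T₃₄ T₁₂_₃₄}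
  {c' : Asc T₁₂ T₁₂_₃₄ T₂_₃₄ T₁_₂₃₄}
  (u : AOver θ₁₂ θ₁₂_₃ θ₂₃ θ₁_₂₃ aK a) (u' : AOver θ₁_₂₃ θ₁₂₃_₄ θ₂₃_₄ θ₁_₂₃₄ aK a')
    (u'' : AOver θ₂₃ θ₂₃_₄ θ₃₄ θ₂_₃₄ aK a'') (y : AOver θ₁₂_₃ θ₁₂₃_₄ θ₃₄ θ₁₂_₃₄ aK c)
    (y' : AOver θ₁₂ θ₁₂_₃₄ θ₂_₃₄ θ₁_₂₃₄ aK c') (pK : PCell aK aK aK aK aK)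

/-- The pentagon cells obtained by transport. -/
def pRestrict : PCell a a' a'' c c' := fun A B E G =>
  ((DblFun.id K).lift2I (θ₁₂₃_₄.ext (u.i A B E) (Φ₄.coh.mapId G)) ((DblFun.id K).lift2I
      (u'.i A (o B E) G) (θ₁_₂₃₄.ext (Φ₁.coh.mapId A) (u''.i B E G)))).symm ≪≫ pK A B E G ≪≫
    (DblFun.id K).lift2I (y.i (o A B) E G) (y'.i A B (o E G))

/-- The restricted cells are conjugates by construction, so the correspondence is `OV.of_iso`. -/
lemma pRestrict_over : POver u u' u'' y y' pK (pRestrict u u' u'' y y' pK) := fun _ _ _ _ =>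
  OV.of_iso _ _ _
end

section
variable {Ob : Type u} {o : Ob → Ob → Ob} {I : Ob} {K Y X₁ X₂ : DblCat Ob}
  {Φ₁ : DblFun X₁ K (fun A => A)} {Φ₂ : DblFun X₂ K (fun A => A)} {Ψ : DblFun Y K (fun A => A)}
  {T : Bi K K K o} {aK : Asc T T T T} {lK : HTrans (T.sectL I) (DblFun.id K)}
  {rK : HTrans (T.sectR I) (DblFun.id K)}

section
variable {S : Bi Y X₁ X₁ o} {S₁ : Bi X₁ X₂ K o} {S₂ : Bi Y K K o}
  {θ : BOver Ψ Φ₁ Φ₁ T S} {η : BOver Φ₁ Φ₂ (DblFun.id K) T S₁}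
  {η' : BOver Ψ (DblFun.id K) (DblFun.id K) T S₂} {a : Asc S S₁ S₁ S₂}
  {t : HTrans (S.sectL I) (DblFun.id X₁)} {t' : HTrans (S₂.sectL I) (DblFun.id K)}
  (u : AOver θ η η η' aK a) (w : LOver θ lK t) (w' : LOver η' lK t') (pK : LCell aK lK lK)

/-- The left unit cells obtained by transport. -/
def lRestrict : LCell a t t' := fun A B =>
  (η.ext (w.i A) (Φ₂.coh.mapId B)).symm ≪≫ pK A B ≪≫
    (DblFun.id K).lift2I (u.i I A B) (w'.i (o A B))

lemma lRestrict_over : LcOver u w w' pK (lRestrict u w w' pK) := fun _ _ => OV.of_iso _ _ _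
end

section
variable {S : Bi X₁ X₂ K o} {S₁ : Bi K Y K o} {S₂ : Bi X₂ Y X₂ o}
  {θ : BOver Φ₁ Φ₂ (DblFun.id K) T S} {η : BOver (DblFun.id K) Ψ (DblFun.id K) T S₁}
  {θ' : BOver Φ₂ Ψ Φ₂ T S₂} {a : Asc S S₁ S₂ S}
  {t : HTrans (S₂.sectR I) (DblFun.id X₂)} {t' : HTrans (S₁.sectR I) (DblFun.id K)}
  (u : AOver θ η θ' θ aK a) (w : ROver θ' rK t) (w' : ROver η rK t') (pK : RCell aK rK rK)

/-- The right unit cells obtained by transport. -/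
def rRestrict : RCell a t t' := fun A B =>
  (w'.i (o A B)).symm ≪≫ pK A B ≪≫
    (DblFun.id K).lift2I (u.i A B I) (θ.ext (Φ₁.coh.mapId A) (w.i B))

lemma rRestrict_over : RcOver u w w' pK (rRestrict u w w' pK) := fun _ _ => OV.of_iso _ _ _
end

section
variable {S : Bi X₁ Y X₁ o} {S₁ : Bi X₁ X₂ K o} {S₂ : Bi Y X₂ X₂ o}
  {θ : BOver Φ₁ Ψ Φ₁ T S} {η : BOver Φ₁ Φ₂ (DblFun.id K) T S₁}
  {θ' : BOver Ψ Φ₂ Φ₂ T S₂} {a : Asc S S₁ S₂ S₁}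
  {t : HTrans (S₂.sectL I) (DblFun.id X₂)} {t' : HTrans (S.sectR I) (DblFun.id X₁)}
  (u : AOver θ η θ' η aK a) (w : LOver θ' lK t) (w' : ROver θ rK t') (pK : MCell aK lK rK)

/-- The middle unit cells obtained by transport. -/
def mRestrict : MCell a t t' := fun A B =>
  ((DblFun.id K).lift2I (u.i A I B) (η.ext (Φ₁.coh.mapId A) (w.i B))).symm ≪≫ pK A B ≪≫
    η.ext (w'.i A) (Φ₂.coh.mapId B)

lemma mRestrict_over : McOver u w w' pK (mRestrict u w w' pK) := fun _ _ => OV.of_iso _ _ _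
end
end

/-! ### The restricted actions and their laws -/

section
variable {Ob : Type u} {D : DblCat.{u, v, w, x} Ob} {K : DblCat.{u, v', w', x'} Ob}
  {o : Ob → Ob → Ob} {I : Ob} {P : DblFun D K (fun A => A)}
  {mD : MonData D o I} {mK : MonData K o I} {θ : Icon (domM P mK.T) (mD.T.comp P)}
  (hθ : IsMonExt mK θ)

namespace IsMonExt
/-- The left action of `D` on `K` obtained by restricting the tensor product of `K`. -/
noncomputable def leftData : LeftData mD (actL P mK.T) :=
  let η := actL_over P mK.T
  let y := HTrans.ascRestrict_over hθ.icon η η η mK.a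
  let t := HTrans.luRestrict_over η mK.lu
  { a := HTrans.ascRestrict hθ.icon η η η mK.a
    lu := HTrans.luRestrict η mK.lu
    p := pRestrict hθ.asc_over y y y y mK.p
    m := mRestrict y t hθ.ru_over mK.m
    l := lRestrict y hθ.lu_over t mK.l }

/-- The right action of `D` on `K` obtained by restricting the tensor product of `K`. -/
noncomputable def rightData : RightData mD (actR P mK.T) :=
  let η := actR_over P mK.T
  let y := HTrans.ascRestrict_over η η hθ.icon η mK.a
  let t := HTrans.ruRestrict_over η mK.ru
  { a := HTrans.ascRestrict η η hθ.icon η mK.a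
    ru := HTrans.ruRestrict η mK.ru
    p := pRestrict y y hθ.asc_over y y mK.p
    m := mRestrict y hθ.lu_over t mK.m
    r := rRestrict y hθ.ru_over t mK.r }

/-- The associator of the left action lies over that of `K`. -/
noncomputable def left_asc : AOver hθ.icon (actL_over P mK.T) (actL_over P mK.T)
    (actL_over P mK.T) mK.a hθ.leftData.a := HTrans.ascRestrict_over _ _ _ _ mK.a

/-- The unit constraint of the left action lies over that of `K`. -/
noncomputable def left_lu : LOver (actL_over P mK.T) mK.lu hθ.leftData.lu :=
  HTrans.luRestrict_over _ mK.lu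

/-- The associator of the right action lies over that of `K`. -/
noncomputable def right_asc : AOver (actR_over P mK.T) (actR_over P mK.T) hθ.icon
    (actR_over P mK.T) mK.a hθ.rightData.a := HTrans.ascRestrict_over _ _ _ _ mK.a

/-- The unit constraint of the right action lies over that of `K`. -/
noncomputable def right_ru : ROver (actR_over P mK.T) mK.ru hθ.rightData.ru :=
  HTrans.ruRestrict_over _ mK.ru

lemma left_p : POver hθ.asc_over hθ.left_asc hθ.left_asc hθ.left_asc hθ.left_asc mK.p
    hθ.leftData.p := pRestrict_over _ _ _ _ _ _

lemma left_m : McOver hθ.left_asc hθ.left_lu hθ.ru_over mK.m hθ.leftData.m :=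
  mRestrict_over _ _ _ _

lemma left_l : LcOver hθ.left_asc hθ.lu_over hθ.left_lu mK.l hθ.leftData.l :=
  lRestrict_over _ _ _ _

lemma right_p : POver hθ.right_asc hθ.right_asc hθ.asc_over hθ.right_asc hθ.right_asc mK.p
    hθ.rightData.p := pRestrict_over _ _ _ _ _ _

lemma right_m : McOver hθ.right_asc hθ.lu_over hθ.right_ru mK.m hθ.rightData.m :=
  mRestrict_over _ _ _ _

lemma right_r : RcOver hθ.right_asc hθ.ru_over hθ.right_ru mK.r hθ.rightData.r :=
  rRestrict_over _ _ _ _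

/-- Every law is the law of the tensor product of `K` seen through correspondences. The action takes
values in `K`, so the functor that must be faithful is the identity; cells of `D` enter through
`asc_over`, `p_over` and `m_over`. -/
theorem leftLaws (H : LeftLaws mK.left) : LeftLaws hθ.leftData where
  a_equiv := HTrans.ascRestrict_isEquiv _ _ _ _ H.a_equiv
  lu_equiv := HTrans.luRestrict_isEquiv _ H.lu_equiv
  p_mod := hθ.left_p.pMod DblFun.id_faithful H.p_mod
  m_mod := hθ.left_m.mMod DblFun.id_faithful H.m_mod
  l_mod := hθ.left_l.lMod DblFun.id_faithful H.l_mod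
  assoc5 := LeftData.assoc5_of_over hθ.p_over hθ.left_p DblFun.id_faithful H
  normL := LeftData.normL_of_over hθ.left_p hθ.m_over hθ.left_m hθ.left_l DblFun.id_faithful H

theorem rightLaws (H : RightLaws mK.right) : RightLaws hθ.rightData where
  a_equiv := HTrans.ascRestrict_isEquiv _ _ _ _ H.a_equiv
  ru_equiv := HTrans.ruRestrict_isEquiv _ H.ru_equiv
  p_mod := hθ.right_p.pMod DblFun.id_faithful H.p_mod
  m_mod := hθ.right_m.mMod DblFun.id_faithful H.m_mod
  r_mod := hθ.right_r.rMod DblFun.id_faithful H.r_mod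
  assoc5 := RightData.assoc5_of_over hθ.p_over hθ.right_p DblFun.id_faithful H
  normR := RightData.normR_of_over hθ.right_p hθ.m_over hθ.right_m hθ.right_r
    DblFun.id_faithful H

/-- The comparison of the two actions. -/
noncomputable def κ (hθ : IsMonExt mK θ) :
    Asc (actL P mK.T) (actR P mK.T) (actR P mK.T) (actL P mK.T) :=
  HTrans.ascRestrict (actL_over P mK.T) (actR_over P mK.T) (actR_over P mK.T) (actL_over P mK.T)
    mK.a

end IsMonExt
end

/-! ### The given icon on the actions, and elimination of the cells of `K` -/

section
variable {Ob : Type u} {Ob' : Type u'} {C : DblCat.{u, v, w, x} Ob}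
  {K : DblCat.{u', v', w', x'} Ob'} {o : Ob → Ob'}

/-- An icon from a functor with the same cells and compositors. -/
def Icon.ofCoh {F F' G : DblFun C K o} (θ : Icon F G) (h₀ : F.toPreFun = F'.toPreFun)
    (h₁ : ∀ {A B E : Ob} (f : C.c A ⟶ C.c B) (g : C.c B ⟶ C.c E),
      sq (F.coh.mapComp f g).hom ≍ sq (F'.coh.mapComp f g).hom)
    (h₂ : ∀ A : Ob, sq (F.coh.mapId A).hom ≍ sq (F'.coh.mapId A).hom) : Icon F' G := by
  obtain ⟨F, c₁⟩ := F
  obtain ⟨F', c₂⟩ := F'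
  subst h₀
  exact
  { cell := θ.cell
    vsq := θ.vsq
    src_vsq := θ.src_vsq
    tgt_vsq := θ.tgt_vsq
    cell_comp f g := (congrArg (· ≫ (θ.cell (f ≫ g)).hom)
      (PreDbl.Glob.ext (eq_of_heq (h₁ f g)))).symm.trans (θ.cell_comp f g)
    cell_id A := (congrArg (· ≫ (θ.cell (𝟙 _)).hom)
      (PreDbl.Glob.ext (eq_of_heq (h₂ A)))).symm.trans (θ.cell_id A)
    vsq_vcomp := θ.vsq_vcomp
    vsq_vid := θ.vsq_vid
    cell_sq := θ.cell_sq }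
end

section
variable {Ob : Type u} {D : DblCat.{u, v, w, x} Ob} {K : DblCat.{u, v', w', x'} Ob}
  {o : Ob → Ob → Ob} {I : Ob} {P : DblFun D K (fun A => A)}

/-- Restricting along `P` one variable after the other gives the same compositor as restricting in
both at once, by functoriality of `T` on 2-cells. The given icon can thus be reused for the action
with unchanged components. -/
lemma domL_actL_mapComp (T : Bi K K K o) {A A' A'' B B' B'' : Ob} (f : D.c A ⟶ D.c A')
    (g : D.c B ⟶ D.c B') (f' : D.c A' ⟶ D.c A'') (g' : D.c B' ⟶ D.c B'') :
    ((domL P (actL P T)).bc f g f' g').hom = ((domM P T).bc f g f' g').hom := by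
  rw [domM_mapComp]
  refine Eq.trans (b := ((T.bc (P.h f) (P.h g) (P.h f') (P.h g')).hom ≫
      T.bg (P.coh.mapComp f f').hom (𝟙 (P.h g ≫ P.h g'))) ≫
    T.bg (P.g (𝟙 (f ≫ f'))) ((P.coh.mapComp g g').hom ≫ P.g (𝟙 (g ≫ g'))))
        (congrArg (· ≫ T.bg (P.g (𝟙 (f ≫ f'))) ((P.coh.mapComp g g').hom ≫ P.g (𝟙 (g ≫ g'))))
      (actL_mapComp P T f (P.h g) f' (P.h g'))) ?_
  rw [P.g_id, P.g_id, Category.comp_id, Category.assoc, ← DblFun.bg_comp, Category.comp_id,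
    Category.id_comp]

lemma domR_actR_mapComp (T : Bi K K K o) {A A' A'' B B' B'' : Ob} (f : D.c A ⟶ D.c A')
    (g : D.c B ⟶ D.c B') (f' : D.c A' ⟶ D.c A'') (g' : D.c B' ⟶ D.c B'') :
    ((domR P (actR P T)).bc f g f' g').hom = ((domM P T).bc f g f' g').hom := by
  rw [domM_mapComp]
  refine Eq.trans (b := ((T.bc (P.h f) (P.h g) (P.h f') (P.h g')).hom ≫
      T.bg (𝟙 (P.h f ≫ P.h f')) (P.coh.mapComp g g').hom) ≫
    T.bg ((P.coh.mapComp f f').hom ≫ P.g (𝟙 (f ≫ f'))) (P.g (𝟙 (g ≫ g'))))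
        (congrArg (· ≫ T.bg ((P.coh.mapComp f f').hom ≫ P.g (𝟙 (f ≫ f'))) (P.g (𝟙 (g ≫ g'))))
      (actR_mapComp P T (P.h f) g (P.h f') g')) ?_
  rw [P.g_id, P.g_id, Category.comp_id, Category.assoc, ← DblFun.bg_comp, Category.comp_id,
    Category.id_comp]

lemma domL_actL_mapId (T : Bi K K K o) (A B : Ob) :
    ((domL P (actL P T)).bu A B).hom = ((domM P T).bu A B).hom := by
  rw [domM_mapId]
  refine Eq.trans (b := ((T.bu A B).hom ≫ T.bg (P.coh.mapId A).hom (𝟙 (𝟙 (K.c B)))) ≫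
    T.bg (P.g (𝟙 (𝟙 (D.c A)))) ((P.coh.mapId B).hom ≫ P.g (𝟙 (𝟙 (D.c B)))))
        (congrArg (· ≫ T.bg (P.g (𝟙 (𝟙 (D.c A)))) ((P.coh.mapId B).hom ≫ P.g (𝟙 (𝟙 (D.c B)))))
      (actL_mapId P T A B)) ?_
  rw [P.g_id, P.g_id, Category.comp_id, Category.assoc, ← DblFun.bg_comp, Category.comp_id,
    Category.id_comp]

lemma domR_actR_mapId (T : Bi K K K o) (A B : Ob) :
    ((domR P (actR P T)).bu A B).hom = ((domM P T).bu A B).hom := by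
  rw [domM_mapId]
  refine Eq.trans (b := ((T.bu A B).hom ≫ T.bg (𝟙 (𝟙 (K.c A))) (P.coh.mapId B).hom) ≫
    T.bg ((P.coh.mapId A).hom ≫ P.g (𝟙 (𝟙 (D.c A)))) (P.g (𝟙 (𝟙 (D.c B)))))
        (congrArg (· ≫ T.bg ((P.coh.mapId A).hom ≫ P.g (𝟙 (𝟙 (D.c A)))) (P.g (𝟙 (𝟙 (D.c B)))))
      (actR_mapId P T A B)) ?_
  rw [P.g_id, P.g_id, Category.comp_id, Category.assoc, ← DblFun.bg_comp, Category.comp_id,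
    Category.id_comp]

lemma sq_domL_actL_mapComp (T : Bi K K K o) {A B E : Ob × Ob} (f : (D.prod D).c A ⟶ (D.prod D).c B)
    (g : (D.prod D).c B ⟶ (D.prod D).c E) : sq ((domL P (actL P T)).coh.mapComp f g).hom ≍
      sq ((domM P T).coh.mapComp f g).hom :=
  heq_of_eq (congrArg sq (domL_actL_mapComp T f.1 f.2 g.1 g.2))

lemma sq_domL_actL_bu (T : Bi K K K o) (A B : Ob) :
    sq ((domL P (actL P T)).bu A B).hom ≍ sq ((domM P T).bu A B).hom :=
  heq_of_eq (congrArg sq (domL_actL_mapId T A B))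

lemma sq_domL_actL_mapId (T : Bi K K K o) (A : Ob × Ob) :
    sq ((domL P (actL P T)).coh.mapId A).hom ≍ sq ((domM P T).coh.mapId A).hom :=
  sq_domL_actL_bu T A.1 A.2

lemma sq_domR_actR_mapComp (T : Bi K K K o) {A B E : Ob × Ob} (f : (D.prod D).c A ⟶ (D.prod D).c B)
    (g : (D.prod D).c B ⟶ (D.prod D).c E) : sq ((domR P (actR P T)).coh.mapComp f g).hom ≍
      sq ((domM P T).coh.mapComp f g).hom :=
  heq_of_eq (congrArg sq (domR_actR_mapComp T f.1 f.2 g.1 g.2))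

lemma sq_domR_actR_bu (T : Bi K K K o) (A B : Ob) :
    sq ((domR P (actR P T)).bu A B).hom ≍ sq ((domM P T).bu A B).hom :=
  heq_of_eq (congrArg sq (domR_actR_mapId T A B))

lemma sq_domR_actR_mapId (T : Bi K K K o) (A : Ob × Ob) :
    sq ((domR P (actR P T)).coh.mapId A).hom ≍ sq ((domM P T).coh.mapId A).hom :=
  sq_domR_actR_bu T A.1 A.2

namespace Icon
variable {T : Bi K K K o} {G : Bi D D K o}

/-- An icon on `P A ⊗ P B` as an icon on the left action. -/
def domL (θ : Icon (domM P T) G) : Icon (_root_.domL P (actL P T)) G :=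
  θ.ofCoh rfl (fun f g => (sq_domL_actL_mapComp T f g).symm) (fun A =>
      (sq_domL_actL_mapId T A).symm)

/-- An icon on `P A ⊗ P B` as an icon on the right action. -/
def domR (θ : Icon (domM P T) G) : Icon (_root_.domR P (actR P T)) G :=
  θ.ofCoh rfl (fun f g => (sq_domR_actR_mapComp T f g).symm) (fun A =>
      (sq_domR_actR_mapId T A).symm)

end Icon

section
variable {mD : MonData D o I} {mK : MonData K o I} {θ : Icon (domM P mK.T) (mD.T.comp P)}

/-- The cell `nK` of the monoidal structure corresponds both to the restricted cell `n` and to `P.g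
n₀`. Cancelling the invertible comparison with the restricted cell leaves the extension condition.
-/
lemma Over2.of_OV {A B : Ob} {nK₁ nK₂ k k' : K.c A ⟶ K.c B} {f f' : D.c A ⟶ D.c B}
    {nK : nK₁ ⟶ nK₂} {n : k ⟶ k'} {n₀ : f ⟶ f'} {X : nK₁ ≅ k} {Y : nK₂ ≅ k'} {X' : nK₁ ≅ P.h f}
    {Y' : nK₂ ≅ P.h f'} {a : k ⟶ P.h f} {b : k' ⟶ P.h f'} (h : OV nK n X Y)
    (h' : OV nK (P.g n₀) X' Y') (hX : X.hom ≫ a = X'.hom) (hY : Y.hom ≫ b = Y'.hom) :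
    Over2 P n n₀ a b := by
  unfold OV at h h'
  unfold Over2
  rw [← cancel_epi X.hom, ← Category.assoc, ← h, Category.assoc, hY, h', ← hX, Category.assoc]

/-- Composite comparisons can be checked factor by factor: interchange merges the two horizontal
composites. -/
lemma DblFun.id_lift2I_comp_lift2 {A B E : Ob} {k l : K.c A ⟶ K.c B} {k' l' : K.c B ⟶ K.c E}
    {f : D.c A ⟶ D.c B} {g : D.c B ⟶ D.c E} {e : k ≅ l} {d : k' ≅ l'} {a : l ⟶ P.h f}
    {b : l' ⟶ P.h g} {a' : k ≅ P.h f} {b' : k' ≅ P.h g} (ha : e.hom ≫ a = a'.hom)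
    (hb : d.hom ≫ b = b'.hom) :
    ((DblFun.id K).lift2I e d).hom ≫ lift2 P a b = (P.lift2I a' b').hom := by
  rw [DblFun.lift2I_hom, ← ha, ← hb]
  have h : (e ⋆ₕ d).hom ≫ lift2 P a b = lift2 P (e.hom ≫ a) (d.hom ≫ b) := by
    rw [hIso_hom]
    unfold lift2
    simp [whisker_exchange_assoc]
  exact (congrArg (fun t => Iso.hom t ≫ lift2 P a b) (DblFun.id_lift2I e d)).trans h

variable (hθ : IsMonExt mK θ)
namespace IsMonExt
-- The icon over the action has identity components and `P` preserves identity 2-cells, so passing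
-- from `K` to the action and then to `D` is the direct passage.
lemma ext_comp_extL {A A' B B' : Ob} {k : K.c A ⟶ K.c A'} {f : D.c A ⟶ D.c A'}
    {l l' : K.c B ⟶ K.c B'} {g : D.c B ⟶ D.c B'} (e : k ≅ P.h f) (d : l ≅ l') (b : l' ⟶ P.h g)
    {b' : l ≅ P.h g} (hb : d.hom ≫ b = b'.hom) :
    ((actL_over P mK.T).ext e d).hom ≫ extL θ.domL f b = (hθ.icon.ext e b').hom := by
  rw [ext_hom, ← hb]
  have h {X : K.c (o A B) ⟶ K.c (o A' B')} (c : mK.T.bh (P.h f) (P.h g) ⟶ X) :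
      (mK.T.bg e.hom d.hom ≫ 𝟙 _) ≫ mK.T.bg (P.g (𝟙 f)) b ≫ c =
        mK.T.bg e.hom (d.hom ≫ b) ≫ c := by
    rw [Category.comp_id, P.g_id, ← Category.assoc, ← DblFun.bg_comp, Category.comp_id]
  exact h _

lemma ext_comp_extR {A A' B B' : Ob} {k k' : K.c A ⟶ K.c A'} {f : D.c A ⟶ D.c A'}
    {l : K.c B ⟶ K.c B'} {g : D.c B ⟶ D.c B'} (e : k ≅ k') (d : l ≅ P.h g) (b : k' ⟶ P.h f)
    {b' : k ≅ P.h f} (hb : e.hom ≫ b = b'.hom) :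
    ((actR_over P mK.T).ext e d).hom ≫ extR θ.domR b g = (hθ.icon.ext b' d).hom := by
  rw [ext_hom, ← hb]
  have h {X : K.c (o A B) ⟶ K.c (o A' B')} (c : mK.T.bh (P.h f) (P.h g) ⟶ X) :
      (mK.T.bg e.hom d.hom ≫ 𝟙 _) ≫ mK.T.bg b (P.g (𝟙 g)) ≫ c =
        mK.T.bg (e.hom ≫ b) d.hom ≫ c := by
    rw [Category.comp_id, P.g_id, ← Category.assoc, ← DblFun.bg_comp, Category.comp_id]
  exact h _
end IsMonExt
end
end

/-! ### The left extension on horizontal 1-cells and on coherence cells -/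

section
variable {Ob : Type u} {D : DblCat.{u, v, w, x} Ob} {K : DblCat.{u, v', w', x'} Ob}
  {o : Ob → Ob → Ob} {I : Ob} {P : DblFun D K (fun A => A)}

/-- The action in the first variable passes through `P`, which preserves identities of `vertCat`. -/
lemma actL_bvI (T : Bi K K K o) {A A' Q Q' : Ob} (s : D.pre.V A A') {z z₀ : K.pre.V Q Q'}
    (b : z ≅ z₀) :
    ((actL P T).bvI (Iso.refl s) b).hom = (T.bvI (Iso.refl (P.mapV s)) b).hom := by
  show (actL P T).vmap (A := (A, Q)) (A' := (A', Q')) (s := (s, z)) (s₀ := (s, z₀))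
    (BSq.vprod (𝟙 s) b.hom) = T.vmap (A := (A, Q)) (A' := (A', Q')) (s := (P.mapV s, z))
      (s₀ := (P.mapV s, z₀)) (BSq.vprod (𝟙 (P.mapV s)) b.hom)
  have h₁ : ((DblFun.fst D K).comp P).vmap (A := (A, Q)) (A' := (A', Q')) (s := (s, z))
      (s₀ := (s, z₀)) (BSq.vprod (𝟙 s) b.hom) = 𝟙 (P.mapV s) := by
    refine (DblFun.comp_vmap _ _ _).trans ((congrArg P.vmap (DblFun.fst_vmap _ _)).trans ?_)
    exact P.vmap_id s
  refine (DblFun.comp_vmap _ _ _).trans (congrArg T.vmap ((DblFun.pair_vmap _ _ _).trans ?_))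
  exact congrArg₂ (BSq.vprod (s := P.mapV s) (s₀ := P.mapV s)) h₁ (DblFun.snd_vmap _ _)

lemma actR_bvI (T : Bi K K K o) {A A' Q Q' : Ob} {z z₀ : K.pre.V A A'} (s : D.pre.V Q Q')
    (b : z ≅ z₀) :
    ((actR P T).bvI b (Iso.refl s)).hom = (T.bvI b (Iso.refl (P.mapV s))).hom := by
  show (actR P T).vmap (A := (A, Q)) (A' := (A', Q')) (s := (z, s)) (s₀ := (z₀, s))
    (BSq.vprod b.hom (𝟙 s)) = T.vmap (A := (A, Q)) (A' := (A', Q')) (s := (z, P.mapV s))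
      (s₀ := (z₀, P.mapV s)) (BSq.vprod b.hom (𝟙 (P.mapV s)))
  have h₁ : ((DblFun.snd K D).comp P).vmap (A := (A, Q)) (A' := (A', Q')) (s := (z, s))
      (s₀ := (z₀, s)) (BSq.vprod b.hom (𝟙 s)) = 𝟙 (P.mapV s) := by
    refine (DblFun.comp_vmap _ _ _).trans ((congrArg P.vmap (DblFun.snd_vmap _ _)).trans ?_)
    exact P.vmap_id s
  refine (DblFun.comp_vmap _ _ _).trans (congrArg T.vmap ((DblFun.pair_vmap _ _ _).trans ?_))
  exact congrArg₂ (BSq.vprod (z := P.mapV s) (z₀ := P.mapV s)) (DblFun.fst_vmap _ _) h₁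

/-- The analogue of `Over2.of_OV` for squares: the square `n` of `K` is eliminated by inverting its
correspondence with the restricted square. -/
lemma Tw.cancel {A B A' B' : Ob} {s s₀ s₁ : K.pre.V A A'} {t t₀ t₁ : K.pre.V B B'}
    {k f : K.c A ⟶ K.c B}
    {k' f' : K.c A' ⟶ K.c B'} {n : BSq K s t k k'} {n₀ : BSq K s₀ t₀ k k'}
    {n₁ : BSq K s₁ t₁ f f'} {e : k ⟶ f} {e' : k' ⟶ f'} {L₀ : s ≅ s₀} {R₀ : t ≅ t₀}
    {L₁ : s ⟶ s₁} {R₁ : t ⟶ t₁} {L : s₀ ⟶ s₁} {R : t₀ ⟶ t₁}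
    (h₀ : Tw n n₀ (𝟙 k) (𝟙 k') L₀.hom R₀.hom) (h₁ : Tw n n₁ e e' L₁ R₁)
    (hL : L₀.hom ≫ L = L₁) (hR : R₀.hom ≫ R = R₁) : Tw n₀ n₁ e e' L R := by
  subst hL hR
  exact (Tw.comp (Tw.symm (e := Iso.refl _) (e' := Iso.refl _) h₀) h₁).congr (Category.id_comp _)
    (Category.id_comp _) (Iso.inv_hom_id_assoc _ _) (Iso.inv_hom_id_assoc _ _)

variable {mD : MonData D o I} {mK : MonData K o I} {θ : Icon (domM P mK.T) (mD.T.comp P)}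
  (hθ : IsMonExt mK θ)

namespace IsMonExt
lemma extL_id {A A' B B' : Ob} (f : D.c A ⟶ D.c A') (g : D.c B ⟶ D.c B') :
    extL θ.domL f (𝟙 (P.h g)) = (hθ.icon.bc f g).hom := by
  rw [hθ.bc_hom]
  unfold extL extM
  exact congrArg (fun t => mK.T.bg t (𝟙 (P.h g)) ≫ (θ.cell (A := (A, B)) (B := (A', B'))
      (f, g)).hom)
    (P.g_id f)

lemma extR_id {A A' B B' : Ob} (f : D.c A ⟶ D.c A') (g : D.c B ⟶ D.c B') :
    extR θ.domR (𝟙 (P.h f)) g = (hθ.icon.bc f g).hom := by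
  rw [hθ.bc_hom]
  unfold extR extM
  exact congrArg (fun t => mK.T.bg (𝟙 (P.h f)) t ≫ (θ.cell (A := (A, B)) (B := (A', B'))
      (f, g)).hom)
    (P.g_id g)

/-- The naturality cell of the associator of `K` at images of 1-cells corresponds to the restricted
cell and to the image of the cell of `D`; only the agreement of the comparisons has to be checked.
The other conditions on 2-cells follow the same pattern. -/
lemma left_a_nat {A A' B B' E E' : Ob} (f : D.c A ⟶ D.c A') (g : D.c B ⟶ D.c B')
    (h : D.c E ⟶ D.c E') :
    Over2 P (hθ.leftData.a.n3 f g (P.h h)).hom (mD.a.n3 f g h).hom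
      (lift2 P (extL θ.domL (mD.T.bh f g) (𝟙 (P.h h))) (eqToHom (hθ.a_app A' B' E')))
      (lift2 P (eqToHom (hθ.a_app A B E)) (extL θ.domL f (extL θ.domL g (𝟙 (P.h h))))) := by
  refine Over2.of_OV (hθ.left_asc.n f g (P.h h)) (hθ.asc_over.n f g h) ?_ ?_
  · exact DblFun.id_lift2I_comp_lift2 (hθ.ext_comp_extL _ _ _ (Category.id_comp _))
      (Category.id_comp _)
  · exact DblFun.id_lift2I_comp_lift2 (Category.id_comp _)
      (hθ.ext_comp_extL _ _ _ ((Category.id_comp _).trans (hθ.extL_id g h)))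

lemma left_lu_nat {A A' : Ob} (f : D.c A ⟶ D.c A') :
    Over2 P (hθ.leftData.lu.ln (P.h f)).hom (mD.lu.ln f).hom
      (lift2 P (extL θ.domL (𝟙 (D.c I)) (𝟙 (P.h f))) (eqToHom (hθ.lu_app A')))
      (lift2 P (eqToHom (hθ.lu_app A)) (𝟙 (P.h f))) := by
  refine Over2.of_OV (hθ.left_lu.n (P.h f)) (hθ.lu_over.n f) ?_ ?_
  · exact DblFun.id_lift2I_comp_lift2 (hθ.ext_comp_extL _ _ _ (Category.id_comp _))
      (Category.id_comp _)
  · exact DblFun.id_lift2I_comp_lift2 (Category.id_comp _) (Category.id_comp _)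

lemma left_p_over (A B E G : Ob) :
    Over2 P (hθ.leftData.p A B E G).hom (mD.p A B E G).hom
      (lift2 P (extL θ.domL (mD.a.a3 A B E) (P.coh.mapId G).hom)
        (lift2 P (eqToHom (hθ.a_app A (o B E) G))
          (extL θ.domL (𝟙 (D.c A)) (eqToHom (hθ.a_app B E G)))))
      (lift2 P (eqToHom (hθ.a_app (o A B) E G)) (eqToHom (hθ.a_app A B (o E G)))) := by
  refine Over2.of_OV (hθ.left_p A B E G) (hθ.p_over A B E G) ?_ ?_
  · exact DblFun.id_lift2I_comp_lift2 (hθ.ext_comp_extL _ _ _ (Category.id_comp _))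
      (DblFun.id_lift2I_comp_lift2 (Category.id_comp _)
        (hθ.ext_comp_extL _ _ _ (Category.id_comp _)))
  · exact DblFun.id_lift2I_comp_lift2 (Category.id_comp _) (Category.id_comp _)

lemma left_m_over (A B : Ob) :
    Over2 P (hθ.leftData.m A B).hom (mD.m A B).hom
      (lift2 P (eqToHom (hθ.a_app A I B)) (extL θ.domL (𝟙 (D.c A)) (eqToHom (hθ.lu_app B))))
      (extL θ.domL (mD.ru.ra A) (P.coh.mapId B).hom) := by
  refine Over2.of_OV (hθ.left_m A B) (hθ.m_over A B) ?_ ?_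
  · exact DblFun.id_lift2I_comp_lift2 (Category.id_comp _)
      (hθ.ext_comp_extL _ _ _ (Category.id_comp _))
  · exact hθ.ext_comp_extL _ _ _ (Category.id_comp _)

lemma left_l_over (A B : Ob) :
    Over2 P (hθ.leftData.l A B).hom (mD.l A B).hom
      (extL θ.domL (mD.lu.la A) (P.coh.mapId B).hom)
      (lift2 P (eqToHom (hθ.a_app I A B)) (eqToHom (hθ.lu_app (o A B)))) := by
  refine Over2.of_OV (hθ.left_l A B) (hθ.l_over A B) ?_ ?_
  · exact hθ.ext_comp_extL _ _ _ (Category.id_comp _)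
  · exact DblFun.id_lift2I_comp_lift2 (Category.id_comp _) (Category.id_comp _)
end IsMonExt
end

/-! ### The left extension on vertical 1-cells -/

section
variable {Ob : Type u} {D : DblCat.{u, v, w, x} Ob} {K : DblCat.{u, v', w', x'} Ob}
  {o : Ob → Ob → Ob} {I : Ob} {P : DblFun D K (fun A => A)}
variable {mD : MonData D o I} {mK : MonData K o I} {θ : Icon (domM P mK.T) (mD.T.comp P)}
  (hθ : IsMonExt mK θ)

namespace IsMonExt

lemma actL_vext_comp {A A' B B' : Ob} {z : K.pre.V A A'} {s : D.pre.V A A'} {y y' : K.pre.V B B'}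
    {t : D.pre.V B B'} (a : z ≅ P.mapV s) (b : y ≅ y') (b' : y' ≅ P.mapV t) :
    ((actL_over P mK.T).vext a b).hom ≫ ((actL P mK.T).bvI (Iso.refl s) b').hom ≫
      (hθ.icon.bw s t).hom = (hθ.icon.vext a (b ≪≫ b')).hom := by
  rw [actL_bvI]
  have h : ((mK.T.bvI a b).hom ≫ 𝟙 _) ≫ (mK.T.bvI (Iso.refl (P.mapV s)) b').hom ≫
      (hθ.icon.bw s t).hom = (mK.T.bvI (a ≪≫ Iso.refl _) (b ≪≫ b') ≪≫ hθ.icon.bw s t).hom := by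
    rw [DblFun.bvI_trans, Category.comp_id, Iso.trans_hom, Iso.trans_hom, Category.assoc]
  rw [Iso.trans_refl] at h
  exact h

lemma actR_vext_comp {A A' B B' : Ob} {z z' : K.pre.V A A'} {s : D.pre.V A A'} {y : K.pre.V B B'}
    {t : D.pre.V B B'} (a : z ≅ z') (a' : z' ≅ P.mapV s) (b : y ≅ P.mapV t) :
    ((actR_over P mK.T).vext a b).hom ≫ ((actR P mK.T).bvI a' (Iso.refl t)).hom ≫
      (hθ.icon.bw s t).hom = (hθ.icon.vext (a ≪≫ a') b).hom := by
  rw [actR_bvI]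
  have h : ((mK.T.bvI a b).hom ≫ 𝟙 _) ≫ (mK.T.bvI a' (Iso.refl (P.mapV t))).hom ≫
      (hθ.icon.bw s t).hom = (mK.T.bvI (a ≪≫ a') (b ≪≫ Iso.refl _) ≪≫ hθ.icon.bw s t).hom := by
    rw [DblFun.bvI_trans, Category.comp_id, Iso.trans_hom, Iso.trans_hom, Category.assoc]
  rw [Iso.trans_refl] at h
  exact h

lemma left_a_tw {A A' B B' E E' : Ob} (s : D.pre.V A A') (t : D.pre.V B B') (r : D.pre.V E E') :
    Tw (hθ.leftData.a.q3 s t (P.mapV r)) (P.bsq (mD.a.q3 s t r)) (eqToHom (hθ.a_app A B E))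
      (eqToHom (hθ.a_app A' B' E')) (hθ.icon.bw (mD.T.bv s t) r).hom
      (((actL P mK.T).bvI (Iso.refl s) (hθ.icon.bw t r)).hom ≫
        (hθ.icon.bw s (mD.T.bv t r)).hom) := by
  -- The squares `L₀` and `R₀` pass from the tensor product of `K` to the action. What is left to
  -- reach `D` are the side squares of the extension condition.
  refine Tw.cancel (L₀ := (actL_over P mK.T).vext (hθ.icon.bw s t) (Iso.refl (P.mapV r)))
    (R₀ := (actL_over P mK.T).vext (Iso.refl (P.mapV s)) (Iso.refl (mK.T.bv (P.mapV t) (P.mapV r))))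
    (hθ.left_asc.s s t (P.mapV r)) (hθ.asc_over.s s t r) ?_ ?_
  · exact congrArg (· ≫ (hθ.icon.bw (mD.T.bv s t) r).hom) (Category.comp_id _)
  · exact (hθ.actL_vext_comp _ _ _).trans
      (congrArg (fun i => (hθ.icon.vext (Iso.refl _) i).hom) (Iso.refl_trans _))

lemma left_a_vsq {A A' B B' E E' : Ob} (s : D.pre.V A A') (t : D.pre.V B B') (r : D.pre.V E E') :
    OverSq P (hθ.leftData.a.s3 s t (P.mapV r)) (mD.a.s3 s t r) (eqToHom (hθ.a_app A B E))
      (eqToHom (hθ.a_app A' B' E')) (vsqL θ.domL (mD.T.bv s t) r)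
      (hcu ((actL P mK.T).bsu (hi s) (vsqL θ.domL t r)) (vsqL θ.domL s (mD.T.bv t r))
        (by rw [DblFun.tgt_bsu, tgt_vsqL, src_vsqL, PreDbl.tgt_shid]))
      (by rw [HTrans.tgt_s3, src_hcu, DblFun.src_bsu, src_vsqL, PreDbl.src_shid])
      (by rw [tgt_vsqL, HTrans.src_s3]) :=
  (overSq_iff (hθ.leftData.a.q3 s t (P.mapV r)) (mD.a.q3 s t r) _ _ _ _ _ _).2
    (hθ.left_a_tw s t r)

lemma left_lu_vsq {A A' : Ob} (s : D.pre.V A A') :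
    OverSq P (hθ.leftData.lu.ls (P.mapV s)) (mD.lu.ls s) (eqToHom (hθ.lu_app A))
        (eqToHom (hθ.lu_app A'))
      (vsqL θ.domL (D.pre.vid I) s) (hi (P.mapV s))
      (by rw [HTrans.tgt_ls, PreDbl.src_shid])
      (by rw [tgt_vsqL, HTrans.src_ls]) := by
  refine (overSq_iff (hθ.leftData.lu.lq (P.mapV s)) (mD.lu.lq s) _ _
      (hθ.icon.bw (D.pre.vid I) s).hom
    (𝟙 (P.mapV s)) _ _).2 ?_
  -- The comparison `vidI` accounts for the vertical identity of `K` in the unit slot, where the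
  -- action uses the image of the one of `D`.
  refine Tw.cancel (L₀ := (actL_over P mK.T).vext (P.vidI I) (Iso.refl (P.mapV s)))
    (R₀ := Iso.refl (P.mapV s)) (hθ.left_lu.s (P.mapV s)) (hθ.lu_over.s s) ?_ (Category.id_comp _)
  exact congrArg (· ≫ (hθ.icon.bw (D.pre.vid I) s).hom) (Category.comp_id _)

theorem isLeftExt : IsLeftExt hθ.leftData θ.domL where
  inv := hθ.inv
  a_app := hθ.a_app
  lu_app := hθ.lu_app
  a_nat := hθ.left_a_nat
  lu_nat := hθ.left_lu_nat
  a_vsq := hθ.left_a_vsq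
  lu_vsq := hθ.left_lu_vsq
  p := hθ.left_p_over
  m := hθ.left_m_over
  l := hθ.left_l_over
end IsMonExt
end

/-! ### The right extension and the biaction -/

section
variable {Ob : Type u} {D : DblCat.{u, v, w, x} Ob} {K : DblCat.{u, v', w', x'} Ob}
  {o : Ob → Ob → Ob} {I : Ob} {P : DblFun D K (fun A => A)}
variable {mD : MonData D o I} {mK : MonData K o I} {θ : Icon (domM P mK.T) (mD.T.comp P)}
  (hθ : IsMonExt mK θ)

namespace IsMonExt

lemma right_a_nat {A A' B B' E E' : Ob} (f : D.c A ⟶ D.c A') (g : D.c B ⟶ D.c B')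
    (h : D.c E ⟶ D.c E') :
    Over2 P (hθ.rightData.a.n3 (P.h f) g h).hom (mD.a.n3 f g h).hom
      (lift2 P (extR θ.domR (extR θ.domR (𝟙 (P.h f)) g) h) (eqToHom (hθ.a_app A' B' E')))
      (lift2 P (eqToHom (hθ.a_app A B E)) (extR θ.domR (𝟙 (P.h f)) (mD.T.bh g h))) := by
  refine Over2.of_OV (hθ.right_asc.n (P.h f) g h) (hθ.asc_over.n f g h) ?_ ?_
  · exact DblFun.id_lift2I_comp_lift2
      (hθ.ext_comp_extR _ _ _ ((Category.id_comp _).trans (hθ.extR_id f g))) (Category.id_comp _)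
  · exact DblFun.id_lift2I_comp_lift2 (Category.id_comp _)
      (hθ.ext_comp_extR _ _ _ (Category.id_comp _))

lemma right_ru_nat {A A' : Ob} (f : D.c A ⟶ D.c A') :
    Over2 P (hθ.rightData.ru.rn (P.h f)).hom (mD.ru.rn f).hom
      (lift2 P (extR θ.domR (𝟙 (P.h f)) (𝟙 (D.c I))) (eqToHom (hθ.ru_app A')))
      (lift2 P (eqToHom (hθ.ru_app A)) (𝟙 (P.h f))) := by
  refine Over2.of_OV (hθ.right_ru.n (P.h f)) (hθ.ru_over.n f) ?_ ?_
  · exact DblFun.id_lift2I_comp_lift2 (hθ.ext_comp_extR _ _ _ (Category.id_comp _))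
      (Category.id_comp _)
  · exact DblFun.id_lift2I_comp_lift2 (Category.id_comp _) (Category.id_comp _)

lemma right_p_over (A B E G : Ob) :
    Over2 P (hθ.rightData.p A B E G).hom (mD.p A B E G).hom
      (lift2 P (extR θ.domR (eqToHom (hθ.a_app A B E)) (𝟙 (D.c G)))
        (lift2 P (eqToHom (hθ.a_app A (o B E) G))
          (extR θ.domR (P.coh.mapId A).hom (mD.a.a3 B E G))))
      (lift2 P (eqToHom (hθ.a_app (o A B) E G)) (eqToHom (hθ.a_app A B (o E G)))) := by
  refine Over2.of_OV (hθ.right_p A B E G) (hθ.p_over A B E G) ?_ ?_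
  · exact DblFun.id_lift2I_comp_lift2 (hθ.ext_comp_extR _ _ _ (Category.id_comp _))
      (DblFun.id_lift2I_comp_lift2 (Category.id_comp _)
        (hθ.ext_comp_extR _ _ _ (Category.id_comp _)))
  · exact DblFun.id_lift2I_comp_lift2 (Category.id_comp _) (Category.id_comp _)

lemma right_m_over (A B : Ob) :
    Over2 P (hθ.rightData.m A B).hom (mD.m A B).hom
      (lift2 P (eqToHom (hθ.a_app A I B)) (extR θ.domR (P.coh.mapId A).hom (mD.lu.la B)))
      (extR θ.domR (eqToHom (hθ.ru_app A)) (𝟙 (D.c B))) := by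
  refine Over2.of_OV (hθ.right_m A B) (hθ.m_over A B) ?_ ?_
  · exact DblFun.id_lift2I_comp_lift2 (Category.id_comp _)
      (hθ.ext_comp_extR _ _ _ (Category.id_comp _))
  · exact hθ.ext_comp_extR _ _ _ (Category.id_comp _)

lemma right_r_over (A B : Ob) :
    Over2 P (hθ.rightData.r A B).hom (mD.r A B).hom
      (eqToHom (hθ.ru_app (o A B)))
      (lift2 P (eqToHom (hθ.a_app A B I)) (extR θ.domR (P.coh.mapId A).hom (mD.ru.ra B))) := by
  refine Over2.of_OV (hθ.right_r A B) (hθ.r_over A B) (Category.id_comp _) ?_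
  exact DblFun.id_lift2I_comp_lift2 (Category.id_comp _)
      (hθ.ext_comp_extR _ _ _ (Category.id_comp _))

lemma right_a_tw {A A' B B' E E' : Ob} (s : D.pre.V A A') (t : D.pre.V B B') (r : D.pre.V E E') :
    Tw (hθ.rightData.a.q3 (P.mapV s) t r) (P.bsq (mD.a.q3 s t r)) (eqToHom (hθ.a_app A B E))
      (eqToHom (hθ.a_app A' B' E'))
      (((actR P mK.T).bvI (hθ.icon.bw s t) (Iso.refl r)).hom ≫ (hθ.icon.bw (mD.T.bv s t) r).hom)
      (hθ.icon.bw s (mD.T.bv t r)).hom := by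
  refine Tw.cancel (L₀ := (actR_over P mK.T).vext (Iso.refl (mK.T.bv (P.mapV s) (P.mapV t)))
      (Iso.refl (P.mapV r)))
    (R₀ := (actR_over P mK.T).vext (Iso.refl (P.mapV s)) (hθ.icon.bw t r))
    (hθ.right_asc.s (P.mapV s) t r) (hθ.asc_over.s s t r) ?_ ?_
  · exact (hθ.actR_vext_comp _ _ _).trans
      (congrArg (fun i => (hθ.icon.vext i (Iso.refl _)).hom) (Iso.refl_trans _))
  · exact congrArg (· ≫ (hθ.icon.bw s (mD.T.bv t r)).hom) (Category.comp_id _)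

lemma right_a_vsq {A A' B B' E E' : Ob} (s : D.pre.V A A') (t : D.pre.V B B')
    (r : D.pre.V E E') :
    OverSq P (hθ.rightData.a.s3 (P.mapV s) t r) (mD.a.s3 s t r) (eqToHom (hθ.a_app A B E))
      (eqToHom (hθ.a_app A' B' E'))
      (hcu ((actR P mK.T).bsu (vsqR θ.domR s t) (hi r)) (vsqR θ.domR (mD.T.bv s t) r)
        (by rw [DblFun.tgt_bsu, tgt_vsqR, src_vsqR, PreDbl.tgt_shid]))
      (vsqR θ.domR s (mD.T.bv t r))
      (by rw [HTrans.tgt_s3, src_vsqR])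
      (by rw [tgt_hcu, tgt_vsqR, HTrans.src_s3]) :=
  (overSq_iff (hθ.rightData.a.q3 (P.mapV s) t r) (mD.a.q3 s t r) _ _ _ _ _ _).2
    (hθ.right_a_tw s t r)

lemma right_ru_vsq {A A' : Ob} (s : D.pre.V A A') :
    OverSq P (hθ.rightData.ru.rs (P.mapV s)) (mD.ru.rs s) (eqToHom (hθ.ru_app A))
      (eqToHom (hθ.ru_app A')) (vsqR θ.domR s (D.pre.vid I)) (hi (P.mapV s))
      (by rw [HTrans.tgt_rs, PreDbl.src_shid])
      (by rw [tgt_vsqR, HTrans.src_rs]) := by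
  refine (overSq_iff (hθ.rightData.ru.rq (P.mapV s)) (mD.ru.rq s) _ _
    (hθ.icon.bw s (D.pre.vid I)).hom (𝟙 (P.mapV s)) _ _).2 ?_
  refine Tw.cancel (L₀ := (actR_over P mK.T).vext (Iso.refl (P.mapV s)) (P.vidI I))
    (R₀ := Iso.refl (P.mapV s)) (hθ.right_ru.s (P.mapV s)) (hθ.ru_over.s s) ?_
    (Category.id_comp _)
  exact congrArg (· ≫ (hθ.icon.bw s (D.pre.vid I)).hom) (Category.comp_id _)

theorem isRightExt : IsRightExt hθ.rightData θ.domR where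
  inv := hθ.inv
  a_app := hθ.a_app
  ru_app := hθ.ru_app
  a_nat := hθ.right_a_nat
  ru_nat := hθ.right_ru_nat
  a_vsq := hθ.right_a_vsq
  ru_vsq := hθ.right_ru_vsq
  p := hθ.right_p_over
  m := hθ.right_m_over
  r := hθ.right_r_over

/-- The comparison of the two actions lies over the associator of `K`. -/
noncomputable def κ_over : AOver (actL_over P mK.T) (actR_over P mK.T) (actR_over P mK.T)
    (actL_over P mK.T) mK.a hθ.κ := HTrans.ascRestrict_over _ _ _ _ mK.a

/-- Here the outer variables are restricted along `P` through both actions: on the source the left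
icon is nested in the right one, on the target the right icon in the left one, and both reduce to
the nested icon of the monoidal extension. -/
lemma κ_nat {A A' B B' E E' : Ob} (f : D.c A ⟶ D.c A') (g : D.c B ⟶ D.c B')
    (h : D.c E ⟶ D.c E') :
    Over2 P (hθ.κ.n3 f (P.h g) h).hom (mD.a.n3 f g h).hom
      (lift2 P (extR θ.domR (extL θ.domL f (𝟙 (P.h g))) h) (eqToHom (hθ.a_app A' B' E')))
      (lift2 P (eqToHom (hθ.a_app A B E)) (extL θ.domL f (extR θ.domR (𝟙 (P.h g)) h))) := by
  refine Over2.of_OV (hθ.κ_over.n f (P.h g) h) (hθ.asc_over.n f g h) ?_ ?_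
  · exact DblFun.id_lift2I_comp_lift2
      (hθ.ext_comp_extR _ _ _ ((Category.id_comp _).trans (hθ.extL_id f g))) (Category.id_comp _)
  · exact DblFun.id_lift2I_comp_lift2 (Category.id_comp _)
      (hθ.ext_comp_extL _ _ _ ((Category.id_comp _).trans (hθ.extR_id g h)))

lemma κ_tw {A A' B B' E E' : Ob} (s : D.pre.V A A') (t : D.pre.V B B') (r : D.pre.V E E') :
    Tw (hθ.κ.q3 s (P.mapV t) r) (P.bsq (mD.a.q3 s t r)) (eqToHom (hθ.a_app A B E))
      (eqToHom (hθ.a_app A' B' E'))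
      (((actR P mK.T).bvI (hθ.icon.bw s t) (Iso.refl r)).hom ≫ (hθ.icon.bw (mD.T.bv s t) r).hom)
      (((actL P mK.T).bvI (Iso.refl s) (hθ.icon.bw t r)).hom ≫
        (hθ.icon.bw s (mD.T.bv t r)).hom) := by
  refine Tw.cancel (L₀ := (actR_over P mK.T).vext (Iso.refl (mK.T.bv (P.mapV s) (P.mapV t)))
      (Iso.refl (P.mapV r)))
    (R₀ := (actL_over P mK.T).vext (Iso.refl (P.mapV s)) (Iso.refl (mK.T.bv (P.mapV t) (P.mapV r))))
    (hθ.κ_over.s s (P.mapV t) r) (hθ.asc_over.s s t r) ?_ ?_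
  · exact (hθ.actR_vext_comp _ _ _).trans
      (congrArg (fun i => (hθ.icon.vext i (Iso.refl _)).hom) (Iso.refl_trans _))
  · exact (hθ.actL_vext_comp _ _ _).trans
      (congrArg (fun i => (hθ.icon.vext (Iso.refl _) i).hom) (Iso.refl_trans _))

/-- The restrictions of the tensor product of `K` form a biaction. -/
theorem isBiaction (hL : LeftLaws mK.left) (hR : RightLaws mK.right) :
    IsBiaction hθ.leftData hθ.rightData θ.domL θ.domR hθ.isLeftExt hθ.isRightExt hθ.κ where
  equiv := HTrans.ascRestrict_isEquiv _ _ _ _ hL.a_equiv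
  a_app := hθ.a_app
  a_nat := hθ.κ_nat
  a_vsq s t r := (overSq_iff (hθ.κ.q3 s (P.mapV t) r) (mD.a.q3 s t r) _ _ _ _ _ _).2
    (hθ.κ_tw s t r)
  -- The variables 1, 2 and 4 are restricted to `D`. The associators at (1, 2, 3) and at (1, 2, 34)
  -- are those of the left action, the other three are instances of `κ`.
  p_third := by
    refine ⟨pRestrict hθ.left_asc hθ.κ_over hθ.κ_over hθ.κ_over hθ.left_asc mK.p,
      (pRestrict_over _ _ _ _ _ _).pMod DblFun.id_faithful hL.p_mod, fun A B E G => ?_⟩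
    refine Over2.of_OV (pRestrict_over hθ.left_asc hθ.κ_over hθ.κ_over hθ.κ_over hθ.left_asc mK.p
      A B E G) (hθ.p_over A B E G) ?_ ?_
    · exact DblFun.id_lift2I_comp_lift2 (hθ.ext_comp_extR _ _ _ (Category.id_comp _))
        (DblFun.id_lift2I_comp_lift2 (Category.id_comp _)
          (hθ.ext_comp_extL _ _ _ (Category.id_comp _)))
    · exact DblFun.id_lift2I_comp_lift2 (Category.id_comp _) (Category.id_comp _)
  -- The variables 1, 3 and 4 are restricted to `D`. The associators at (2, 3, 4) and at (12, 3, 4)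
  -- are those of the right action, the other three are instances of `κ`.
  p_second := by
    refine ⟨pRestrict hθ.κ_over hθ.κ_over hθ.right_asc hθ.right_asc hθ.κ_over mK.p,
      (pRestrict_over _ _ _ _ _ _).pMod DblFun.id_faithful hL.p_mod, fun A B E G => ?_⟩
    refine Over2.of_OV (pRestrict_over hθ.κ_over hθ.κ_over hθ.right_asc hθ.right_asc hθ.κ_over mK.p
      A B E G) (hθ.p_over A B E G) ?_ ?_
    · exact DblFun.id_lift2I_comp_lift2 (hθ.ext_comp_extR _ _ _ (Category.id_comp _))
        (DblFun.id_lift2I_comp_lift2 (Category.id_comp _)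
          (hθ.ext_comp_extL _ _ _ (Category.id_comp _)))
    · exact DblFun.id_lift2I_comp_lift2 (Category.id_comp _) (Category.id_comp _)
  -- The left unit cell of `K`, with the second variable restricted to `D`.
  l_unit := by
    refine ⟨lRestrict hθ.κ_over hθ.left_lu hθ.left_lu mK.l,
      (lRestrict_over _ _ _ _).lMod DblFun.id_faithful hL.l_mod, fun A B => ?_⟩
    refine Over2.of_OV (lRestrict_over hθ.κ_over hθ.left_lu hθ.left_lu mK.l A B)
      (hθ.l_over A B) ?_ ?_
    · exact hθ.ext_comp_extR _ _ _ (Category.id_comp _)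
    · exact DblFun.id_lift2I_comp_lift2 (Category.id_comp _) (Category.id_comp _)
  -- The right unit cell of `K`, with the first variable restricted to `D`.
  r_unit := by
    refine ⟨rRestrict hθ.κ_over hθ.right_ru hθ.right_ru mK.r,
      (rRestrict_over _ _ _ _).rMod DblFun.id_faithful hR.r_mod, fun A B => ?_⟩
    refine Over2.of_OV (rRestrict_over hθ.κ_over hθ.right_ru hθ.right_ru mK.r A B)
      (hθ.r_over A B) (Category.id_comp _) ?_
    exact DblFun.id_lift2I_comp_lift2 (Category.id_comp _)
      (hθ.ext_comp_extL _ _ _ (Category.id_comp _))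
end IsMonExt
end

theorem mainTheorem8 {ObM : Type u} {M : DblCat.{u, v, w, x} ObM} {oM : ObM → ObM → ObM} {J : ObM}
    (mM : HMonoidal M oM J)
    {Ob : Type u'} {D : DblCat.{u', v', w', x'} Ob} {o : Ob → Ob → Ob} {I : Ob}
    (mD : HMonoidal D o I)
    {oF : ObM → Ob → Ob} (F : LaxAction mM D oF)
    (c : F.coParaPre.Coherence) (cP : FunCoh (C := D) (D := F.coPara c) F.embPre)
    (mK : HMonoidal (F.coPara c) o I)
    (θ : Icon (domM (F.emb c cP) mK.T) (mD.T.comp (F.emb c cP)))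
    (hθ : IsMonExt mK.toMonData θ) :
    ∃ (L : LeftData mD.toMonData (actL (F.emb c cP) mK.T))
      (R : RightData mD.toMonData (actR (F.emb c cP) mK.T))
      (θL : Icon (domL (F.emb c cP) (actL (F.emb c cP) mK.T)) (mD.T.comp (F.emb c cP)))
      (θR : Icon (domR (F.emb c cP) (actR (F.emb c cP) mK.T)) (mD.T.comp (F.emb c cP)))
      (hL : IsLeftExt L θL) (hR : IsRightExt R θR),
      LeftLaws L ∧ RightLaws R ∧
      (∀ {A B : Ob × Ob} (f : (D.prod D).c A ⟶ (D.prod D).c B),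
        θL.cell f = θ.cell f ∧ θR.cell f = θ.cell f) ∧
      (∀ {A A' : Ob × Ob} (s : (D.prod D).pre.V A A'),
        θL.vsq s = θ.vsq s ∧ θR.vsq s = θ.vsq s) ∧
      ∃ κ : Asc (actL (F.emb c cP) mK.T) (actR (F.emb c cP) mK.T)
          (actR (F.emb c cP) mK.T) (actL (F.emb c cP) mK.T),
        IsBiaction L R θL θR hL hR κ :=
  ⟨hθ.leftData, hθ.rightData, θ.domL, θ.domR, hθ.isLeftExt, hθ.isRightExt,
    -- The icons on the two actions were obtained by changing only the compositors of their source,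
    -- so their components are those of `θ` by definition.
    hθ.leftLaws mK.leftLaws, hθ.rightLaws mK.rightLaws, fun _ => ⟨rfl, rfl⟩,
    fun _ => ⟨rfl, rfl⟩, hθ.κ, hθ.isBiaction mK.leftLaws mK.rightLaws⟩
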